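/- Let $P$ be a polygon: a compact region in the Euclidean plane that is the closure of its connected interior and whose boundary is a finite union of non-degenerate segments (the edges) which meet only in common endpoints (the vertices), with exactly two edges meeting at each vertex. ($P$ need not be convex or simply connected.) Let $\mathcal A$ be the finite set of edges of $P$, with the discrete topology. A (forward or bi-infinite) billiard trajectory, moving in straight lines in $P$ with optical reflection at edges, is nonsingular if it never meets a vertex. Let $B(P)\subset\mathcal A^{\mathbb Z}$ be the set of the sequences of edges successively hit by nonsingular bi-infinite trajectories, let $B_+(P)\subset\mathcal A^{\mathbb N}$ be the set of the sequences of edges successively hit by nonsingular forward trajectories (if the trajectory starts on an edge, that edge is not recorded), and let $\overline{B(P)}$ and $\overline{B_+(P)}$ be their closures in the product topology. Two distinct edges are adjacent if they share an endpoint. A set $S$ of edges is a set of common prefixes for a sequence $(E_i)_{i\ge 1}\in\mathcal A^{\mathbb N}$ if $(A,E_1,E_2,\dots)\in\overline{B_+(P)}$ for every $A\in S$. A sequence $(E_i)_{i\ge1}$ is grazing if it extends to a bi-infinite sequence $(E_i)_{i\in\mathbb Z}\in\overline{B(P)}$ for which there are edges $F,G$ with $\{E_0,E_1\}\cap\{F,G\}=\emptyset$,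 $(F,E_0,E_{-1},E_{-2},\dots)\in\overline{B_+(P)}$ and $(G,E_1,E_2,\dots)\in\overline{B_+(P)}$; otherwise it is non-grazing. A sequence $(E_i)_{i\ge1}$ is aperiodic if it is not eventually periodic. Then two distinct edges $A$ and $B$ of $P$ are adjacent if and only if there is an aperiodic non-grazing sequence $(E_i)_{i\ge1}\in\mathcal A^{\mathbb N}$ for which $\{A,B\}$ is a pair of common prefixes. -/

import Mathlib

/-- The Euclidean plane. -/
abbrev BilliardPlane : Type := EuclideanSpace ℝ (Fin 2)

/-- A polygon in the plane whose edges are indexed by `ι`: a compact region which is the closure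
of its connected interior, and whose boundary is made up of non-degenerate segments (the edges)
that meet only in common endpoints, exactly two edges meeting at every vertex.  The boundary is
thus a disjoint union of simple closed polygonal curves.  The polygon need be neither convex nor
simply connected, and straight angles are allowed. -/
structure PolygonTable (ι : Type*) where
  /-- the closed region -/
  carrier : Set BilliardPlane
  /-- one endpoint of every edge -/
  src : ι → BilliardPlane
  /-- the other endpoint of every edge -/
  tgt : ι → BilliardPlane
  isCompact_carrier : IsCompact carrier
  closure_interior : closure (interior carrier) = carrier
  isConnected_interior : IsConnected (interior carrier)
  src_ne_tgt : ∀ i, src i ≠ tgt i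
  frontier_eq : frontier carrier = ⋃ i, segment ℝ (src i) (tgt i)
  edges_inter : ∀ i j, i ≠ j →
    segment ℝ (src i) (tgt i) ∩ segment ℝ (src j) (tgt j) ⊆ {src i, tgt i} ∩ {src j, tgt j}
  vertex_two_edges : ∀ i, ∀ q ∈ ({src i, tgt i} : Set BilliardPlane),
    ∃! j, j ≠ i ∧ q ∈ ({src j, tgt j} : Set BilliardPlane)

namespace PolygonTable

variable {ι : Type*}

/-- The vertices of the polygon. -/
def vertices (P : PolygonTable ι) : Set BilliardPlane :=
  Set.range P.src ∪ Set.range P.tgt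

/-- An edge without its two endpoints. -/
def edgeInterior (P : PolygonTable ι) (i : ι) : Set BilliardPlane :=
  openSegment ℝ (P.src i) (P.tgt i)

/-- Two different edges are adjacent if they share an endpoint. -/
def Adjacent (P : PolygonTable ι) (A B : ι) : Prop :=
  A ≠ B ∧ (({P.src A, P.tgt A} : Set BilliardPlane) ∩ {P.src B, P.tgt B}).Nonempty

/-- Optical reflection of a direction in an edge: the component along the edge is kept and the
component orthogonal to the edge changes its sign. -/
noncomputable def reflect (P : PolygonTable ι) (i : ι) (v : BilliardPlane) : BilliardPlane :=
  (Submodule.span ℝ {P.tgt i - P.src i}).reflection v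

/-- A straight piece of a billiard trajectory, run from `a` to `b` in direction `v`, all of whose
points between `a` and `b` are interior to the polygon. -/
def IsLeg (P : PolygonTable ι) (a b v : BilliardPlane) : Prop :=
  (∃ t : ℝ, 0 < t ∧ b = a + t • v) ∧ openSegment ℝ a b ⊆ interior P.carrier

/-- The forward trajectory of `(p, u)` is nonsingular (it never meets a vertex), it bounces in the
points `y 1, y 2, …`, and `e n` is the edge that contains `y (n + 1)`; the `n`-th leg has
direction `v n`.  If `p` lies on an edge, that edge is not recorded. -/
structure IsForwardTrajectory (P : PolygonTable ι) (p u : BilliardPlane)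
    (y v : ℕ → BilliardPlane) (e : ℕ → ι) : Prop where
  start : y 0 = p
  direction : v 0 = u
  leg : ∀ n, P.IsLeg (y n) (y (n + 1)) (v n)
  bounce : ∀ n, y (n + 1) ∈ P.edgeInterior (e n)
  optical : ∀ n, v (n + 1) = P.reflect (e n) (v n)

/-- The forward bounce spectrum: the forward bounce sequences of all nonsingular forward
trajectories. -/
def forwardBounceSpectrum (P : PolygonTable ι) : Set (ℕ → ι) :=
  {e | ∃ p u : BilliardPlane, p ∈ P.carrier ∧ p ∉ P.vertices ∧ ‖u‖ = 1 ∧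
    ∃ y v : ℕ → BilliardPlane, P.IsForwardTrajectory p u y v e}

/-- A nonsingular bi-infinite trajectory with bounce points `y n` on the edges `e n`, the leg from
`y n` to `y (n + 1)` having direction `v n`. -/
structure IsFullTrajectory (P : PolygonTable ι)
    (y v : ℤ → BilliardPlane) (e : ℤ → ι) : Prop where
  unit : ∀ n, ‖v n‖ = 1
  leg : ∀ n, P.IsLeg (y n) (y (n + 1)) (v n)
  bounce : ∀ n, y n ∈ P.edgeInterior (e n)
  optical : ∀ n, v (n + 1) = P.reflect (e (n + 1)) (v n)

/-- The bounce spectrum: the bounce sequences of all nonsingular bi-infinite trajectories.  The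
base point of a trajectory lies on the leg from `y 0` to `y 1`; as every point of the trajectory
may serve as its base point, the set is invariant under shifts. -/
def bounceSpectrum (P : PolygonTable ι) : Set (ℤ → ι) :=
  {e | ∃ y v : ℤ → BilliardPlane, P.IsFullTrajectory y v e}

/-- The closure of the forward bounce spectrum in the product of discrete spaces. -/
def closedForwardBounceSpectrum (P : PolygonTable ι) : Set (ℕ → ι) :=
  letI : TopologicalSpace ι := ⊥
  closure P.forwardBounceSpectrum

/-- The closure of the bounce spectrum in the product of discrete spaces. -/
def closedBounceSpectrum (P : PolygonTable ι) : Set (ℤ → ι) :=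
  letI : TopologicalSpace ι := ⊥
  closure P.bounceSpectrum

/-- The sequence `(A, E 0, E 1, …)`. -/
def prepend (A : ι) (E : ℕ → ι) : ℕ → ι
  | 0 => A
  | n + 1 => E n

/-- The edge `A` is a prefix for the sequence `E`. -/
def IsPrefix (P : PolygonTable ι) (A : ι) (E : ℕ → ι) : Prop :=
  prepend A E ∈ P.closedForwardBounceSpectrum

/-- `S` is a set of common prefixes for the sequence `E`. -/
def IsCommonPrefixes (P : PolygonTable ι) (S : Set ι) (E : ℕ → ι) : Prop :=
  ∀ A ∈ S, P.IsPrefix A E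

/-- The pair `{F, G}` grazes an ideal trajectory with the bi-infinite bounce sequence `E`. -/
def Grazes (P : PolygonTable ι) (F G : ι) (E : ℤ → ι) : Prop :=
  E ∈ P.closedBounceSpectrum ∧
    ({E 0, E 1} : Set ι) ∩ {F, G} = ∅ ∧
    P.IsPrefix F (fun n : ℕ => E (-(n : ℤ))) ∧
    P.IsPrefix G (fun n : ℕ => E ((n : ℤ) + 1))

/-- A one-sided sequence is grazing if it is the part with indices `1, 2, …` of the bounce
sequence of an ideal trajectory that is grazed by some pair of edges. -/
def IsGrazing (P : PolygonTable ι) (E : ℕ → ι) : Prop :=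
  ∃ (F G : ι) (E' : ℤ → ι), P.Grazes F G E' ∧ ∀ n : ℕ, E' ((n : ℤ) + 1) = E n

/-- A one-sided sequence is aperiodic if none of its tails is periodic. -/
def IsAperiodic (E : ℕ → ι) : Prop :=
  ¬ ∃ N k : ℕ, 0 < k ∧ ∀ n, N ≤ n → E (n + k) = E n

end PolygonTable

/-! ### Oriented area and inner product in the plane. -/

set_option linter.unusedSectionVars false
open Filter Topology
open scoped RealInnerProductSpace

/-! Sequences in the closed spectra are codes of ideal trajectories, that is, limits of nonsingular
trajectories that may touch vertices or run along edges (`IsPrefix.exists_ideal`,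
`Ideal.mem_closedBounceSpectrum`). Along two ideal trajectories with the same code the signed
distance is, up to an alternating sign, an affine function of length whose slope is the angle term
`cross v u` (`separation`). Total length tends to infinity (`exists_length_bound`) while the table
is bounded, so equal codes force equal directions (`IdealFrom.dir_eq`).

The core is that an aperiodic code also determines the line (`IdealFrom.cross_eq_zero`). Otherwise
two parallel trajectories bound a strip of positive width. Among the limits of such pairs take one
of almost maximal width. A return with a small turn would drift sideways while keeping the code and
would combine with the original pair into a wider strip (`Ideal.no_drift`), so some return is
exactly parallel, with a shift smaller than the width. A passage strictly inside the strip follows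
the code of the strip (`IdealFrom.code_eq_of_shift`), and a passage with zero shift repeats the
state (`IdealFrom.code_eq_of_state_eq`). In both cases the code is eventually periodic.

If the edges are adjacent, shoot a ray into the table from the common vertex. All but countably many
directions give a nonsingular ray with aperiodic future and aperiodic possible pasts. Shifting the
ray parallel to itself along either edge makes both edges prefixes. By uniqueness of lines, any
bi-infinite extension passes through the vertex, and a grazing edge in its past would have to start
at the vertex too, where both edges face the wrong way (`exists_of_adjacent`).

Conversely, the ideal trajectories from the two prefixes share a line. If they start at the same
point, this point is a common endpoint. If one starts ahead of the other, paths beside the line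
yield an edge hit by the backward continuation on the opposite side, and the sequence is grazing
(`Inward.isGrazing`, `isGrazing_of_ahead`). The case of a trajectory that starts along its own edge
is reduced to the preceding edge (`Ideal.inward_of_slope_eq_zero`). -/

/-- The oriented area spanned by two vectors of the plane. -/
def cross (x y : BilliardPlane) : ℝ := x 0 * y 1 - x 1 * y 0

theorem cross_add_right (x y z : BilliardPlane) : cross x (y + z) = cross x y + cross x z := by
  simp [cross]; ring
theorem cross_sub_right (x y z : BilliardPlane) : cross x (y - z) = cross x y - cross x z := by
  simp [cross]; ring
theorem cross_sub_left (x y z : BilliardPlane) : cross (x - y) z = cross x z - cross y z := by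
  simp [cross]; ring
theorem cross_smul_right (t : ℝ) (x y : BilliardPlane) : cross x (t • y) = t * cross x y := by
  simp [cross]; ring
theorem cross_smul_left (t : ℝ) (x y : BilliardPlane) : cross (t • x) y = t * cross x y := by
  simp [cross]; ring
theorem cross_neg_right (x y : BilliardPlane) : cross x (-y) = -cross x y := by
  simp [cross]; ring
theorem cross_neg_left (x y : BilliardPlane) : cross (-x) y = -cross x y := by
  simp [cross]; ring
theorem cross_self_eq (x : BilliardPlane) : cross x x = 0 := by
  simp [cross]; ring
theorem cross_swap (x y : BilliardPlane) : cross x y = -cross y x := by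
  simp [cross]; ring
theorem cross_zero_right (x : BilliardPlane) : cross x 0 = 0 := by simp [cross]

theorem inner_plane (x y : BilliardPlane) : ⟪x, y⟫ = x 0 * y 0 + x 1 * y 1 := by
  simp [PiLp.inner_apply, Fin.sum_univ_two]; ring

theorem norm_sq_plane (x : BilliardPlane) : ‖x‖ ^ 2 = x 0 ^ 2 + x 1 ^ 2 := by
  rw [← real_inner_self_eq_norm_sq, inner_plane]; ring

theorem cross_sq_add_inner_sq (x y : BilliardPlane) :
    cross x y ^ 2 + ⟪x, y⟫ ^ 2 = ‖x‖ ^ 2 * ‖y‖ ^ 2 := by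
  rw [norm_sq_plane, norm_sq_plane, inner_plane, cross]; ring

theorem abs_cross_le (x y : BilliardPlane) : |cross x y| ≤ ‖x‖ * ‖y‖ := by
  refine abs_le_of_sq_le_sq ?_ (by positivity)
  rw [mul_pow, ← cross_sq_add_inner_sq]; nlinarith [sq_nonneg ⟪x, y⟫]

theorem continuous_cross : Continuous fun p : BilliardPlane × BilliardPlane => cross p.1 p.2 := by
  unfold cross; fun_prop

theorem Filter.Tendsto.cross {α : Type*} {l : Filter α} {f g : α → BilliardPlane}
    {x y : BilliardPlane} (hf : Tendsto f l (𝓝 x)) (hg : Tendsto g l (𝓝 y)) :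
    Tendsto (fun a => cross (f a) (g a)) l (𝓝 (cross x y)) :=
  (continuous_cross.tendsto (x, y)).comp (hf.prodMk_nhds hg)

/-- A vector with vanishing oriented area against a unit vector is a multiple of it. -/
theorem eq_smul_of_cross_eq_zero {v x : BilliardPlane} (hv : ‖v‖ = 1) (h : cross v x = 0) :
    x = ⟪v, x⟫ • v := by
  have h1 : v 0 ^ 2 + v 1 ^ 2 = 1 := by rw [← norm_sq_plane, hv]; norm_num
  rw [inner_plane]
  unfold _root_.cross at h
  ext i
  fin_cases i
  · simp only [Fin.zero_eta, PiLp.smul_apply, smul_eq_mul]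
    linear_combination (-x 0) * h1 - v 1 * h
  · simp only [Fin.mk_one, PiLp.smul_apply, smul_eq_mul]
    linear_combination (-x 1) * h1 + v 0 * h

theorem exists_smul_of_cross_eq_zero {d x : BilliardPlane} (hd : d ≠ 0) (h : cross d x = 0) :
    x = (⟪d, x⟫ / ‖d‖ ^ 2) • d := by
  have hn : ‖d‖ ≠ 0 := norm_ne_zero_iff.2 hd
  have h1 : ‖(‖d‖⁻¹ • d)‖ = 1 := norm_smul_inv_norm hd
  have h2 : cross (‖d‖⁻¹ • d) x = 0 := by rw [cross_smul_left, h, mul_zero]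
  have h3 := eq_smul_of_cross_eq_zero h1 h2
  rw [inner_smul_left, smul_smul] at h3
  convert h3 using 2
  simp; field_simp

theorem eq_or_eq_neg_of_cross_eq_zero {v u : BilliardPlane} (hv : ‖v‖ = 1) (hu : ‖u‖ = 1)
    (h : cross v u = 0) : u = v ∨ u = -v := by
  have h1 := eq_smul_of_cross_eq_zero hv h
  have h2 := cross_sq_add_inner_sq v u
  rw [h, hv, hu] at h2
  have h3 : (⟪v, u⟫ - 1) * (⟪v, u⟫ + 1) = 0 := by linarith
  rcases mul_eq_zero.1 h3 with h4 | h4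
  · left; rw [h1, show ⟪v, u⟫ = 1 by linarith, one_smul]
  · right; rw [h1, show ⟪v, u⟫ = -1 by linarith, neg_one_smul]

theorem eq_of_cross_eq_of_inner_eq {v x y : BilliardPlane} (hv : ‖v‖ = 1)
    (h : cross v x = cross v y) (h' : ⟪v, x⟫ = ⟪v, y⟫) : x = y := by
  have h1 := eq_smul_of_cross_eq_zero hv (show cross v (x - y) = 0 by rw [cross_sub_right, h, sub_self])
  rw [inner_sub_right, h', sub_self, zero_smul] at h1
  exact sub_eq_zero.1 h1

/-! ### Reflections, edges and the two sides of an edge. -/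

namespace PolygonTable

variable {ι : Type*} (P : PolygonTable ι)

/-- The vector along an edge. -/
def edgeVec (e : ι) : BilliardPlane := P.tgt e - P.src e

theorem edgeVec_ne_zero (e : ι) : P.edgeVec e ≠ 0 := sub_ne_zero.2 (P.src_ne_tgt e).symm

theorem norm_edgeVec_pos (e : ι) : 0 < ‖P.edgeVec e‖ := norm_pos_iff.2 (P.edgeVec_ne_zero e)

theorem norm_reflect (e : ι) (v : BilliardPlane) : ‖P.reflect e v‖ = ‖v‖ :=
  LinearIsometryEquiv.norm_map _ _

theorem reflect_reflect (e : ι) (v : BilliardPlane) : P.reflect e (P.reflect e v) = v :=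
  Submodule.reflection_reflection _ _

theorem reflect_neg (e : ι) (v : BilliardPlane) : P.reflect e (-v) = -P.reflect e v :=
  map_neg _ _

theorem inner_reflect (e : ι) (v w : BilliardPlane) :
    ⟪P.reflect e v, P.reflect e w⟫ = ⟪v, w⟫ := LinearIsometryEquiv.inner_map_map _ _ _

theorem continuous_reflect (e : ι) : Continuous (P.reflect e) :=
  LinearIsometryEquiv.continuous _

theorem reflect_apply (e : ι) (v : BilliardPlane) :
    P.reflect e v = (2 * (⟪P.edgeVec e, v⟫ / ‖P.edgeVec e‖ ^ 2)) • P.edgeVec e - v := by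
  unfold reflect
  rw [Submodule.reflection_singleton_apply]
  simp only [edgeVec, RCLike.ofReal_real_eq_id, id]
  rw [← Nat.cast_smul_eq_nsmul ℝ, smul_smul]; norm_cast

theorem cross_reflect (e : ι) (v w : BilliardPlane) :
    cross (P.reflect e v) (P.reflect e w) = -cross v w := by
  have hd := norm_edgeVec_pos P e
  rw [reflect_apply, reflect_apply, inner_plane, inner_plane]
  have h := norm_sq_plane (P.edgeVec e)
  set d := P.edgeVec e
  have h2 : d 0 ^ 2 + d 1 ^ 2 ≠ 0 := by rw [← h]; positivity
  rw [h]
  simp only [cross, PiLp.sub_apply, PiLp.smul_apply, smul_eq_mul]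
  field_simp
  ring

theorem reflect_of_cross_eq_zero {e : ι} {x : BilliardPlane} (h : cross (P.edgeVec e) x = 0) :
    P.reflect e x = x := by
  rw [exists_smul_of_cross_eq_zero (P.edgeVec_ne_zero e) h]
  unfold reflect
  apply Submodule.reflection_mem_subspace_eq_self
  exact Submodule.smul_mem _ _ (Submodule.mem_span_singleton_self _)

theorem cross_edgeVec_reflect (e : ι) (v : BilliardPlane) :
    cross (P.edgeVec e) (P.reflect e v) = -cross (P.edgeVec e) v := by
  have h := P.cross_reflect e (P.edgeVec e) v
  rwa [P.reflect_of_cross_eq_zero (cross_self_eq (P.edgeVec e))] at h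

/-- The closed edge. -/
def edge (e : ι) : Set BilliardPlane := segment ℝ (P.src e) (P.tgt e)

/-- The affine coordinate along an edge, `0` at the source and `1` at the target. -/
noncomputable def param (e : ι) (x : BilliardPlane) : ℝ :=
  ⟪P.edgeVec e, x - P.src e⟫ / ‖P.edgeVec e‖ ^ 2

theorem continuous_param (e : ι) : Continuous (P.param e) := by
  unfold param; fun_prop

theorem param_src_add (e : ι) (t : ℝ) : P.param e (P.src e + t • P.edgeVec e) = t := by
  have := norm_edgeVec_pos P e
  unfold param
  rw [add_sub_cancel_left, inner_smul_right, real_inner_self_eq_norm_sq]; field_simp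

theorem eq_src_add {e : ι} {x : BilliardPlane} (h : cross (P.edgeVec e) (x - P.src e) = 0) :
    x = P.src e + P.param e x • P.edgeVec e := by
  have := exists_smul_of_cross_eq_zero (P.edgeVec_ne_zero e) h
  unfold param
  rw [← this]; simp

theorem mem_edgeInterior_iff {e : ι} {x : BilliardPlane} : x ∈ P.edgeInterior e ↔
    cross (P.edgeVec e) (x - P.src e) = 0 ∧ 0 < P.param e x ∧ P.param e x < 1 := by
  unfold edgeInterior
  rw [openSegment_eq_image']
  constructor
  · rintro ⟨t, ⟨h0, h1⟩, rfl⟩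
    change _ ∧ 0 < P.param e (P.src e + t • P.edgeVec e) ∧
      P.param e (P.src e + t • P.edgeVec e) < 1
    rw [param_src_add]
    refine ⟨?_, h0, h1⟩
    simp only [add_sub_cancel_left]
    change cross (P.edgeVec e) (t • P.edgeVec e) = 0
    rw [cross_smul_right, cross_self_eq, mul_zero]
  · rintro ⟨h, h0, h1⟩
    exact ⟨_, ⟨h0, h1⟩, (P.eq_src_add h).symm⟩

theorem mem_edge_iff {e : ι} {x : BilliardPlane} : x ∈ P.edge e ↔
    cross (P.edgeVec e) (x - P.src e) = 0 ∧ 0 ≤ P.param e x ∧ P.param e x ≤ 1 := by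
  unfold edge
  rw [segment_eq_image']
  constructor
  · rintro ⟨t, ⟨h0, h1⟩, rfl⟩
    change _ ∧ 0 ≤ P.param e (P.src e + t • P.edgeVec e) ∧
      P.param e (P.src e + t • P.edgeVec e) ≤ 1
    rw [param_src_add]
    refine ⟨?_, h0, h1⟩
    simp only [add_sub_cancel_left]
    change cross (P.edgeVec e) (t • P.edgeVec e) = 0
    rw [cross_smul_right, cross_self_eq, mul_zero]
  · rintro ⟨h, h0, h1⟩
    exact ⟨_, ⟨h0, h1⟩, (P.eq_src_add h).symm⟩

theorem edgeInterior_subset_edge (e : ι) : P.edgeInterior e ⊆ P.edge e :=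
  openSegment_subset_segment _ _ _

theorem isClosed_edge (e : ι) : IsClosed (P.edge e) := by
  have : P.edge e = {x | cross (P.edgeVec e) (x - P.src e) = 0} ∩ {x | 0 ≤ P.param e x} ∩
      {x | P.param e x ≤ 1} := by
    ext x; simp [mem_edge_iff, and_assoc]
  rw [this]
  have h1 : Continuous fun x => cross (P.edgeVec e) (x - P.src e) := by unfold cross; fun_prop
  exact ((isClosed_eq h1 continuous_const).inter
    (isClosed_le continuous_const (P.continuous_param e))).inter
    (isClosed_le (P.continuous_param e) continuous_const)

theorem src_mem_edge (e : ι) : P.src e ∈ P.edge e := left_mem_segment _ _ _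
theorem tgt_mem_edge (e : ι) : P.tgt e ∈ P.edge e := right_mem_segment _ _ _

theorem frontier_eq' : frontier P.carrier = ⋃ e, P.edge e := P.frontier_eq

theorem edge_subset_frontier (e : ι) : P.edge e ⊆ frontier P.carrier := by
  rw [frontier_eq']; exact Set.subset_iUnion _ e

theorem isClosed_carrier : IsClosed P.carrier := P.isCompact_carrier.isClosed

theorem edge_subset_carrier (e : ι) : P.edge e ⊆ P.carrier :=
  (P.edge_subset_frontier e).trans P.isClosed_carrier.frontier_subset

theorem notMem_interior_of_mem_edge {e : ι} {x : BilliardPlane} (h : x ∈ P.edge e) :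
    x ∉ interior P.carrier := (P.edge_subset_frontier e h).2

theorem exists_mem_edge {x : BilliardPlane} (h : x ∈ P.carrier) (h' : x ∉ interior P.carrier) :
    ∃ e, x ∈ P.edge e := by
  have : x ∈ frontier P.carrier := by
    rw [P.isClosed_carrier.frontier_eq]; exact ⟨h, h'⟩
  rw [frontier_eq'] at this
  simpa using this

theorem src_notMem_edgeInterior (e : ι) : P.src e ∉ P.edgeInterior e := fun h =>
  P.src_ne_tgt e (left_mem_openSegment_iff.1 h)

theorem tgt_notMem_edgeInterior (e : ι) : P.tgt e ∉ P.edgeInterior e := fun h =>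
  P.src_ne_tgt e (right_mem_openSegment_iff.1 h)

/-- A point in the interior of an edge lies on no other edge. -/
theorem eq_of_mem_edgeInterior {e f : ι} {x : BilliardPlane} (h : x ∈ P.edgeInterior e)
    (h' : x ∈ P.edge f) : e = f := by
  by_contra hne
  have := (P.edges_inter e f hne ⟨P.edgeInterior_subset_edge e h, h'⟩).1
  rcases this with h1 | h1
  · exact P.src_notMem_edgeInterior e (h1 ▸ h)
  · exact P.tgt_notMem_edgeInterior e (h1 ▸ h)

theorem mem_edgeInterior_of_notMem_vertices {e : ι} {x : BilliardPlane} (h : x ∈ P.edge e)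
    (h' : x ∉ P.vertices) : x ∈ P.edgeInterior e := by
  apply mem_openSegment_of_ne_left_right _ _ h
  · rintro rfl; exact h' (Or.inl ⟨e, rfl⟩)
  · rintro rfl; exact h' (Or.inr ⟨e, rfl⟩)

theorem edgeInterior_notMem_vertices {e : ι} {x : BilliardPlane} (h : x ∈ P.edgeInterior e) :
    x ∉ P.vertices := by
  rintro (⟨f, rfl⟩ | ⟨f, rfl⟩)
  · have := P.eq_of_mem_edgeInterior h (P.src_mem_edge f); subst this
    exact P.src_notMem_edgeInterior _ h
  · have := P.eq_of_mem_edgeInterior h (P.tgt_mem_edge f); subst this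
    exact P.tgt_notMem_edgeInterior _ h

theorem subset_interior_or_of_isPreconnected {s : Set BilliardPlane} (hs : IsPreconnected s)
    (h : ∀ x ∈ s, ∀ e, x ∉ P.edge e) : s ⊆ interior P.carrier ∨ s ⊆ P.carrierᶜ := by
  apply IsPreconnected.subset_or_subset isOpen_interior P.isClosed_carrier.isOpen_compl _ _ hs
  · exact Set.disjoint_left.2 fun x hx hx' => hx' (interior_subset hx)
  · intro x hx
    by_cases h1 : x ∈ interior P.carrier
    · exact Or.inl h1
    · refine Or.inr fun h2 => ?_
      obtain ⟨e, he⟩ := P.exists_mem_edge h2 h1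
      exact h x hx e he

theorem openSegment_subset_interior {a b : BilliardPlane}
    (h : ∀ x ∈ openSegment ℝ a b, ∀ e, x ∉ P.edge e)
    (h' : ∃ x ∈ openSegment ℝ a b, x ∈ P.carrier) : openSegment ℝ a b ⊆ interior P.carrier := by
  rcases P.subset_interior_or_of_isPreconnected
    (convex_openSegment a b).isPreconnected h with h1 | h1
  · exact h1
  · obtain ⟨x, hx, hx'⟩ := h'; exact absurd hx' (h1 hx)

section Finite
variable [Finite ι]

theorem exists_ball_disjoint_edges (x : BilliardPlane) :
    ∃ ε > 0, ∀ y ∈ Metric.ball x ε, ∀ f, y ∈ P.edge f → x ∈ P.edge f := by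
  have h : ∀ f : ι, ∀ᶠ y in 𝓝 x, y ∈ P.edge f → x ∈ P.edge f := by
    intro f
    by_cases hx : x ∈ P.edge f
    · exact Eventually.of_forall fun _ _ => hx
    · filter_upwards [(P.isClosed_edge f).isOpen_compl.mem_nhds hx] with y hy hy'
      exact absurd hy' hy
  obtain ⟨ε, hε, hb⟩ := Metric.eventually_nhds_iff_ball.1 (eventually_all.2 h)
  exact ⟨ε, hε, hb⟩

/-- One side of an edge is, locally, interior to the polygon and the other one is outside. -/
theorem exists_local_sides {e : ι} {b : BilliardPlane} (hb : b ∈ P.edgeInterior e) :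
    ∃ s : ℝ, (s = 1 ∨ s = -1) ∧ ∃ ε > 0, ∀ x ∈ Metric.ball b ε,
      (0 < s * cross (P.edgeVec e) (x - P.src e) → x ∈ interior P.carrier) ∧
      (s * cross (P.edgeVec e) (x - P.src e) < 0 → x ∉ P.carrier) := by
  obtain ⟨ε, hε, hball⟩ := P.exists_ball_disjoint_edges b
  have hcont : Continuous fun x => cross (P.edgeVec e) (x - P.src e) := by unfold cross; fun_prop
  have hb0 := (P.mem_edgeInterior_iff.1 hb).1
  -- Near `b` only `e` is present, so each open half disc misses all edges and, being convex, lies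
  -- entirely inside or entirely outside.
  have key : ∀ s : ℝ, s ≠ 0 → ∀ x ∈ Metric.ball b ε, 0 < s * cross (P.edgeVec e) (x - P.src e) →
      ∀ f, x ∉ P.edge f := by
    intro s _ x hx h f hf
    have := P.eq_of_mem_edgeInterior hb (hball x hx f hf)
    subst this
    rw [(P.mem_edge_iff.1 hf).1] at h; simp at h
  have hconv : ∀ s : ℝ, s ≠ 0 →
      Metric.ball b ε ∩ {x | 0 < s * cross (P.edgeVec e) (x - P.src e)} ⊆ interior P.carrier ∨
      Metric.ball b ε ∩ {x | 0 < s * cross (P.edgeVec e) (x - P.src e)} ⊆ P.carrierᶜ := by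
    intro s hs
    refine P.subset_interior_or_of_isPreconnected ?_ fun x hx => key s hs x hx.1 hx.2
    refine ((convex_ball b ε).inter ?_).isPreconnected
    intro x hx y hy p q hp hq hpq
    simp only [Set.mem_ofPred_eq] at *
    have : p • x + q • y - P.src e = p • (x - P.src e) + q • (y - P.src e) := by
      rw [smul_sub, smul_sub]; nth_rw 1 [← one_smul ℝ (P.src e), ← hpq, add_smul]; abel
    rw [this, cross_add_right, cross_smul_right, cross_smul_right]
    rcases hp.lt_or_eq with hp | rfl
    · nlinarith [mul_pos hp hx, mul_nonneg hq hy.le]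
    · have : q = 1 := by linarith
      subst this; simpa using hy
  have hself : (interior P.carrier ∩ Metric.ball b ε).Nonempty := by
    have : b ∈ closure (interior P.carrier) := by
      rw [P.closure_interior]; exact P.edge_subset_carrier e (P.edgeInterior_subset_edge e hb)
    rw [mem_closure_iff_nhds] at this
    obtain ⟨y, h1, h2⟩ := this _ (Metric.ball_mem_nhds b hε)
    exact ⟨y, h2, h1⟩
  -- At least one half disc must be inside: `b` is a limit of interior points, and an interior point
  -- on the line can be pushed off it.
  have hoff : ∃ y ∈ interior P.carrier ∩ Metric.ball b ε,
      cross (P.edgeVec e) (y - P.src e) ≠ 0 := by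
    obtain ⟨y, hy⟩ := hself
    by_cases h0 : cross (P.edgeVec e) (y - P.src e) = 0
    swap
    · exact ⟨y, hy, h0⟩
    set n : BilliardPlane := !₂[-(P.edgeVec e 1), P.edgeVec e 0] with hn
    have hcn : cross (P.edgeVec e) n = ‖P.edgeVec e‖ ^ 2 := by
      rw [norm_sq_plane]; simp [cross, hn]; ring
    have hopen : IsOpen (interior P.carrier ∩ Metric.ball b ε) :=
      isOpen_interior.inter Metric.isOpen_ball
    have ht : Tendsto (fun t : ℝ => y + t • n) (𝓝[>] 0) (𝓝 y) := by
      have : Continuous fun t : ℝ => y + t • n := by fun_prop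
      have h2 := this.tendsto 0
      simp only [zero_smul, add_zero] at h2
      exact h2.mono_left nhdsWithin_le_nhds
    obtain ⟨t, h1, h2⟩ := ((ht.eventually (hopen.mem_nhds hy)).and self_mem_nhdsWithin).exists
    refine ⟨_, h1, ?_⟩
    rw [add_sub_right_comm, cross_add_right, h0, cross_smul_right, hcn, zero_add]
    have := P.norm_edgeVec_pos e
    have h2' : (0:ℝ) < t := h2
    positivity
  have fin : ∀ s : ℝ, (s = 1 ∨ s = -1) →
      Metric.ball b ε ∩ {x | 0 < s * cross (P.edgeVec e) (x - P.src e)} ⊆ interior P.carrier →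
      ∃ s : ℝ, (s = 1 ∨ s = -1) ∧ ∃ ε > 0, ∀ x ∈ Metric.ball b ε,
      (0 < s * cross (P.edgeVec e) (x - P.src e) → x ∈ interior P.carrier) ∧
      (s * cross (P.edgeVec e) (x - P.src e) < 0 → x ∉ P.carrier) := by
    intro s hs h1
    have hs0 : s ≠ 0 := by rcases hs with rfl | rfl <;> norm_num
    refine ⟨s, hs, ε, hε, fun x hx => ⟨fun h => h1 ⟨hx, h⟩, fun h => ?_⟩⟩
    rcases hconv (-s) (neg_ne_zero.2 hs0) with h2 | h2
    · exfalso
      -- If both half discs were inside, the whole disc would be in the closed table, and the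
      -- frontier point `b` would be interior.
      have hint : Metric.ball b ε ⊆ P.carrier := by
        intro z hz
        rcases lt_trichotomy 0 (s * cross (P.edgeVec e) (z - P.src e)) with h3 | h3 | h3
        · exact interior_subset (h1 ⟨hz, h3⟩)
        · obtain ⟨y, hy, hy0⟩ := hoff
          rw [← P.isClosed_carrier.closure_eq]
          -- points off the line converge to `z`
          have ht : Tendsto (fun t : ℝ => z + t • (y - b)) (𝓝[>] 0) (𝓝 z) := by
            have : Continuous fun t : ℝ => z + t • (y - b) := by fun_prop
            have h2 := this.tendsto 0
            simp only [zero_smul, add_zero] at h2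
            exact h2.mono_left nhdsWithin_le_nhds
          refine mem_closure_of_tendsto ht ?_
          filter_upwards [ht.eventually (Metric.isOpen_ball.mem_nhds hz), self_mem_nhdsWithin]
            with t ht1 ht2
          have ht2' : (0:ℝ) < t := ht2
          have hz0 : cross (P.edgeVec e) (z - P.src e) = 0 := by
            rcases mul_eq_zero.1 h3.symm with h | h
            · exact absurd h hs0
            · exact h
          have hval : cross (P.edgeVec e) (z + t • (y - b) - P.src e) =
              t * cross (P.edgeVec e) (y - P.src e) := by
            rw [add_sub_right_comm, cross_add_right, hz0, cross_smul_right,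
              show y - b = (y - P.src e) - (b - P.src e) by abel, cross_sub_right, hb0]; ring
          have hne : s * cross (P.edgeVec e) (z + t • (y - b) - P.src e) ≠ 0 := by
            rw [hval]; exact mul_ne_zero hs0 (mul_ne_zero ht2'.ne' hy0)
          rcases lt_or_gt_of_ne hne with h4 | h4
          · exact interior_subset (h2 ⟨ht1, by simp only [Set.mem_ofPred_eq]; linarith⟩)
          · exact interior_subset (h1 ⟨ht1, h4⟩)
        · exact interior_subset (h2 ⟨hz, by simp only [Set.mem_ofPred_eq]; linarith⟩)
      exact P.notMem_interior_of_mem_edge (P.edgeInterior_subset_edge e hb)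
        (mem_interior.2 ⟨_, hint, Metric.isOpen_ball, Metric.mem_ball_self hε⟩)
    · exact h2 ⟨hx, by simp only [Set.mem_ofPred_eq]; linarith⟩
  obtain ⟨y, ⟨hy1, hy2⟩, hy0⟩ := hoff
  rcases lt_or_gt_of_ne hy0 with h4 | h4
  · refine fin (-1) (Or.inr rfl) ?_
    rcases hconv (-1) (by norm_num) with h | h
    · exact h
    · exact absurd (interior_subset hy1) (h ⟨hy2, by simp only [Set.mem_ofPred_eq]; linarith⟩)
  · refine fin 1 (Or.inl rfl) ?_
    rcases hconv 1 (by norm_num) with h | h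
    · exact h
    · exact absurd (interior_subset hy1) (h ⟨hy2, by simp only [Set.mem_ofPred_eq]; linarith⟩)

end Finite
end PolygonTable

/-! ### Orientation of edges, heights, legs and steps. -/

namespace PolygonTable
variable {ι : Type*} (P : PolygonTable ι)

section Finite
variable [Finite ι]

/-- The same side of an edge is interior to the polygon along the whole edge. -/
theorem exists_orientation (e : ι) :
    ∃ s : ℝ, (s = 1 ∨ s = -1) ∧ ∀ b ∈ P.edgeInterior e, ∃ ε > 0, ∀ x ∈ Metric.ball b ε,
      (0 < s * cross (P.edgeVec e) (x - P.src e) → x ∈ interior P.carrier) ∧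
      (s * cross (P.edgeVec e) (x - P.src e) < 0 → x ∉ P.carrier) := by
  set Q : ℝ → BilliardPlane → Prop := fun s b => ∃ ε > 0, ∀ x ∈ Metric.ball b ε,
      (0 < s * cross (P.edgeVec e) (x - P.src e) → x ∈ interior P.carrier) ∧
      (s * cross (P.edgeVec e) (x - P.src e) < 0 → x ∉ P.carrier) with hQ
  have hopen : ∀ s, IsOpen {b | Q s b} := by
    intro s
    rw [Metric.isOpen_iff]
    rintro b ⟨ε, hε, h⟩
    refine ⟨ε / 2, by positivity, fun c hc => ⟨ε / 2, by positivity, fun x hx => h x ?_⟩⟩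
    rw [Metric.mem_ball] at *
    linarith [dist_triangle x c b]
  by_contra hcon
  push Not at hcon
  obtain ⟨b1, hb1, hn1⟩ := hcon 1 (Or.inl rfl)
  obtain ⟨b2, hb2, hn2⟩ := hcon (-1) (Or.inr rfl)
  have hcover : P.edgeInterior e ⊆ {b | Q 1 b} ∪ {b | Q (-1) b} := by
    intro b hb
    obtain ⟨s, rfl | rfl, h⟩ := P.exists_local_sides hb
    · exact Or.inl h
    · exact Or.inr h
  have hc : IsPreconnected (P.edgeInterior e) := (convex_openSegment _ _).isPreconnected
  have n1 : ¬ Q 1 b1 := by rintro ⟨ε, hε, h⟩; obtain ⟨x, hx, h'⟩ := hn1 ε hε; exact (h x hx).2 (h' (h x hx).1).1 (h' (h x hx).1).2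
  have n2 : ¬ Q (-1) b2 := by rintro ⟨ε, hε, h⟩; obtain ⟨x, hx, h'⟩ := hn2 ε hε; exact (h x hx).2 (h' (h x hx).1).1 (h' (h x hx).1).2
  -- The two sign classes are open and cover the connected open edge; if both occur they overlap,
  -- and a point slightly off the edge would be both inside and outside.
  obtain ⟨b, hb, ⟨ε1, hε1, h1⟩, ⟨ε2, hε2, h2⟩⟩ := hc _ _ (hopen 1) (hopen (-1)) hcover
    ⟨b2, hb2, (hcover hb2).resolve_right n2⟩ ⟨b1, hb1, (hcover hb1).resolve_left n1⟩
  have hb0 := (P.mem_edgeInterior_iff.1 hb).1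
  set n : BilliardPlane := !₂[-(P.edgeVec e 1), P.edgeVec e 0] with hn
  have hcn : cross (P.edgeVec e) n = ‖P.edgeVec e‖ ^ 2 := by
    rw [norm_sq_plane]; simp [cross, hn]; ring
  have ht : Tendsto (fun t : ℝ => b + t • n) (𝓝[>] 0) (𝓝 b) := by
    have : Continuous fun t : ℝ => b + t • n := by fun_prop
    have h2 := this.tendsto 0
    simp only [zero_smul, add_zero] at h2
    exact h2.mono_left nhdsWithin_le_nhds
  obtain ⟨t, ⟨ht1, ht2⟩, ht3⟩ := (((ht.eventually (Metric.ball_mem_nhds b hε1)).and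
    (ht.eventually (Metric.ball_mem_nhds b hε2))).and self_mem_nhdsWithin).exists
  have ht3' : (0:ℝ) < t := ht3
  have hpos : 0 < cross (P.edgeVec e) (b + t • n - P.src e) := by
    rw [add_sub_right_comm, cross_add_right, hb0, cross_smul_right, hcn, zero_add]
    have := P.norm_edgeVec_pos e
    positivity
  exact (h2 _ ht2).2 (by linarith) (interior_subset ((h1 _ ht1).1 (by linarith)))

/-- The sign which makes the inner side of an edge positive. -/
noncomputable def orient (e : ι) : ℝ := (P.exists_orientation e).choose

theorem orient_sq (e : ι) : P.orient e * P.orient e = 1 := by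
  rcases (P.exists_orientation e).choose_spec.1 with h | h <;>
  · unfold orient; rw [h]; norm_num

theorem orient_ne_zero (e : ι) : P.orient e ≠ 0 := fun h => by
  have := P.orient_sq e; rw [h] at this; norm_num at this

/-- The inward component of a vector relative to an edge. -/
noncomputable def slope (e : ι) (v : BilliardPlane) : ℝ := P.orient e * cross (P.edgeVec e) v

/-- The (unnormalized) signed height over the line of an edge, positive on the inner side. -/
noncomputable def height (e : ι) (x : BilliardPlane) : ℝ := P.slope e (x - P.src e)

theorem slope_add (e : ι) (v w : BilliardPlane) : P.slope e (v + w) = P.slope e v + P.slope e w := by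
  unfold slope; rw [cross_add_right]; ring
theorem slope_sub (e : ι) (v w : BilliardPlane) : P.slope e (v - w) = P.slope e v - P.slope e w := by
  unfold slope; rw [cross_sub_right]; ring
theorem slope_smul (e : ι) (t : ℝ) (v : BilliardPlane) : P.slope e (t • v) = t * P.slope e v := by
  unfold slope; rw [cross_smul_right]; ring
theorem slope_neg (e : ι) (v : BilliardPlane) : P.slope e (-v) = -P.slope e v := by
  unfold slope; rw [cross_neg_right]; ring
theorem slope_reflect (e : ι) (v : BilliardPlane) : P.slope e (P.reflect e v) = -P.slope e v := by
  unfold slope; rw [cross_edgeVec_reflect]; ring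
theorem slope_eq_zero_iff {e : ι} {v : BilliardPlane} :
    P.slope e v = 0 ↔ cross (P.edgeVec e) v = 0 := by
  unfold slope; simp [P.orient_ne_zero e]
theorem continuous_slope (e : ι) : Continuous (P.slope e) := by
  unfold slope cross; fun_prop
theorem continuous_height (e : ι) : Continuous (P.height e) := by
  unfold height slope cross; fun_prop

theorem height_sub_height (e : ι) (x y : BilliardPlane) :
    P.height e x - P.height e y = P.slope e (x - y) := by
  unfold height; rw [← slope_sub]; congr 1; abel
theorem height_add (e : ι) (x v : BilliardPlane) :
    P.height e (x + v) = P.height e x + P.slope e v := by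
  unfold height; rw [← slope_add]; congr 1; abel
theorem height_comb (e : ι) (x y : BilliardPlane) (s : ℝ) :
    P.height e (x + s • (y - x)) = (1 - s) * P.height e x + s * P.height e y := by
  rw [height_add, slope_smul, ← height_sub_height]; ring

theorem height_eq_zero_iff {e : ι} {x : BilliardPlane} :
    P.height e x = 0 ↔ cross (P.edgeVec e) (x - P.src e) = 0 := P.slope_eq_zero_iff

theorem height_eq_zero {e : ι} {x : BilliardPlane} (h : x ∈ P.edge e) : P.height e x = 0 :=
  P.height_eq_zero_iff.2 (P.mem_edge_iff.1 h).1

theorem height_eq_zero' {e : ι} {x : BilliardPlane} (h : x ∈ P.edgeInterior e) :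
    P.height e x = 0 := P.height_eq_zero (P.edgeInterior_subset_edge e h)

theorem cross_edgeVec_sub {e : ι} {x y : BilliardPlane} (hx : P.height e x = 0)
    (hy : P.height e y = 0) : cross (P.edgeVec e) (x - y) = 0 := by
  rw [← slope_eq_zero_iff, ← height_sub_height, hx, hy, sub_zero]

theorem reflect_sub {e : ι} {x y : BilliardPlane} (hx : P.height e x = 0)
    (hy : P.height e y = 0) : P.reflect e (x - y) = x - y :=
  P.reflect_of_cross_eq_zero (P.cross_edgeVec_sub hx hy)

theorem exists_ball_height {e : ι} {b : BilliardPlane} (hb : b ∈ P.edgeInterior e) :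
    ∃ ε > 0, ∀ x ∈ Metric.ball b ε,
      (0 < P.height e x → x ∈ interior P.carrier) ∧ (P.height e x < 0 → x ∉ P.carrier) :=
  (P.exists_orientation e).choose_spec.2 b hb

theorem eventually_mem_edgeInterior {e : ι} {b : BilliardPlane} (hb : b ∈ P.edgeInterior e) :
    ∀ᶠ x in 𝓝 b, P.height e x = 0 → x ∈ P.edgeInterior e := by
  have h := P.mem_edgeInterior_iff.1 hb
  have hc := (P.continuous_param e).tendsto b
  filter_upwards [hc.eventually (lt_mem_nhds h.2.1), hc.eventually (gt_mem_nhds h.2.2)]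
    with x h1 h2 h3
  exact P.mem_edgeInterior_iff.2 ⟨P.height_eq_zero_iff.1 h3, h1, h2⟩

/-- A direction which points, at `p`, into the interior of the polygon. -/
def PointsInto (p v : BilliardPlane) : Prop :=
  ∃ ε > (0 : ℝ), ∀ t : ℝ, 0 < t → t < ε → p + t • v ∈ interior P.carrier

theorem tendsto_ray (p v : BilliardPlane) :
    Tendsto (fun t : ℝ => p + t • v) (𝓝[>] 0) (𝓝 p) := by
  have : Continuous fun t : ℝ => p + t • v := by fun_prop
  have h2 := this.tendsto 0
  simp only [zero_smul, add_zero] at h2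
  exact h2.mono_left nhdsWithin_le_nhds

/-- A negative slope leads outside at once and a zero slope keeps the ray on the edge for a while;
neither is interior. -/
theorem PointsInto.slope_pos {e : ι} {p v : BilliardPlane} (h : P.PointsInto p v)
    (hp : p ∈ P.edgeInterior e) : 0 < P.slope e v := by
  obtain ⟨ε, hε, hi⟩ := h
  by_contra hcon
  push Not at hcon
  obtain ⟨δ, hδ, hd⟩ := P.exists_ball_height hp
  have ht := tendsto_ray p v
  have h0 : ∀ᶠ t : ℝ in 𝓝[>] 0, t < ε := nhdsWithin_le_nhds (gt_mem_nhds hε)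
  obtain ⟨t, ⟨⟨⟨h1, h2⟩, h3⟩, h4⟩⟩ := (((ht.eventually (Metric.ball_mem_nhds p hδ)).and
    (ht.eventually (P.eventually_mem_edgeInterior hp))).and h0).and self_mem_nhdsWithin |>.exists
  have h4' : (0:ℝ) < t := h4
  have hin := hi t h4' h3
  have hh : P.height e (p + t • v) = t * P.slope e v := by
    rw [height_add, P.height_eq_zero' hp, slope_smul, zero_add]
  rcases hcon.lt_or_eq with hlt | heq
  · exact (hd _ h1).2 (by rw [hh]; exact mul_neg_of_pos_of_neg h4' hlt) (interior_subset hin)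
  · have := h2 (by rw [hh, heq, mul_zero])
    exact P.notMem_interior_of_mem_edge (P.edgeInterior_subset_edge e this) hin

theorem pointsInto_of_slope_pos {e : ι} {p v : BilliardPlane} (hp : p ∈ P.edgeInterior e)
    (h : 0 < P.slope e v) : P.PointsInto p v := by
  obtain ⟨δ, hδ, hd⟩ := P.exists_ball_height hp
  have ht := (tendsto_ray p v).eventually (Metric.ball_mem_nhds p hδ)
  obtain ⟨ε, hε, hi⟩ := mem_nhdsGT_iff_exists_Ioo_subset.1 ht
  refine ⟨ε, hε, fun t h0 h1 => (hd _ (hi ⟨h0, h1⟩)).1 ?_⟩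
  rw [height_add, P.height_eq_zero' hp, slope_smul, zero_add]
  positivity

theorem mem_openSegment_iff_ray {a v x : BilliardPlane} {t : ℝ} (ht : 0 < t) :
    x ∈ openSegment ℝ a (a + t • v) ↔ ∃ s, 0 < s ∧ s < t ∧ x = a + s • v := by
  rw [openSegment_eq_image']
  constructor
  · rintro ⟨θ, ⟨h0, h1⟩, rfl⟩
    refine ⟨θ * t, by positivity, by nlinarith, ?_⟩
    simp [smul_smul]
  · rintro ⟨s, h0, h1, rfl⟩
    refine ⟨s / t, ⟨by positivity, by rw [div_lt_one ht]; exact h1⟩, ?_⟩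
    simp only [add_sub_cancel_left, smul_smul, div_mul_cancel₀ _ ht.ne']

theorem IsLeg.pointsInto {a b v : BilliardPlane} (h : P.IsLeg a b v) : P.PointsInto a v := by
  obtain ⟨⟨t, ht, rfl⟩, h⟩ := h
  exact ⟨t, ht, fun s h0 h1 => h ((mem_openSegment_iff_ray ht).2 ⟨s, h0, h1, rfl⟩)⟩

theorem IsLeg.reverse {a b v : BilliardPlane} (h : P.IsLeg a b v) : P.IsLeg b a (-v) := by
  obtain ⟨⟨t, ht, rfl⟩, h⟩ := h
  refine ⟨⟨t, ht, by simp⟩, ?_⟩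
  rwa [openSegment_symm]

/-- The end of a leg that stops at the boundary is determined by its start and direction. -/
theorem IsLeg.end_unique {a b b' v : BilliardPlane} (h : P.IsLeg a b v) (h' : P.IsLeg a b' v)
    {e f : ι} (hb : b ∈ P.edge e) (hb' : b' ∈ P.edge f) : b = b' := by
  obtain ⟨⟨t, ht, rfl⟩, h⟩ := h
  obtain ⟨⟨s, hs, rfl⟩, h'⟩ := h'
  rcases lt_trichotomy t s with hts | rfl | hts
  · exact absurd (h' ((mem_openSegment_iff_ray hs).2 ⟨t, ht, hts, rfl⟩))
      (P.notMem_interior_of_mem_edge hb)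
  · rfl
  · exact absurd (h ((mem_openSegment_iff_ray ht).2 ⟨s, hs, hts, rfl⟩))
      (P.notMem_interior_of_mem_edge hb')

end Finite

/-- One step of a nonsingular billiard trajectory: a leg between inner points of two edges,
followed by the reflection at its end. -/
structure Step (e e' : ι) (p v p' v' : BilliardPlane) : Prop where
  unit : ‖v‖ = 1
  dep : p ∈ P.edgeInterior e
  arr : p' ∈ P.edgeInterior e'
  leg : P.IsLeg p p' v
  optical : v' = P.reflect e' v

namespace Step
variable [Finite ι] {P} {e e' : ι} {p v p' v' : BilliardPlane} (h : P.Step e e' p v p' v')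
include h

theorem slope_dep : 0 < P.slope e v := h.leg.pointsInto.slope_pos P h.dep
theorem slope_arr : P.slope e' v < 0 := by
  have := h.leg.reverse.pointsInto.slope_pos P h.arr
  rw [slope_neg] at this; linarith
theorem exists_pos : ∃ t : ℝ, 0 < t ∧ p' = p + t • v := h.leg.1
theorem height_arr : 0 < P.height e p' := by
  obtain ⟨t, ht, rfl⟩ := h.exists_pos
  rw [height_add, P.height_eq_zero' h.dep, slope_smul, zero_add]
  exact mul_pos ht h.slope_dep
theorem height_dep : 0 < P.height e' p := by
  obtain ⟨t, ht, hp⟩ := h.exists_pos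
  have := P.height_eq_zero' h.arr
  rw [hp, height_add, slope_smul] at this
  nlinarith [mul_neg_of_pos_of_neg ht h.slope_arr]
theorem ne : e ≠ e' := by
  rintro rfl
  have := h.height_arr
  rw [P.height_eq_zero' h.arr] at this
  exact lt_irrefl _ this
theorem reverse {w : BilliardPlane} (hw : w = P.reflect e (-v)) :
    P.Step e' e p' (-v) p w := ⟨by rw [norm_neg, h.unit], h.arr, h.dep, h.leg.reverse, hw⟩
theorem next_unique {f : ι} {q w : BilliardPlane} {e₀ : ι} (h' : P.Step e₀ f p v q w) :
    p' = q ∧ e' = f := by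
  have := h.leg.end_unique P h'.leg (P.edgeInterior_subset_edge _ h.arr)
    (P.edgeInterior_subset_edge _ h'.arr)
  subst this
  exact ⟨rfl, P.eq_of_mem_edgeInterior h.arr (P.edgeInterior_subset_edge _ h'.arr)⟩
end Step

end PolygonTable

/-! ### Bounces near a vertex and a lower bound for length. -/

namespace PolygonTable
variable {ι : Type*} (P : PolygonTable ι) [Finite ι]

theorem cross_reflect_sub {e : ι} {x y v : BilliardPlane} (hx : P.height e x = 0)
    (hy : P.height e y = 0) : cross (P.reflect e v) (x - y) = -cross v (x - y) := by
  have h := P.cross_reflect e v (x - y)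
  rwa [P.reflect_sub hx hy] at h

theorem inner_reflect_sub {e : ι} {x y v : BilliardPlane} (hx : P.height e x = 0)
    (hy : P.height e y = 0) : ⟪P.reflect e v, x - y⟫ = ⟪v, x - y⟫ := by
  have h := P.inner_reflect e v (x - y)
  rwa [P.reflect_sub hx hy] at h

theorem mem_endpoints_of_mem_edges {e f : ι} {x : BilliardPlane} (hne : e ≠ f)
    (he : x ∈ P.edge e) (hf : x ∈ P.edge f) :
    x ∈ ({P.src e, P.tgt e} : Set BilliardPlane) ∧ x ∈ ({P.src f, P.tgt f} : Set BilliardPlane) :=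
  P.edges_inter e f hne ⟨he, hf⟩

theorem eq_or_eq_of_mem_edges {e f g : ι} {x : BilliardPlane} (hne : e ≠ f)
    (he : x ∈ P.edge e) (hf : x ∈ P.edge f) (hg : x ∈ P.edge g) : g = e ∨ g = f := by
  by_contra hcon
  push Not at hcon
  have h1 := P.mem_endpoints_of_mem_edges hne he hf
  have h2 := P.mem_endpoints_of_mem_edges hcon.1.symm he hg
  obtain ⟨j, -, hj⟩ := P.vertex_two_edges e x h1.1
  exact hcon.2 ((hj g ⟨hcon.1, h2.2⟩).trans (hj f ⟨hne.symm, h1.2⟩).symm)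

/-- The edge `e`, seen from one of its endpoints `w`, points in a unit direction. -/
theorem exists_direction {e : ι} {w : BilliardPlane}
    (hw : w ∈ ({P.src e, P.tgt e} : Set BilliardPlane)) :
    ∃ a : BilliardPlane, ‖a‖ = 1 ∧ P.slope e a = 0 ∧ ∃ L : ℝ, 0 < L ∧
      ∀ x, x ∈ P.edgeInterior e ↔ ∃ s : ℝ, 0 < s ∧ s < L ∧ x = w + s • a := by
  have hd := P.norm_edgeVec_pos e
  have hd' := P.edgeVec_ne_zero e
  have key : ∀ d : BilliardPlane, ‖d‖ ≠ 0 → ∀ x, x ∈ openSegment ℝ w (w + d) ↔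
      ∃ s : ℝ, 0 < s ∧ s < ‖d‖ ∧ x = w + s • (‖d‖⁻¹ • d) := by
    intro d hdn x
    have h0 : 0 < ‖d‖ := lt_of_le_of_ne (norm_nonneg _) (Ne.symm hdn)
    rw [← mem_openSegment_iff_ray h0, smul_smul, mul_inv_cancel₀ hdn, one_smul]
  rcases hw with rfl | hw
  · refine ⟨‖P.edgeVec e‖⁻¹ • P.edgeVec e, norm_smul_inv_norm hd', ?_, ‖P.edgeVec e‖, hd, ?_⟩
    · rw [slope_smul, P.slope_eq_zero_iff.2 (cross_self_eq _), mul_zero]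
    · intro x
      rw [← key _ hd.ne', edgeInterior, edgeVec, add_sub_cancel]
  · obtain rfl : w = P.tgt e := hw
    refine ⟨‖-P.edgeVec e‖⁻¹ • (-P.edgeVec e), norm_smul_inv_norm (neg_ne_zero.2 hd'), ?_,
      ‖P.edgeVec e‖, hd, ?_⟩
    · rw [slope_smul, slope_neg, P.slope_eq_zero_iff.2 (cross_self_eq _), neg_zero, mul_zero]
    · intro x
      rw [← norm_neg (P.edgeVec e), ← key _ (by rw [norm_neg]; exact hd.ne'), edgeInterior,
        edgeVec, openSegment_symm]
      simp

/-- Two edges with a common endpoint are not hit alternately for long. -/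
theorem exists_bound_alternating {A B : ι} {w : BilliardPlane} (hne : A ≠ B)
    (hA : w ∈ P.edge A) (hB : w ∈ P.edge B) :
    ∃ N : ℕ, ∀ (y v : ℕ → BilliardPlane) (e : ℕ → ι),
      (∀ k < N, P.Step (e k) (e (k + 1)) (y k) (v k) (y (k + 1)) (v (k + 1))) →
      (∀ k ≤ N, e k = A ∨ e k = B) → False := by
  obtain ⟨h1, h2⟩ := P.mem_endpoints_of_mem_edges hne hA hB
  obtain ⟨a, ha, hsa, La, -, hpa⟩ := P.exists_direction h1
  obtain ⟨b, hb, hsb, Lb, -, hpb⟩ := P.exists_direction h2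
  -- a uniform direction for both edges
  have hdir : ∀ e, e = A ∨ e = B → P.height e w = 0 := by
    rintro e (rfl | rfl)
    · exact P.height_eq_zero hA
    · exact P.height_eq_zero hB
  have hcross : ∀ e f x y, e ≠ f → (e = A ∨ e = B) → (f = A ∨ f = B) → x ∈ P.edgeInterior e →
      y ∈ P.edgeInterior f → |cross (x - w) (y - w)| = ‖x - w‖ * ‖y - w‖ * |cross a b| := by
    have : ∀ x y, x ∈ P.edgeInterior A → y ∈ P.edgeInterior B →
        |cross (x - w) (y - w)| = ‖x - w‖ * ‖y - w‖ * |cross a b| := by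
      intro x y hx hy
      obtain ⟨s, hs, -, rfl⟩ := (hpa x).1 hx
      obtain ⟨t, ht, -, rfl⟩ := (hpb y).1 hy
      simp only [add_sub_cancel_left, cross_smul_left, cross_smul_right, abs_mul, norm_smul, ha, hb,
        Real.norm_eq_abs]
      ring
    rintro e f x y hef (rfl | rfl) (rfl | rfl) hx hy
    · exact absurd rfl hef
    · exact this x y hx hy
    · rw [cross_swap, abs_neg, this y x hy hx]; ring
    · exact absurd rfl hef
  -- If the edges are collinear, a leg from one to the other would stay on the line of its first
  -- edge, against the positive height of its end; one step is already too many.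
  by_cases hc : cross a b = 0
  · refine ⟨1, fun y v e hst he => ?_⟩
    have hs := hst 0 one_pos
    have he0 := he 0 zero_le_one
    have he1 := he 1 le_rfl
    have := hcross _ _ _ _ hs.ne he0 he1 hs.dep hs.arr
    rw [hc, abs_zero, mul_zero, abs_eq_zero] at this
    obtain ⟨t, ht, hy1⟩ := hs.exists_pos
    have hy0 : y 0 - w ≠ 0 := by
      intro h
      rw [sub_eq_zero] at h
      have := hs.dep
      rw [h] at this
      rcases he0 with h0 | h0 <;> rw [h0] at this
      · exact P.edgeInterior_notMem_vertices this
          (by rcases h1 with h1 | h1 <;> rw [h1]; exacts [Or.inl ⟨_, rfl⟩, Or.inr ⟨_, rfl⟩])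
      · exact P.edgeInterior_notMem_vertices this
          (by rcases h2 with h1 | h1 <;> rw [h1]; exacts [Or.inl ⟨_, rfl⟩, Or.inr ⟨_, rfl⟩])
    have h3 := exists_smul_of_cross_eq_zero hy0 this
    have h4 := hs.height_arr
    have h5 : P.slope (e 0) (y 0 - w) = 0 := by
      rw [← height_sub_height, P.height_eq_zero' hs.dep, hdir _ he0, sub_zero]
    have h6 : P.height (e 0) (y 1) = P.height (e 0) w + P.slope (e 0) (y 1 - w) := by
      rw [← height_sub_height]; ring
    have h7 : y (0 + 1) = y 1 := rfl
    rw [h7] at h4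
    rw [h6, h3, slope_smul, h5, hdir _ he0] at h4
    simp at h4
  set c := |cross a b| with hcdef
  have hcpos : 0 < c := abs_pos.2 hc
  obtain ⟨N, hN⟩ := exists_nat_gt (Real.pi / c)
  -- The additional step supplies the unit norm of `v N`.
  refine ⟨N + 1, fun y v e hst he => ?_⟩
  set h := |cross (y 0 - w) (v 0)| with hh
  set p : ℕ → ℝ := fun k => ⟪y k - w, v k⟫ with hp
  have hx0 : ∀ k ≤ N + 1, P.height (e k) w = 0 := fun k hk => hdir _ (he k hk)
  -- Both edges lie on lines through `w`. Reflection there flips the sign of the moment about `w`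
  -- and keeps the radial component, so the unfolded path is a straight line at the constant
  -- distance `h` from `w`, with position `p k` along it.
  have hstep : ∀ k < N + 1, ∃ t : ℝ, 0 < t ∧ y (k + 1) = y k + t • v k ∧
      cross (y (k + 1) - w) (v (k + 1)) = -cross (y k - w) (v k) ∧ p (k + 1) = p k + t := by
    intro k hk
    have hs := hst k hk
    obtain ⟨t, ht, hy⟩ := hs.exists_pos
    have hh0 := P.height_eq_zero' hs.arr
    refine ⟨t, ht, hy, ?_, ?_⟩
    · rw [hs.optical, cross_swap, P.cross_reflect_sub hh0 (hx0 _ hk), neg_neg, hy,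
        show y k + t • v k - w = (y k - w) + t • v k by abel, cross_add_right, cross_smul_right,
        cross_self_eq, cross_swap]; ring
    · simp only [hp]
      rw [hs.optical, real_inner_comm, P.inner_reflect_sub hh0 (hx0 _ hk), hy,
        show y k + t • v k - w = (y k - w) + t • v k by abel, inner_add_right, inner_smul_right,
        real_inner_self_eq_norm_sq, hs.unit, real_inner_comm]; ring
  have habs : ∀ k ≤ N + 1, |cross (y k - w) (v k)| = h := by
    intro k
    induction k with
    | zero => intro _; rfl
    | succ k ih =>
      intro hk
      obtain ⟨t, -, -, h3, -⟩ := hstep k hk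
      rw [h3, abs_neg, ih (by omega)]
  -- With zero moment the first leg would lie on a line through `w`: it would start at `w` or run
  -- along its edge.
  have hpos : 0 < h := by
    have hs := hst 0 (by omega)
    rw [hh]
    refine abs_pos.2 fun h0 => ?_
    have h1 : P.slope (e 0) (y 0 - w) = 0 := by
      rw [← height_sub_height, P.height_eq_zero' hs.dep, hx0 0 (by omega), sub_zero]
    have h3 := eq_smul_of_cross_eq_zero hs.unit
      (show cross (v 0) (y 0 - w) = 0 by rw [cross_swap, h0, neg_zero])
    rw [h3, slope_smul] at h1
    rcases mul_eq_zero.1 h1 with h4 | h4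
    · rw [h4, zero_smul] at h3
      have hdep := hs.dep
      rw [sub_eq_zero.1 h3] at hdep
      have hv : w ∈ P.vertices := by
        rcases P.mem_endpoints_of_mem_edges hne hA hB with ⟨h1 | h1, -⟩ <;> rw [h1]
        exacts [Or.inl ⟨_, rfl⟩, Or.inr ⟨_, rfl⟩]
      exact P.edgeInterior_notMem_vertices hdep hv
    · exact hs.slope_dep.ne' h4
  have hunit : ∀ k < N + 1, ‖v k‖ = 1 := fun k hk => (hst k hk).unit
  have hnorm : ∀ k < N + 1, ‖y k - w‖ ^ 2 = p k ^ 2 + h ^ 2 := by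
    intro k hk
    have := cross_sq_add_inner_sq (y k - w) (v k)
    rw [hunit k hk, ← sq_abs, habs k hk.le] at this
    simp only [hp]; linarith
  -- `arctan (p k / h)` is the angle at which the unfolded point is seen from `w`. Computing the
  -- area of the triangle with vertices `w`, `y k`, `y (k + 1)` in two ways shows that the sine of
  -- the increment is `c`; hence the increment is at least `c`, while the total is less than `π`.
  have hinc : ∀ k < N, c ≤ Real.arctan (p (k + 1) / h) - Real.arctan (p k / h) := by
    intro k hk
    have hs := hst k (by omega)
    obtain ⟨t, ht, hy, -, hpk⟩ := hstep k (by omega)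
    have hcr := hcross _ _ _ _ hs.ne (he k (by omega)) (he (k + 1) (by omega)) hs.dep hs.arr
    have hcr2 : |cross (y k - w) (y (k + 1) - w)| = t * h := by
      rw [hy, show y k + t • v k - w = (y k - w) + t • v k by abel, cross_add_right,
        cross_self_eq, cross_smul_right, zero_add, abs_mul, habs k (by omega), abs_of_pos ht]
    have hsq : ∀ j < N + 1, √(1 + (p j / h) ^ 2) = ‖y j - w‖ / h := by
      intro j hj
      rw [show 1 + (p j / h) ^ 2 = (‖y j - w‖ / h) ^ 2 by
        rw [div_pow, div_pow, hnorm j hj]; field_simp; ring]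
      exact Real.sqrt_sq (by positivity)
    have hn : ∀ j < N + 1, 0 < ‖y j - w‖ := by
      intro j hj
      have := hnorm j hj
      by_contra h0
      have h0' : ‖y j - w‖ = 0 := le_antisymm (not_lt.1 h0) (norm_nonneg _)
      rw [h0'] at this
      nlinarith [sq_nonneg (p j)]
    have hsin : Real.sin (Real.arctan (p (k + 1) / h) - Real.arctan (p k / h)) = c := by
      rw [Real.sin_sub, Real.sin_arctan, Real.cos_arctan, Real.sin_arctan, Real.cos_arctan,
        hsq k (by omega), hsq (k + 1) (by omega), hpk]
      have a1 := hn k (by omega)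
      have a2 := hn (k + 1) (by omega)
      rw [hcr2] at hcr
      field_simp
      linarith
    rw [← hsin]
    refine Real.sin_le (sub_nonneg.2 (Real.arctan_strictMono.monotone ?_))
    rw [hpk]; gcongr; linarith
  have hsum : ∀ k ≤ N, k * c ≤ Real.arctan (p k / h) - Real.arctan (p 0 / h) := by
    intro k
    induction k with
    | zero => intro _; simp
    | succ k ih =>
      intro hk
      have := ih (by omega)
      have := hinc k (by omega)
      push_cast; linarith
  have h3 := hsum N le_rfl
  have h4 := Real.arctan_lt_pi_div_two (p N / h)
  have h5 := Real.neg_pi_div_two_lt_arctan (p 0 / h)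
  rw [div_lt_iff₀ hcpos] at hN
  linarith

/-- A Lebesgue number for the cover by the balls of `exists_ball_disjoint_edges`: all edges that
come within `δ` of a point pass through a single point. -/
theorem exists_cluster_radius : ∃ δ > 0, ∀ x ∈ P.carrier, ∃ x₀, ∀ e, ∀ p ∈ P.edge e,
    dist p x < δ → x₀ ∈ P.edge e := by
  choose r hr hball using P.exists_ball_disjoint_edges
  obtain ⟨δ, hδ, h⟩ := lebesgue_number_lemma_of_metric P.isCompact_carrier
    (c := fun x => Metric.ball x (r x)) (fun x => Metric.isOpen_ball)
    (fun x _ => Set.mem_iUnion.2 ⟨x, Metric.mem_ball_self (hr x)⟩)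
  refine ⟨δ, hδ, fun x hx => ?_⟩
  obtain ⟨x₀, hx₀⟩ := h x hx
  exact ⟨x₀, fun e p hp hd => hball x₀ p (hx₀ hd) e hp⟩

/-- Sufficiently many successive legs have a total length which is bounded below. -/
theorem exists_length_bound : ∃ (N : ℕ) (δ : ℝ), 0 < δ ∧ ∀ (y v : ℕ → BilliardPlane) (e : ℕ → ι),
    (∀ k < N, P.Step (e k) (e (k + 1)) (y k) (v k) (y (k + 1)) (v (k + 1))) →
    δ ≤ ∑ k ∈ Finset.range N, dist (y k) (y (k + 1)) := by
  -- The bound for alternating hits depends only on the pair of edges; as there are finitely many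
  -- pairs, the maximum `M` serves them all.
  have hN : ∀ q : ι × ι, ∃ N : ℕ, ∀ w, q.1 ≠ q.2 → w ∈ P.edge q.1 → w ∈ P.edge q.2 →
      ∀ (y v : ℕ → BilliardPlane) (e : ℕ → ι),
      (∀ k < N, P.Step (e k) (e (k + 1)) (y k) (v k) (y (k + 1)) (v (k + 1))) →
      (∀ k ≤ N, e k = q.1 ∨ e k = q.2) → False := by
    intro q
    by_cases h : ∃ w, q.1 ≠ q.2 ∧ w ∈ P.edge q.1 ∧ w ∈ P.edge q.2
    · obtain ⟨w, h1, h2, h3⟩ := h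
      obtain ⟨N, hN⟩ := P.exists_bound_alternating h1 h2 h3
      exact ⟨N, fun _ _ _ _ => hN⟩
    · exact ⟨0, fun w h1 h2 h3 => absurd ⟨w, h1, h2, h3⟩ h⟩
  choose N hN using hN
  obtain ⟨M, hM⟩ := (Set.finite_range N).bddAbove
  obtain ⟨δ, hδ, hcl⟩ := P.exists_cluster_radius
  refine ⟨M + 1, δ, hδ, fun y v e hst => ?_⟩
  by_contra hlt
  push Not at hlt
  have hy0 : y 0 ∈ P.carrier :=
    P.edge_subset_carrier _ (P.edgeInterior_subset_edge _ (hst 0 (by omega)).dep)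
  obtain ⟨x₀, hx₀⟩ := hcl _ hy0
  -- A total length below `δ` keeps every bounce within `δ` of `y 0`. All edges hit then pass
  -- through `x₀`, so only two edges occur, which is impossible for that many steps.
  have hmem : ∀ k ≤ M + 1, x₀ ∈ P.edge (e k) := by
    intro k hk
    have hin : y k ∈ P.edgeInterior (e k) := by
      rcases Nat.lt_or_ge k (M + 1) with h | h
      · exact (hst k h).dep
      · obtain rfl : k = M + 1 := by omega
        exact (hst M (by omega)).arr
    refine hx₀ _ _ (P.edgeInterior_subset_edge _ hin) ?_
    rw [dist_comm]
    refine lt_of_le_of_lt ((dist_le_range_sum_dist y k).trans ?_) hlt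
    exact Finset.sum_le_sum_of_subset_of_nonneg (Finset.range_mono hk)
      fun _ _ _ => dist_nonneg
  have hne : e 0 ≠ e 1 := (hst 0 (by omega)).ne
  have hle : N (e 0, e 1) ≤ M := hM ⟨_, rfl⟩
  refine hN (e 0, e 1) x₀ hne (hmem 0 (by omega)) (hmem 1 (by omega)) y v e
    (fun k hk => hst k (by omega)) fun k hk => ?_
  exact P.eq_or_eq_of_mem_edges hne (hmem 0 (by omega)) (hmem 1 (by omega)) (hmem k (by omega))

end PolygonTable

/-! ### Ideal trajectories: separation, parallelism, reversal and compactness. -/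

namespace PolygonTable
variable {ι : Type*} (P : PolygonTable ι)

/-- A step of an ideal trajectory: the closed conditions which limits of steps satisfy. -/
structure LimitStep (e e' : ι) (p v p' v' : BilliardPlane) : Prop where
  unit : ‖v‖ = 1
  dep : p ∈ P.edge e
  arr : p' ∈ P.edge e'
  eq : p' = p + dist p p' • v
  optical : v' = P.reflect e' v

theorem Step.limitStep {P : PolygonTable ι} {e e' : ι} {p v p' v' : BilliardPlane}
    (h : P.Step e e' p v p' v') : P.LimitStep e e' p v p' v' where
  unit := h.unit
  dep := P.edgeInterior_subset_edge _ h.dep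
  arr := P.edgeInterior_subset_edge _ h.arr
  eq := by
    obtain ⟨t, ht, rfl⟩ := h.leg.1
    rw [dist_self_add_right, norm_smul, h.unit, mul_one, Real.norm_of_nonneg ht.le]
  optical := h.optical

variable [Finite ι]

namespace LimitStep
variable {P} {e e' : ι} {p v p' v' q u q' u' : BilliardPlane}

theorem cross_dir (h : P.LimitStep e e' p v p' v') (h' : P.LimitStep e e' q u q' u') :
    cross v' u' = -cross v u := by rw [h.optical, h'.optical, cross_reflect]

theorem inner_dir (h : P.LimitStep e e' p v p' v') (h' : P.LimitStep e e' q u q' u') :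
    ⟪v', u'⟫ = ⟪v, u⟫ := by rw [h.optical, h'.optical, inner_reflect]

/-- Both end points lie on the line of `e'`, so their difference is fixed by the reflection and only
the orientation changes; the second leg contributes its length times the turn. -/
theorem cross_sub (h : P.LimitStep e e' p v p' v') (h' : P.LimitStep e e' q u q' u') :
    cross v' (q' - p') = -(cross v (q - p) + dist q q' * cross v u) := by
  rw [h.optical, P.cross_reflect_sub (P.height_eq_zero h'.arr) (P.height_eq_zero h.arr)]
  conv_lhs => rw [h.eq, h'.eq]
  simp only [cross_sub_right, cross_add_right, cross_smul_right, cross_self_eq]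
  ring

theorem inner_sub (h : P.LimitStep e e' p v p' v') (h' : P.LimitStep e e' q u q' u') :
    ⟪v', q' - p'⟫ = ⟪v, q - p⟫ + dist q q' * ⟪v, u⟫ - dist p p' := by
  rw [h.optical, P.inner_reflect_sub (P.height_eq_zero h'.arr) (P.height_eq_zero h.arr)]
  conv_lhs => rw [h.eq, h'.eq]
  simp only [inner_sub_right, inner_add_right, inner_smul_right, real_inner_self_eq_norm_sq, h.unit]
  ring
end LimitStep

section Sequences
variable {P} {e : ℕ → ι} {p v q u : ℕ → BilliardPlane} {n : ℕ}

/-- The separation of two trajectories with the same bounce sequence is an affine function of the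
length, up to the alternating sign. -/
theorem separation (h : ∀ k < n, P.LimitStep (e k) (e (k + 1)) (p k) (v k) (p (k + 1)) (v (k + 1)))
    (h' : ∀ k < n, P.LimitStep (e k) (e (k + 1)) (q k) (u k) (q (k + 1)) (u (k + 1)))
    {k : ℕ} (hk : k ≤ n) :
    cross (v k) (u k) = (-1) ^ k * cross (v 0) (u 0) ∧ ⟪v k, u k⟫ = ⟪v 0, u 0⟫ ∧
    cross (v k) (q k - p k) = (-1) ^ k * (cross (v 0) (q 0 - p 0) +
      cross (v 0) (u 0) * ∑ i ∈ Finset.range k, dist (q i) (q (i + 1))) ∧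
    ⟪v k, q k - p k⟫ = ⟪v 0, q 0 - p 0⟫ + ⟪v 0, u 0⟫ *
      (∑ i ∈ Finset.range k, dist (q i) (q (i + 1))) -
      ∑ i ∈ Finset.range k, dist (p i) (p (i + 1)) := by
  induction k with
  | zero => simp
  | succ k ih =>
    obtain ⟨h1, h2, h3, h4⟩ := ih (by omega)
    have a := h k (by omega)
    have b := h' k (by omega)
    refine ⟨?_, ?_, ?_, ?_⟩
    · rw [a.cross_dir b, h1]; ring
    · rw [a.inner_dir b, h2]
    · rw [a.cross_sub b, h3, h1, Finset.sum_range_succ]; ring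
    · rw [a.inner_sub b, h4, h2, Finset.sum_range_succ, Finset.sum_range_succ]; ring
end Sequences

theorem exists_diameter : ∃ D : ℝ, 0 < D ∧ ∀ x ∈ P.carrier, ∀ y ∈ P.carrier, ‖x - y‖ ≤ D := by
  obtain ⟨C, hC⟩ := P.isCompact_carrier.isBounded.exists_norm_le
  refine ⟨2 * |C| + 1, by positivity, fun x hx y hy => ?_⟩
  have := norm_sub_le x y
  have := hC x hx
  have := hC y hy
  linarith [le_abs_self C]

/-- The `n`-th step of a trajectory indexed by the integers. -/
def StepAt (y v : ℤ → BilliardPlane) (e : ℤ → ι) (n : ℤ) : Prop :=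
  P.Step (e n) (e (n + 1)) (y n) (v n) (y (n + 1)) (v (n + 1))

/-- The ideal trajectories on the window from `a` to `b`: limits of nonsingular ones. -/
def Approx (y v : ℤ → BilliardPlane) (e : ℤ → ι) (a b : ℤ) : Prop :=
  ∀ ε > 0, ∃ y' v' : ℤ → BilliardPlane, (∀ n, a ≤ n → n < b → P.StepAt y' v' e n) ∧
    ∀ n, a ≤ n → n ≤ b → dist (y' n) (y n) < ε ∧ dist (v' n) (v n) < ε

/-- Ideal trajectories from the index `a` on. -/
def IdealFrom (a : ℤ) (y v : ℤ → BilliardPlane) (e : ℤ → ι) : Prop := ∀ b, P.Approx y v e a b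

/-- Bi-infinite ideal trajectories. -/
def Ideal (y v : ℤ → BilliardPlane) (e : ℤ → ι) : Prop := ∀ a b, P.Approx y v e a b

variable {P}
theorem Approx.mono {y v : ℤ → BilliardPlane} {e : ℤ → ι} {a b a' b' : ℤ}
    (h : P.Approx y v e a b) (ha : a ≤ a') (hb : b' ≤ b) : P.Approx y v e a' b' := by
  intro ε hε
  obtain ⟨y', v', h1, h2⟩ := h ε hε
  exact ⟨y', v', fun n hn hn' => h1 n (by omega) (by omega), fun n hn hn' =>
    h2 n (by omega) (by omega)⟩

theorem Approx.shift {y v : ℤ → BilliardPlane} {e : ℤ → ι} {a b : ℤ} (c : ℤ)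
    (h : P.Approx y v e (c + a) (c + b)) :
    P.Approx (fun n => y (c + n)) (fun n => v (c + n)) (fun n => e (c + n)) a b := by
  intro ε hε
  obtain ⟨y', v', h1, h2⟩ := h ε hε
  refine ⟨fun n => y' (c + n), fun n => v' (c + n), fun n hn hn' => ?_, fun n hn hn' =>
    h2 (c + n) (by omega) (by omega)⟩
  have := h1 (c + n) (by omega) (by omega)
  simp only [StepAt] at this ⊢
  rwa [← add_assoc]

theorem StepAt.congr {y v : ℤ → BilliardPlane} {e f : ℤ → ι} {n : ℤ} (h : P.StepAt y v e n)
    (h1 : e n = f n) (h2 : e (n + 1) = f (n + 1)) : P.StepAt y v f n := by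
  simp only [StepAt] at h ⊢; rwa [← h1, ← h2]

theorem Approx.congr {y v : ℤ → BilliardPlane} {e f : ℤ → ι} {a b : ℤ}
    (h : P.Approx y v e a b) (hf : ∀ n, a ≤ n → n ≤ b → e n = f n) : P.Approx y v f a b := by
  intro ε hε
  obtain ⟨y', v', h1, h2⟩ := h ε hε
  exact ⟨y', v', fun n hn hn' => (h1 n hn hn').congr (hf n hn (by omega))
    (hf (n + 1) (by omega) (by omega)), h2⟩

theorem approx_of_step {y v : ℤ → BilliardPlane} {e : ℤ → ι} {a b : ℤ}
    (h : ∀ n, a ≤ n → n < b → P.StepAt y v e n) : P.Approx y v e a b :=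
  fun ε hε => ⟨y, v, h, fun n _ _ => by simpa using hε⟩

theorem Approx.exists_seq {y v : ℤ → BilliardPlane} {e : ℤ → ι} {a b : ℤ}
    (h : P.Approx y v e a b) : ∃ Y V : ℕ → ℤ → BilliardPlane,
      (∀ k n, a ≤ n → n < b → P.StepAt (Y k) (V k) e n) ∧
      ∀ n, a ≤ n → n ≤ b → Tendsto (fun k => Y k n) atTop (𝓝 (y n)) ∧
        Tendsto (fun k => V k n) atTop (𝓝 (v n)) := by
  have h' : ∀ k : ℕ, (0 : ℝ) < 1 / (k + 1) := fun k => by positivity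
  choose Y V h1 h2 using fun k : ℕ => h (1 / (k + 1)) (h' k)
  refine ⟨Y, V, fun k => h1 k, fun n hn hn' => ⟨?_, ?_⟩⟩ <;> rw [tendsto_iff_dist_tendsto_zero]
  · exact squeeze_zero (fun _ => dist_nonneg) (fun k => (h2 k n hn hn').1.le)
      tendsto_one_div_add_atTop_nhds_zero_nat
  · exact squeeze_zero (fun _ => dist_nonneg) (fun k => (h2 k n hn hn').2.le)
      tendsto_one_div_add_atTop_nhds_zero_nat

/-- A sequence of trajectories whose codes agree with the limit code on longer and longer parts. -/
theorem IdealFrom.exists_seq {y v : ℤ → BilliardPlane} {e : ℤ → ι} {a : ℤ}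
    (h : P.IdealFrom a y v e) : ∃ Y V : ℕ → ℤ → BilliardPlane,
      (∀ (k : ℕ) n, a ≤ n → n < a + k → P.StepAt (Y k) (V k) e n) ∧
      ∀ n, a ≤ n → Tendsto (fun k => Y k n) atTop (𝓝 (y n)) ∧
        Tendsto (fun k => V k n) atTop (𝓝 (v n)) := by
  have h' : ∀ k : ℕ, (0 : ℝ) < 1 / (k + 1) := fun k => by positivity
  choose Y V h1 h2 using fun k : ℕ => h (a + k) (1 / (k + 1)) (h' k)
  refine ⟨Y, V, fun k => h1 k, fun n hn => ⟨?_, ?_⟩⟩ <;> rw [tendsto_iff_dist_tendsto_zero]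
  · refine squeeze_zero' (Eventually.of_forall fun _ => dist_nonneg) ?_
      tendsto_one_div_add_atTop_nhds_zero_nat
    filter_upwards [eventually_ge_atTop (n - a).toNat] with k hk
    exact (h2 k n hn (by omega)).1.le
  · refine squeeze_zero' (Eventually.of_forall fun _ => dist_nonneg) ?_
      tendsto_one_div_add_atTop_nhds_zero_nat
    filter_upwards [eventually_ge_atTop (n - a).toNat] with k hk
    exact (h2 k n hn (by omega)).2.le

/-- All conditions of a `LimitStep` are closed, while interiority of the end points and of the leg
may be lost; a subsequence of true steps is enough. -/
theorem limitStep_of_tendsto {e e' : ι} {p v p' v' : BilliardPlane}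
    {p₁ v₁ p₂ v₂ : ℕ → BilliardPlane}
    (h : ∃ᶠ k in atTop, P.Step e e' (p₁ k) (v₁ k) (p₂ k) (v₂ k))
    (h1 : Tendsto p₁ atTop (𝓝 p)) (h2 : Tendsto v₁ atTop (𝓝 v))
    (h3 : Tendsto p₂ atTop (𝓝 p')) (h4 : Tendsto v₂ atTop (𝓝 v')) :
    P.LimitStep e e' p v p' v' := by
  obtain ⟨φ, hφ, h⟩ := extraction_of_frequently_atTop h
  replace h1 := h1.comp hφ.tendsto_atTop
  replace h2 := h2.comp hφ.tendsto_atTop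
  replace h3 := h3.comp hφ.tendsto_atTop
  replace h4 := h4.comp hφ.tendsto_atTop
  refine ⟨?_, ?_, ?_, ?_, ?_⟩
  · exact tendsto_nhds_unique h2.norm (tendsto_const_nhds.congr fun k => (h k).unit.symm)
  · exact (P.isClosed_edge e).mem_of_tendsto h1 (Eventually.of_forall fun k => (h k).limitStep.dep)
  · exact (P.isClosed_edge e').mem_of_tendsto h3 (Eventually.of_forall fun k => (h k).limitStep.arr)
  · exact tendsto_nhds_unique h3
      ((h1.add ((h1.dist h3).smul h2)).congr fun k => (h k).limitStep.eq.symm)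
  · exact tendsto_nhds_unique h4 ((((P.continuous_reflect e').tendsto v).comp h2).congr
      fun k => (h k).optical.symm)

theorem Approx.limitStep {y v : ℤ → BilliardPlane} {e : ℤ → ι} {a b : ℤ}
    (h : P.Approx y v e a b) {n : ℤ} (hn : a ≤ n) (hn' : n < b) :
    P.LimitStep (e n) (e (n + 1)) (y n) (v n) (y (n + 1)) (v (n + 1)) := by
  obtain ⟨Y, V, h1, h2⟩ := h.exists_seq
  exact limitStep_of_tendsto (Frequently.of_forall fun k => h1 k n hn hn')
    (h2 n hn hn'.le).1 (h2 n hn hn'.le).2 (h2 (n + 1) (by omega) (by omega)).1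
    (h2 (n + 1) (by omega) (by omega)).2

theorem Approx.ne {y v : ℤ → BilliardPlane} {e : ℤ → ι} {a b : ℤ}
    (h : P.Approx y v e a b) {n : ℤ} (hn : a ≤ n) (hn' : n < b) : e n ≠ e (n + 1) := by
  obtain ⟨y', v', h1, -⟩ := h 1 one_pos
  exact (h1 n hn hn').ne

theorem Approx.limitStep_nat {y v : ℤ → BilliardPlane} {e : ℤ → ι} {a b : ℤ}
    (h : P.Approx y v e a b) {k : ℕ} (hk : a + k < b) :
    P.LimitStep (e (a + k)) (e (a + (k + 1 : ℕ))) (y (a + k)) (v (a + k)) (y (a + (k + 1 : ℕ)))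
      (v (a + (k + 1 : ℕ))) := by
  have := h.limitStep (n := a + k) (by omega) hk
  rwa [add_assoc] at this

theorem IdealFrom.limitStep_nat {y v : ℤ → BilliardPlane} {e : ℤ → ι} {a : ℤ}
    (h : P.IdealFrom a y v e) (k : ℕ) :
    P.LimitStep (e (a + k)) (e (a + (k + 1 : ℕ))) (y (a + k)) (v (a + k)) (y (a + (k + 1 : ℕ)))
      (v (a + (k + 1 : ℕ))) := (h (a + k + 1)).limitStep_nat (by omega)

theorem IdealFrom.limitStep {y v : ℤ → BilliardPlane} {e : ℤ → ι} {a : ℤ}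
    (h : P.IdealFrom a y v e) {n : ℤ} (hn : a ≤ n) :
    P.LimitStep (e n) (e (n + 1)) (y n) (v n) (y (n + 1)) (v (n + 1)) :=
  (h (n + 1)).limitStep hn (by omega)

theorem IdealFrom.mono {y v : ℤ → BilliardPlane} {e : ℤ → ι} {a a' : ℤ}
    (h : P.IdealFrom a y v e) (ha : a ≤ a') : P.IdealFrom a' y v e :=
  fun b => (h b).mono ha le_rfl

theorem Ideal.idealFrom {y v : ℤ → BilliardPlane} {e : ℤ → ι} (h : P.Ideal y v e) (a : ℤ) :
    P.IdealFrom a y v e := fun b => h a b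

theorem Ideal.limitStep {y v : ℤ → BilliardPlane} {e : ℤ → ι} (h : P.Ideal y v e) (n : ℤ) :
    P.LimitStep (e n) (e (n + 1)) (y n) (v n) (y (n + 1)) (v (n + 1)) :=
  (h.idealFrom n).limitStep le_rfl

theorem Ideal.shift {y v : ℤ → BilliardPlane} {e : ℤ → ι} (h : P.Ideal y v e) (c : ℤ) :
    P.Ideal (fun n => y (c + n)) (fun n => v (c + n)) (fun n => e (c + n)) :=
  fun _ _ => (h _ _).shift c

theorem LimitStep.dep_mem_carrier {e e' : ι} {p v p' v' : BilliardPlane}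
    (h : P.LimitStep e e' p v p' v') : p ∈ P.carrier := P.edge_subset_carrier _ h.dep

-- Each block of `N` legs has length at least `δ`; the inequality passes from approximating
-- trajectories to ideal ones by continuity of the finite sum.
variable (P) in
theorem exists_length_bound' : ∃ (N : ℕ) (δ : ℝ), 0 < δ ∧ ∀ (y v : ℤ → BilliardPlane) (e : ℤ → ι)
    (a : ℤ) (J : ℕ), P.Approx y v e a (a + (N * J : ℕ)) →
    J * δ ≤ ∑ k ∈ Finset.range (N * J), dist (y (a + k)) (y (a + (k + 1 : ℕ))) := by
  obtain ⟨N, δ, hδ, h⟩ := P.exists_length_bound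
  refine ⟨N, δ, hδ, fun y v e a J => ?_⟩
  induction J with
  | zero => intro _; simp
  | succ J ih =>
    intro hA
    have h1 := ih (hA.mono le_rfl (by push_cast; nlinarith))
    rw [Nat.mul_succ, Finset.sum_range_add]
    have h2 : δ ≤ ∑ k ∈ Finset.range N,
        dist (y (a + (N * J + k : ℕ))) (y (a + (N * J + k + 1 : ℕ))) := by
      obtain ⟨Y, V, h3, h4⟩ := hA.exists_seq
      have ht : Tendsto (fun m => ∑ k ∈ Finset.range N,
          dist (Y m (a + (N * J + k : ℕ))) (Y m (a + (N * J + k + 1 : ℕ)))) atTop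
          (𝓝 (∑ k ∈ Finset.range N,
            dist (y (a + (N * J + k : ℕ))) (y (a + (N * J + k + 1 : ℕ))))) := by
        refine tendsto_finsetSum _ fun k hk => ?_
        have hk' : k < N := Finset.mem_range.1 hk
        refine ((h4 _ ?_ ?_).1).dist ((h4 _ ?_ ?_).1) <;> push_cast <;> nlinarith
      refine ge_of_tendsto ht (Eventually.of_forall fun m => ?_)
      refine h (fun k => Y m (a + (N * J + k : ℕ))) (fun k => V m (a + (N * J + k : ℕ)))
        (fun k => e (a + (N * J + k : ℕ))) fun k hk => ?_
      have := h3 m (a + (N * J + k : ℕ)) (by push_cast; nlinarith) (by push_cast; nlinarith)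
      simp only [StepAt] at this
      convert this using 2 <;> push_cast <;> ring
    push_cast at h1 h2 ⊢
    linarith

/-- Two ideal trajectories with the same bounce sequence are parallel. -/
theorem IdealFrom.dir_eq {y v z u : ℤ → BilliardPlane} {e f : ℤ → ι} {a : ℤ}
    (h : P.IdealFrom a y v e) (h' : P.IdealFrom a z u f) (hef : ∀ n, a ≤ n → e n = f n) {n : ℤ}
    (hn : a ≤ n) : v n = u n := by
  replace h := h.mono hn
  replace h' : P.IdealFrom n z u e := fun b => ((h'.mono hn) b).congr
    fun m hm _ => (hef m (by omega)).symm
  obtain ⟨D, hD, hdiam⟩ := P.exists_diameter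
  obtain ⟨N, δ, hδ, hlen⟩ := P.exists_length_bound'
  have hsep := fun k => separation (n := k) (k := k) (e := fun k => e (n + k))
    (fun k _ => h.limitStep_nat k) (fun k _ => h'.limitStep_nat k) le_rfl
  have hb : ∀ k : ℕ, ‖z (n + k) - y (n + k)‖ ≤ D := fun k =>
    hdiam _ (h'.limitStep_nat k).dep_mem_carrier _ (h.limitStep_nat k).dep_mem_carrier
  simp only [Nat.cast_zero, add_zero] at hsep
  have hun : ∀ k : ℕ, ‖v (n + k)‖ = 1 := fun k => (h.limitStep_nat k).unit
  have hv1 : ‖v n‖ = 1 := by simpa using hun 0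
  have hu1 : ‖u n‖ = 1 := by simpa using (h'.limitStep_nat 0).unit
  -- A nonzero turn times an unbounded length would exceed the bound `2 * D` for the change of the
  -- separation.
  have hcr : cross (v n) (u n) = 0 := by
    by_contra hne
    obtain ⟨J, hJ⟩ := exists_nat_gt ((2 * D) / (|cross (v n) (u n)| * δ))
    rw [div_lt_iff₀ (by positivity)] at hJ
    have h1 := (hsep (N * J)).2.2.1
    have h2 := hlen z u e n J (h' _)
    have h3 := abs_cross_le (v (n + (N * J : ℕ))) (z (n + (N * J : ℕ)) - y (n + (N * J : ℕ)))
    rw [hun, one_mul] at h3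
    have h4 := abs_cross_le (v n) (z n - y n)
    have h5 := hb 0
    simp only [Nat.cast_zero, add_zero] at h5
    rw [hv1, one_mul] at h4
    rw [h1, abs_mul, abs_pow, abs_neg, abs_one, one_pow, one_mul] at h3
    set S := ∑ i ∈ Finset.range (N * J), dist (z (n + i)) (z (n + (i + 1 : ℕ)))
    have h6 : |cross (v n) (u n) * S| ≤ 2 * D := by
      have := abs_sub_abs_le_abs_sub (cross (v n) (u n) * S) (-cross (v n) (z n - y n))
      rw [abs_neg, sub_neg_eq_add, add_comm (cross (v n) (u n) * S)] at this
      linarith [h3.trans (hb _)]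
    rw [abs_mul] at h6
    have : |cross (v n) (u n)| * (J * δ) ≤ |cross (v n) (u n)| * |S| := by
      gcongr; exact h2.trans (le_abs_self _)
    nlinarith
  rcases eq_or_eq_neg_of_cross_eq_zero hv1 hu1 hcr with h0 | h0
  · exact h0.symm
  -- For opposite directions the component of the separation along `v` decreases by the sum of both
  -- lengths, which again is unbounded.
  exfalso
  obtain ⟨J, hJ⟩ := exists_nat_gt ((2 * D) / δ)
  rw [div_lt_iff₀ (by positivity)] at hJ
  have h1 := (hsep (N * J)).2.2.2
  have h2 := hlen z u e n J (h' _)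
  have h3 := abs_real_inner_le_norm (v (n + (N * J : ℕ))) (z (n + (N * J : ℕ)) - y (n + (N * J : ℕ)))
  have h4 := abs_real_inner_le_norm (v n) (z n - y n)
  have h5 := hb 0
  simp only [Nat.cast_zero, add_zero] at h5
  rw [hun, one_mul] at h3
  rw [hv1, one_mul] at h4
  rw [h0, inner_neg_right, real_inner_self_eq_norm_sq, hv1] at h1
  have h6 : 0 ≤ ∑ i ∈ Finset.range (N * J), dist (y (n + i)) (y (n + (i + 1 : ℕ))) :=
    Finset.sum_nonneg fun _ _ => dist_nonneg
  have h7 := hb (N * J)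
  rw [abs_le] at h3 h4
  linarith [h3.1, h4.2]

theorem Ideal.dir_eq {y v z u : ℤ → BilliardPlane} {e : ℤ → ι}
    (h : P.Ideal y v e) (h' : P.Ideal z u e) : v = u := by
  funext n
  exact (h.idealFrom n).dir_eq (h'.idealFrom n) (fun _ _ => rfl) le_rfl

/-- Time reversal of ideal trajectories. -/
theorem Ideal.reverse {y v : ℤ → BilliardPlane} {e : ℤ → ι} (h : P.Ideal y v e) :
    P.Ideal (fun n => y (-n)) (fun n => -v (-n - 1)) (fun n => e (-n)) := by
  intro a b ε hε
  -- The reversed leg at index `n` is the old leg at `-n - 1`, so the window needs one more index on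
  -- the left.
  obtain ⟨y', v', h1, h2⟩ := h (-b - 1) (-a) ε hε
  refine ⟨fun n => y' (-n), fun n => -v' (-n - 1), fun n hn hn' => ?_, fun n hn hn' =>
    ⟨(h2 (-n) (by omega) (by omega)).1, ?_⟩⟩
  · have s1 := h1 (-n - 1) (by omega) (by omega)
    have s2 := h1 (-(n + 1) - 1) (by omega) (by omega)
    simp only [StepAt] at s1 s2 ⊢
    rw [show -n - 1 + 1 = -n by ring] at s1
    rw [show -(n + 1) - 1 + 1 = -n - 1 by ring] at s2
    rw [show -(n + 1) = -n - 1 by ring] at s2 ⊢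
    refine s1.reverse ?_
    rw [s2.optical, reflect_neg, reflect_reflect]
  · rw [dist_neg_neg]
    exact (h2 (-n - 1) (by omega) (by omega)).2

/-- Tychonoff's theorem for values that are in `K` only eventually, at a rate depending on the
index: early values are replaced by a fixed point of `K`, which does not affect limits. -/
theorem exists_convergent_subseq {X I : Type*} [TopologicalSpace X] [FirstCountableTopology X]
    [Countable I] {K : Set X} (hK : IsCompact K) (hne : K.Nonempty) (f : ℕ → I → X)
    (h : ∀ n, ∀ᶠ k in atTop, f k n ∈ K) : ∃ φ : ℕ → ℕ, StrictMono φ ∧ ∃ g : I → X,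
      ∀ n, g n ∈ K ∧ Tendsto (fun k => f (φ k) n) atTop (𝓝 (g n)) := by
  classical
  obtain ⟨x₀, hx₀⟩ := hne
  set f' : ℕ → I → X := fun k n => if f k n ∈ K then f k n else x₀ with hf'
  have hmem : ∀ k, f' k ∈ Set.pi Set.univ fun _ => K := by
    intro k n _
    simp only [hf']
    split_ifs with h
    exacts [h, hx₀]
  obtain ⟨g, hg, φ, hφ, hlim⟩ := (isCompact_univ_pi fun _ : I => hK).tendsto_subseq hmem
  refine ⟨φ, hφ, g, fun n => ⟨hg n trivial, ?_⟩⟩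
  refine ((tendsto_pi_nhds.1 hlim) n).congr' ?_
  filter_upwards [hφ.tendsto_atTop.eventually (h n)] with k hk
  simp [hf', hk]

/-- Limits of ideal trajectories are ideal trajectories. -/
theorem approx_of_tendsto {Y V : ℕ → ℤ → BilliardPlane} {C : ℕ → ℤ → ι}
    {y v : ℤ → BilliardPlane} {e : ℤ → ι} {a b : ℤ}
    (h : ∃ᶠ k in atTop, P.Approx (Y k) (V k) (C k) a b)
    (hy : ∀ n, a ≤ n → n ≤ b → Tendsto (fun k => Y k n) atTop (𝓝 (y n)))
    (hv : ∀ n, a ≤ n → n ≤ b → Tendsto (fun k => V k n) atTop (𝓝 (v n)))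
    (he : ∀ n, a ≤ n → n ≤ b → ∀ᶠ k in atTop, C k n = e n) : P.Approx y v e a b := by
  intro ε hε
  have h1 : ∀ᶠ k in atTop, ∀ n ∈ Finset.Icc a b,
      dist (Y k n) (y n) < ε / 2 ∧ dist (V k n) (v n) < ε / 2 ∧ C k n = e n := by
    rw [eventually_all_finset]
    intro n hn
    rw [Finset.mem_Icc] at hn
    filter_upwards [(hy n hn.1 hn.2).eventually (Metric.ball_mem_nhds _ (half_pos hε)),
      (hv n hn.1 hn.2).eventually (Metric.ball_mem_nhds _ (half_pos hε)), he n hn.1 hn.2]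
      with k h1 h2 h3 using ⟨h1, h2, h3⟩
  obtain ⟨k, hk, hall⟩ := (h.and_eventually h1).exists
  replace hk := hk.congr fun n hn hn' => (hall n (Finset.mem_Icc.2 ⟨hn, hn'⟩)).2.2
  obtain ⟨y', v', h2, h3⟩ := hk (ε / 2) (half_pos hε)
  refine ⟨y', v', h2, fun n hn hn' => ?_⟩
  have h4 := hall n (Finset.mem_Icc.2 ⟨hn, hn'⟩)
  have h5 := h3 n hn hn'
  constructor
  · linarith [dist_triangle (y' n) (Y k n) (y n), h4.1, h5.1]
  · linarith [dist_triangle (v' n) (V k n) (v n), h4.2.1, h5.2]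

/-- The closure in a product of discrete spaces. -/
theorem mem_closure_discrete_iff {I : Type*} {S : Set (I → ι)} {x : I → ι} :
    (let : TopologicalSpace ι := ⊥; x ∈ closure S) ↔
      ∀ F : Finset I, ∃ y ∈ S, ∀ i ∈ F, y i = x i := by
  let : TopologicalSpace ι := ⊥
  have : DiscreteTopology ι := ⟨rfl⟩
  change x ∈ closure S ↔ _
  rw [mem_closure_iff]
  constructor
  · intro h F
    obtain ⟨y, h1, h2⟩ := h ((F : Set I).pi fun i => {x i})
      (isOpen_set_pi F.finite_toSet fun i _ => isOpen_discrete _) (fun i _ => rfl)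
    exact ⟨y, h2, fun i hi => h1 i hi⟩
  · intro h o ho hx
    obtain ⟨F, u, h1, h2⟩ := isOpen_pi_iff.1 ho x hx
    obtain ⟨y, hy, hF⟩ := h F
    exact ⟨y, h2 fun i hi => by rw [hF i hi]; exact (h1 i hi).2, hy⟩

end PolygonTable

/-! ### Legs squeezed between two legs with the same end edge. -/

namespace PolygonTable
variable {ι : Type*} {P : PolygonTable ι} [Finite ι]

theorem height_comb_pos {e : ι} {x y : BilliardPlane} {s : ℝ} (hs : 0 < s) (hs' : s < 1)
    (hx : 0 < P.height e x) (hy : 0 < P.height e y) : 0 < P.height e (x + s • (y - x)) := by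
  rw [height_comb]; nlinarith

theorem cross_comb (w a x y : BilliardPlane) (s : ℝ) :
    cross w (x + s • (y - x) - a) = (1 - s) * cross w (x - a) + s * cross w (y - a) := by
  simp only [cross_sub_right, cross_add_right, cross_smul_right]; ring

theorem comb_mem_edgeInterior {e : ι} {x y : BilliardPlane} {s : ℝ} (hs : 0 < s) (hs' : s < 1)
    (hx : x ∈ P.edgeInterior e) (hy : y ∈ P.edgeInterior e) :
    x + s • (y - x) ∈ P.edgeInterior e := by
  have h : Convex ℝ (P.edgeInterior e) := convex_openSegment _ _
  rw [show x + s • (y - x) = (1 - s) • x + s • y by module]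
  exact h hx hy (by linarith) hs.le (by ring)

theorem comb_mem_openSegment {x y : BilliardPlane} {s : ℝ} (hs : 0 < s) (hs' : s < 1) :
    x + s • (y - x) ∈ openSegment ℝ x y := by
  rw [openSegment_eq_image']; exact ⟨s, ⟨hs, hs'⟩, rfl⟩

theorem exists_comb_of_height_eq_zero {e : ι} {x y c : BilliardPlane} (hx : P.height e x = 0)
    (hy : P.height e y = 0) (hc : P.height e c = 0) (hxy : x ≠ y) :
    ∃ s : ℝ, c = x + s • (y - x) := by
  have h1 := P.cross_edgeVec_sub hy hx
  have h2 := P.cross_edgeVec_sub hc hx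
  have h3 : cross (y - x) (c - x) = 0 := by
    rw [exists_smul_of_cross_eq_zero (P.edgeVec_ne_zero e) h1,
      exists_smul_of_cross_eq_zero (P.edgeVec_ne_zero e) h2, cross_smul_left, cross_smul_right,
      cross_self_eq]; ring
  have h4 := exists_smul_of_cross_eq_zero (sub_ne_zero.2 hxy.symm) h3
  exact ⟨_, by rw [← h4]; abel⟩

/-- A point on the line of an edge which lies between two lines through points of that edge. -/
theorem exists_comb_of_between {e : ι} {x y c u w : BilliardPlane} {σ : ℝ}
    (hx : P.height e x = 0) (hy : P.height e y = 0) (hc : P.height e c = 0)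
    (h1 : 0 < σ * cross u (c - x)) (h2 : σ * cross w (c - y) < 0)
    (h3 : 0 < σ * cross u (y - x)) (h4 : σ * cross w (x - y) < 0) :
    ∃ s : ℝ, 0 < s ∧ s < 1 ∧ c = x + s • (y - x) := by
  have hxy : x ≠ y := by rintro rfl; simp [cross_zero_right] at h3
  obtain ⟨s, rfl⟩ := exists_comb_of_height_eq_zero hx hy hc hxy
  rw [add_sub_cancel_left, cross_smul_right] at h1
  have h5 : x + s • (y - x) - y = (1 - s) • (x - y) := by module
  rw [h5, cross_smul_right] at h2
  refine ⟨s, ?_, ?_, rfl⟩ <;> nlinarith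

/-- Where an affine function changes sign on a segment. -/
theorem exists_zero_comb {α β : ℝ} (h1 : α < 0) (h2 : 0 < β) :
    ∃ s : ℝ, 0 < s ∧ s < 1 ∧ (1 - s) * α + s * β = 0 := by
  refine ⟨-α / (β - α), div_pos (by linarith) (by linarith), ?_, ?_⟩
  · rw [div_lt_one (by linarith)]; linarith
  · have : β - α ≠ 0 := by linarith
    field_simp; ring

/-- A point on the line of a step, between the lines of its two edges, is on the open leg. -/
theorem Step.mem_interior_of_between {e e' : ι} {p v p' v' f : BilliardPlane}
    (h : P.Step e e' p v p' v') (h0 : cross v (f - p) = 0) (h1 : 0 < P.height e f)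
    (h2 : 0 < P.height e' f) : f ∈ interior P.carrier := by
  obtain ⟨t, ht, hp'⟩ := h.exists_pos
  have hf := eq_smul_of_cross_eq_zero h.unit h0
  set s := ⟪v, f - p⟫
  have hf' : f = p + s • v := by rw [← hf]; abel
  have hs : 0 < s := by
    rw [hf', height_add, P.height_eq_zero' h.dep, slope_smul, zero_add] at h1
    have := h.slope_dep
    by_contra hcon
    nlinarith
  have hst : s < t := by
    have h3 := P.height_sub_height e' f p'
    rw [P.height_eq_zero' h.arr, hp', hf',
      show p + s • v - (p + t • v) = (s - t) • v by module, slope_smul] at h3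
    rw [hf'] at h2
    have := h.slope_arr
    by_contra hcon
    nlinarith
  apply h.leg.2
  rw [hp', hf', mem_openSegment_iff_ray ht]
  exact ⟨s, hs, hst, rfl⟩

/-- A billiard ball squeezed between two legs with the same end edge hits that edge, if a later
translate of it leaves the strip. -/
theorem Step.end_eq {e₀ e₁ e₂ : ι} {a₁ u₁ b₁ w₁ a₃ u₃ b₃ w₃ a₂ u₂ b₂ w₂ a₄ u₄ b₄ w₄ : BilliardPlane}
    {σ D : ℝ} (r₁ : P.Step e₀ e₁ a₁ u₁ b₁ w₁) (r₃ : P.Step e₀ e₁ a₃ u₃ b₃ w₃)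
    (q₂ : P.Step e₀ e₂ a₂ u₂ b₂ w₂) (q₄ : P.Step e₀ e₂ a₄ u₄ b₄ w₄)
    (hD : ∀ x ∈ P.carrier, ∀ y ∈ P.carrier, ‖x - y‖ ≤ D)
    (ha₂ : 0 < σ * cross u₁ (a₂ - a₁)) (hb₂ : 0 < σ * cross u₁ (b₂ - a₁))
    (ha₂' : σ * cross u₃ (a₂ - a₃) < 0) (hb₂' : σ * cross u₃ (b₂ - a₃) < 0)
    (hb₄ : 0 < σ * cross u₃ (b₄ - a₃)) (ha₁ : σ * cross u₃ (a₁ - a₃) < 0)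
    (hb₁ : σ * cross u₃ (b₁ - a₃) < 0)
    (hb₃ : ∀ t : ℝ, 0 ≤ t → t ≤ D → 0 < σ * cross u₁ (a₃ + t • u₃ - a₁)) : e₁ = e₂ := by
  have hD0 : 0 ≤ D := (norm_nonneg _).trans (hD a₁ (P.edge_subset_carrier e₀
    (P.edgeInterior_subset_edge _ r₁.dep)) a₁ (P.edge_subset_carrier e₀
    (P.edgeInterior_subset_edge _ r₁.dep)))
  have car : ∀ {e x}, x ∈ P.edgeInterior e → x ∈ P.carrier := fun h =>
    P.edge_subset_carrier _ (P.edgeInterior_subset_edge _ h)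
  have c1 : cross u₁ (b₁ - a₁) = 0 := by
    obtain ⟨t, -, h⟩ := r₁.exists_pos
    rw [h, add_sub_cancel_left, cross_smul_right, cross_self_eq, mul_zero]
  obtain ⟨t₃, ht₃, hr₃⟩ := r₃.exists_pos
  have c3 : cross u₃ (b₃ - a₃) = 0 := by
    rw [hr₃, add_sub_cancel_left, cross_smul_right, cross_self_eq, mul_zero]
  have ht₃D : t₃ ≤ D := by
    have := hD b₃ (car r₃.arr) a₃ (car r₃.dep)
    rwa [hr₃, add_sub_cancel_left, norm_smul, r₃.unit, mul_one, Real.norm_of_nonneg ht₃.le] at this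
  have ha₃ : 0 < σ * cross u₁ (a₃ - a₁) := by simpa using hb₃ 0 le_rfl hD0
  have hb₃' : 0 < σ * cross u₁ (b₃ - a₁) := by rw [hr₃]; exact hb₃ t₃ ht₃.le ht₃D
  -- points between the two lines on `e₁` are on `e₁`
  have key : ∀ c, P.height e₁ c = 0 → 0 < σ * cross u₁ (c - a₁) → σ * cross u₃ (c - a₃) < 0 →
      c ∈ P.edgeInterior e₁ := by
    intro c hc h1 h2
    have e1 : ∀ x, cross u₁ (x - b₁) = cross u₁ (x - a₁) := fun x => by
      rw [← sub_sub_sub_cancel_right x b₁ a₁, cross_sub_right, c1, sub_zero]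
    have e3 : ∀ x, cross u₃ (x - b₃) = cross u₃ (x - a₃) := fun x => by
      rw [← sub_sub_sub_cancel_right x b₃ a₃, cross_sub_right, c3, sub_zero]
    obtain ⟨s, hs, hs', rfl⟩ := exists_comb_of_between (σ := σ) (u := u₁) (w := u₃)
      (P.height_eq_zero' r₁.arr) (P.height_eq_zero' r₃.arr) hc (by rwa [e1]) (by rwa [e3])
      (by rwa [e1]) (by rwa [e3])
    exact comb_mem_edgeInterior hs hs' r₁.arr r₃.arr
  -- On the line of `e₀` the point `a₂` lies between `a₁` and `a₃`, both of which have positive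
  -- height over `e₁`.
  have hA : 0 < P.height e₁ a₂ := by
    obtain ⟨s, hs, hs', rfl⟩ := exists_comb_of_between (σ := σ) (u := u₁) (w := u₃)
      (P.height_eq_zero' r₁.dep) (P.height_eq_zero' r₃.dep) (P.height_eq_zero' q₂.dep)
      ha₂ ha₂' ha₃ ha₁
    exact height_comb_pos hs hs' r₁.height_dep r₃.height_dep
  by_contra hne
  -- If `b₂` is below the line of `e₁`, the leg has crossed `e₁` in an interior point of the table;
  -- if it is on the line, `b₂` belongs to both edges.
  rcases lt_trichotomy (P.height e₁ b₂) 0 with hB | hB | hB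
  · obtain ⟨s, hs, hs', h0⟩ := exists_zero_comb (neg_lt_zero.2 hA) (neg_pos.2 hB)
    have hc : a₂ + s • (b₂ - a₂) ∈ P.edgeInterior e₁ := by
      apply key
      · rw [height_comb]; linarith
      · rw [cross_comb, mul_add]; nlinarith
      · rw [cross_comb, mul_add]; nlinarith
    exact P.notMem_interior_of_mem_edge (P.edgeInterior_subset_edge _ hc)
      (q₂.leg.2 (comb_mem_openSegment hs hs'))
  · exact hne (P.eq_of_mem_edgeInterior (key b₂ hB hb₂ hb₂') (P.edgeInterior_subset_edge _ q₂.arr))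
  -- Now `e₂` begins above `e₁` inside the strip and reaches `b₄` beyond the third line, so it
  -- crosses that line at some `f`. Below `e₁` this forces `e₂` to cross `e₁`; on `e₁` it gives `f =
  -- b₃`; above `e₁` the point `f` would block the third leg.
  · obtain ⟨s, hs, hs', h0⟩ := exists_zero_comb hb₂' hb₄
    set f := b₂ + s • (b₄ - b₂) with hf
    have hfe : f ∈ P.edgeInterior e₂ := comb_mem_edgeInterior hs hs' q₂.arr q₄.arr
    have hf0 : 0 < P.height e₀ f := height_comb_pos hs hs' q₂.height_arr q₄.height_arr
    have hf3 : σ * cross u₃ (f - a₃) = 0 := by rw [hf, cross_comb]; linarith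
    have hσ : σ ≠ 0 := by rintro rfl; simp at hb₄
    have hf3' : cross u₃ (f - a₃) = 0 := (mul_eq_zero.1 hf3).resolve_left hσ
    rcases lt_trichotomy (P.height e₁ f) 0 with hF | hF | hF
    · have hfl := eq_smul_of_cross_eq_zero r₃.unit hf3'
      have hfl' : f = a₃ + ⟪u₃, f - a₃⟫ • u₃ := by rw [← hfl]; abel
      have ht0 : 0 ≤ ⟪u₃, f - a₃⟫ := by
        rw [hfl', height_add, P.height_eq_zero' r₃.dep, slope_smul, zero_add] at hf0
        have := r₃.slope_dep
        by_contra hcon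
        nlinarith
      have htD : ⟪u₃, f - a₃⟫ ≤ D := by
        have := real_inner_le_norm u₃ (f - a₃)
        rw [r₃.unit, one_mul] at this
        exact this.trans (hD _ (car hfe) _ (car r₃.dep))
      have hf1 : 0 < σ * cross u₁ (f - a₁) := by rw [hfl']; exact hb₃ _ ht0 htD
      obtain ⟨s', hs1, hs1', h0'⟩ := exists_zero_comb hF hB
      have hc2 : f + s' • (b₂ - f) ∈ P.edgeInterior e₂ := comb_mem_edgeInterior hs1 hs1' hfe q₂.arr
      refine hne (P.eq_of_mem_edgeInterior (key _ ?_ ?_ ?_) (P.edgeInterior_subset_edge _ hc2))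
      · rw [height_comb, h0']
      · rw [cross_comb, mul_add]; nlinarith
      · rw [cross_comb, mul_add]; nlinarith
    · -- the point on the edge `e₁` is the end of the third leg
      have hfb : f = b₃ := by
        have h1 := P.height_sub_height e₁ f b₃
        have h2 : cross u₃ (f - b₃) = 0 := by
          rw [← sub_sub_sub_cancel_right f b₃ a₃, cross_sub_right, c3, hf3', sub_zero]
        have h3 := eq_smul_of_cross_eq_zero r₃.unit h2
        rw [hF, P.height_eq_zero' r₃.arr, h3, slope_smul, sub_zero] at h1
        have h4 := (mul_eq_zero.1 h1.symm).resolve_right r₃.slope_arr.ne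
        rw [h4, zero_smul] at h3
        exact sub_eq_zero.1 h3
      rw [hfb] at hfe
      exact hne (P.eq_of_mem_edgeInterior r₃.arr (P.edgeInterior_subset_edge _ hfe))
    · exact P.notMem_interior_of_mem_edge (P.edgeInterior_subset_edge _ hfe)
        (r₃.mem_interior_of_between hf3' hf0 hF)

variable (P) in
/-- Limits of steps between two edges. -/
def ClosureStep (e e' : ι) (p v p' : BilliardPlane) : Prop :=
  ∃ a u b w : ℕ → BilliardPlane, (∀ k, P.Step e e' (a k) (u k) (b k) (w k)) ∧
    Tendsto a atTop (𝓝 p) ∧ Tendsto u atTop (𝓝 v) ∧ Tendsto b atTop (𝓝 p')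

theorem Approx.closureStep {y v : ℤ → BilliardPlane} {e : ℤ → ι} {a b : ℤ}
    (h : P.Approx y v e a b) {n : ℤ} (hn : a ≤ n) (hn' : n < b) :
    P.ClosureStep (e n) (e (n + 1)) (y n) (v n) (y (n + 1)) := by
  obtain ⟨Y, V, h1, h2⟩ := h.exists_seq
  exact ⟨_, _, _, _, fun k => h1 k n hn hn', (h2 n hn hn'.le).1, (h2 n hn hn'.le).2,
    (h2 (n + 1) (by omega) (by omega)).1⟩

theorem ClosureStep.cross_eq_zero {e e' : ι} {p v p' : BilliardPlane}
    (h : P.ClosureStep e e' p v p') : cross v (p' - p) = 0 := by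
  obtain ⟨a, u, b, w, h1, h2, h3, h4⟩ := h
  refine tendsto_nhds_unique (h3.cross (h4.sub h2)) (tendsto_const_nhds.congr fun k => ?_)
  obtain ⟨t, -, h⟩ := (h1 k).exists_pos
  rw [h, add_sub_cancel_left, cross_smul_right, cross_self_eq, mul_zero]

/-- The bounding limit legs are parallel and all inequalities between signed distances are strict,
so they persist for the approximating steps, to which `Step.end_eq` applies. -/
theorem ClosureStep.end_eq {e₀ e₁ e₂ : ι} {p v p' q q' r w r' s w' s' : BilliardPlane} {σ : ℝ}
    (h₁ : P.ClosureStep e₀ e₁ p v p') (h₃ : P.ClosureStep e₀ e₁ q v q')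
    (h₂ : P.ClosureStep e₀ e₂ r w r') (h₄ : P.ClosureStep e₀ e₂ s w' s')
    (hr : 0 < σ * cross v (r - p)) (hr' : 0 < σ * cross v (r' - p))
    (hrq : σ * cross v (r - p) < σ * cross v (q - p))
    (hrq' : σ * cross v (r' - p) < σ * cross v (q - p))
    (hs : σ * cross v (q - p) < σ * cross v (s' - p)) : e₁ = e₂ := by
  obtain ⟨D, hD, hdiam⟩ := P.exists_diameter
  have c1 := h₁.cross_eq_zero
  obtain ⟨a₁, u₁, b₁, w₁, r₁, ha₁, hu₁, hb₁⟩ := h₁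
  obtain ⟨a₃, u₃, b₃, w₃, r₃, ha₃, hu₃, hb₃⟩ := h₃
  obtain ⟨a₂, u₂, b₂, w₂, q₂, ha₂, hu₂, hb₂⟩ := h₂
  obtain ⟨a₄, u₄, b₄, w₄, q₄, ha₄, hu₄, hb₄⟩ := h₄
  have e1 : ∀ x, cross v (x - q) = cross v (x - p) - cross v (q - p) := fun x => by
    rw [← cross_sub_right, sub_sub_sub_cancel_right]
  have pos : ∀ {f g : ℕ → BilliardPlane} {x y : BilliardPlane}, Tendsto f atTop (𝓝 x) →
      Tendsto g atTop (𝓝 y) → 0 < σ * cross x y → ∀ᶠ k in atTop, 0 < σ * cross (f k) (g k) :=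
    fun hf hg h => ((hf.cross hg).const_mul σ).eventually (lt_mem_nhds h)
  have neg : ∀ {f g : ℕ → BilliardPlane} {x y : BilliardPlane}, Tendsto f atTop (𝓝 x) →
      Tendsto g atTop (𝓝 y) → σ * cross x y < 0 → ∀ᶠ k in atTop, σ * cross (f k) (g k) < 0 :=
    fun hf hg h => ((hf.cross hg).const_mul σ).eventually (gt_mem_nhds h)
  -- The approximating bounding lines need not be parallel, but their mutual turn tends to zero, so
  -- they do not cross within the diameter `D`.
  have hlast : ∀ᶠ k in atTop, 0 < σ * cross (u₁ k) (a₃ k - a₁ k) - |σ * cross (u₁ k) (u₃ k)| * D := by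
    have h1 := ((hu₁.cross (ha₃.sub ha₁)).const_mul σ).sub
      (((hu₁.cross hu₃).const_mul σ).abs.mul_const D)
    rw [cross_self_eq, mul_zero, abs_zero, zero_mul, sub_zero] at h1
    exact h1.eventually (lt_mem_nhds (by linarith))
  have g1 := pos hu₁ (ha₂.sub ha₁) hr
  have g2 := pos hu₁ (hb₂.sub ha₁) hr'
  have g3 := neg hu₃ (ha₂.sub ha₃) (by rw [e1, mul_sub]; linarith)
  have g4 := neg hu₃ (hb₂.sub ha₃) (by rw [e1, mul_sub]; linarith)
  have g5 := pos hu₃ (hb₄.sub ha₃) (by rw [e1, mul_sub]; linarith)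
  have g6 := neg hu₃ (ha₁.sub ha₃) (by rw [e1, sub_self, cross_zero_right]; linarith)
  have g7 := neg hu₃ (hb₁.sub ha₃) (by rw [e1, c1]; linarith)
  obtain ⟨k, k1, k2, k3, k4, k5, k6, k7, k8⟩ :=
    (g1.and (g2.and (g3.and (g4.and (g5.and (g6.and (g7.and hlast))))))).exists
  refine (r₁ k).end_eq (r₃ k) (q₂ k) (q₄ k) hdiam k1 k2 k3 k4 k5 k6 k7 fun t ht ht' => ?_
  rw [add_sub_right_comm, cross_add_right, cross_smul_right]
  have := neg_abs_le (σ * cross (u₁ k) (u₃ k))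
  nlinarith [abs_nonneg (σ * cross (u₁ k) (u₃ k))]

end PolygonTable

/-! ### A strip of almost maximal width cannot drift. -/

namespace PolygonTable
variable {ι : Type*} {P : PolygonTable ι} [Finite ι]

/-- Compactness of the space of ideal trajectories, for pairs with the same bounce sequences. -/
theorem exists_limit_pair {Y V Z U : ℕ → ℤ → BilliardPlane} {C : ℕ → ℤ → ι}
    (h : ∀ L : ℕ, ∀ᶠ k in atTop, P.Approx (Y k) (V k) (C k) (-L) L ∧
      P.Approx (Z k) (U k) (C k) (-L) L) :
    ∃ φ : ℕ → ℕ, StrictMono φ ∧ ∃ (y v z : ℤ → BilliardPlane) (e : ℤ → ι),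
      P.Ideal y v e ∧ P.Ideal z v e ∧ ∀ n, Tendsto (fun k => Y (φ k) n) atTop (𝓝 (y n)) ∧
        Tendsto (fun k => V (φ k) n) atTop (𝓝 (v n)) ∧
        Tendsto (fun k => Z (φ k) n) atTop (𝓝 (z n)) ∧
        Tendsto (fun k => U (φ k) n) atTop (𝓝 (v n)) ∧ ∀ᶠ k in atTop, C (φ k) n = e n := by
  let : TopologicalSpace ι := ⊥
  have : DiscreteTopology ι := ⟨rfl⟩
  set K : Set (((BilliardPlane × BilliardPlane) × BilliardPlane × BilliardPlane) × ι) :=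
    (((P.carrier ×ˢ Metric.closedBall 0 1) ×ˢ P.carrier ×ˢ Metric.closedBall 0 1) ×ˢ Set.univ)
    with hK
  have hKc : IsCompact K :=
    (((P.isCompact_carrier.prod (isCompact_closedBall _ _)).prod
      (P.isCompact_carrier.prod (isCompact_closedBall _ _))).prod isCompact_univ)
  have hKm : ∀ n : ℤ, ∀ᶠ k in atTop, (((Y k n, V k n), Z k n, U k n), C k n) ∈ K := by
    intro n
    filter_upwards [h (n.natAbs + 1)] with k hk
    have h1 := hk.1.limitStep (n := n) (by omega) (by omega)
    have h2 := hk.2.limitStep (n := n) (by omega) (by omega)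
    refine ⟨⟨⟨h1.dep_mem_carrier, ?_⟩, h2.dep_mem_carrier, ?_⟩, trivial⟩
    · simp [h1.unit]
    · simp [h2.unit]
  obtain ⟨k₀, hk₀⟩ := (hKm 0).exists
  obtain ⟨φ, hφ, g, hg⟩ := exists_convergent_subseq hKc ⟨_, hk₀⟩
    (fun k n => (((Y k n, V k n), Z k n, U k n), C k n)) hKm
  have hy : ∀ n, Tendsto (fun k => Y (φ k) n) atTop (𝓝 (g n).1.1.1) := fun n =>
    (hg n).2.fst_nhds.fst_nhds.fst_nhds
  have hv : ∀ n, Tendsto (fun k => V (φ k) n) atTop (𝓝 (g n).1.1.2) := fun n =>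
    (hg n).2.fst_nhds.fst_nhds.snd_nhds
  have hz : ∀ n, Tendsto (fun k => Z (φ k) n) atTop (𝓝 (g n).1.2.1) := fun n =>
    (hg n).2.fst_nhds.snd_nhds.fst_nhds
  have hu : ∀ n, Tendsto (fun k => U (φ k) n) atTop (𝓝 (g n).1.2.2) := fun n =>
    (hg n).2.fst_nhds.snd_nhds.snd_nhds
  have hc : ∀ n, ∀ᶠ k in atTop, C (φ k) n = (g n).2 := fun n => by
    have := (hg n).2.snd_nhds
    rw [nhds_discrete, tendsto_pure] at this
    exact this
  have hyi : P.Ideal (fun n => (g n).1.1.1) (fun n => (g n).1.1.2) (fun n => (g n).2) := by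
    intro a b
    refine approx_of_tendsto (Eventually.frequently ?_) (fun n _ _ => hy n) (fun n _ _ => hv n)
      fun n _ _ => hc n
    filter_upwards [hφ.tendsto_atTop.eventually (h (a.natAbs + b.natAbs))] with k hk
    exact hk.1.mono (by omega) (by omega)
  have hzi : P.Ideal (fun n => (g n).1.2.1) (fun n => (g n).1.2.2) (fun n => (g n).2) := by
    intro a b
    refine approx_of_tendsto (Eventually.frequently ?_) (fun n _ _ => hz n) (fun n _ _ => hu n)
      fun n _ _ => hc n
    filter_upwards [hφ.tendsto_atTop.eventually (h (a.natAbs + b.natAbs))] with k hk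
    exact hk.2.mono (by omega) (by omega)
  -- The two limits have the same code and are therefore parallel, even though `V` and `U` were
  -- unrelated.
  have heq := hyi.dir_eq hzi
  refine ⟨φ, hφ, _, _, _, _, hyi, heq ▸ hzi, fun n => ⟨hy n, hv n, hz n, ?_, hc n⟩⟩
  rw [congrFun heq n]
  exact hu n

/-- Every finite part of `e'` occurs in `e`. -/
def SubCode (e' e : ℤ → ι) : Prop := ∀ L : ℕ, ∃ c : ℤ, ∀ n, -(L : ℤ) ≤ n → n ≤ L → e' n = e (c + n)

theorem Ideal.width {y v z : ℤ → BilliardPlane} {e : ℤ → ι} (hy : P.Ideal y v e)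
    (hz : P.Ideal z v e) (a : ℤ) (j : ℕ) :
    cross (v (a + j)) (z (a + j) - y (a + j)) = (-1) ^ j * cross (v a) (z a - y a) := by
  have := (separation (n := j) (e := fun k => e (a + k))
    (fun k _ => (hy.idealFrom a).limitStep_nat k)
    (fun k _ => (hz.idealFrom a).limitStep_nat k) le_rfl).2.2.1
  simpa [cross_self_eq] using this

theorem Ideal.width_even {y v z : ℤ → BilliardPlane} {e : ℤ → ι} (hy : P.Ideal y v e)
    (hz : P.Ideal z v e) {a : ℤ} (ha : Even a) :
    cross (v a) (z a - y a) = cross (v 0) (z 0 - y 0) := by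
  rcases le_total 0 a with h | h
  · have := hy.width hz 0 a.toNat
    rw [zero_add, Int.toNat_of_nonneg h, Even.neg_one_pow, one_mul] at this
    · exact this
    · rw [← Int.even_coe_nat, Int.toNat_of_nonneg h]; exact ha
  · have := hy.width hz a (-a).toNat
    rw [Int.toNat_of_nonneg (by omega), Even.neg_one_pow, one_mul, add_neg_cancel] at this
    · exact this.symm
    · rw [← Int.even_coe_nat, Int.toNat_of_nonneg (by omega)]; exact ha.neg

/-- Recurrence with a small turn to one side is impossible, if no pair is much wider. -/
theorem Ideal.no_drift {y v z : ℤ → BilliardPlane} {e : ℤ → ι} (hy : P.Ideal y v e)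
    (hz : P.Ideal z v e) {σ M W : ℝ} (hσ : σ = 1 ∨ σ = -1)
    (hWdef : σ * cross (v 0) (z 0 - y 0) = W) (hW : 0 < W) (hM : M < 9 / 8 * W)
    (hmax : ∀ y' v' z' e', P.Ideal y' v' e' → P.Ideal z' v' e' → SubCode e' e →
      |cross (v' 0) (z' 0 - y' 0)| ≤ M)
    {a b : ℕ → ℤ} (ha : ∀ k, Even (a k)) (hb : ∀ k, Even (b k)) (hab : ∀ k, e (a k) = e (b k))
    (hvv : Tendsto (fun k => v (b k) - v (a k)) atTop (𝓝 0))
    (hyy : Tendsto (fun k => y (b k) - y (a k)) atTop (𝓝 0))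
    (hη : ∀ k, 0 < σ * cross (v (a k)) (v (b k)))
    (hS : ∀ k, 0 < σ * cross (v (a k)) (y (b k) - y (a k)))
    (hT : ∀ k, 0 < σ * cross (v (a k)) (z (b k) - z (a k))) : False := by
  -- The passage from `b k` is compared with that from `a k`: its shift `S k j` grows by the turn `η
  -- k` times the length travelled. Until the shift is comparable with `W` the codes agree; when it
  -- first reaches `W / 8`, the old `y` and the shifted `z` bound a strip of width at least `9 / 8 *
  -- W` in the limit.
  obtain ⟨D, hD, hdiam⟩ := P.exists_diameter
  obtain ⟨N, δ, hδ, hlen⟩ := P.exists_length_bound'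
  set η : ℕ → ℝ := fun k => σ * cross (v (a k)) (v (b k)) with hηdef
  set Λ : ℕ → ℕ → ℝ := fun k j => ∑ i ∈ Finset.range j, dist (y (b k + i)) (y (b k + (i + 1 : ℕ)))
    with hΛ
  set Λz : ℕ → ℕ → ℝ := fun k j =>
    ∑ i ∈ Finset.range j, dist (z (b k + i)) (z (b k + (i + 1 : ℕ))) with hΛz
  set S : ℕ → ℕ → ℝ := fun k j => σ * cross (v (a k)) (y (b k) - y (a k)) + η k * Λ k j with hSdef
  have hycar : ∀ n, y n ∈ P.carrier := fun n => (hy.limitStep n).dep_mem_carrier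
  have hzcar : ∀ n, z n ∈ P.carrier := fun n => (hz.limitStep n).dep_mem_carrier
  have hSpos : ∀ k j, 0 < S k j := fun k j => by
    have : 0 ≤ Λ k j := Finset.sum_nonneg fun _ _ => dist_nonneg
    have h1 := hη k
    have h2 := hS k
    simp only [hSdef]
    exact add_pos_of_pos_of_nonneg h2 (mul_nonneg h1.le this)
  have hSstep : ∀ k j, S k (j + 1) ≤ S k j + η k * D := fun k j => by
    simp only [hSdef, hΛ, Finset.sum_range_succ]
    have h1 : dist (y (b k + j)) (y (b k + (j + 1 : ℕ))) ≤ D := by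
      rw [dist_eq_norm]; exact hdiam _ (hycar _) _ (hycar _)
    have := mul_le_mul_of_nonneg_left h1 (hη k).le
    linarith
  have hSmany : ∀ k j i, S k (j + i) ≤ S k j + i * (η k * D) := fun k j i => by
    induction i with
    | zero => simp
    | succ i ih => have := hSstep k (j + i); rw [← add_assoc]; push_cast; linarith
  have hσσ : σ * σ = 1 := by rcases hσ with rfl | rfl <;> norm_num
  -- the separations while the codes agree
  have hsep : ∀ k (j : ℕ), (∀ i ≤ j, e (a k + i) = e (b k + i)) →
      σ * cross (v (a k + j)) (v (b k + j)) = (-1) ^ j * η k ∧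
      σ * cross (v (a k + j)) (y (b k + j) - y (a k + j)) = (-1) ^ j * S k j ∧
      ∃ T > 0, σ * cross (v (a k + j)) (z (b k + j) - z (a k + j)) = (-1) ^ j * T := by
    intro k j hag
    have hcong : ∀ {x : ℤ → BilliardPlane}, P.Ideal x v e → ∀ i < j,
        P.LimitStep (e (a k + i)) (e (a k + (i + 1 : ℕ))) (x (b k + i)) (v (b k + i))
          (x (b k + (i + 1 : ℕ))) (v (b k + (i + 1 : ℕ))) := by
      intro x hx i hi
      rw [hag i hi.le, hag (i + 1) hi]
      exact (hx.idealFrom (b k)).limitStep_nat i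
    have s1 := separation (n := j) (e := fun i => e (a k + i))
      (fun i _ => (hy.idealFrom (a k)).limitStep_nat i) (hcong hy) le_rfl
    have s2 := separation (n := j) (e := fun i => e (a k + i))
      (fun i _ => (hz.idealFrom (a k)).limitStep_nat i) (hcong hz) le_rfl
    simp only [Nat.cast_zero, add_zero] at s1 s2
    refine ⟨?_, ?_, σ * cross (v (a k)) (z (b k) - z (a k)) + η k * Λz k j, ?_, ?_⟩
    · rw [s1.1]; simp only [hηdef]; ring
    · rw [s1.2.2.1]; simp only [hSdef, hηdef, hΛ]; ring
    · exact add_pos_of_pos_of_nonneg (hT k)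
        (mul_nonneg (hη k).le (Finset.sum_nonneg fun _ _ => dist_nonneg))
    · rw [s2.2.2.1]; simp only [hηdef, hΛz]; ring
  -- While `S k j < W / 2`, one more leg moves the shifted `y` by less than `W / 4`, so it stays
  -- strictly inside the strip, and the shifted `z` lies beyond it; `ClosureStep.end_eq` then gives
  -- the same next edge.
  have hagree : ∀ k, η k * D < W / 4 → ∀ j, (∀ i < j, S k i < W / 2) →
      ∀ i ≤ j, e (a k + i) = e (b k + i) := by
    intro k hk j
    induction j with
    | zero => intro _ i hi; obtain rfl : i = 0 := by omega
              simpa using hab k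
    | succ j ih =>
      intro hj
      have hag := ih fun i hi => hj i (by omega)
      intro i hi
      rcases Nat.lt_or_ge i (j + 1) with h | h
      · exact hag i (by omega)
      obtain rfl : i = j + 1 := by omega
      obtain ⟨s1, s2, T, hT0, s3⟩ := hsep k j hag
      have hw := hy.width hz (a k) j
      rw [hy.width_even hz (ha k)] at hw
      have hpm : ((-1 : ℝ) ^ j) * (-1) ^ j = 1 := by rw [← mul_pow]; norm_num
      have hτ : ∀ x r, σ * x = (-1) ^ j * r → ((-1) ^ j * σ) * x = r := fun x r h => by
        rw [mul_assoc, h, ← mul_assoc, hpm, one_mul]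
      have t1 := hτ _ _ s1
      have t2 := hτ _ _ s2
      have t3 := hτ _ _ s3
      have t4 : ((-1) ^ j * σ) * cross (v (a k + j)) (z (a k + j) - y (a k + j)) = W := by
        rw [hw, ← hWdef]; linear_combination (σ * cross (v 0) (z 0 - y 0)) * hpm
      have ly := (hy.limitStep (b k + j)).eq
      have lz := (hz.limitStep (b k + j)).eq
      have hdy : dist (y (b k + j)) (y (b k + j + 1)) ≤ D := by
        rw [dist_eq_norm]; exact hdiam _ (hycar _) _ (hycar _)
      have hdz : 0 ≤ dist (z (b k + j)) (z (b k + j + 1)) := dist_nonneg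
      have hdy0 : 0 ≤ dist (y (b k + j)) (y (b k + j + 1)) := dist_nonneg
      set dy := dist (y (b k + j)) (y (b k + j + 1))
      set dz := dist (z (b k + j)) (z (b k + j + 1))
      have t5 : ((-1) ^ j * σ) * cross (v (a k + j)) (y (b k + j + 1) - y (a k + j)) =
          S k j + dy * η k := by
        rw [ly, add_sub_right_comm, cross_add_right, cross_smul_right, mul_add, t2, ← t1]; ring
      have t6 : ((-1) ^ j * σ) * cross (v (a k + j)) (z (b k + j + 1) - y (a k + j)) =
          T + W + dz * η k := by
        rw [lz, show z (b k + j) + dz • v (b k + j) - y (a k + j) = (z (b k + j) - z (a k + j)) +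
          (z (a k + j) - y (a k + j)) + dz • v (b k + j) by abel, cross_add_right, cross_add_right,
          cross_smul_right, mul_add, mul_add, t3, t4, ← t1]; ring
      have hSj := hj j (by omega)
      have hηk := hη k
      have h7 : dy * η k ≤ η k * D := by rw [mul_comm]; exact mul_le_mul_of_nonneg_left hdy hηk.le
      have hsp := hSpos k j
      have h1 := (hy (a k + j) (a k + j + 1)).closureStep le_rfl (by omega)
      have h3 := (hz (a k + j) (a k + j + 1)).closureStep le_rfl (by omega)
      have h2 := (hy (b k + j) (b k + j + 1)).closureStep le_rfl (by omega)
      have h4 := (hz (b k + j) (b k + j + 1)).closureStep le_rfl (by omega)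
      rw [← hag j le_rfl] at h2 h4
      have := h1.end_eq h3 h2 h4 (σ := (-1) ^ j * σ) (by rw [t2]; exact hsp)
        (by rw [t5]; have := mul_nonneg hdy0 hηk.le; linarith) (by rw [t2, t4]; linarith)
        (by rw [t5, t4]; linarith)
        (by rw [t6, t4]; have := mul_nonneg hdz hηk.le; linarith)
      push_cast
      rw [← add_assoc, ← add_assoc]; exact this
  have hunb : ∀ k, ∃ j, W / 8 ≤ S k j := by
    intro k
    obtain ⟨J, hJ⟩ := exists_nat_gt (W / 8 / (η k * δ))
    have hηk : 0 < η k := hη k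
    rw [div_lt_iff₀ (by positivity)] at hJ
    refine ⟨N * J, ?_⟩
    have h1 : J * δ ≤ Λ k (N * J) := hlen y v e (b k) J (hy _ _)
    have h2 := mul_le_mul_of_nonneg_left h1 hηk.le
    simp only [hSdef]
    have := hS k
    linarith
  classical
  -- The first time at which the shift reaches `W / 8`.
  set m : ℕ → ℕ := fun k => Nat.find (hunb k) with hm
  have hmS : ∀ k, W / 8 ≤ S k (m k) := fun k => Nat.find_spec (hunb k)
  have hmlt : ∀ k j, j < m k → S k j < W / 8 := fun k j hj => not_le.1 (Nat.find_min (hunb k) hj)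
  -- the turn and the initial shift tend to zero
  have hη0 : Tendsto η atTop (𝓝 0) := by
    refine squeeze_zero_norm (a := fun k => ‖v (b k) - v (a k)‖) (fun k => ?_) (by simpa using hvv.norm)
    have h1 : cross (v (a k)) (v (b k)) = cross (v (a k)) (v (b k) - v (a k)) := by
      rw [cross_sub_right, cross_self_eq, sub_zero]
    have h2 := abs_cross_le (v (a k)) (v (b k) - v (a k))
    rw [(hy.limitStep _).unit, one_mul] at h2
    simp only [hηdef, norm_mul, Real.norm_eq_abs]
    rw [h1]
    rcases hσ with rfl | rfl <;> simpa using h2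
  have hS0 : Tendsto (fun k => S k 0) atTop (𝓝 0) := by
    refine squeeze_zero_norm (a := fun k => ‖y (b k) - y (a k)‖) (fun k => ?_) (by simpa using hyy.norm)
    have h2 := abs_cross_le (v (a k)) (y (b k) - y (a k))
    rw [(hy.limitStep _).unit, one_mul] at h2
    simp only [hSdef, hΛ, Finset.range_zero, Finset.sum_empty, mul_zero, add_zero, norm_mul,
      Real.norm_eq_abs]
    rcases hσ with rfl | rfl <;> simpa using h2
  -- The turn tends to zero, so `m k` tends to infinity, and `L` further legs raise the shift only
  -- to less than `W / 8 + W / 4`, still below `W / 2`. Hence the codes agree on arbitrarily long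
  -- windows around `m k`.
  have hlong : ∀ L : ℕ, ∀ᶠ k in atTop, L ≤ m k ∧ ∀ i ≤ m k + L, e (a k + i) = e (b k + i) := by
    intro L
    have h1 : Tendsto (fun k => S k 0 + L * (η k * D)) atTop (𝓝 0) := by
      have := hS0.add ((hη0.mul_const D).const_mul (L : ℝ))
      simpa using this
    have h2 : Tendsto (fun k => (L + 2) * (η k * D)) atTop (𝓝 0) := by
      have := (hη0.mul_const D).const_mul (L + 2 : ℝ)
      simpa using this
    filter_upwards [h1.eventually (gt_mem_nhds (show 0 < W / 8 by linarith)),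
      h2.eventually (gt_mem_nhds (show 0 < W / 4 by linarith))] with k k1 k2
    have hηk : 0 < η k := hη k
    have hL : L < m k := by
      by_contra hcon
      have h3 := hSmany k 0 (m k)
      have h4 : (m k : ℝ) * (η k * D) ≤ L * (η k * D) := by
        have : (m k : ℝ) ≤ L := by exact_mod_cast not_lt.1 hcon
        gcongr
      have := hmS k
      rw [zero_add] at h3
      linarith
    refine ⟨hL.le, hagree k ?_ _ fun i hi => ?_⟩
    · have : 0 ≤ (L : ℝ) := Nat.cast_nonneg _
      nlinarith [mul_pos hηk hD]
    · rcases lt_or_ge i (m k) with h | h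
      · have := hmlt k i h; linarith
      · have h3 := hSmany k (m k - 1) (i - (m k - 1))
        rw [Nat.add_sub_cancel' (by omega)] at h3
        have h4 := hmlt k (m k - 1) (by omega)
        have h5 : ((i - (m k - 1) : ℕ) : ℝ) ≤ L + 2 := by
          have : i - (m k - 1) ≤ L + 2 := by omega
          exact_mod_cast this
        have h6 := mul_le_mul_of_nonneg_right h5 (mul_pos hηk hD).le
        linarith
  -- The mixed pair: `y` followed from `a k`, but `z` followed from `b k`, both recentred at time `m
  -- k`.
  obtain ⟨φ, hφ, y', v', z', e', hy', hz', hlim⟩ := exists_limit_pair (P := P)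
    (Y := fun k n => y (a k + m k + n)) (V := fun k n => v (a k + m k + n))
    (Z := fun k n => z (b k + m k + n)) (U := fun k n => v (b k + m k + n))
    (C := fun k n => e (a k + m k + n)) (fun L => by
      filter_upwards [hlong L] with k hk
      refine ⟨hy.shift _ _ _, (hz.shift (b k + m k) _ _).congr fun n hn hn' => ?_⟩
      have := hk.2 (m k + n).toNat (by omega)
      rw [Int.toNat_of_nonneg (by omega)] at this
      simp only [add_assoc]
      exact this.symm)
  have hsub : SubCode e' e := by
    intro L
    have : ∀ᶠ k in atTop, ∀ n ∈ Finset.Icc (-L : ℤ) L, e (a (φ k) + m (φ k) + n) = e' n := by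
      rw [eventually_all_finset]
      exact fun n _ => (hlim n).2.2.2.2
    obtain ⟨k, hk⟩ := this.exists
    exact ⟨a (φ k) + m (φ k), fun n h1 h2 => (hk n (Finset.mem_Icc.2 ⟨h1, h2⟩)).symm⟩
  have hle := hmax y' v' z' e' hy' hz' hsub
  obtain ⟨ly, lv, lz, lu, -⟩ := hlim 0
  simp only [add_zero] at ly lv lz lu
  -- The mixed width is `W + S k (m k)`, up to an error controlled by the difference of the two
  -- directions, which vanishes in the limit.
  have hbig : ∀ k, η k * D < W / 4 → (∀ i ≤ m k, e (a k + i) = e (b k + i)) →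
      W + W / 8 - ‖v (a k + m k) - v (b k + m k)‖ * D ≤
      |cross (v (a k + m k)) (z (b k + m k) - y (a k + m k))| := by
    intro k _ hk
    obtain ⟨-, s2, -⟩ := hsep k (m k) hk
    have hw := hy.width hz (b k) (m k)
    rw [hy.width_even hz (hb k)] at hw
    have h1 := abs_cross_le (v (a k + m k) - v (b k + m k)) (z (b k + m k) - y (b k + m k))
    have h2 := mul_le_mul_of_nonneg_left (hdiam _ (hzcar (b k + m k)) _ (hycar (b k + m k)))
      (norm_nonneg (v (a k + m k) - v (b k + m k)))
    have h3 : cross (v (a k + m k)) (z (b k + m k) - y (a k + m k)) =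
        cross (v (a k + m k) - v (b k + m k)) (z (b k + m k) - y (b k + m k)) +
        cross (v (b k + m k)) (z (b k + m k) - y (b k + m k)) +
        cross (v (a k + m k)) (y (b k + m k) - y (a k + m k)) := by
      simp only [cross_sub_left, cross_sub_right]; ring
    have h4 : σ * cross (v (b k + m k)) (z (b k + m k) - y (b k + m k)) = (-1) ^ m k * W := by
      rw [hw, ← hWdef]; ring
    have h5 := hmS k
    have h6 : |σ * cross (v (a k + m k)) (z (b k + m k) - y (a k + m k))| =
        |cross (v (a k + m k)) (z (b k + m k) - y (a k + m k))| := by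
      rcases hσ with rfl | rfl <;> simp
    rw [← h6, h3, mul_add, mul_add, h4, s2, add_assoc]
    have h7 : |σ * cross (v (a k + m k) - v (b k + m k)) (z (b k + m k) - y (b k + m k))| ≤
        ‖v (a k + m k) - v (b k + m k)‖ * D := by
      rw [abs_mul]; rcases hσ with rfl | rfl <;> simpa using h1.trans h2
    have h8 : |(-1) ^ m k * W + (-1) ^ m k * S k (m k)| = W + S k (m k) := by
      rw [← mul_add, abs_mul, abs_pow, abs_neg, abs_one, one_pow, one_mul,
        abs_of_pos (add_pos hW (hSpos _ _))]
    have h9 := abs_sub_abs_le_abs_sub ((-1) ^ m k * W + (-1) ^ m k * S k (m k))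
      (-(σ * cross (v (a k + m k) - v (b k + m k)) (z (b k + m k) - y (b k + m k))))
    rw [abs_neg, h8, sub_neg_eq_add, add_comm _ (σ * _)] at h9
    linarith
  have hfin : W + W / 8 ≤ |cross (v' 0) (z' 0 - y' 0)| := by
    have l1 : Tendsto (fun k => W + W / 8 -
        ‖v (a (φ k) + m (φ k)) - v (b (φ k) + m (φ k))‖ * D) atTop (𝓝 (W + W / 8)) := by
      have := ((lv.sub lu).norm.mul_const D).const_sub (W + W / 8)
      simpa using this
    refine le_of_tendsto_of_tendsto l1 (lv.cross (lz.sub ly)).abs ?_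
    filter_upwards [hφ.tendsto_atTop.eventually (hlong 0), hφ.tendsto_atTop.eventually
      ((hη0.mul_const D).eventually (gt_mem_nhds (show 0 * D < W / 4 by linarith)))] with k h1 h2
    exact hbig (φ k) h2 fun i hi => h1.2 i (by omega)
  linarith

end PolygonTable

/-! ### Exactly parallel returns of an almost maximal strip. -/

namespace PolygonTable
variable {ι : Type*} {P : PolygonTable ι} [Finite ι]

theorem norm_sub_le_two_mul_abs_cross {v u : BilliardPlane} (hv : ‖v‖ = 1) (hu : ‖u‖ = 1)
    (h : ‖v - u‖ ≤ 1) : ‖v - u‖ ≤ 2 * |cross v u| := by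
  have h1 := cross_sq_add_inner_sq v u
  have h2 := norm_sub_sq_real v u
  rw [hv, hu] at h1 h2
  have h3 : ‖v - u‖ ^ 2 ≤ 1 := by nlinarith [norm_nonneg (v - u)]
  refine abs_le_of_sq_le_sq' ?_ (by positivity) |>.2
  rw [mul_pow, sq_abs]
  nlinarith

/-- Reduction to `Ideal.no_drift`: a turn that does not oppose the shift of `y` eventually
dominates, and after a fixed number `J` of legs the shifts of both `y` and `z` have the sign of the
turn. -/
theorem Ideal.no_weak_drift {y v z : ℤ → BilliardPlane} {e : ℤ → ι} (hy : P.Ideal y v e)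
    (hz : P.Ideal z v e) {M : ℝ} (hW : cross (v 0) (z 0 - y 0) ≠ 0)
    (hM : M < 9 / 8 * |cross (v 0) (z 0 - y 0)|)
    (hmax : ∀ y' v' z' e', P.Ideal y' v' e' → P.Ideal z' v' e' → SubCode e' e →
      |cross (v' 0) (z' 0 - y' 0)| ≤ M)
    {a b : ℕ → ℤ} (ha : ∀ k, Even (a k)) (hb : ∀ k, Even (b k))
    (hab : ∀ n : ℕ, ∀ᶠ k in atTop, e (a k + n) = e (b k + n))
    (hvv : ∀ n : ℕ, Tendsto (fun k => v (b k + n) - v (a k + n)) atTop (𝓝 0))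
    (hyy : ∀ n : ℕ, Tendsto (fun k => y (b k + n) - y (a k + n)) atTop (𝓝 0))
    (hzz : ∀ n : ℕ, Tendsto (fun k => z (b k + n) - z (a k + n)) atTop (𝓝 0))
    (hS : ∃ᶠ k in atTop, cross (v (a k)) (v (b k)) ≠ 0 ∧
      0 ≤ cross (v (a k)) (v (b k)) * cross (v (a k)) (y (b k) - y (a k))) : False := by
  obtain ⟨D, hD, hdiam⟩ := P.exists_diameter
  obtain ⟨N, δ, hδ, hlen⟩ := P.exists_length_bound'
  obtain ⟨J', hJ'⟩ := exists_nat_gt ((2 * D) / δ)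
  rw [div_lt_iff₀ hδ] at hJ'
  -- The factor `2` makes `J` even, which preserves the parity of the indices; the length of `J`
  -- legs exceeds `2 * D`.
  set J := N * (2 * J') with hJ
  have hJe : Even (J : ℤ) := by
    rw [hJ]; push_cast; exact ⟨N * J', by ring⟩
  have hJl : ∀ x, P.Ideal x v e → ∀ c : ℤ,
      2 * D < ∑ i ∈ Finset.range J, dist (x (c + i)) (x (c + (i + 1 : ℕ))) := by
    intro x hx c
    have := hlen x v e c (2 * J') (hx _ _)
    push_cast at this hJ' ⊢
    have : (0 : ℝ) ≤ J' := Nat.cast_nonneg _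
    nlinarith
  have hyc : ∀ n, y n ∈ P.carrier := fun n => (hy.limitStep n).dep_mem_carrier
  have hzc : ∀ n, z n ∈ P.carrier := fun n => (hz.limitStep n).dep_mem_carrier
  -- after `J` more legs both shifts have the sign of the turn
  have hev : ∀ᶠ k in atTop, (∀ i ∈ Finset.range (J + 1), e (a k + i) = e (b k + i)) ∧
      ‖v (b k) - v (a k)‖ < 1 := by
    refine ((eventually_all_finset _).2 fun i _ => hab i).and ?_
    have := (hvv 0).norm
    simp only [Nat.cast_zero, add_zero, norm_zero] at this
    exact this.eventually (gt_mem_nhds one_pos)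
  have hgood : ∃ᶠ k in atTop, (e (a k + J) = e (b k + J) ∧
      cross (v (a k + J)) (v (b k + J)) ≠ 0 ∧
      0 < cross (v (a k + J)) (v (b k + J)) * cross (v (a k + J)) (y (b k + J) - y (a k + J)) ∧
      0 < cross (v (a k + J)) (v (b k + J)) *
        cross (v (a k + J)) (z (b k + J) - z (a k + J))) := by
    refine (hS.and_eventually hev).mono fun k hk => ?_
    obtain ⟨⟨hη, hηS⟩, hag, hv1⟩ := hk
    have hag' : ∀ i ≤ J, e (a k + i) = e (b k + i) := fun i hi =>
      hag i (Finset.mem_range.2 (by omega))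
    have hcong : ∀ {x : ℤ → BilliardPlane}, P.Ideal x v e → ∀ i < J,
        P.LimitStep (e (a k + i)) (e (a k + (i + 1 : ℕ))) (x (b k + i)) (v (b k + i))
          (x (b k + (i + 1 : ℕ))) (v (b k + (i + 1 : ℕ))) := by
      intro x hx i hi
      rw [hag' i hi.le, hag' (i + 1) hi]
      exact (hx.idealFrom (b k)).limitStep_nat i
    have s1 := separation (n := J) (e := fun i => e (a k + i))
      (fun i _ => (hy.idealFrom (a k)).limitStep_nat i) (hcong hy) le_rfl
    have s2 := separation (n := J) (e := fun i => e (a k + i))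
      (fun i _ => (hz.idealFrom (a k)).limitStep_nat i) (hcong hz) le_rfl
    have hpow : (-1 : ℝ) ^ J = 1 := Even.neg_one_pow (by exact_mod_cast hJe)
    simp only [Nat.cast_zero, add_zero, hpow, one_mul] at s1 s2
    rw [s1.1, s1.2.2.1, s2.2.2.1]
    have l1 := hJl y hy (b k)
    have l2 := hJl z hz (b k)
    set η := cross (v (a k)) (v (b k))
    set Λ := ∑ i ∈ Finset.range J, dist (y (b k + i)) (y (b k + (i + 1 : ℕ)))
    set Λz := ∑ i ∈ Finset.range J, dist (z (b k + i)) (z (b k + (i + 1 : ℕ)))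
    have hη2 : 0 < η ^ 2 := by positivity
    refine ⟨hag' J le_rfl, hη, by nlinarith, ?_⟩
    -- The width is the same at both even indices, so the shifts of `z` and `y` differ only through
    -- the turn of the direction, by at most `2 * |η| * D`. The growth of the shift over more than
    -- `2 * D` of length outweighs this.
    have hw : cross (v (a k)) (z (b k) - z (a k)) = cross (v (a k)) (y (b k) - y (a k)) +
        cross (v (a k) - v (b k)) (z (b k) - y (b k)) := by
      have h1 := hy.width_even hz (ha k)
      rw [← hy.width_even hz (hb k)] at h1
      simp only [cross_sub_left, cross_sub_right] at h1 ⊢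
      linarith
    have h1 := abs_cross_le (v (a k) - v (b k)) (z (b k) - y (b k))
    have h2 := norm_sub_le_two_mul_abs_cross (hy.limitStep (a k)).unit (hy.limitStep (b k)).unit
      (by rw [norm_sub_rev]; exact hv1.le)
    have h3 := hdiam _ (hzc (b k)) _ (hyc (b k))
    have h4 : |cross (v (a k) - v (b k)) (z (b k) - y (b k))| ≤ 2 * |η| * D :=
      h1.trans (mul_le_mul h2 h3 (norm_nonneg _) (by positivity))
    have h5 : -(2 * η ^ 2 * D) ≤ η * cross (v (a k) - v (b k)) (z (b k) - y (b k)) := by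
      refine le_trans ?_ (neg_abs_le _)
      rw [abs_mul, ← sq_abs η]
      nlinarith [mul_le_mul_of_nonneg_left h4 (abs_nonneg η)]
    rw [hw]
    nlinarith
  have hmul : ∀ x r s : ℝ, 0 < x * r → 0 < x * s → 0 < r * s := fun x r s h h' => by
    rcases lt_trichotomy x 0 with hx | hx | hx
    · exact mul_pos_of_neg_of_neg (by nlinarith) (by nlinarith)
    · simp [hx] at h
    · exact mul_pos (by nlinarith) (by nlinarith)
  have hfin : ∀ {y z : ℤ → BilliardPlane} (hy : P.Ideal y v e) (hz : P.Ideal z v e)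
      (hM : M < 9 / 8 * |cross (v 0) (z 0 - y 0)|)
      (hyy : ∀ n : ℕ, Tendsto (fun k => y (b k + n) - y (a k + n)) atTop (𝓝 0)),
      (∃ᶠ k in atTop, (e (a k + J) = e (b k + J) ∧
      0 < cross (v 0) (z 0 - y 0) * cross (v (a k + J)) (v (b k + J)) ∧
      0 < cross (v (a k + J)) (v (b k + J)) * cross (v (a k + J)) (y (b k + J) - y (a k + J)) ∧
      0 < cross (v (a k + J)) (v (b k + J)) *
        cross (v (a k + J)) (z (b k + J) - z (a k + J)))) → False := by
    intro y z hy hz hM hyy hfr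
    obtain ⟨φ, hφ, hall⟩ := extraction_of_frequently_atTop hfr
    obtain ⟨σ, hσ, hσω⟩ : ∃ σ : ℝ, (σ = 1 ∨ σ = -1) ∧
        σ * cross (v 0) (z 0 - y 0) = |cross (v 0) (z 0 - y 0)| := by
      rcases abs_cases (cross (v 0) (z 0 - y 0)) with h | h
      · exact ⟨1, Or.inl rfl, by rw [h.1, one_mul]⟩
      · exact ⟨-1, Or.inr rfl, by rw [h.1]; ring⟩
    have hω : 0 < |cross (v 0) (z 0 - y 0)| := by
      rw [abs_pos]; intro h0; have := (hall 0).2.1; rw [h0, zero_mul] at this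
      exact lt_irrefl _ this
    have hω' : 0 < cross (v 0) (z 0 - y 0) * σ := by rw [mul_comm, hσω]; exact hω
    have e1 : ∀ k, 0 < σ * cross (v (a (φ k) + J)) (v (b (φ k) + J)) := fun k =>
      hmul _ _ _ hω' (hall k).2.1
    refine hy.no_drift hz hσ hσω hω hM hmax (a := fun k => a (φ k) + J) (b := fun k => b (φ k) + J)
      (fun k => (ha _).add hJe) (fun k => (hb _).add hJe) (fun k => (hall k).1)
      ((hvv J).comp hφ.tendsto_atTop) ((hyy J).comp hφ.tendsto_atTop) e1
      (fun k => hmul _ _ _ (by rw [mul_comm]; exact e1 k) (hall k).2.2.1)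
      (fun k => hmul _ _ _ (by rw [mul_comm]; exact e1 k) (hall k).2.2.2)
  have hswap : cross (v 0) (y 0 - z 0) = -cross (v 0) (z 0 - y 0) := by
    rw [← neg_sub, cross_neg_right]
  by_cases hc : ∃ᶠ k in atTop, (e (a k + J) = e (b k + J) ∧
      0 < cross (v 0) (z 0 - y 0) * cross (v (a k + J)) (v (b k + J)) ∧
      0 < cross (v (a k + J)) (v (b k + J)) * cross (v (a k + J)) (y (b k + J) - y (a k + J)) ∧
      0 < cross (v (a k + J)) (v (b k + J)) *
        cross (v (a k + J)) (z (b k + J) - z (a k + J)))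
  · exact hfin hy hz hM hyy hc
  -- If the turn usually points away from `z`, exchange `y` and `z`: this changes the sign of the
  -- width.
  · rw [not_frequently] at hc
    refine hfin hz hy (by rw [hswap, abs_neg]; exact hM) hzz ((hgood.and_eventually hc).mono ?_)
    rintro k ⟨⟨h1, h2, h3, h4⟩, h5⟩
    refine ⟨h1, ?_, h4, h3⟩
    by_contra hcon
    refine h5 ⟨h1, ?_, h3, h4⟩
    rw [hswap] at hcon
    rcases (mul_ne_zero hW h2).lt_or_gt with h | h
    · linarith
    · exact h

theorem SubCode.reverse {e' e : ℤ → ι} (h : SubCode e' (fun n => e (-n))) :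
    SubCode (fun n => e' (-n)) e := by
  intro L
  obtain ⟨c, hc⟩ := h L
  refine ⟨-c, fun n h1 h2 => ?_⟩
  exact (hc (-n) (by omega) (by omega)).trans (congrArg e (by ring))

theorem Ideal.reverse_width {y v z : ℤ → BilliardPlane} {e : ℤ → ι} (hy : P.Ideal y v e)
    (hz : P.Ideal z v e) :
    cross (-v (-0 - 1)) (z (-0) - y (-0)) = cross (v 0) (z 0 - y 0) := by
  have h1 := (hy.limitStep (-0 - 1)).cross_sub (hz.limitStep (-0 - 1))
  have h2 := (hy.limitStep (-0 - 1)).eq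
  have h3 := (hz.limitStep (-0 - 1)).eq
  rw [show (-0 - 1 + 1 : ℤ) = -0 by ring] at h1 h2 h3
  rw [neg_zero] at *
  rw [h1, cross_self_eq, h2, h3, cross_neg_left]
  simp only [cross_sub_right, cross_add_right, cross_smul_right, cross_self_eq]
  ring

/-- A pair of almost maximal width returns in a parallel position close to itself. -/
theorem Ideal.exists_parallel {y v z : ℤ → BilliardPlane} {e : ℤ → ι} (hy : P.Ideal y v e)
    (hz : P.Ideal z v e) {M : ℝ} (hW : cross (v 0) (z 0 - y 0) ≠ 0)
    (hM : M < 9 / 8 * |cross (v 0) (z 0 - y 0)|)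
    (hmax : ∀ y' v' z' e', P.Ideal y' v' e' → P.Ideal z' v' e' → SubCode e' e →
      |cross (v' 0) (z' 0 - y' 0)| ≤ M) {ε : ℝ} (hε : 0 < ε) :
    ∃ a b : ℤ, a < b ∧ Even (b - a) ∧ e a = e b ∧ v a = v b ∧
      |cross (v a) (y b - y a)| < ε := by
  by_contra hcon
  push Not at hcon
  -- Consecutive terms of a convergent subsequence of even shifts are close returns; if the claim
  -- fails, their turns are eventually nonzero.
  obtain ⟨φ, hφ, y', v', z', e', -, -, hlim⟩ := exists_limit_pair (P := P)
    (Y := fun k n => y (2 * k + n)) (V := fun k n => v (2 * k + n))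
    (Z := fun k n => z (2 * k + n)) (U := fun k n => v (2 * k + n))
    (C := fun k n => e (2 * k + n)) (fun L => Eventually.of_forall fun k =>
      ⟨hy.shift _ _ _, hz.shift _ _ _⟩)
  set a : ℕ → ℤ := fun k => 2 * (φ k : ℤ) with hadef
  set b : ℕ → ℤ := fun k => 2 * (φ (k + 1) : ℤ) with hbdef
  have ha : ∀ k, Even (a k) := fun k => even_two_mul _
  have hb : ∀ k, Even (b k) := fun k => even_two_mul _
  have hlt : ∀ k, a k < b k := fun k => by
    have := hφ (Nat.lt_add_one k)
    simp only [hadef, hbdef]; omega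
  have hshift : Tendsto (fun k : ℕ => k + 1) atTop atTop := tendsto_add_atTop_nat 1
  have hyy : ∀ n : ℤ, Tendsto (fun k => y (b k + n) - y (a k + n)) atTop (𝓝 0) := fun n => by
    have := ((hlim n).1.comp hshift).sub (hlim n).1
    rwa [sub_self] at this
  have hzz : ∀ n : ℤ, Tendsto (fun k => z (b k + n) - z (a k + n)) atTop (𝓝 0) := fun n => by
    have := ((hlim n).2.2.1.comp hshift).sub (hlim n).2.2.1
    rwa [sub_self] at this
  have hvv : ∀ n : ℤ, Tendsto (fun k => v (b k + n) - v (a k + n)) atTop (𝓝 0) := fun n => by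
    have := ((hlim n).2.1.comp hshift).sub (hlim n).2.1
    rwa [sub_self] at this
  have hab : ∀ n : ℤ, ∀ᶠ k in atTop, e (a k + n) = e (b k + n) := fun n => by
    filter_upwards [(hlim n).2.2.2.2, hshift.eventually (hlim n).2.2.2.2] with k h1 h2
    exact h1.trans h2.symm
  have hunit : ∀ n, ‖v n‖ = 1 := fun n => (hy.limitStep n).unit
  have hne : ∀ᶠ k in atTop, e (a k) = e (b k) ∧ cross (v (a k)) (v (b k)) ≠ 0 := by
    have h1 := hab 0
    have h2 := (hyy 0).norm
    have h3 := (hvv 0).norm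
    simp only [add_zero, norm_zero] at h1 h2 h3
    filter_upwards [h1, h2.eventually (gt_mem_nhds hε), h3.eventually (gt_mem_nhds one_pos)]
      with k k1 k2 k3
    refine ⟨k1, fun h0 => ?_⟩
    have h4 := hcon (a k) (b k) (hlt k) ((hb k).sub (ha k)) k1
    have h5 := abs_cross_le (v (a k)) (y (b k) - y (a k))
    rw [hunit, one_mul] at h5
    rcases eq_or_eq_neg_of_cross_eq_zero (hunit _) (hunit _) h0 with h6 | h6
    · linarith [h4 h6.symm]
    · rw [h6, ← neg_add', norm_neg, ← two_smul ℝ, norm_smul, hunit] at k3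
      norm_num at k3
  by_cases hc : ∃ᶠ k in atTop,
      0 ≤ cross (v (a k)) (v (b k)) * cross (v (a k)) (y (b k) - y (a k))
  · exact hy.no_weak_drift hz hW hM hmax ha hb (fun n => hab n) (fun n => hvv n) (fun n => hyy n)
      (fun n => hzz n) ((hc.and_eventually hne).mono fun k hk => ⟨hk.2.2, hk.1⟩)
  -- If the shift opposes the turn, reverse time: with reversed and reflected directions the turn
  -- changes sign while the shift does not.
  · rw [not_frequently] at hc
    have hrw := hy.reverse_width hz
    refine hy.reverse.no_weak_drift hz.reverse (M := M) (a := fun k => -a k) (b := fun k => -b k)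
      (by rw [hrw]; exact hW) (by rw [hrw]; exact hM) ?_ (fun k => (ha k).neg)
      (fun k => (hb k).neg) (fun n => ?_) (fun n => ?_) (fun n => ?_) (fun n => ?_) ?_
    · intro y₁ v₁ z₁ e₁ h1 h2 h3
      have := hmax _ _ _ _ h1.reverse h2.reverse h3.reverse
      rwa [h1.reverse_width h2] at this
    · simpa only [neg_add, neg_neg] using hab (-n)
    · have := (hvv (-n - 1)).neg
      simp only [neg_zero, neg_sub_neg] at this ⊢
      refine this.congr fun k => ?_
      rw [show -(-b k + (n : ℤ)) - 1 = b k + (-n - 1) by ring,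
        show -(-a k + (n : ℤ)) - 1 = a k + (-n - 1) by ring]
      abel
    · simpa only [neg_add, neg_neg] using hyy (-n)
    · simpa only [neg_add, neg_neg] using hzz (-n)
    · refine (hne.and hc).frequently.mono fun k hk => ?_
      obtain ⟨⟨k1, k2⟩, k3⟩ := hk
      have s1 := hy.limitStep (a k - 1)
      have s2 := hy.limitStep (b k - 1)
      rw [sub_add_cancel] at s1 s2
      simp only [neg_neg]
      have c1 : cross (-v (a k - 1)) (-v (b k - 1)) = -cross (v (a k)) (v (b k)) := by
        rw [s1.optical, s2.optical, ← k1, cross_reflect, cross_neg_left, cross_neg_right]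
      have c2 : cross (-v (a k - 1)) (y (b k) - y (a k)) =
          cross (v (a k)) (y (b k) - y (a k)) := by
        rw [s1.optical, P.cross_reflect_sub, cross_neg_left]
        · rw [k1]; exact P.height_eq_zero s2.arr
        · exact P.height_eq_zero s1.arr
      rw [c1, c2]
      exact ⟨neg_ne_zero.2 k2, by linarith⟩

end PolygonTable

/-! ### One-sided neighbourhoods of ideal legs. -/

namespace PolygonTable
variable {ι : Type*} {P : PolygonTable ι} [Finite ι]

variable (P) in
/-- The point where the line from `p` in direction `u` meets the line of the edge `e`. -/
noncomputable def hit (e : ι) (p u : BilliardPlane) : BilliardPlane :=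
  p - (P.height e p / P.slope e u) • u

theorem height_hit {e : ι} {p u : BilliardPlane} (h : P.slope e u ≠ 0) :
    P.height e (P.hit e p u) = 0 := by
  unfold hit
  rw [sub_eq_add_neg, ← neg_smul, height_add, slope_smul]; field_simp; ring

theorem cross_hit_sub {e : ι} {p u : BilliardPlane} : cross u (P.hit e p u - p) = 0 := by
  unfold hit
  rw [sub_sub_cancel_left, cross_neg_right, cross_smul_right, cross_self_eq]; ring

/-- Two points on the line of an edge and on a line transversal to it. -/
theorem eq_of_height_eq_zero {e : ι} {x y v : BilliardPlane} (hs : P.slope e v ≠ 0)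
    (hx : P.height e x = 0) (hy : P.height e y = 0) (h : cross v (x - y) = 0) : x = y := by
  have hv : v ≠ 0 := by rintro rfl; exact hs (by rw [slope_eq_zero_iff, cross_zero_right])
  have h1 := exists_smul_of_cross_eq_zero hv h
  have h2 := P.height_sub_height e x y
  rw [hx, hy, sub_zero, h1, slope_smul] at h2
  have h3 := (mul_eq_zero.1 h2.symm).resolve_right hs
  rw [h3, zero_smul] at h1
  exact sub_eq_zero.1 h1

theorem hit_eq {e : ι} {x x' v : BilliardPlane} (hs : P.slope e v ≠ 0)
    (hx' : P.height e x' = 0) (h : cross v (x' - x) = 0) : P.hit e x v = x' := by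
  refine eq_of_height_eq_zero hs (height_hit hs) hx' ?_
  rw [← sub_sub_sub_cancel_right _ x' x, cross_sub_right, cross_hit_sub, h, sub_zero]

theorem continuousAt_hit {e : ι} {x v : BilliardPlane} (hs : P.slope e v ≠ 0) :
    ContinuousAt (fun q : BilliardPlane × BilliardPlane => P.hit e q.1 q.2) (x, v) := by
  unfold hit
  have h1 : ContinuousAt (fun q : BilliardPlane × BilliardPlane => P.height e q.1) (x, v) :=
    ((P.continuous_height e).comp continuous_fst).continuousAt
  have h2 : ContinuousAt (fun q : BilliardPlane × BilliardPlane => P.slope e q.2) (x, v) :=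
    ((P.continuous_slope e).comp continuous_snd).continuousAt
  exact continuousAt_fst.sub ((h1.div h2 hs).smul continuousAt_snd)

theorem cross_eq_zero_of_slope_eq_zero {e : ι} {v x y : BilliardPlane} (hs : P.slope e v = 0)
    (hx : P.height e x = 0) (hy : P.height e y = 0) : cross v (x - y) = 0 := by
  have h1 := exists_smul_of_cross_eq_zero (P.edgeVec_ne_zero e) (P.slope_eq_zero_iff.1 hs)
  have h2 := exists_smul_of_cross_eq_zero (P.edgeVec_ne_zero e) (P.cross_edgeVec_sub hx hy)
  rw [h1, h2, cross_smul_left, cross_smul_right, cross_self_eq]; ring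

variable (P) in
/-- A limit of steps which all pass on the same side. -/
def SideStep (σ : ℝ) (e e' : ι) (x v x' : BilliardPlane) : Prop :=
  ∃ r V r' w : ℕ → BilliardPlane, (∀ k, P.Step e e' (r k) (V k) (r' k) (w k)) ∧
    Tendsto r atTop (𝓝 x) ∧ Tendsto V atTop (𝓝 v) ∧ Tendsto r' atTop (𝓝 x') ∧
    ∀ k, 0 < σ * cross v (r k - x) ∧ 0 < σ * cross v (r' k - x)

theorem SideStep.closureStep {σ : ℝ} {e e' : ι} {x v x' : BilliardPlane}
    (h : P.SideStep σ e e' x v x') : P.ClosureStep e e' x v x' := by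
  obtain ⟨r, V, r', w, h1, h2, h3, h4, -⟩ := h
  exact ⟨r, V, r', w, h1, h2, h3, h4⟩

theorem ClosureStep.facts {e e' : ι} {x v x' : BilliardPlane} (h : P.ClosureStep e e' x v x') :
    ‖v‖ = 1 ∧ x ∈ P.edge e ∧ x' ∈ P.edge e' ∧ 0 ≤ P.slope e v ∧ P.slope e' v ≤ 0 ∧
      0 ≤ P.height e x' ∧ 0 ≤ P.height e' x := by
  obtain ⟨r, V, r', w, h1, h2, h3, h4⟩ := h
  refine ⟨tendsto_nhds_unique h3.norm (tendsto_const_nhds.congr fun k => (h1 k).unit.symm),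
    (P.isClosed_edge e).mem_of_tendsto h2 (Eventually.of_forall fun k => (h1 k).limitStep.dep),
    (P.isClosed_edge e').mem_of_tendsto h4 (Eventually.of_forall fun k => (h1 k).limitStep.arr),
    ge_of_tendsto (((P.continuous_slope e).tendsto v).comp h3)
      (Eventually.of_forall fun k => (h1 k).slope_dep.le),
    le_of_tendsto (((P.continuous_slope e').tendsto v).comp h3)
      (Eventually.of_forall fun k => (h1 k).slope_arr.le),
    ge_of_tendsto (((P.continuous_height e).tendsto x').comp h4)
      (Eventually.of_forall fun k => (h1 k).height_arr.le),
    ge_of_tendsto (((P.continuous_height e').tendsto x).comp h2)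
      (Eventually.of_forall fun k => (h1 k).height_dep.le)⟩

theorem param_comb (e : ι) (x y : BilliardPlane) (s : ℝ) :
    P.param e (x + s • (y - x)) = (1 - s) * P.param e x + s * P.param e y := by
  unfold param
  rw [show x + s • (y - x) - P.src e = (1 - s) • (x - P.src e) + s • (y - P.src e) by module,
    inner_add_right, inner_smul_right, inner_smul_right]
  ring

/-- Points on one side of an end point of an edge belong to the edge. -/
theorem eventually_side {e e' : ι} {x v r : BilliardPlane} {σ : ℝ} (hx : x ∈ P.edge e)
    (hx' : 0 ≤ P.height e' x) (hr : r ∈ P.edgeInterior e) (hr' : 0 < P.height e' r)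
    (hσ : 0 < σ * cross v (r - x)) :
    ∀ᶠ p in 𝓝 x, P.height e p = 0 → 0 < σ * cross v (p - x) →
      p ∈ P.edgeInterior e ∧ 0 < P.height e' p := by
  have hc : Continuous fun p => σ * cross v (p - x) := by unfold cross; fun_prop
  have hlt : ∀ᶠ p in 𝓝 x, σ * cross v (p - x) < σ * cross v (r - x) := by
    refine (hc.tendsto x).eventually (gt_mem_nhds ?_)
    rw [sub_self, cross_zero_right, mul_zero]; exact hσ
  filter_upwards [hlt] with p h1 h2 h3
  have hxr : x ≠ r := by rintro rfl; rw [sub_self, cross_zero_right, mul_zero] at hσ; exact lt_irrefl _ hσ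
  obtain ⟨s, rfl⟩ := exists_comb_of_height_eq_zero (P.height_eq_zero hx) (P.height_eq_zero' hr) h2 hxr
  rw [add_sub_cancel_left, cross_smul_right] at h1 h3
  have hs : 0 < s := by by_contra hcon; nlinarith
  have hs' : s < 1 := by by_contra hcon; nlinarith
  constructor
  · have h4 := P.mem_edgeInterior_iff.1 hr
    have h5 := P.mem_edge_iff.1 hx
    refine P.mem_edgeInterior_iff.2 ⟨P.height_eq_zero_iff.1 h2, ?_, ?_⟩ <;> rw [param_comb] <;>
      nlinarith
  · rw [height_comb]; nlinarith

theorem comb_mem_edge {e : ι} {x y : BilliardPlane} {s : ℝ} (hs : 0 ≤ s) (hs' : s ≤ 1)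
    (hx : x ∈ P.edge e) (hy : y ∈ P.edge e) : x + s • (y - x) ∈ P.edge e := by
  have h : Convex ℝ (P.edge e) := convex_segment _ _
  rw [show x + s • (y - x) = (1 - s) • x + s • y by module]
  exact h hx hy (by linarith) hs (by ring)

/-- The approximating points of an edge are on the expected side of the approximating lines. -/
theorem eventually_cross_neg {e : ι} {x v : BilliardPlane} {r V : ℕ → BilliardPlane} {σ : ℝ}
    (hx : P.height e x = 0) (hr : ∀ k, P.height e (r k) = 0) (hV : Tendsto V atTop (𝓝 v))
    (hσ : ∀ k, 0 < σ * cross v (r k - x)) :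
    ∀ᶠ k in atTop, σ * cross (V k) (x - r k) < 0 := by
  have h1 : ∀ᶠ k in atTop, 0 < σ * cross (V k) (r 0 - x) :=
    ((hV.cross tendsto_const_nhds).const_mul σ).eventually (lt_mem_nhds (hσ 0))
  have hxr : x ≠ r 0 := by
    intro h; have := hσ 0; rw [← h, sub_self, cross_zero_right, mul_zero] at this
    exact lt_irrefl _ this
  filter_upwards [h1] with k hk
  obtain ⟨s, hs⟩ := exists_comb_of_height_eq_zero hx (hr 0) (hr k) hxr
  have h2 := hσ k
  have h3 := hσ 0
  rw [hs, add_sub_cancel_left, cross_smul_right] at h2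
  rw [hs, sub_add_cancel_left, cross_neg_right, cross_smul_right]
  have hs : 0 < s := by by_contra hcon; nlinarith
  nlinarith

variable (P) in
/-- The situation in which all lines next to the segment from `x` to `x'`, on one side of it,
connect the edges `e` and `e'` inside the polygon. -/
structure SideBarrier (σ : ℝ) (e e' : ι) (x v x' : BilliardPlane) : Prop where
  dep : x ∈ P.edge e
  arr : x' ∈ P.edge e'
  line : cross v (x' - x) = 0
  slope_dep : 0 < P.slope e v
  slope_arr : P.slope e' v < 0
  height_dep : 0 ≤ P.height e' x
  height_arr : 0 ≤ P.height e x'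
  side_dep : ∃ r ∈ P.edgeInterior e, 0 < P.height e' r ∧ 0 < σ * cross v (r - x)
  side_arr : ∃ r ∈ P.edgeInterior e', 0 < P.height e r ∧ 0 < σ * cross v (r - x)
  barrier : ∀ f, ∀ g ∈ segment ℝ x x', g ∈ P.edge f → ∀ z ∈ P.edge f, 0 < P.height e z →
    0 < P.height e' z → 0 < σ * cross v (z - x) → 0 ≤ P.height e g → 0 ≤ P.height e' g → False

variable (P) in
/-- Next to the segment from `x` to `x'`, everything on one side of it is a step. -/
def SideFree (σ : ℝ) (e e' : ι) (x v : BilliardPlane) : Prop :=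
  ∀ᶠ q : BilliardPlane × BilliardPlane in 𝓝 (x, v), ‖q.2‖ = 1 → P.height e q.1 = 0 →
    0 < σ * cross v (q.1 - x) → 0 ≤ σ * cross v q.2 →
    P.Step e e' q.1 q.2 (P.hit e' q.1 q.2) (P.reflect e' q.2)

/-- Near the limit leg, transversality keeps the end points on their edges. An edge away from the
segment stays away from nearby legs; an edge that touches the segment cannot meet a leg on the side
`σ`, by `barrier`. -/
theorem SideBarrier.sideFree {σ : ℝ} {e e' : ι} {x v x' : BilliardPlane}
    (h : P.SideBarrier σ e e' x v x') : P.SideFree σ e e' x v := by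
  obtain ⟨hx, hx', hc, hsl, hsl', hhx, hhx', ⟨r, hr, hr1, hr2⟩, ⟨r', hr', hr1', hr2'⟩, hbar⟩ := h
  have hdev' : ∀ z, cross v (z - x') = cross v (z - x) := fun z => by
    rw [← sub_sub_sub_cancel_right z x' x, cross_sub_right, hc, sub_zero]
  have hhit : Tendsto (fun q : BilliardPlane × BilliardPlane => P.hit e' q.1 q.2) (𝓝 (x, v))
      (𝓝 x') := by
    have := (continuousAt_hit (P := P) (x := x) hsl'.ne).tendsto
    rwa [hit_eq hsl'.ne (P.height_eq_zero hx') hc] at this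
  have hfst : Tendsto (fun q : BilliardPlane × BilliardPlane => q.1) (𝓝 (x, v)) (𝓝 x) :=
    continuous_fst.tendsto (x, v)
  have hsnd : Tendsto (fun q : BilliardPlane × BilliardPlane => q.2) (𝓝 (x, v)) (𝓝 v) :=
    continuous_snd.tendsto (x, v)
  have E1 := hfst.eventually (eventually_side hx hhx hr hr1 hr2)
  have E2 := hhit.eventually (eventually_side (v := v) (σ := σ) hx' hhx' hr' hr1'
    (by rw [hdev']; exact hr2'))
  have E3 := (((P.continuous_slope e).tendsto v).comp hsnd).eventually (lt_mem_nhds hsl)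
  have E4 := (((P.continuous_slope e').tendsto v).comp hsnd).eventually (gt_mem_nhds hsl')
  have E5 : ∀ᶠ q : BilliardPlane × BilliardPlane in 𝓝 (x, v), ∀ f,
      0 < σ * cross v (q.1 - x) → 0 < σ * cross v (P.hit e' q.1 q.2 - x) →
      P.height e q.1 = 0 → 0 < P.height e' q.1 → P.height e' (P.hit e' q.1 q.2) = 0 →
      0 < P.height e (P.hit e' q.1 q.2) →
      ∀ z ∈ openSegment ℝ q.1 (P.hit e' q.1 q.2), z ∉ P.edge f := by
    rw [eventually_all]
    intro f
    by_cases hf : ∃ g ∈ segment ℝ x x', g ∈ P.edge f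
    · obtain ⟨g, hg, hgf⟩ := hf
      refine Eventually.of_forall fun q h1 h2 h3 h4 h5 h6 z hz hzf => ?_
      refine hbar f g hg hgf z hzf ?_ ?_ ?_ ?_ ?_
      · rw [openSegment_eq_image'] at hz
        obtain ⟨s, ⟨hs0, hs1⟩, rfl⟩ := hz
        simp only; rw [height_comb, h3]; nlinarith
      · rw [openSegment_eq_image'] at hz
        obtain ⟨s, ⟨hs0, hs1⟩, rfl⟩ := hz
        simp only; rw [height_comb, h5]; nlinarith
      · rw [openSegment_eq_image'] at hz
        obtain ⟨s, ⟨hs0, hs1⟩, rfl⟩ := hz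
        simp only; rw [cross_comb, mul_add]; nlinarith
      · rw [segment_eq_image'] at hg
        obtain ⟨θ, ⟨hθ0, hθ1⟩, rfl⟩ := hg
        simp only; rw [height_comb, P.height_eq_zero hx]; nlinarith
      · rw [segment_eq_image'] at hg
        obtain ⟨θ, ⟨hθ0, hθ1⟩, rfl⟩ := hg
        simp only; rw [height_comb, P.height_eq_zero hx']; nlinarith
    -- An edge disjoint from the compact segment misses a whole convex thickening of it, which
    -- contains the nearby legs.
    · push Not at hf
      have hcomp : IsCompact (segment ℝ x x') := by
        rw [← convexHull_pair]; exact (Set.toFinite _).isCompact_convexHull (𝕜 := ℝ)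
      obtain ⟨δ, hδ, hsub⟩ := hcomp.exists_thickening_subset_open
        (P.isClosed_edge f).isOpen_compl fun g hg => hf g hg
      filter_upwards [hfst.eventually (Metric.ball_mem_nhds x hδ),
        hhit.eventually (Metric.ball_mem_nhds x' hδ)] with q q1 q2
      intro _ _ _ _ _ _ z hz
      have hconv : Convex ℝ (Metric.thickening δ (segment ℝ x x')) :=
        (convex_segment x x').thickening δ
      refine hsub (hconv.openSegment_subset ?_ ?_ hz)
      · exact Metric.mem_thickening_iff.2 ⟨x, left_mem_segment _ _ _, q1⟩
      · exact Metric.mem_thickening_iff.2 ⟨x', right_mem_segment _ _ _, q2⟩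
  rw [SideFree]
  filter_upwards [E1, E2, E3, E4, E5] with q q1 q2 q3 q4 q5 hu h0 h1 h2
  have h3 := height_hit (p := q.1) q4.ne
  obtain ⟨q1, q1'⟩ := q1 h0 h1
  have q7 : 0 < -P.height e' q.1 / P.slope e' q.2 := div_pos_of_neg_of_neg (by linarith) q4
  have q8 : P.hit e' q.1 q.2 = q.1 + (-P.height e' q.1 / P.slope e' q.2) • q.2 := by
    unfold hit; rw [neg_div, neg_smul, sub_eq_add_neg]
  set t := -P.height e' q.1 / P.slope e' q.2
  replace h2 : 0 < σ * cross v (P.hit e' q.1 q.2 - x) := by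
    rw [q8, add_sub_right_comm, cross_add_right, cross_smul_right]
    have := mul_nonneg q7.le h2
    linarith
  obtain ⟨q2, q2'⟩ := q2 h3 (by rw [hdev']; exact h2)
  have q6 := fun f => q5 f h1 h2 h0 q1' h3 q2'
  refine ⟨hu, q1, q2, ⟨⟨_, q7, q8⟩, P.openSegment_subset_interior (fun z hz f => q6 f z hz) ?_⟩, rfl⟩
  -- A segment free of edges is entirely inside or outside; its beginning is inside because it
  -- leaves `e` with positive slope.
  obtain ⟨ε, hε, hi⟩ := P.pointsInto_of_slope_pos q1 q3
  refine ⟨q.1 + (min ε t / 2) • q.2, ?_, interior_subset (hi _ ?_ ?_)⟩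
  · rw [q8, mem_openSegment_iff_ray q7]
    refine ⟨_, by positivity, ?_, rfl⟩
    have := min_le_right ε t
    linarith
  · positivity
  · have := min_le_left ε t
    linarith

/-- An edge joining a point of the limit segment to a point on the side `σ` is cut by the
approximating legs on that side. The cut would be both interior and on an edge. -/
theorem SideStep.sideBarrier {σ : ℝ} {e e' : ι} {x v x' : BilliardPlane}
    (h : P.SideStep σ e e' x v x') (hs : P.slope e v ≠ 0) (hs' : P.slope e' v ≠ 0) :
    P.SideBarrier σ e e' x v x' := by
  obtain ⟨-, hx, hx', hsl, hsl', hhx', hhx⟩ := h.closureStep.facts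
  have hc := h.closureStep.cross_eq_zero
  obtain ⟨r, V, r', w, hst, hr, hV, hr', hdev⟩ := h
  have hdev' : ∀ z, cross v (z - x') = cross v (z - x) := fun z => by
    rw [← sub_sub_sub_cancel_right z x' x, cross_sub_right, hc, sub_zero]
  refine ⟨hx, hx', hc, lt_of_le_of_ne hsl hs.symm, lt_of_le_of_ne hsl' hs', hhx, hhx',
    ⟨r 0, (hst 0).dep, (hst 0).height_dep, (hdev 0).1⟩,
    ⟨r' 0, (hst 0).arr, (hst 0).height_arr, (hdev 0).2⟩, ?_⟩
  intro f g hg hgf z hzf hze hze' hzd hge hge'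
  rw [segment_eq_image'] at hg
  obtain ⟨θ, ⟨hθ0, hθ1⟩, rfl⟩ := hg
  simp only at hgf hge hge'
  set g := x + θ • (x' - x) with hgdef
  have F1 : ∀ᶠ k in atTop, 0 < σ * cross (V k) (z - r k) :=
    ((hV.cross (tendsto_const_nhds.sub hr)).const_mul σ).eventually (lt_mem_nhds hzd)
  have F2 := eventually_cross_neg (P := P) (P.height_eq_zero hx)
    (fun k => P.height_eq_zero' (hst k).dep) hV fun k => (hdev k).1
  have F3 := eventually_cross_neg (P := P) (σ := σ) (P.height_eq_zero hx')
    (fun k => P.height_eq_zero' (hst k).arr) hV fun k => by rw [hdev']; exact (hdev k).2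
  obtain ⟨k, k1, k2, k3⟩ := (F1.and (F2.and F3)).exists
  -- Both ends of the limit segment lie beyond the approximating line, hence so does `g`, whereas
  -- `z` is on the near side.
  have k4 : σ * cross (V k) (g - r k) < 0 := by
    obtain ⟨t, -, ht⟩ := (hst k).exists_pos
    have h7 : cross (V k) (x' - r' k) = cross (V k) (x' - r k) := by
      rw [ht, ← sub_sub, cross_sub_right, cross_smul_right, cross_self_eq]; ring
    rw [h7] at k3
    rw [hgdef, cross_comb, mul_add]
    rcases hθ0.lt_or_eq with h | h
    · nlinarith
    · rw [← h]; linarith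
  have hσ : σ ≠ 0 := by rintro rfl; simp at k1
  obtain ⟨s', hs0', hs1', h0⟩ := exists_zero_comb k4 k1
  have hzero : cross (V k) (g + s' • (z - g) - r k) = 0 := by
    rw [cross_comb]
    exact (mul_eq_zero.1 (show σ * _ = 0 by rw [← h0]; ring)).resolve_left hσ
  refine P.notMem_interior_of_mem_edge (e := f) (comb_mem_edge hs0'.le hs1'.le hgf hzf)
    ((hst k).mem_interior_of_between hzero ?_ ?_)
  · rw [height_comb]; nlinarith
  · rw [height_comb]; nlinarith

/-- Next to a limit of steps which pass on one side, everything on that side is a step. -/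
theorem SideStep.sideFree {σ : ℝ} {e e' : ι} {x v x' : BilliardPlane}
    (h : P.SideStep σ e e' x v x') (hs : P.slope e v ≠ 0) (hs' : P.slope e' v ≠ 0) :
    P.SideFree σ e e' x v := (h.sideBarrier hs hs').sideFree

end PolygonTable

/-! ### Returns that repeat the code. -/

namespace PolygonTable
variable {ι : Type*} {P : PolygonTable ι} [Finite ι]

/-- An approximating step on the same line as the limit leg, with nearby direction and transversal
edges, has the same end points. So the ideal leg is itself a true step. -/
theorem IdealFrom.step_of_frequently {y v : ℤ → BilliardPlane} {E : ℤ → ι}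
    {Y V : ℕ → ℤ → BilliardPlane} {n : ℤ}
    (h : ∃ᶠ k in atTop, P.StepAt (Y k) (V k) E n ∧ cross (v n) (V k n) = 0 ∧
      cross (v n) (Y k n - y n) = 0 ∧ cross (v (n + 1)) (Y k (n + 1) - y (n + 1)) = 0)
    (hs : P.slope (E n) (v n) ≠ 0) (hs' : P.slope (E (n + 1)) (v (n + 1)) ≠ 0)
    (hl : P.LimitStep (E n) (E (n + 1)) (y n) (v n) (y (n + 1)) (v (n + 1)))
    (hV : Tendsto (fun k => V k n) atTop (𝓝 (v n))) : P.StepAt y v E n := by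
  have h1 : ∀ᶠ k in atTop, dist (V k n) (v n) < 1 := hV.eventually (Metric.ball_mem_nhds _ one_pos)
  obtain ⟨k, ⟨h2, h3, h4, h5⟩, h6⟩ := (h.and_eventually h1).exists
  have hVn : V k n = v n := by
    rcases eq_or_eq_neg_of_cross_eq_zero hl.unit h2.unit h3 with h | h
    · exact h
    · rw [h, dist_eq_norm, ← neg_add', norm_neg, ← two_smul ℝ, norm_smul, hl.unit] at h6
      norm_num at h6
  have e1 := eq_of_height_eq_zero hs (P.height_eq_zero' h2.dep) (P.height_eq_zero hl.dep) h4
  have e2 := eq_of_height_eq_zero hs' (P.height_eq_zero' h2.arr) (P.height_eq_zero hl.arr) h5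
  have e3 : V k (n + 1) = v (n + 1) := by rw [h2.optical, hl.optical, hVn]
  simp only [StepAt] at h2 ⊢
  rwa [e1, e2, e3, hVn] at h2

/-- The nonsingular trajectories which approximate an ideal one either can be replaced by the ideal
one itself, or they finally pass on one side of it. -/
theorem IdealFrom.one_sided {y v : ℤ → BilliardPlane} {E : ℤ → ι} (hy : P.IdealFrom 0 y v E)
    (hs : ∀ n : ℕ, P.slope (E n) (v n) ≠ 0) :
    (∀ n : ℕ, P.StepAt y v E n) ∨ ∃ (σ : ℝ) (n₀ : ℕ), ∀ n : ℕ, n₀ ≤ n →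
      P.SideStep ((-1) ^ n * σ) (E n) (E (n + 1)) (y n) (v n) (y (n + 1)) := by
  obtain ⟨Y, V, hst, hlim⟩ := hy.exists_seq
  set η : ℕ → ℝ := fun k => cross (v 0) (V k 0) with hη
  -- With the alternating sign removed, the shift `D k n` changes monotonically in `n`, at the rate
  -- of the turn `η k`.
  set D : ℕ → ℕ → ℝ := fun k n => (-1) ^ n * cross (v n) (Y k n - y n) with hD
  have hpm : ∀ n : ℕ, ((-1 : ℝ) ^ n) * (-1) ^ n = 1 := fun n => by rw [← mul_pow]; norm_num
  have hstep : ∀ (k n : ℕ), n < k → P.StepAt (Y k) (V k) E n := fun k n hn =>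
    hst k n (by omega) (by omega)
  have hsep : ∀ k n : ℕ, n ≤ k → cross (v n) (V k n) = (-1) ^ n * η k ∧
      D k n = D k 0 + η k * ∑ i ∈ Finset.range n, dist (Y k i) (Y k (i + 1 : ℕ)) := by
    intro k n hn
    have s := separation (n := n) (e := fun i : ℕ => E i) (p := fun i : ℕ => y i)
      (v := fun i : ℕ => v i) (q := fun i : ℕ => Y k i) (u := fun i : ℕ => V k i)
      (fun i _ => by simpa using hy.limitStep_nat i)
      (fun i hi => by simpa [StepAt] using (hstep k i (by omega)).limitStep) le_rfl
    refine ⟨by simpa using s.1, ?_⟩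
    have := s.2.2.1
    simp only [hD, hη]
    rw [this, ← mul_assoc, hpm]
    simp
  have hdist : ∀ k n : ℕ, n < k → 0 < dist (Y k n) (Y k (n + 1 : ℕ)) := fun k n hn => by
    obtain ⟨t, ht, h⟩ := (hstep k n hn).exists_pos
    push_cast
    rw [h, dist_self_add_right, norm_smul, (hstep k n hn).unit, mul_one,
      Real.norm_of_nonneg ht.le]
    exact ht
  have hmono : ∀ k n : ℕ, n < k → D k (n + 1) = D k n + η k * dist (Y k n) (Y k (n + 1 : ℕ)) := by
    intro k n hn
    rw [(hsep k n hn.le).2, (hsep k (n + 1) hn).2, Finset.sum_range_succ]; ring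
  -- a frequent sign at both ends of a leg
  have side : ∀ (σ : ℝ) (n : ℕ), (∃ᶠ k in atTop, n < k ∧ 0 < σ * D k n ∧ 0 < σ * D k (n + 1)) →
      P.SideStep ((-1) ^ n * σ) (E n) (E (n + 1)) (y n) (v n) (y (n + 1)) := by
    intro σ n h
    obtain ⟨φ, hφ, hall⟩ := extraction_of_frequently_atTop h
    have l1 := hlim n (by omega)
    have l2 := hlim (n + 1) (by omega)
    refine ⟨fun k => Y (φ k) n, fun k => V (φ k) n, fun k => Y (φ k) (n + 1),
      fun k => V (φ k) (n + 1), fun k => hstep _ _ (hall k).1, l1.1.comp hφ.tendsto_atTop,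
      l1.2.comp hφ.tendsto_atTop, l2.1.comp hφ.tendsto_atTop, fun k => ?_⟩
    obtain ⟨h1, h2, h3⟩ := hall k
    have hl := hy.limitStep (n := n) (by omega)
    have e1 : (-1 : ℝ) ^ (n + 1) * cross (v (n + 1)) (Y (φ k) (n + 1) - y (n + 1)) =
        (-1) ^ n * cross (v n) (Y (φ k) (n + 1) - y n) := by
      have st := hstep _ _ h1
      rw [hl.optical, P.cross_reflect_sub (P.height_eq_zero' st.arr) (P.height_eq_zero hl.arr)]
      conv_lhs => rw [hl.eq]
      rw [← sub_sub, cross_sub_right _ _ (_ • _), cross_smul_right, cross_self_eq]; ring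
    simp only [hD] at h2 h3
    push_cast at h3
    rw [e1] at h3
    constructor <;> nlinarith
  -- A shift with sign `τ`, combined with a turn that does not oppose it, keeps its sign from the
  -- index `n₀` on.
  have mirror : ∀ τ : ℝ, (τ = 1 ∨ τ = -1) → (∃ n₀ : ℕ, ∃ᶠ k in atTop, 0 ≤ τ * η k ∧
      0 < τ * D k n₀) → ∃ (σ : ℝ) (n₀ : ℕ), ∀ n : ℕ, n₀ ≤ n →
      P.SideStep ((-1) ^ n * σ) (E n) (E (n + 1)) (y n) (v n) (y (n + 1)) := by
    rintro τ - ⟨n₀, hf⟩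
    refine ⟨τ, n₀, fun n hn => side τ n ?_⟩
    refine (hf.and_eventually (eventually_gt_atTop n)).mono ?_
    rintro k ⟨⟨h1, h2⟩, h3⟩
    have hle : ∀ m, n₀ ≤ m → m ≤ k → 0 < τ * D k m := by
      intro m hm
      induction m, hm using Nat.le_induction with
      | base => exact fun _ => h2
      | succ m hm ih =>
        intro hk
        have := hmono k m hk
        rw [this, mul_add, ← mul_assoc]
        have := mul_nonneg h1 (hdist k m hk).le
        linarith [ih (by omega)]
    exact ⟨h3, hle n hn h3.le, hle (n + 1) (by omega) h3⟩
  by_cases c1 : ∃ n₀ : ℕ, ∃ᶠ k in atTop, 0 ≤ (1 : ℝ) * η k ∧ 0 < (1 : ℝ) * D k n₀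
  · exact Or.inr (mirror 1 (Or.inl rfl) c1)
  by_cases c2 : ∃ n₀ : ℕ, ∃ᶠ k in atTop, 0 ≤ (-1 : ℝ) * η k ∧ 0 < (-1 : ℝ) * D k n₀
  · exact Or.inr (mirror (-1) (Or.inr rfl) c2)
  push Not at c1 c2
  -- If a turn `τ` never leads to a shift of sign `τ`, the shift is nonpositive at `n + 2`; strict
  -- growth makes it negative at `n` and `n + 1`.
  have turn : ∀ τ : ℝ, (∀ n : ℕ, ∀ᶠ k in atTop, 0 ≤ τ * η k → τ * D k n ≤ 0) →
      (∃ᶠ k in atTop, 0 < τ * η k) → ∀ n : ℕ, 0 ≤ n →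
      P.SideStep ((-1) ^ n * -τ) (E n) (E (n + 1)) (y n) (v n) (y (n + 1)) := by
    intro τ h1 h2 n _
    refine side _ n ((h2.and_eventually (((h1 n).and (h1 (n + 2))).and
      (eventually_gt_atTop (n + 2)))).mono ?_)
    rintro k ⟨h3, ⟨h4, h5⟩, h6⟩
    have m1 := hmono k n (by omega)
    have m2 := hmono k (n + 1) (by omega)
    have d1 := mul_pos h3 (hdist k n (by omega))
    have d2 := mul_pos h3 (hdist k (n + 1) (by omega))
    have := h5 h3.le
    rw [show n + 2 = n + 1 + 1 from rfl, m2] at this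
    refine ⟨by omega, ?_, ?_⟩
    · rw [m1] at this; nlinarith
    · nlinarith
  by_cases c3 : ∃ᶠ k in atTop, 0 < (1 : ℝ) * η k
  · exact Or.inr ⟨-1, 0, turn 1 (fun n => (c1 n).mono fun k hk h => hk h) c3⟩
  by_cases c4 : ∃ᶠ k in atTop, 0 < (-1 : ℝ) * η k
  · exact Or.inr ⟨- -1, 0, turn (-1) (fun n => (c2 n).mono fun k hk h => hk h) c4⟩
  rw [not_frequently] at c3 c4
  -- In the remaining case turns and shifts vanish for each fixed index, so the approximations lie
  -- on the ideal trajectory itself.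
  left
  intro n
  have hz : ∀ m : ℕ, ∀ᶠ k in atTop, η k = 0 ∧ D k m = 0 := fun m => by
    filter_upwards [c3, c4, c1 m, c2 m] with k k1 k2 k3 k4
    have h0 : η k = 0 := by linarith
    have := k3 (by rw [h0, mul_zero])
    have := k4 (by rw [h0, mul_zero])
    exact ⟨h0, by linarith⟩
  have hD0 : ∀ k m : ℕ, D k m = 0 → cross (v m) (Y k m - y m) = 0 := fun k m h =>
    (mul_eq_zero.1 h).resolve_left (by positivity)
  have hsn := hs (n + 1)
  push_cast at hsn
  refine IdealFrom.step_of_frequently (Y := Y) (V := V) (Eventually.frequently ?_) (hs n) hsn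
    (hy.limitStep (by omega)) (hlim n (by omega)).2
  filter_upwards [hz n, hz (n + 1), eventually_gt_atTop n] with k k1 k2 k3
  refine ⟨hstep k n k3, ?_, hD0 _ _ k1.2, ?_⟩
  · rw [(hsep k n k3.le).1, k1.1, mul_zero]
  · have := hD0 _ _ k2.2
    push_cast at this
    exact this

/-- Two passages of an ideal trajectory in the same state have the same future. -/
theorem IdealFrom.code_eq_of_state_eq {y v : ℤ → BilliardPlane} {E : ℤ → ι}
    (hy : P.IdealFrom 0 y v E) (hs : ∀ n : ℕ, P.slope (E n) (v n) ≠ 0) {i j n₀ : ℕ} {σ : ℝ}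
    (hside : (∀ n : ℕ, P.StepAt y v E n) ∨ ∀ n : ℕ, n₀ ≤ n →
      P.SideStep ((-1) ^ n * σ) (E n) (E (n + 1)) (y n) (v n) (y (n + 1)))
    (hi : n₀ ≤ i) (hj : n₀ ≤ j) (hpar : (-1 : ℝ) ^ i = (-1) ^ j) (hE : E i = E j) (hv : v i = v j)
    (hyy : y i = y j) (m : ℕ) : E (i + m) = E (j + m) ∧ v (i + m) = v (j + m) ∧
      y (i + m) = y (j + m) := by
  induction m with
  | zero => simpa using ⟨hE, hv, hyy⟩
  | succ m ih =>
    obtain ⟨h1, h2, h3⟩ := ih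
    have l1 := hy.limitStep (n := i + m) (by omega)
    have l2 := hy.limitStep (n := j + m) (by omega)
    have s1 := hs (i + m)
    have s1' := hs (i + m + 1)
    have s2' := hs (j + m + 1)
    push_cast at s1 s1' s2'
    push_cast
    rw [← add_assoc, ← add_assoc]
    have hslope : ∀ {e : ι} {u w : BilliardPlane}, w = P.reflect e u → P.slope e w ≠ 0 →
        P.slope e u ≠ 0 := by
      rintro e u w rfl h h'
      exact h (by rw [slope_reflect, h', neg_zero])
    have a1 := hslope l1.optical s1'
    have a2 := hslope l2.optical s2'
    suffices hEq : E (i + m + 1) = E (j + m + 1) by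
      have hv' : v (i + m + 1) = v (j + m + 1) := by rw [l1.optical, l2.optical, hEq, h2]
      refine ⟨hEq, hv', ?_⟩
      have b1 := P.height_eq_zero l1.arr
      have b2 := P.height_eq_zero l2.arr
      rw [← hEq] at b2
      refine eq_of_height_eq_zero a1 b1 b2 ?_
      rw [l1.eq, l2.eq, ← h2, ← h3]
      simp only [cross_sub_right, cross_add_right, cross_smul_right, cross_self_eq]
      ring
    rcases hside with hside | hside
    · have r1 := hside (i + m)
      have r2 := hside (j + m)
      simp only [StepAt] at r1 r2
      push_cast at r1 r2
      rw [← h2, ← h3] at r2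
      exact (r1.next_unique r2).2
    · have r1 := hside (i + m) (by omega)
      have r2 := hside (j + m) (by omega)
      rw [pow_add] at r1 r2
      rw [← hpar] at r2
      push_cast at r1 r2
      rw [← h1, ← h2, ← h3] at r2
      rw [← h2] at a2
      set τ := (-1 : ℝ) ^ i * (-1) ^ m * σ
      have t1 := (r1.sideFree s1 a1)
      have t2 := (r2.sideFree s1 a2)
      -- A point slightly to the common free side, with direction exactly `v`, makes a step for both
      -- passages. Determinism gives the same next edge; equality of parities ensures that the free
      -- sides coincide.
      obtain ⟨r, V, r', w, hst, hr, -, -, hdev⟩ := id r1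
      have hr' : Tendsto (fun k => (r k, v (i + m))) atTop (𝓝 (y (i + m), v (i + m))) :=
        hr.prodMk_nhds tendsto_const_nhds
      obtain ⟨k, k1, k2⟩ := ((hr'.eventually t1).and (hr'.eventually t2)).exists
      have c : 0 ≤ τ * cross (v (i + m)) (v (i + m)) := by rw [cross_self_eq, mul_zero]
      have k1 := k1 l1.unit (P.height_eq_zero' (hst k).dep) (hdev k).1 c
      have k2 := k2 l1.unit (P.height_eq_zero' (hst k).dep) (hdev k).1 c
      exact (k1.next_unique k2).2

/-- A passage strictly inside the strip between two ideal trajectories with the same code has the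
same future as they have. -/
theorem IdealFrom.code_eq_of_shift {y v z : ℤ → BilliardPlane} {E : ℤ → ι} {a : ℤ}
    (hy : P.IdealFrom a y v E) (hz : P.IdealFrom a z v E) {i j : ℤ} (hi : a ≤ i) (hj : a ≤ j)
    {σ : ℝ} (hE : E i = E j) (hv : v i = v j) (h1 : 0 < σ * cross (v i) (y j - y i))
    (h2 : σ * cross (v i) (y j - y i) < σ * cross (v i) (z i - y i))
    (h3 : 0 < σ * cross (v i) (z j - z i)) (m : ℕ) : E (i + m) = E (j + m) := by
  have hcong : ∀ m : ℕ, (∀ k ≤ m, E (i + k) = E (j + k)) → ∀ {x : ℤ → BilliardPlane},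
      P.IdealFrom a x v E → ∀ k < m,
      P.LimitStep (E (i + k)) (E (i + (k + 1 : ℕ))) (x (j + k)) (v (j + k))
          (x (j + (k + 1 : ℕ))) (v (j + (k + 1 : ℕ))) := by
    intro m hm x hx k hk
    rw [hm k hk.le, hm (k + 1) hk]
    exact (hx.mono hj).limitStep_nat k
  suffices h : ∀ k ≤ m, E (i + k) = E (j + k) from h m le_rfl
  induction m with
  | zero => intro k hk; obtain rfl : k = 0 := by omega
            simpa using hE
  | succ m ih =>
    intro k hk
    rcases Nat.lt_or_ge k (m + 1) with h | h
    · exact ih k (by omega)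
    obtain rfl : k = m + 1 := by omega
    have s1 := separation (n := m) (e := fun k => E (i + k))
      (fun k _ => (hy.mono hi).limitStep_nat k) (hcong m ih hy) le_rfl
    have s2 := separation (n := m) (e := fun k => E (i + k))
      (fun k _ => (hz.mono hi).limitStep_nat k) (hcong m ih hz) le_rfl
    have s3 := separation (n := m) (e := fun k => E (i + k))
      (fun k _ => (hy.mono hi).limitStep_nat k) (fun k _ => (hz.mono hi).limitStep_nat k) le_rfl
    simp only [Nat.cast_zero, add_zero, ← hv, cross_self_eq, zero_mul, mul_zero,
      real_inner_self_eq_norm_sq, (hy.limitStep hi).unit] at s1 s2 s3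
    have hvm : v (j + m) = v (i + m) := by
      have u1 := (hy.limitStep (n := i + m) (by omega)).unit
      refine eq_of_cross_eq_of_inner_eq u1 ?_ ?_
      · rw [s1.1, cross_self_eq]
      · rw [s1.2.1, real_inner_self_eq_norm_sq, u1]
    have hpm : ((-1 : ℝ) ^ m) * (-1) ^ m = 1 := by rw [← mul_pow]; norm_num
    have hτ : ∀ x r, x = (-1) ^ m * r → ((-1) ^ m * σ) * x = σ * r := fun x r h => by
      rw [h]; linear_combination (σ * r) * hpm
    have t1 := hτ _ _ s1.2.2.1
    have t2 := hτ _ _ s2.2.2.1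
    have t3 := hτ _ _ s3.2.2.1
    have c1 := (hy (i + m + 1)).closureStep (n := i + m) (by omega) (by omega)
    have c3 := (hz (i + m + 1)).closureStep (n := i + m) (by omega) (by omega)
    have c2 := (hy (j + m + 1)).closureStep (n := j + m) (by omega) (by omega)
    have c4 := (hz (j + m + 1)).closureStep (n := j + m) (by omega) (by omega)
    have ly := (hy.limitStep (n := j + m) (by omega)).eq
    have lz := (hz.limitStep (n := j + m) (by omega)).eq
    rw [← ih m le_rfl] at c2 c4
    rw [hvm] at ly lz
    have g : ∀ (x x' w : BilliardPlane) (d : ℝ), x' = x + d • v (i + m) →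
        cross (v (i + m)) (x' - w) = cross (v (i + m)) (x - w) := fun x x' w d h => by
      rw [h, add_sub_right_comm, cross_add_right, cross_smul_right, cross_self_eq]; ring
    have t4 : ((-1) ^ m * σ) * cross (v (i + m)) (z (j + m) - y (i + m)) =
        σ * cross (v i) (z j - z i) + σ * cross (v i) (z i - y i) := by
      rw [← t2, ← t3, ← sub_add_sub_cancel _ (z (i + m)), cross_add_right]; ring
    -- The pair at `i` bounds the strip, the passage of `y` from `j` is inside it, and that of `z`
    -- from `j` is beyond it.
    have := c1.end_eq c3 c2 c4 (σ := (-1) ^ m * σ) (by rw [t1]; exact h1)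
      (by rw [g _ _ _ _ ly, t1]; exact h1) (by rw [t1, t3]; exact h2)
      (by rw [g _ _ _ _ ly, t1, t3]; exact h2) (by rw [g _ _ _ _ lz, t3, t4]; linarith)
    push_cast
    rw [← add_assoc, ← add_assoc]; exact this

end PolygonTable

/-! ### An aperiodic code determines its line. -/

namespace PolygonTable
variable {ι : Type*} {P : PolygonTable ι} [Finite ι]

/-- Every finite part of `e'` occurs infinitely often in the future of `E`. -/
def RecurrentSubCode (e' E : ℤ → ι) : Prop :=
  ∀ L N : ℕ, ∃ c : ℕ, N ≤ c ∧ ∀ n, -(L : ℤ) ≤ n → n ≤ L → e' n = E (c + n)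

theorem SubCode.recurrent {e'' e' E : ℤ → ι} (h : SubCode e'' e') (h' : RecurrentSubCode e' E) :
    RecurrentSubCode e'' E := by
  intro L N
  obtain ⟨c, hc⟩ := h L
  obtain ⟨c', hN, hc'⟩ := h' (L + c.natAbs) (N + c.natAbs)
  refine ⟨(c' + c).toNat, by omega, fun n h1 h2 => ?_⟩
  rw [hc n h1 h2, hc' _ (by omega) (by omega), Int.toNat_of_nonneg (by omega), add_assoc]

theorem IdealFrom.shift {y v : ℤ → BilliardPlane} {e : ℤ → ι} {a c : ℤ} (h : P.IdealFrom a y v e)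
    {b b' : ℤ} (hc : a ≤ c + b) :
    P.Approx (fun n => y (c + n)) (fun n => v (c + n)) (fun n => e (c + n)) b b' :=
  (h.mono hc _).shift c

theorem IdealFrom.width {y v z : ℤ → BilliardPlane} {e : ℤ → ι} {a : ℤ} (hy : P.IdealFrom a y v e)
    (hz : P.IdealFrom a z v e) (j : ℕ) :
    cross (v (a + j)) (z (a + j) - y (a + j)) = (-1) ^ j * cross (v a) (z a - y a) := by
  have := (separation (n := j) (e := fun k => e (a + k))
    (fun k _ => hy.limitStep_nat k) (fun k _ => hz.limitStep_nat k) le_rfl).2.2.1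
  simpa [cross_self_eq] using this

/-- The limits of a pair of ideal trajectories. -/
theorem IdealFrom.exists_limit {y v z : ℤ → BilliardPlane} {E : ℤ → ι} (hy : P.IdealFrom 0 y v E)
    (hz : P.IdealFrom 0 z v E) : ∃ y' v' z' e', P.Ideal y' v' e' ∧ P.Ideal z' v' e' ∧
      RecurrentSubCode e' E ∧ cross (v' 0) (z' 0 - y' 0) = cross (v 0) (z 0 - y 0) := by
  obtain ⟨φ, hφ, y', v', z', e', hy', hz', hlim⟩ := exists_limit_pair (P := P)
    (Y := fun k n => y (2 * k + n)) (V := fun k n => v (2 * k + n))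
    (Z := fun k n => z (2 * k + n)) (U := fun k n => v (2 * k + n))
    (C := fun k n => E (2 * k + n)) (fun L => by
      filter_upwards [eventually_ge_atTop L] with k hk
      exact ⟨hy.shift (by omega), hz.shift (by omega)⟩)
  refine ⟨y', v', z', e', hy', hz', fun L N => ?_, ?_⟩
  · have : ∀ᶠ k in atTop, ∀ n ∈ Finset.Icc (-L : ℤ) L, E (2 * (φ k : ℕ) + n) = e' n := by
      rw [eventually_all_finset]
      exact fun n _ => (hlim n).2.2.2.2
    obtain ⟨k, hk, hN⟩ := (this.and (hφ.tendsto_atTop.eventually_ge_atTop N)).exists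
    exact ⟨2 * φ k, by omega, fun n h1 h2 => by
      rw [← hk n (Finset.mem_Icc.2 ⟨h1, h2⟩)]; push_cast; rfl⟩
  · obtain ⟨l1, l2, l3, -, -⟩ := hlim 0
    refine tendsto_nhds_unique (l2.cross (l3.sub l1)) (tendsto_const_nhds.congr fun k => ?_)
    have := hy.width hz (2 * φ k)
    rw [Even.neg_one_pow (even_two_mul _), one_mul, zero_add] at this
    push_cast at this
    rw [add_zero, this]

/-- In a pair of ideal trajectories of positive width, there are passages in parallel positions
that are close to each other. -/
theorem IdealFrom.exists_return {y v z : ℤ → BilliardPlane} {E : ℤ → ι}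
    (hy : P.IdealFrom 0 y v E) (hz : P.IdealFrom 0 z v E) (hw : cross (v 0) (z 0 - y 0) ≠ 0)
    {ε : ℝ} (hε : 0 < ε) (N : ℕ) : ∃ i m : ℕ, N ≤ i ∧ 0 < m ∧ Even m ∧ E i = E (i + m) ∧
      v i = v (i + m) ∧ |cross (v i) (y (i + m) - y i)| < ε := by
  obtain ⟨D, hD, hdiam⟩ := P.exists_diameter
  -- The supremum is taken over all pairs whose code recurs in the future of `E`. This class is
  -- closed under passing to a `SubCode`, so the supremum bounds all limits that occur in the drift
  -- argument.
  set 𝒲 : Set ℝ := {w | ∃ y' v' z' e', P.Ideal y' v' e' ∧ P.Ideal z' v' e' ∧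
      RecurrentSubCode e' E ∧ w = |cross (v' 0) (z' 0 - y' 0)|} with h𝒲
  have hbdd : BddAbove 𝒲 := by
    refine ⟨D, ?_⟩
    rintro w ⟨y', v', z', e', h1, h2, -, rfl⟩
    have := abs_cross_le (v' 0) (z' 0 - y' 0)
    rw [(h1.limitStep 0).unit, one_mul] at this
    exact this.trans (hdiam _ (h2.limitStep 0).dep_mem_carrier _ (h1.limitStep 0).dep_mem_carrier)
  obtain ⟨y₀, v₀, z₀, e₀, g1, g2, g3, g4⟩ := hy.exists_limit hz
  have hmem : |cross (v 0) (z 0 - y 0)| ∈ 𝒲 := ⟨y₀, v₀, z₀, e₀, g1, g2, g3, by rw [g4]⟩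
  have hpos : 0 < sSup 𝒲 := (abs_pos.2 hw).trans_le (le_csSup hbdd hmem)
  obtain ⟨w, ⟨y', v', z', e', hy', hz', hrec, rfl⟩, hlt⟩ :=
    -- A width above `16 / 17` of the supremum makes the supremum less than `17 / 16`, hence less
    -- than `9 / 8`, of that width.
    exists_lt_of_lt_csSup ⟨_, hmem⟩ (show sSup 𝒲 * (16 / 17) < sSup 𝒲 by linarith)
  obtain ⟨a, b, hab, hev, he, hv, hsm⟩ := hy'.exists_parallel hz' (M := sSup 𝒲) (ε := ε)
    (fun h0 => by rw [h0, abs_zero] at hlt; linarith) (by linarith)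
    (fun y'' v'' z'' e'' h1 h2 h3 => le_csSup hbdd ⟨y'', v'', z'', e'', h1, h2, h3.recurrent hrec, rfl⟩)
    hε
  choose c hcN hc using fun L : ℕ => hrec L (L + N)
  have hcong : ∀ (L : ℕ) {x : ℤ → BilliardPlane}, P.IdealFrom 0 x v E →
      P.Approx (fun n => x (c L + n)) (fun n => v (c L + n)) e' (-L) L := fun L x hx =>
    (hx.shift (c := c L) (b := -L) (b' := L) (by have := hcN L; omega)).congr
      fun n h1 h2 => (hc L n h1 h2).symm
  obtain ⟨φ, hφ, p, u, q, f, hp, hq, hlim⟩ := exists_limit_pair (P := P)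
    (Y := fun L n => y (c L + n)) (V := fun L n => v (c L + n))
    (Z := fun L n => z (c L + n)) (U := fun L n => v (c L + n))
    (C := fun L n => e' n) (fun L => by
      filter_upwards [eventually_ge_atTop L] with k hk
      exact ⟨(hcong k hy).mono (by omega) (by omega), (hcong k hz).mono (by omega) (by omega)⟩)
  have hfe : f = e' := funext fun n => ((hlim n).2.2.2.2).exists.choose_spec.symm
  subst hfe
  have hu : v' = u := hy'.dir_eq hp
  subst hu
  have hbd : b = a + (b - a).toNat := by omega
  set m := (b - a).toNat with hm
  have hmev : (-1 : ℝ) ^ m = 1 := Even.neg_one_pow (by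
    rw [← Int.even_coe_nat, hm, Int.toNat_of_nonneg (by omega)]; exact hev)
  -- The pairs of code `e'` have constant width at indices of equal parity, so the limit `p` of the
  -- windows of `y` returns with the same shift as `y'`.
  have hcr : cross (v' a) (p b - p a) = cross (v' a) (y' b - y' a) := by
    have := hy'.width hp a m
    rw [← hbd, hmev, one_mul, ← hv] at this
    simp only [cross_sub_right] at this ⊢
    linarith
  have hlim' : Tendsto (fun k => |cross (v (c (φ k) + a)) (y (c (φ k) + b) - y (c (φ k) + a))|)
      atTop (𝓝 |cross (v' a) (y' b - y' a)|) := by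
    rw [← hcr]
    exact ((hlim a).2.1.cross ((hlim b).1.sub (hlim a).1)).abs
  obtain ⟨k, hk, hkL⟩ := ((hlim'.eventually (gt_mem_nhds hsm)).and
    (hφ.tendsto_atTop.eventually_ge_atTop (a.natAbs + b.natAbs))).exists
  have hcN := hcN (φ k)
  have hc := hc (φ k)
  have hcong := hcong (φ k) hy
  set C := c (φ k)
  set L := φ k
  have hi : ((C + a).toNat : ℤ) = C + a := Int.toNat_of_nonneg (by omega)
  have hj : (C : ℤ) + a + m = C + b := by omega
  refine ⟨(C + a).toNat, m, by omega, by omega, by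
    rw [← Int.even_coe_nat, hm, Int.toNat_of_nonneg (by omega)]; exact hev, ?_, ?_, ?_⟩
  · rw [hi, hj, ← hc a (by omega) (by omega), ← hc b (by omega) (by omega), he]
  · rw [hi, hj]
    -- Over an even number of common bounces the angle to the trajectory `y'` is unchanged. As `v' a
    -- = v' b`, the return in `E` is exactly, not just approximately, parallel.
    have s := separation (n := m) (e := fun i => f (a + i))
      (fun i _ => (hy'.idealFrom a).limitStep_nat i)
      (fun i hi => (hcong.mono (a' := a) (b' := b) (by omega) (by omega)).limitStep_nat
        (k := i) (by omega)) le_rfl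
    simp only [Nat.cast_zero, add_zero, ← hbd, ← hv, hmev, one_mul] at s
    exact (eq_of_cross_eq_of_inner_eq (hy'.limitStep a).unit s.1 s.2.1).symm
  · rw [hi, hj]; exact hk

theorem Approx.congr_points {y v y' v' : ℤ → BilliardPlane} {e : ℤ → ι} {a b : ℤ}
    (h : P.Approx y v e a b) (hy : ∀ n, a ≤ n → n ≤ b → y n = y' n)
    (hv : ∀ n, a ≤ n → n ≤ b → v n = v' n) : P.Approx y' v' e a b := by
  intro ε hε
  obtain ⟨Y, V, h1, h2⟩ := h ε hε
  exact ⟨Y, V, h1, fun n hn hn' => by rw [← hy n hn hn', ← hv n hn hn']; exact h2 n hn hn'⟩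

theorem slope_ne_zero_of_cross_ne_zero {e : ι} {v x y : BilliardPlane} (hx : P.height e x = 0)
    (hy : P.height e y = 0) (h : cross v (x - y) ≠ 0) : P.slope e v ≠ 0 :=
  fun h0 => h (cross_eq_zero_of_slope_eq_zero h0 hx hy)

/-- An aperiodic code determines the line of the trajectory. -/
theorem IdealFrom.cross_eq_zero {y v z u : ℤ → BilliardPlane} {E : ℤ → ι}
    (hE : IsAperiodic fun n : ℕ => E n) (hy : P.IdealFrom 0 y v E) (hz : P.IdealFrom 0 z u E) :
    cross (v 0) (z 0 - y 0) = 0 := by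
  by_contra hw
  have hvu : ∀ n, 0 ≤ n → u n = v n := fun n hn => (hy.dir_eq hz (fun _ _ => rfl) hn).symm
  replace hz : P.IdealFrom 0 z v E := fun b => (hz b).congr_points (fun _ _ _ => rfl)
    fun n hn _ => hvu n hn
  have hwn : ∀ n : ℕ, cross (v n) (z n - y n) = (-1) ^ n * cross (v 0) (z 0 - y 0) := fun n => by
    simpa using hy.width hz n
  -- A positive width excludes motion along an edge: both points of the pair would then lie on one
  -- line.
  have hslope : ∀ n : ℕ, P.slope (E n) (v n) ≠ 0 := fun n => by
    refine slope_ne_zero_of_cross_ne_zero (P.height_eq_zero (hz.limitStep (n := n) (by omega)).dep)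
      (P.height_eq_zero (hy.limitStep (n := n) (by omega)).dep) ?_
    rw [hwn]
    exact mul_ne_zero (by positivity) hw
  have hper : ∀ i m : ℕ, 0 < m → (∀ k : ℕ, E ((i : ℤ) + k) = E ((i : ℤ) + m + k)) → False := by
    intro i m hm h
    refine hE ⟨i, m, hm, fun n hn => ?_⟩
    have := h (n - i)
    rw [show ((i : ℤ) + (n - i : ℕ)) = n by omega,
      show ((i : ℤ) + m + (n - i : ℕ)) = (n + m : ℕ) by push_cast; omega] at this
    exact this.symm
  have hside := hy.one_sided hslope
  obtain ⟨n₀, σ₀, hside⟩ : ∃ (n₀ : ℕ) (σ : ℝ), (∀ n : ℕ, P.StepAt y v E n) ∨ ∀ n : ℕ, n₀ ≤ n →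
      P.SideStep ((-1) ^ n * σ) (E n) (E (n + 1)) (y n) (v n) (y (n + 1)) := by
    rcases hside with h | ⟨σ, n₀, h⟩
    · exact ⟨0, 0, Or.inl h⟩
    · exact ⟨n₀, σ, Or.inr h⟩
  obtain ⟨i, m, hi, hm, hev, h1, h2, h3⟩ := hy.exists_return hz hw (abs_pos.2 hw) n₀
  have hmev : (-1 : ℝ) ^ m = 1 := hev.neg_one_pow
  have hwi := hwn i
  have hwj := hwn (i + m)
  rw [pow_add, hmev, mul_one, ← hwi] at hwj
  push_cast at hwj
  rw [← h2] at hwj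
  have hwabs : |cross (v i) (z i - y i)| = |cross (v 0) (z 0 - y 0)| := by
    rw [hwi, abs_mul, abs_pow, abs_neg, abs_one, one_pow, one_mul]
  rw [← hwabs] at h3
  have hzy : cross (v i) (z (i + m) - z i) = cross (v i) (y (i + m) - y i) := by
    simp only [cross_sub_right] at hwj ⊢; linarith
  have hflip : cross (v i) (y i - z i) = -cross (v i) (z i - y i) := by
    rw [← neg_sub, cross_neg_right]
  set s := cross (v i) (y (i + m) - y i)
  set ω := cross (v i) (z i - y i)
  have key : ∀ {p q : ℤ → BilliardPlane} (hp : P.IdealFrom 0 p v E) (hq : P.IdealFrom 0 q v E)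
      (σ : ℝ), cross (v i) (p (i + m) - p i) = s → cross (v i) (q (i + m) - q i) = s →
      0 < σ * s → σ * s < σ * cross (v i) (q i - p i) → False := by
    intro p q hp hq σ e1 e2 e3 e4
    exact hper i m hm fun k => hp.code_eq_of_shift hq (i := i) (j := i + m) (σ := σ) (by omega)
      (by omega) h1 h2 (by rw [e1]; exact e3) (by rw [e1]; exact e4) (by rw [e2]; exact e3) k
  -- The shift `s` is smaller than the width `ω`. If its sign is that of `ω`, the passage of `y` is
  -- inside the strip; if opposite, that of `z` is; if `s = 0`, the state repeats.
  rcases lt_trichotomy s 0 with hs | hs | hs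
  · rw [abs_of_neg hs] at h3
    rcases abs_cases ω with hω | hω
    · exact key hz hy (-1) hzy rfl (by linarith) (by rw [hflip]; linarith)
    · exact key hy hz (-1) rfl hzy (by linarith) (by change _ < -1 * ω; linarith)
  · have hyy : y i = y (i + m) := by
      have a1 := P.height_eq_zero (hy.limitStep (n := i) (by omega)).dep
      have a2 := P.height_eq_zero (hy.limitStep (n := i + m) (by omega)).dep
      rw [← h1] at a2
      exact (eq_of_height_eq_zero (hslope i) a2 a1 hs).symm
    refine hper i m hm fun k => ?_
    have := (hy.code_eq_of_state_eq hslope hside hi (j := i + m) (by omega)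
      (by rw [pow_add, hmev, mul_one]) (by push_cast; exact h1) (by push_cast; exact h2)
      (by push_cast; exact hyy) k).1
    push_cast at this
    exact this
  · rw [abs_of_pos hs] at h3
    rcases abs_cases ω with hω | hω
    · exact key hy hz 1 rfl hzy (by linarith) (by change _ < 1 * ω; linarith)
    · exact key hz hy 1 hzy rfl (by linarith) (by rw [hflip]; linarith)

end PolygonTable

/-! ### Existence and stability of legs and finite paths. -/

namespace PolygonTable
variable {ι : Type*} {P : PolygonTable ι} [Finite ι]

/-- A ray which points into the polygon meets the boundary. -/
theorem PointsInto.exists_leg {p u : BilliardPlane} (h : P.PointsInto p u) (hu : ‖u‖ = 1) :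
    ∃ x e, P.IsLeg p x u ∧ x ∈ P.edge e := by
  obtain ⟨ε, hε, hi⟩ := h
  have hray : Continuous fun t : ℝ => p + t • u := by fun_prop
  set S : Set ℝ := {t | ε / 2 ≤ t ∧ p + t • u ∉ interior P.carrier} with hS
  have hSc : IsClosed S :=
    isClosed_Ici.inter ((isOpen_interior.preimage hray).isClosed_compl)
  have hSn : S.Nonempty := by
    obtain ⟨C, hC⟩ := P.isCompact_carrier.isBounded.exists_norm_le
    refine ⟨max (ε / 2) (‖p‖ + C + 1), le_max_left _ _, fun h => ?_⟩
    have h1 := hC _ (interior_subset h)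
    set t := max (ε / 2) (‖p‖ + C + 1)
    have ht : ‖p‖ + C + 1 ≤ t := le_max_right _ _
    have ht0 : 0 ≤ t := le_trans (by positivity) (le_max_left (ε / 2) _)
    have h2 := norm_sub_le (p + t • u) p
    rw [add_sub_cancel_left, norm_smul, hu, mul_one, Real.norm_of_nonneg ht0] at h2
    linarith
  have hSb : BddBelow S := ⟨ε / 2, fun t ht => ht.1⟩
  set T := sInf S
  have hT : T ∈ S := hSc.csInf_mem hSn hSb
  have hT0 : 0 < T := (half_pos hε).trans_le hT.1
  have hlt : ∀ t, 0 < t → t < T → p + t • u ∈ interior P.carrier := fun t h0 h1 => by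
    rcases lt_or_ge t (ε / 2) with h | h
    · exact hi t h0 (by linarith)
    · by_contra hcon
      exact absurd (csInf_le hSb ⟨h, hcon⟩) (not_le.2 h1)
  have hcar : p + T • u ∈ P.carrier := by
    refine P.isClosed_carrier.mem_of_tendsto
      ((hray.tendsto T).mono_left (nhdsWithin_le_nhds (s := Set.Iio T))) ?_
    have h0 : ∀ᶠ t : ℝ in 𝓝[<] T, 0 < t := nhdsWithin_le_nhds (lt_mem_nhds hT0)
    filter_upwards [h0, self_mem_nhdsWithin] with t h1 h2
    exact interior_subset (hlt t h1 h2)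
  obtain ⟨e, he⟩ := P.exists_mem_edge hcar hT.2
  refine ⟨_, e, ⟨⟨T, hT0, rfl⟩, fun x hx => ?_⟩, he⟩
  obtain ⟨s, h0, h1, rfl⟩ := (mem_openSegment_iff_ray hT0).1 hx
  exact hlt s h0 h1

/-- Legs which end inside an edge are stable. -/
theorem IsLeg.eventually {x x' v : BilliardPlane} {e' : ι} (h : P.IsLeg x x' v)
    (hx' : x' ∈ P.edgeInterior e') (hs : P.slope e' v < 0)
    {l : Filter (BilliardPlane × BilliardPlane)} (hl : l ≤ 𝓝 (x, v))
    (hstart : ∃ ρ > 0, ∀ᶠ q in l, ∀ τ : ℝ, 0 < τ → τ < ρ →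
      q.1 + τ • q.2 ∈ interior P.carrier) :
    ∀ᶠ q in l, P.IsLeg q.1 (P.hit e' q.1 q.2) q.2 ∧ P.hit e' q.1 q.2 ∈ P.edgeInterior e' := by
  obtain ⟨⟨t, ht, rfl⟩, hin⟩ := h
  obtain ⟨ρ, hρ, hstart⟩ := hstart
  obtain ⟨ε, hε, hball⟩ := P.exists_ball_height hx'
  have hF : Continuous fun q : (BilliardPlane × BilliardPlane) × ℝ => q.1.1 + q.2 • q.1.2 := by
    fun_prop
  have hhit : Tendsto (fun q : BilliardPlane × BilliardPlane => P.hit e' q.1 q.2) (𝓝 (x, v))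
      (𝓝 (x + t • v)) := by
    have := (continuousAt_hit (P := P) (x := x) hs.ne).tendsto
    rwa [hit_eq hs.ne (P.height_eq_zero' hx')] at this
    rw [add_sub_cancel_left, cross_smul_right, cross_self_eq, mul_zero]
  have E1 : ∀ᶠ q in 𝓝 (((x, v), t) : (BilliardPlane × BilliardPlane) × ℝ),
      q.1.1 + q.2 • q.1.2 ∈ Metric.ball (x + t • v) ε :=
    (hF.tendsto ((x, v), t)).eventually (Metric.ball_mem_nhds _ hε)
  rw [nhds_prod_eq, eventually_prod_iff] at E1
  obtain ⟨pa, hpa, pb, hpb, hpab⟩ := E1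
  obtain ⟨κ, hκ, hpb⟩ := Metric.eventually_nhds_iff.1 hpb
  -- A perturbed leg is checked in three ranges: the start by `hstart`, this compact middle by
  -- openness of the interior, and the end by the inner half disc at the arrival point.
  have E2 : ∀ᶠ q in 𝓝 (x, v), ∀ τ ∈ Set.Icc (min ρ t / 2) (t - κ / 2),
      q.1 + τ • q.2 ∈ interior P.carrier := by
    refine isCompact_Icc.eventually_forall_of_forall_eventually fun τ hτ => ?_
    refine (hF.tendsto ((x, v), τ)).eventually (isOpen_interior.mem_nhds (hin ?_))
    refine (mem_openSegment_iff_ray ht).2 ⟨τ, ?_, by linarith [hτ.2], rfl⟩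
    exact lt_of_lt_of_le (by positivity) hτ.1
  have E3 : ∀ᶠ q : BilliardPlane × BilliardPlane in 𝓝 (x, v), P.slope e' q.2 < 0 :=
    (((P.continuous_slope e').tendsto v).comp (continuous_snd.tendsto (x, v))).eventually
      (gt_mem_nhds hs)
  have ht' : -P.height e' x / P.slope e' v = t := by
    have := P.height_eq_zero' hx'
    rw [height_add, slope_smul] at this
    rw [div_eq_iff hs.ne]; linarith
  have E4 : Tendsto (fun q : BilliardPlane × BilliardPlane => -P.height e' q.1 / P.slope e' q.2)
      (𝓝 (x, v)) (𝓝 t) := by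
    have := ((((P.continuous_height e').tendsto x).comp (continuous_fst.tendsto (x, v))).neg).div
      (((P.continuous_slope e').tendsto v).comp (continuous_snd.tendsto (x, v))) hs.ne
    rwa [ht'] at this
  have E5 := hhit.eventually (P.eventually_mem_edgeInterior hx')
  filter_upwards [hstart, hl hpa, hl E2, hl E3, hl (E4.eventually (lt_mem_nhds ht)),
    hl (E4.eventually (Metric.ball_mem_nhds t (half_pos hκ))), hl E5] with q q0 q1 q2 q3 q4 q5 q6
  have h3 := height_hit (p := q.1) q3.ne
  have q8 : P.hit e' q.1 q.2 = q.1 + (-P.height e' q.1 / P.slope e' q.2) • q.2 := by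
    unfold hit; rw [neg_div, neg_smul, sub_eq_add_neg]
  set T := -P.height e' q.1 / P.slope e' q.2 with hT
  refine ⟨⟨⟨T, q4, q8⟩, ?_⟩, q6 h3⟩
  intro z hz
  rw [q8] at hz
  obtain ⟨τ, h0, h1, rfl⟩ := (mem_openSegment_iff_ray q4).1 hz
  rw [Real.dist_eq, abs_lt] at q5
  by_cases c1 : τ < ρ
  · exact q0 τ h0 c1
  by_cases c2 : τ ≤ t - κ / 2
  · refine q2 τ ⟨?_, c2⟩
    have := min_le_left ρ t
    linarith
  · refine (hball _ (hpab q1 (hpb (y := τ) ?_))).1 ?_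
    · rw [Real.dist_eq, abs_lt]; constructor <;> linarith
    · rw [q8, height_add, slope_smul] at h3
      rw [height_add, slope_smul]
      nlinarith

/-- Steps are stable. -/
theorem Step.eventually {e e' : ι} {x v x' w : BilliardPlane} (h : P.Step e e' x v x' w) :
    ∀ᶠ q : BilliardPlane × BilliardPlane in 𝓝 (x, v), ‖q.2‖ = 1 → P.height e q.1 = 0 →
      P.Step e e' q.1 q.2 (P.hit e' q.1 q.2) (P.reflect e' q.2) := by
  have hfst : Tendsto (fun q : BilliardPlane × BilliardPlane => q.1) (𝓝 (x, v)) (𝓝 x) :=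
    continuous_fst.tendsto (x, v)
  have hsnd : Tendsto (fun q : BilliardPlane × BilliardPlane => q.2) (𝓝 (x, v)) (𝓝 v) :=
    continuous_snd.tendsto (x, v)
  obtain ⟨ε, hε, hball⟩ := P.exists_ball_height h.dep
  have hF : Continuous fun q : (BilliardPlane × BilliardPlane) × ℝ => q.1.1 + q.2 • q.1.2 := by
    fun_prop
  have E1 : ∀ᶠ q in 𝓝 (((x, v), 0) : (BilliardPlane × BilliardPlane) × ℝ),
      q.1.1 + q.2 • q.1.2 ∈ Metric.ball x ε := by
    refine (hF.tendsto ((x, v), 0)).eventually ?_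
    simp only [zero_smul, add_zero]
    exact Metric.ball_mem_nhds _ hε
  rw [nhds_prod_eq, eventually_prod_iff] at E1
  obtain ⟨pa, hpa, pb, hpb, hpab⟩ := E1
  obtain ⟨ρ, hρ, hpb⟩ := Metric.eventually_nhds_iff.1 hpb
  have E2 := (((P.continuous_slope e).tendsto v).comp hsnd).eventually (lt_mem_nhds h.slope_dep)
  have key := h.leg.eventually h.arr h.slope_arr
    (l := 𝓝 (x, v) ⊓ 𝓟 {q | P.height e q.1 = 0}) inf_le_left ⟨ρ, hρ, by
      rw [eventually_inf_principal]
      filter_upwards [hpa, E2] with q q1 q2 q3 τ h0 h1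
      refine (hball _ (hpab q1 (hpb (y := τ) ?_))).1 ?_
      · rw [Real.dist_eq, sub_zero, abs_of_pos h0]; exact h1
      · have q3' : P.height e q.1 = 0 := q3
        rw [height_add, slope_smul, q3', zero_add]
        exact mul_pos h0 q2⟩
  rw [eventually_inf_principal] at key
  filter_upwards [key, hfst.eventually (P.eventually_mem_edgeInterior h.dep)] with q q1 q2 hu h0
  obtain ⟨q3, q4⟩ := q1 h0
  exact ⟨hu, q2 h0, q4, q3, rfl⟩

variable (P) in
/-- The state after `n` steps, if the edges `e 1, e 2, …` are hit in this order. -/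
noncomputable def ghost (e : ℕ → ι) (q : BilliardPlane × BilliardPlane) :
    ℕ → BilliardPlane × BilliardPlane
  | 0 => q
  | n + 1 => (P.hit (e (n + 1)) (ghost e q n).1 (ghost e q n).2,
      P.reflect (e (n + 1)) (ghost e q n).2)

variable (P) in
/-- A finite piece of a nonsingular trajectory. -/
def Path (e : ℕ → ι) (y v : ℕ → BilliardPlane) (n : ℕ) : Prop :=
  ∀ k < n, P.Step (e k) (e (k + 1)) (y k) (v k) (y (k + 1)) (v (k + 1))

theorem norm_ghost (e : ℕ → ι) {q : BilliardPlane × BilliardPlane} (h : ‖q.2‖ = 1) (n : ℕ) :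
    ‖(P.ghost e q n).2‖ = 1 := by
  induction n with
  | zero => exact h
  | succ n ih => rw [ghost, norm_reflect, ih]

theorem tendsto_ghost {e : ℕ → ι} {y v : ℕ → BilliardPlane} {n : ℕ}
    (hl : ∀ k < n, cross (v k) (y (k + 1) - y k) = 0 ∧ P.height (e (k + 1)) (y (k + 1)) = 0 ∧
      P.slope (e (k + 1)) (v k) ≠ 0 ∧ v (k + 1) = P.reflect (e (k + 1)) (v k)) {k : ℕ}
    (hk : k ≤ n) :
    Tendsto (fun q => P.ghost e q k) (𝓝 (y 0, v 0)) (𝓝 (y k, v k)) := by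
  induction k with
  | zero => exact tendsto_id
  | succ k ih =>
    obtain ⟨h1, h2, h3, h4⟩ := hl k (by omega)
    have h := ih (by omega)
    have h5 := (continuousAt_hit (P := P) (x := y k) h3).tendsto.comp h
    rw [PolygonTable.hit_eq h3 h2 h1] at h5
    have h6 := (((P.continuous_reflect (e (k + 1))).tendsto (v k)).comp
      (continuous_snd.tendsto (y k, v k))).comp h
    rw [h4]
    exact h5.prodMk_nhds h6

theorem Path.tendsto_ghost {e : ℕ → ι} {y v : ℕ → BilliardPlane} {n : ℕ} (h : P.Path e y v n)
    {k : ℕ} (hk : k ≤ n) :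
    Tendsto (fun q => P.ghost e q k) (𝓝 (y 0, v 0)) (𝓝 (y k, v k)) := by
  refine PolygonTable.tendsto_ghost (fun k hk => ?_) hk
  have s := h k hk
  refine ⟨?_, P.height_eq_zero' s.arr, s.slope_arr.ne, s.optical⟩
  obtain ⟨t, -, h⟩ := s.exists_pos
  rw [h, add_sub_cancel_left, cross_smul_right, cross_self_eq, mul_zero]

/-- Finite pieces of trajectories are stable. -/
theorem Path.eventually {e : ℕ → ι} {y v : ℕ → BilliardPlane} {n : ℕ} (h : P.Path e y v n) :
    ∀ᶠ q : BilliardPlane × BilliardPlane in 𝓝 (y 0, v 0), ‖q.2‖ = 1 → P.height (e 0) q.1 = 0 →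
      P.Path e (fun k => (P.ghost e q k).1) (fun k => (P.ghost e q k).2) n := by
  have : ∀ᶠ q : BilliardPlane × BilliardPlane in 𝓝 (y 0, v 0), ∀ k ∈ Finset.range n,
      ‖(P.ghost e q k).2‖ = 1 → P.height (e k) (P.ghost e q k).1 = 0 →
      P.Step (e k) (e (k + 1)) (P.ghost e q k).1 (P.ghost e q k).2 (P.ghost e q (k + 1)).1
        (P.ghost e q (k + 1)).2 := by
    rw [eventually_all_finset]
    intro k hk
    rw [Finset.mem_range] at hk
    exact (h.tendsto_ghost hk.le).eventually (h k hk).eventually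
  filter_upwards [this] with q hq hu h0 k hk
  have hz : P.height (e k) (P.ghost e q k).1 = 0 := by
    cases k with
    | zero => exact h0
    | succ k =>
      have hs := (h k (by omega)).slope_arr
      have : ∀ j ≤ k, P.height (e j) (P.ghost e q j).1 = 0 := by
        intro j
        induction j with
        | zero => exact fun _ => h0
        | succ j ih =>
          intro hj
          exact P.height_eq_zero' (hq j (Finset.mem_range.2 (by omega)) (norm_ghost e hu j)
            (ih (by omega))).arr
      exact P.height_eq_zero' (hq k (Finset.mem_range.2 (by omega)) (norm_ghost e hu k)
        (this k le_rfl)).arr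
  exact hq k (Finset.mem_range.2 hk) (norm_ghost e hu k) hz

/-- Unit vectors close to a given one, on a prescribed side, outside a countable set. -/
theorem exists_unit_near {C : Set BilliardPlane} (hC : C.Countable) {w : BilliardPlane}
    (hw : ‖w‖ = 1) {σ : ℝ} (hσ : σ ≠ 0) {U : Set BilliardPlane} (hU : U ∈ 𝓝 w) :
    ∃ u ∈ U, ‖u‖ = 1 ∧ u ∉ C ∧ 0 < σ * cross w u := by
  have hw2 : w 0 ^ 2 + w 1 ^ 2 = 1 := by rw [← norm_sq_plane, hw]; norm_num
  -- Rotation of `w` by the angle `t` towards the side `σ`. It is injective for small `t`, so a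
  -- countable set is avoided.
  set f : ℝ → BilliardPlane := fun t => Real.cos t • w + (σ * Real.sin t / |σ|) • !₂[-w 1, w 0]
    with hf
  have hσa : 0 < |σ| := abs_pos.2 hσ
  have hσσ : σ ^ 2 / |σ| ^ 2 = 1 := by rw [sq_abs, div_self (by positivity)]
  have hcr : ∀ t, σ * cross w (f t) = |σ| * Real.sin t := fun t => by
    have : cross w (!₂[-w 1, w 0] : BilliardPlane) = 1 := by
      rw [← hw2]; simp [cross]; ring
    simp only [hf]
    rw [cross_add_right, cross_smul_right, cross_smul_right, cross_self_eq, this]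
    field_simp
    rw [sq_abs]; ring
  have hnorm : ∀ t, ‖f t‖ = 1 := fun t => by
    have h1 : ‖f t‖ ^ 2 = 1 := by
      rw [norm_sq_plane]
      simp only [hf, PiLp.add_apply, PiLp.smul_apply, smul_eq_mul]
      simp only [Matrix.cons_val_zero, Matrix.cons_val_one]
      have : (σ * Real.sin t / |σ|) ^ 2 = Real.sin t ^ 2 := by
        rw [div_pow, mul_pow, mul_div_right_comm, hσσ, one_mul]
      linear_combination (Real.cos t ^ 2 + (σ * Real.sin t / |σ|) ^ 2) * hw2 + this +
        Real.sin_sq_add_cos_sq t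
    exact (pow_eq_one_iff_of_nonneg (norm_nonneg _) two_ne_zero).1 h1
  have hcont : Continuous f := by
    have h1 := Real.continuous_cos
    have h2 := Real.continuous_sin
    simp only [hf]
    exact (h1.smul continuous_const).add (((continuous_const.mul h2).div_const _).smul
      continuous_const)
  have hf0 : f 0 = w := by simp [hf]
  have h1 : f ⁻¹' U ∈ 𝓝 (0 : ℝ) := hcont.continuousAt.preimage_mem_nhds (by rw [hf0]; exact hU)
  obtain ⟨δ, hδ, hball⟩ := Metric.mem_nhds_iff.1 h1
  set S := Set.Ioo 0 (min δ 1) ∩ f ⁻¹' C with hS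
  have hinj : Set.InjOn f S := by
    rintro s ⟨⟨hs0, hs1⟩, -⟩ t ⟨⟨ht0, ht1⟩, -⟩ hst
    have h2 := hcr s
    rw [hst, hcr t] at h2
    have h3 := mul_left_cancel₀ hσa.ne' h2
    have hpi := Real.pi_gt_three
    have := min_le_right δ 1
    exact (Real.injOn_sin ⟨by linarith, by linarith⟩ ⟨by linarith, by linarith⟩ h3).symm
  have hSc : S.Countable := (show Set.MapsTo f S C from fun t ht => ht.2).countable_of_injOn hinj hC
  obtain ⟨t, ht, ht'⟩ := (hSc.dense_compl ℝ).exists_mem_open (isOpen_Ioo (a := 0) (b := min δ 1))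
    (Set.nonempty_Ioo.2 (by positivity))
  have hpi := Real.pi_gt_three
  refine ⟨f t, hball ?_, hnorm t, fun h => ht ⟨ht', h⟩, ?_⟩
  · rw [Metric.mem_ball, Real.dist_eq, sub_zero, abs_of_pos ht'.1]
    exact ht'.2.trans_le (min_le_left _ _)
  · rw [hcr]
    have := ht'.2.trans_le (min_le_right _ _)
    exact mul_pos hσa (Real.sin_pos_of_pos_of_lt_pi ht'.1 (by linarith))

end PolygonTable

/-! ### Nonsingular rays and their continuation to both sides. -/

namespace PolygonTable
variable {ι : Type*} {P : PolygonTable ι} [Finite ι]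

variable (P) in
/-- The first `n` steps of a nonsingular ray from the point `p` of the edge `A`. -/
structure FinRay (A : ι) (p u : BilliardPlane) (y v : ℕ → BilliardPlane) (e : ℕ → ι) (n : ℕ) :
    Prop where
  start : y 0 = p
  direction : v 0 = u
  edge : e 0 = A
  leg : ∀ k < n, P.IsLeg (y k) (y (k + 1)) (v k)
  bounce : ∀ k < n, y (k + 1) ∈ P.edgeInterior (e (k + 1))
  optical : ∀ k < n, v (k + 1) = P.reflect (e (k + 1)) (v k)

variable (P) in
/-- A nonsingular ray from the point `p` of the edge `A`. -/
def IsRay (A : ι) (p u : BilliardPlane) (y v : ℕ → BilliardPlane) (e : ℕ → ι) : Prop :=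
  ∀ n, P.FinRay A p u y v e n

theorem FinRay.norm {A : ι} {p u : BilliardPlane} {y v : ℕ → BilliardPlane} {e : ℕ → ι} {n : ℕ}
    (h : P.FinRay A p u y v e n) (hu : ‖u‖ = 1) {k : ℕ} (hk : k ≤ n) : ‖v k‖ = 1 := by
  induction k with
  | zero => rw [h.direction, hu]
  | succ k ih => rw [h.optical k hk, norm_reflect, ih (by omega)]

theorem FinRay.limitStep {A : ι} {p u : BilliardPlane} {y v : ℕ → BilliardPlane} {e : ℕ → ι}
    {n : ℕ} (h : P.FinRay A p u y v e n) (hu : ‖u‖ = 1) (hp : p ∈ P.edge A) {k : ℕ} (hk : k < n) :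
    P.LimitStep (e k) (e (k + 1)) (y k) (v k) (y (k + 1)) (v (k + 1)) := by
  refine ⟨h.norm hu hk.le, ?_, P.edgeInterior_subset_edge _ (h.bounce k hk), ?_, h.optical k hk⟩
  · cases k with
    | zero => rw [h.start, h.edge]; exact hp
    | succ k => exact P.edgeInterior_subset_edge _ (h.bounce k (by omega))
  · obtain ⟨t, ht, h1⟩ := (h.leg k hk).1
    rw [h1, dist_self_add_right, norm_smul, h.norm hu hk.le, mul_one, Real.norm_of_nonneg ht.le]

theorem FinRay.step {A : ι} {p u : BilliardPlane} {y v : ℕ → BilliardPlane} {e : ℕ → ι}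
    {n : ℕ} (h : P.FinRay A p u y v e n) (hu : ‖u‖ = 1) {k : ℕ} (hk : k + 1 < n) :
    P.Step (e (k + 1)) (e (k + 1 + 1)) (y (k + 1)) (v (k + 1)) (y (k + 1 + 1)) (v (k + 1 + 1)) :=
  ⟨h.norm hu hk.le, h.bounce k (by omega), h.bounce _ hk, h.leg _ hk, h.optical _ hk⟩

/-- A finite ray can be prolonged unless it runs into a vertex. -/
theorem FinRay.extend {A : ι} {p u : BilliardPlane} {y v : ℕ → BilliardPlane} {e : ℕ → ι}
    {n : ℕ} (h : P.FinRay A p u y v e n) (hu : ‖u‖ = 1) (hpu : P.PointsInto p u)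
    (hv : ∀ w ∈ P.vertices, ¬ P.IsLeg (y n) w (v n)) :
    ∃ x f, P.IsLeg (y n) x (v n) ∧ x ∈ P.edgeInterior f := by
  have hin : P.PointsInto (y n) (v n) := by
    cases n with
    | zero => rw [h.start, h.direction]; exact hpu
    | succ n =>
      refine P.pointsInto_of_slope_pos (h.bounce n (by omega)) ?_
      rw [h.optical n (by omega), slope_reflect]
      have := (h.leg n (by omega)).reverse.pointsInto.slope_pos P (h.bounce n (by omega))
      rwa [slope_neg] at this
  obtain ⟨x, f, h1, h2⟩ := hin.exists_leg (h.norm hu le_rfl)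
  exact ⟨x, f, h1, P.mem_edgeInterior_of_notMem_vertices h2 fun hx => hv x hx h1⟩

/-- Prolong step by step; a subtype of reachable states records that each state comes from a finite
ray, so that the next step always exists. -/
theorem exists_isRay {A : ι} {p u : BilliardPlane} (hu : ‖u‖ = 1) (hpu : P.PointsInto p u)
    (h : ∀ y v e n, P.FinRay A p u y v e n → ∀ w ∈ P.vertices, ¬ P.IsLeg (y n) w (v n)) :
    ∃ y v e, P.IsRay A p u y v e := by
  classical
  set T := {s : BilliardPlane × BilliardPlane × ι // ∃ y v e n, P.FinRay A p u y v e n ∧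
    s = (y n, v n, e n)} with hT
  have hnext : ∀ s : T, ∃ s' : T, P.IsLeg s.1.1 s'.1.1 s.1.2.1 ∧
      s'.1.1 ∈ P.edgeInterior s'.1.2.2 ∧ s'.1.2.1 = P.reflect s'.1.2.2 s.1.2.1 := by
    rintro ⟨_, y, v, e, n, hr, rfl⟩
    obtain ⟨x, f, h1, h2⟩ := hr.extend hu hpu (h y v e n hr)
    have hne : ∀ k < n, k ≠ n + 1 ∧ k + 1 ≠ n + 1 := fun k hk => by omega
    have hy : ∀ k, k ≠ n + 1 → Function.update y (n + 1) x k = y k :=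
      fun k hk => Function.update_of_ne hk _ _
    have hv : ∀ k, k ≠ n + 1 → Function.update v (n + 1) (P.reflect f (v n)) k = v k :=
      fun k hk => Function.update_of_ne hk _ _
    have he : ∀ k, k ≠ n + 1 → Function.update e (n + 1) f k = e k :=
      fun k hk => Function.update_of_ne hk _ _
    refine ⟨⟨(x, P.reflect f (v n), f), Function.update y (n + 1) x,
      Function.update v (n + 1) (P.reflect f (v n)), Function.update e (n + 1) f, n + 1,
      ⟨?_, ?_, ?_, ?_, ?_, ?_⟩, ?_⟩, h1, h2, rfl⟩
    · simpa using hr.start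
    · simpa using hr.direction
    · simpa using hr.edge
    · intro k hk
      rcases Nat.lt_succ_iff_lt_or_eq.1 hk with hk | rfl
      · rw [hy _ (hne k hk).1, hy _ (hne k hk).2, hv _ (hne k hk).1]; exact hr.leg k hk
      · simpa using h1
    · intro k hk
      rcases Nat.lt_succ_iff_lt_or_eq.1 hk with hk | rfl
      · rw [hy _ (hne k hk).2, he _ (hne k hk).2]; exact hr.bounce k hk
      · simpa using h2
    · intro k hk
      rcases Nat.lt_succ_iff_lt_or_eq.1 hk with hk | rfl
      · rw [hv _ (hne k hk).2, he _ (hne k hk).2, hv _ (hne k hk).1]; exact hr.optical k hk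
      · simp
    · simp
  choose g hg using hnext
  have h0 : ∃ y v e n, P.FinRay A p u y v e n ∧ (p, u, A) = (y n, v n, e n) :=
    ⟨fun _ => p, fun _ => u, fun _ => A, 0, ⟨rfl, rfl, rfl, by omega, by omega, by omega⟩, rfl⟩
  set s : ℕ → T := fun n => g^[n] ⟨(p, u, A), h0⟩ with hs
  have hs' : ∀ n, s (n + 1) = g (s n) := fun n => Function.iterate_succ_apply' g n _
  refine ⟨fun n => (s n).1.1, fun n => (s n).1.2.1, fun n => (s n).1.2.2, fun n =>
    ⟨rfl, rfl, rfl, fun k _ => ?_, fun k _ => ?_, fun k _ => ?_⟩⟩ <;> simp only [hs']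
  exacts [(hg (s k)).1, (hg (s k)).2.1, (hg (s k)).2.2]

/-- Rays from one point have no initial shift, so after the same bounces their distance is the turn
times the positive travelled length. If both reach `w`, the turn is zero. -/
theorem FinRay.direction_unique {A : ι} {p u u' w : BilliardPlane} (hp : p ∈ P.edge A)
    {y v y' v' : ℕ → BilliardPlane} {e e' : ℕ → ι} {n : ℕ} (h : P.FinRay A p u y v e n)
    (h' : P.FinRay A p u' y' v' e' n) (hu : ‖u‖ = 1) (hu' : ‖u'‖ = 1)
    (hee : ∀ k ≤ n, e k = e' k) (hw : P.IsLeg (y n) w (v n)) (hw' : P.IsLeg (y' n) w (v' n)) :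
    u = u' := by
  have s := separation (n := n) (e := e) (fun k hk => h.limitStep hu hp hk) (fun k hk => by
    rw [hee k hk.le, hee (k + 1) hk]; exact h'.limitStep hu' hp hk) le_rfl
  rw [h.start, h'.start, h.direction, h'.direction, sub_self, cross_zero_right, inner_zero_right,
    zero_add, zero_add] at s
  obtain ⟨t, ht, rfl⟩ := hw.1
  obtain ⟨t', ht', hw2⟩ := hw'.1
  have hd : y' n - y n = t • v n - t' • v' n := by
    rw [sub_eq_sub_iff_add_eq_add, add_comm (t • v n), hw2]
  obtain ⟨s1, s2, s3, s4⟩ := s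
  rw [hd, cross_sub_right, cross_smul_right, cross_smul_right, cross_self_eq, s1] at s3
  rw [hd, inner_sub_right, inner_smul_right, inner_smul_right, real_inner_self_eq_norm_sq,
    h.norm hu le_rfl, s2] at s4
  have hΛ : 0 ≤ ∑ i ∈ Finset.range n, dist (y i) (y (i + 1)) :=
    Finset.sum_nonneg fun _ _ => dist_nonneg
  have hΛ' : 0 ≤ ∑ i ∈ Finset.range n, dist (y' i) (y' (i + 1)) :=
    Finset.sum_nonneg fun _ _ => dist_nonneg
  generalize (∑ i ∈ Finset.range n, dist (y i) (y (i + 1))) = Λ at *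
  generalize (∑ i ∈ Finset.range n, dist (y' i) (y' (i + 1))) = Λ' at *
  have hc : cross u u' = 0 := by
    have h1 : (-1 : ℝ) ^ n * (cross u u' * (Λ' + t')) = 0 := by linear_combination -s3
    have h2 := (mul_eq_zero.1 h1).resolve_left (pow_ne_zero _ (by norm_num))
    exact (mul_eq_zero.1 h2).resolve_right (by linarith)
  rcases eq_or_eq_neg_of_cross_eq_zero hu hu' hc with h1 | h1
  · exact h1.symm
  · rw [h1, inner_neg_right, real_inner_self_eq_norm_sq, hu] at s4
    nlinarith

/-- All but countably many directions give nonsingular rays. -/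
theorem countable_singular {A : ι} {p : BilliardPlane} (hp : p ∈ P.edge A) :
    {u | ‖u‖ = 1 ∧ P.PointsInto p u ∧ ¬ ∃ y v e, P.IsRay A p u y v e}.Countable := by
  have hvert : P.vertices.Countable :=
    ((Set.finite_range P.src).union (Set.finite_range P.tgt)).countable
  -- A singular direction is determined by the number of bounces before the vertex, their edges and
  -- the vertex: countably many data.
  refine Set.Countable.mono (s₂ := ⋃ n : ℕ, ⋃ c : Fin (n + 1) → ι, ⋃ w ∈ P.vertices,
    {u | ‖u‖ = 1 ∧ ∃ y v e, P.FinRay A p u y v e n ∧ (∀ k : Fin (n + 1), e k = c k) ∧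
      P.IsLeg (y n) w (v n)}) ?_ ?_
  · rintro u ⟨hu, hpu, hno⟩
    by_contra hcon
    refine hno (exists_isRay hu hpu fun y v e n hr w hw hleg => hcon ?_)
    simp only [Set.mem_iUnion]
    exact ⟨n, fun k => e k, w, hw, hu, y, v, e, hr, fun _ => rfl, hleg⟩
  · refine Set.countable_iUnion fun n => Set.countable_iUnion fun c => hvert.biUnion fun w _ => ?_
    refine Set.Subsingleton.countable ?_
    rintro u ⟨hu, y, v, e, hr, hc, hleg⟩ u' ⟨hu', y', v', e', hr', hc', hleg'⟩
    refine hr.direction_unique hp hr' hu hu' (fun k hk => ?_) hleg hleg'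
    exact (hc ⟨k, by omega⟩).trans (hc' ⟨k, by omega⟩).symm

theorem isFullTrajectory_iff {y v : ℤ → BilliardPlane} {e : ℤ → ι} :
    P.IsFullTrajectory y v e ↔ ∀ n, P.StepAt y v e n :=
  ⟨fun h n => ⟨h.unit n, h.bounce n, h.bounce (n + 1), h.leg n, h.optical n⟩,
    fun h => ⟨fun n => (h n).unit, fun n => (h n).leg, fun n => (h n).dep, fun n => (h n).optical⟩⟩

theorem IsRay.step {A : ι} {p u : BilliardPlane} {y v : ℕ → BilliardPlane} {e : ℕ → ι}
    (h : P.IsRay A p u y v e) (hu : ‖u‖ = 1) (hp : p ∈ P.edgeInterior A) (k : ℕ) :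
    P.Step (e k) (e (k + 1)) (y k) (v k) (y (k + 1)) (v (k + 1)) := by
  cases k with
  | zero =>
    have h1 := h 1
    refine ⟨h1.norm hu (by omega), ?_, h1.bounce 0 (by omega), h1.leg 0 (by omega),
      h1.optical 0 (by omega)⟩
    rw [h1.start, h1.edge]; exact hp
  | succ k => exact (h (k + 3)).step hu (by omega)

/-- Two nonsingular rays from opposite directions make up a bi-infinite trajectory. -/
theorem IsRay.exists_full {A : ι} {p u : BilliardPlane} {y v y' v' : ℕ → BilliardPlane}
    {e e' : ℕ → ι} (h : P.IsRay A p u y v e) (h' : P.IsRay A p (-P.reflect A u) y' v' e')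
    (hu : ‖u‖ = 1) (hp : p ∈ P.edgeInterior A) : ∃ Y V E, P.IsFullTrajectory Y V E ∧
      ∀ n : ℕ, Y n = y n ∧ V n = v n ∧ E n = e n := by
  have hu' : ‖-P.reflect A u‖ = 1 := by rw [norm_neg, norm_reflect, hu]
  refine ⟨fun n => if 0 ≤ n then y n.toNat else y' (-n).toNat,
    fun n => if 0 ≤ n then v n.toNat else -v' (-n - 1).toNat,
    fun n => if 0 ≤ n then e n.toNat else e' (-n).toNat, isFullTrajectory_iff.2 fun n => ?_,
    fun n => by simp⟩
  rcases lt_trichotomy n (-1) with hn | rfl | hn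
  · obtain ⟨m, rfl⟩ : ∃ m : ℕ, n = -(m : ℤ) - 2 := ⟨(-n - 2).toNat, by omega⟩
    have h1 := (h'.step hu' hp (m + 1)).reverse (w := -v' m) (by
      rw [reflect_neg, (h'.step hu' hp m).optical, reflect_reflect])
    have k1 : (-(-(m : ℤ) - 2)).toNat = m + 1 + 1 := by omega
    have k2 : (-(-(m : ℤ) - 2 + 1)).toNat = m + 1 := by omega
    have k3 : (-(-(m : ℤ) - 2) - 1).toNat = m + 1 := by omega
    have k4 : (-(-(m : ℤ) - 2 + 1) - 1).toNat = m := by omega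
    simp only [StepAt]
    rw [if_neg (by omega), if_neg (by omega), if_neg (by omega), if_neg (by omega),
      if_neg (by omega), if_neg (by omega), k1, k2, k3, k4]
    exact h1
  · have h1 := (h'.step hu' hp 0).reverse (w := u) (by
      rw [(h' 0).direction, neg_neg, (h' 0).edge, reflect_reflect])
    simp only [StepAt]
    rw [(h' 0).edge, (h' 0).start] at h1
    have e1 := (h 0).edge
    have e2 := (h 0).start
    have e3 := (h 0).direction
    simpa [e1, e2, e3] using h1
  · have h1 := h.step hu hp n.toNat
    simp only [StepAt]
    rw [if_pos (by omega), if_pos (by omega), if_pos (by omega), if_pos (by omega),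
      if_pos (by omega), if_pos (by omega)]
    convert h1 using 2 <;> omega

theorem Path.code_unique {e e' : ℕ → ι} {y v y' v' : ℕ → BilliardPlane} {n : ℕ}
    (h : P.Path e y v n) (h' : P.Path e' y' v' n) (h0 : e 0 = e' 0) (hy : y 0 = y' 0)
    (hv : v 0 = v' 0) {k : ℕ} (hk : k ≤ n) : e k = e' k ∧ y k = y' k ∧ v k = v' k := by
  induction k with
  | zero => exact ⟨h0, hy, hv⟩
  | succ k ih =>
    obtain ⟨h1, h2, h3⟩ := ih (by omega)
    have s := h k hk
    have s' := h' k hk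
    rw [← h2, ← h3] at s'
    obtain ⟨h4, h5⟩ := s.next_unique s'
    exact ⟨h5, h4, by rw [s.optical, s'.optical, h5]⟩

/-- A finite piece of a trajectory is close to a bi-infinite nonsingular trajectory. -/
theorem Path.exists_full {e : ℕ → ι} {y v : ℕ → BilliardPlane} {n : ℕ} (h : P.Path e y v (n + 1))
    {σ ε : ℝ} (hσ : σ ≠ 0) (hε : 0 < ε) : ∃ Y V E, P.IsFullTrajectory Y V E ∧ Y 0 = y 0 ∧
      dist (V 0) (v 0) < ε ∧ 0 < σ * cross (v 0) (V 0) ∧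
      ∀ k : ℕ, k ≤ n + 1 → E k = e k ∧ dist (Y k) (y k) < ε ∧ dist (V k) (v k) < ε := by
  have s0 := h 0 (by omega)
  have hp := s0.dep
  set A := e 0
  set p := y 0
  have hbad := P.countable_singular (P.edgeInterior_subset_edge _ hp)
  set B := {u | ‖u‖ = 1 ∧ P.PointsInto p u ∧ ¬ ∃ y v e, P.IsRay A p u y v e}
  -- The directions `u` whose reversed incoming direction `-P.reflect A u` is singular.
  have hbad' : ((fun u => P.reflect A (-u)) '' B).Countable := hbad.image _
  have hpair : Tendsto (fun u : BilliardPlane => (p, u)) (𝓝 (v 0)) (𝓝 (p, v 0)) :=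
    tendsto_const_nhds.prodMk_nhds tendsto_id
  have E1 := hpair.eventually h.eventually
  have E2 : ∀ᶠ u in 𝓝 (v 0), 0 < P.slope A u :=
    ((P.continuous_slope A).tendsto (v 0)).eventually (lt_mem_nhds s0.slope_dep)
  have E3 : ∀ᶠ u in 𝓝 (v 0), ∀ k ∈ Finset.range (n + 2),
      P.ghost e (p, u) k ∈ Metric.ball (y k, v k) ε := by
    rw [eventually_all_finset]
    intro k hk
    rw [Finset.mem_range] at hk
    exact hpair.eventually ((h.tendsto_ghost (by omega)).eventually (Metric.ball_mem_nhds _ hε))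
  obtain ⟨u, ⟨⟨⟨h1, h2⟩, h3⟩, h4⟩, hu, hnot, hside⟩ := exists_unit_near (hbad.union hbad')
    s0.unit hσ (inter_mem (inter_mem (inter_mem E1 E2) E3) (Metric.ball_mem_nhds _ hε))
  rw [Set.mem_union, not_or] at hnot
  have hray : ∃ y v e, P.IsRay A p u y v e := by
    by_contra hcon
    exact hnot.1 ⟨hu, P.pointsInto_of_slope_pos hp h2, hcon⟩
  have hray' : ∃ y v e, P.IsRay A p (-P.reflect A u) y v e := by
    by_contra hcon
    refine hnot.2 ⟨-P.reflect A u, ⟨by rw [norm_neg, norm_reflect, hu],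
      P.pointsInto_of_slope_pos hp ?_, hcon⟩, ?_⟩
    · rw [slope_neg, slope_reflect, neg_neg]; exact h2
    · simp only [neg_neg, reflect_reflect]
  obtain ⟨y₁, v₁, e₁, hr⟩ := hray
  obtain ⟨y₂, v₂, e₂, hr'⟩ := hray'
  obtain ⟨Y, V, E, hfull, hYV⟩ := hr.exists_full hr' hu hp
  have h1 := h1 hu (P.height_eq_zero' hp)
  have hcode := fun k (hk : k ≤ n + 1) => Path.code_unique (e' := e₁) (y' := y₁) (v' := v₁) h1
    (fun k _ => hr.step hu hp k) (hr 0).edge.symm (hr 0).start.symm (hr 0).direction.symm hk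
  have hV0 : V 0 = u := (hYV 0).2.1.trans (hr 0).direction
  refine ⟨Y, V, E, hfull, (hYV 0).1.trans (hr 0).start, hV0 ▸ h4, hV0 ▸ hside, fun k hk => ?_⟩
  obtain ⟨c1, c2, c3⟩ := hcode k hk
  have := h3 k (Finset.mem_range.2 (by omega))
  rw [(hYV k).1, (hYV k).2.1, (hYV k).2.2, ← c1, ← c2, ← c3]
  rw [Metric.mem_ball, Prod.dist_eq, max_lt_iff] at this
  exact ⟨rfl, this⟩

end PolygonTable

/-! ### The closed spectra in terms of ideal trajectories. -/

namespace PolygonTable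
variable {ι : Type*} {P : PolygonTable ι} [Finite ι]

theorem IsForwardTrajectory.path {p u : BilliardPlane} {y v : ℕ → BilliardPlane} {e : ℕ → ι}
    (h : P.IsForwardTrajectory p u y v e) (hu : ‖u‖ = 1) (n : ℕ) :
    P.Path e (fun k => y (k + 1)) (fun k => v (k + 1)) n := fun k _ => by
  have hn : ∀ k, ‖v k‖ = 1 := fun k => by
    induction k with
    | zero => rw [h.direction, hu]
    | succ k ih => rw [h.optical, norm_reflect, ih]
  exact ⟨hn _, h.bounce k, h.bounce (k + 1), h.leg (k + 1), h.optical (k + 1)⟩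

theorem vertices_notMem_interior {x : BilliardPlane} (hx : x ∈ interior P.carrier) :
    x ∉ P.vertices := by
  rintro (⟨e, rfl⟩ | ⟨e, rfl⟩)
  · exact P.notMem_interior_of_mem_edge (P.src_mem_edge e) hx
  · exact P.notMem_interior_of_mem_edge (P.tgt_mem_edge e) hx

/-- The forward trajectory is started at the midpoint of the leg before `y 0`, so that `e 0` is
recorded as its first edge. -/
theorem IsFullTrajectory.mem_forwardBounceSpectrum {y v : ℤ → BilliardPlane} {e : ℤ → ι}
    (h : P.IsFullTrajectory y v e) : (fun n : ℕ => e n) ∈ P.forwardBounceSpectrum := by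
  obtain ⟨⟨t, ht, hy⟩, hleg⟩ := h.leg (-1)
  rw [show (-1 : ℤ) + 1 = 0 from rfl] at hy hleg
  set p := y (-1) + (t / 2) • v (-1) with hp
  have hp' : p ∈ interior P.carrier := hleg (by
    rw [hy, mem_openSegment_iff_ray ht]; exact ⟨t / 2, by linarith, by linarith, rfl⟩)
  refine ⟨p, v (-1), interior_subset hp', vertices_notMem_interior hp', h.unit _,
    fun n => if n = 0 then p else y (n - 1), fun n => v (n - 1), rfl, rfl, fun n => ?_,
    fun n => ?_, fun n => ?_⟩
  · cases n with
    | zero =>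
      refine ⟨⟨t / 2, by linarith, ?_⟩, fun x hx => hleg ?_⟩
      · simp only [if_pos, zero_add, one_ne_zero, if_false, Nat.cast_one, sub_self, Nat.cast_zero,
          zero_sub]
        rw [hy, hp]; module
      · have hy' : y 0 = p + (t / 2) • v (-1) := by rw [hy, hp]; module
        simp only [if_pos, zero_add, one_ne_zero, if_false, Nat.cast_one, sub_self] at hx
        rw [hy', mem_openSegment_iff_ray (by linarith)] at hx
        obtain ⟨s, h1, h2, rfl⟩ := hx
        rw [hy, mem_openSegment_iff_ray ht]
        exact ⟨t / 2 + s, by linarith, by linarith, by rw [hp]; module⟩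
    | succ n => simpa using h.leg n
  · simpa using h.bounce n
  · simpa using h.optical ((n : ℤ) - 1)

theorem IsFullTrajectory.shift {y v : ℤ → BilliardPlane} {e : ℤ → ι}
    (h : P.IsFullTrajectory y v e) (c : ℤ) :
    P.IsFullTrajectory (fun n => y (c + n)) (fun n => v (c + n)) (fun n => e (c + n)) :=
  ⟨fun n => h.unit _, fun n => by simpa [add_assoc] using h.leg (c + n), fun n => h.bounce _,
    fun n => by simpa [add_assoc] using h.optical (c + n)⟩

/-- A prefix is recognised on finite pieces of trajectories. -/
theorem isPrefix_iff {A : ι} {E : ℕ → ι} : P.IsPrefix A E ↔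
    ∀ n, ∃ y v e, P.Path e y v n ∧ e 0 = A ∧ ∀ k < n, e (k + 1) = E k := by
  rw [IsPrefix, closedForwardBounceSpectrum, mem_closure_discrete_iff]
  constructor
  · intro h n
    obtain ⟨f, ⟨p, u, -, -, hu, y, v, hf⟩, hfE⟩ := h (Finset.range (n + 1))
    exact ⟨_, _, f, hf.path hu n, hfE 0 (by simp), fun k hk => hfE (k + 1) (by simpa using hk)⟩
  · intro h F
    obtain ⟨n, hn⟩ : ∃ n, ∀ k ∈ F, k ≤ n := ⟨F.sup id, fun k hk => Finset.le_sup (f := id) hk⟩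
    obtain ⟨y, v, e, hpath, h0, he⟩ := h (n + 1)
    obtain ⟨Y, V, C, hfull, -, -, -, hC⟩ := hpath.exists_full one_ne_zero one_pos
    refine ⟨_, hfull.mem_forwardBounceSpectrum, fun k hk => ?_⟩
    have hk' := hn k hk
    rw [(hC k (by omega)).1]
    cases k with
    | zero => exact h0
    | succ k => exact he k (by omega)

theorem IsFullTrajectory.approx {y v : ℤ → BilliardPlane} {e : ℤ → ι}
    (h : P.IsFullTrajectory y v e) (a b : ℤ) : P.Approx y v e a b :=
  approx_of_step fun n _ _ => isFullTrajectory_iff.1 h n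

/-- A prefix comes from an ideal trajectory. -/
theorem IsPrefix.exists_ideal {A : ι} {E : ℕ → ι} (h : P.IsPrefix A E) :
    ∃ y v e, P.Ideal y v e ∧ e 0 = A ∧ ∀ n : ℕ, e (n + 1) = E n := by
  have hfull : ∀ k : ℕ, ∃ Y V C, P.IsFullTrajectory Y V C ∧ C 0 = A ∧
      ∀ j : ℕ, j ≤ k → C (j + 1) = E j := fun k => by
    obtain ⟨y, v, e, hpath, h0, he⟩ := isPrefix_iff.1 h (k + 1)
    obtain ⟨Y, V, C, hfull, -, -, -, hC⟩ := hpath.exists_full one_ne_zero one_pos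
    refine ⟨Y, V, C, hfull, (hC 0 (by omega)).1.trans h0, fun j hj => ?_⟩
    have := (hC (j + 1) (by omega)).1
    rw [he j (by omega)] at this
    exact_mod_cast this
  choose Y V C hf h0 hE using hfull
  obtain ⟨φ, hφ, y, v, z, e, hy, -, hlim⟩ := exists_limit_pair (Y := Y) (V := V) (Z := Y) (U := V)
    (C := C) fun L => Eventually.of_forall fun k => ⟨(hf k).approx _ _, (hf k).approx _ _⟩
  refine ⟨y, v, e, hy, ?_, fun n => ?_⟩
  · obtain ⟨k, hk⟩ := (hlim 0).2.2.2.2.exists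
    exact hk.symm.trans (h0 _)
  · obtain ⟨k, hk, hk'⟩ := ((hlim (n + 1)).2.2.2.2.and (eventually_ge_atTop n)).exists
    exact hk.symm.trans (hE _ n (hk'.trans (hφ.id_le k)))

theorem exists_ideal_of_mem_closedBounceSpectrum {E : ℤ → ι} (h : E ∈ P.closedBounceSpectrum) :
    ∃ y v, P.Ideal y v E := by
  rw [closedBounceSpectrum, mem_closure_discrete_iff] at h
  choose C hC hCE using fun k : ℕ => h (Finset.Icc (-(k : ℤ)) k)
  choose Y V hf using hC
  obtain ⟨φ, hφ, y, v, z, e, hy, -, hlim⟩ := exists_limit_pair (Y := Y) (V := V) (Z := Y) (U := V)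
    (C := C) fun L => Eventually.of_forall fun k => ⟨(hf k).approx _ _, (hf k).approx _ _⟩
  have he : e = E := by
    funext n
    obtain ⟨k, hk, hk'⟩ := ((hlim n).2.2.2.2.and (eventually_ge_atTop n.natAbs)).exists
    refine hk.symm.trans (hCE _ n (Finset.mem_Icc.2 ?_))
    have := hk'.trans (hφ.id_le k)
    omega
  exact ⟨y, v, he ▸ hy⟩

/-- The nonnegative part of a window of real steps. -/
theorem path_of_stepAt {y v : ℤ → BilliardPlane} {e : ℤ → ι} {a : ℤ} {n : ℕ}
    (h : ∀ k, a ≤ k → k < a + n → P.StepAt y v e k) :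
    P.Path (fun k => e (a + k)) (fun k => y (a + k)) (fun k => v (a + k)) n := fun k hk => by
  have := h (a + k) (by omega) (by omega)
  simpa [StepAt, add_assoc] using this

/-- Each finite window of the code is realised by true steps, and these are continued to a
nonsingular bi-infinite trajectory; the shift by `L` puts the window back in place. -/
theorem Ideal.mem_closedBounceSpectrum {y v : ℤ → BilliardPlane} {E : ℤ → ι}
    (h : P.Ideal y v E) : E ∈ P.closedBounceSpectrum := by
  rw [closedBounceSpectrum, mem_closure_discrete_iff]
  intro F
  obtain ⟨L, hL⟩ : ∃ L : ℕ, ∀ k ∈ F, k.natAbs ≤ L :=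
    ⟨F.sup Int.natAbs, fun k hk => Finset.le_sup (f := Int.natAbs) hk⟩
  obtain ⟨y', v', hs, -⟩ := h (-L) (L + 1) 1 one_pos
  have hpath : P.Path (fun k => E (-L + k)) (fun k => y' (-L + k)) (fun k => v' (-L + k))
    (2 * L + 1) := path_of_stepAt fun k h1 h2 => hs k h1 (by push_cast at h2; omega)
  obtain ⟨Y, V, C, hfull, -, -, -, hC⟩ := hpath.exists_full one_ne_zero one_pos
  refine ⟨_, ⟨_, _, hfull.shift L⟩, fun k hk => ?_⟩
  have := hL k hk
  have h1 := (hC (L + k).toNat (by omega)).1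
  rw [show (((L : ℤ) + k).toNat : ℤ) = L + k by omega] at h1
  rw [h1]
  congr 1
  omega

end PolygonTable

/-! ### The table near a vertex. -/

namespace PolygonTable
variable {ι : Type*} {P : PolygonTable ι} [Finite ι]

variable (P) in
/-- The edge `e` starts at `q` in the direction `a`. -/
structure Arm (e : ι) (q a : BilliardPlane) (κ : ℝ) : Prop where
  mem : q ∈ P.edge e
  unit : ‖a‖ = 1
  coeff_ne : κ ≠ 0
  slope_eq : ∀ x, P.slope e x = κ * cross a x
  ray : ∀ x ∈ P.edge e, ∃ s : ℝ, 0 ≤ s ∧ x = q + s • a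
  inner_ray : ∃ L > (0 : ℝ), ∀ s, 0 < s → s < L → q + s • a ∈ P.edgeInterior e

theorem exists_arm {e : ι} {q : BilliardPlane}
    (hq : q ∈ ({P.src e, P.tgt e} : Set BilliardPlane)) : ∃ a κ, P.Arm e q a κ := by
  obtain ⟨d, hd, hedge, hint, η, hη, hd'⟩ : ∃ d : BilliardPlane, d ≠ 0 ∧
      P.edge e = segment ℝ q (q + d) ∧ P.edgeInterior e = openSegment ℝ q (q + d) ∧
      ∃ η : ℝ, η ≠ 0 ∧ P.edgeVec e = η • d := by
    rcases hq with rfl | hq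
    · exact ⟨P.edgeVec e, P.edgeVec_ne_zero e, by simp [edge, edgeVec],
        by simp [edgeInterior, edgeVec], 1, one_ne_zero, (one_smul _ _).symm⟩
    · obtain rfl : q = P.tgt e := hq
      refine ⟨-P.edgeVec e, neg_ne_zero.2 (P.edgeVec_ne_zero e), ?_, ?_, -1, by norm_num, by simp⟩
      · rw [edge, segment_symm]; simp [edgeVec]
      · rw [edgeInterior, openSegment_symm]; simp [edgeVec]
  have hn : 0 < ‖d‖ := norm_pos_iff.2 hd
  have hda : d = ‖d‖ • (‖d‖⁻¹ • d) := by rw [smul_smul, mul_inv_cancel₀ hn.ne', one_smul]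
  refine ⟨‖d‖⁻¹ • d, P.orient e * (η * ‖d‖), ?_, norm_smul_inv_norm hd,
    mul_ne_zero (P.orient_ne_zero e) (mul_ne_zero hη hn.ne'), fun x => ?_, fun x hx => ?_,
    ‖d‖, hn, fun s hs hs' => ?_⟩
  · rw [hedge]; exact left_mem_segment _ _ _
  · rw [slope, hd', cross_smul_left, cross_smul_left]
    field_simp
  · rw [hedge, segment_eq_image'] at hx
    obtain ⟨t, ht, rfl⟩ := hx
    refine ⟨t * ‖d‖, mul_nonneg ht.1 hn.le, ?_⟩
    rw [mul_smul, ← hda, add_sub_cancel_left]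
  · rw [hint]
    have h := (mem_openSegment_iff_ray (a := q) (v := ‖d‖⁻¹ • d) hn).2 ⟨s, hs, hs', rfl⟩
    rwa [← hda] at h

/-- The points next to an arm in a direction that does not meet the other arm are all interior or
all exterior. -/
theorem Arm.sector {A B : ι} {q a b : BilliardPlane} {κ κ' : ℝ} (hA : P.Arm A q a κ)
    (hB : P.Arm B q b κ') (hAB : A ≠ B) {θ : BilliardPlane} (hθ : cross a θ ≠ 0)
    (hfree : ∀ s τ s' : ℝ, 0 ≤ s → 0 < τ → 0 ≤ s' → s • a + τ • θ ≠ s' • b) :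
    ∃ ρ > (0 : ℝ), ∀ s τ : ℝ, 0 ≤ s → s < ρ → 0 < τ → τ < ρ →
      (0 < P.slope A θ → q + s • a + τ • θ ∈ interior P.carrier) ∧
      (P.slope A θ < 0 → q + s • a + τ • θ ∉ P.carrier) := by
  obtain ⟨ε, hε, hball⟩ := P.exists_ball_disjoint_edges q
  -- Near `q` only the edges `A` and `B` are present; transversality to `a` excludes `A`, and
  -- `hfree` excludes `B`.
  have hsect : ∀ s τ : ℝ, 0 ≤ s → 0 < τ → ∀ f, q + s • a + τ • θ ∈ Metric.ball q ε →
      q + s • a + τ • θ ∉ P.edge f := by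
    intro s τ hs hτ f hb hf
    rcases P.eq_or_eq_of_mem_edges hAB hA.mem hB.mem (hball _ hb f hf) with rfl | rfl
    · obtain ⟨s', -, h⟩ := hA.ray _ hf
      have h1 : cross a (q + s • a + τ • θ) = cross a (q + s' • a) := by rw [h]
      rw [cross_add_right, cross_add_right, cross_add_right, cross_smul_right, cross_smul_right,
        cross_smul_right, cross_self_eq] at h1
      have : τ * cross a θ = 0 := by linarith
      exact (mul_ne_zero hτ.ne' hθ) this
    · obtain ⟨s', hs', h⟩ := hB.ray _ hf
      rw [add_assoc] at h
      exact hfree s τ s' hs hτ hs' (add_left_cancel h)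
  set ρ := ε / (2 * (1 + ‖θ‖)) with hρ
  have hpos : 0 < 1 + ‖θ‖ := by positivity
  have hρ0 : 0 < ρ := by positivity
  have hin : ∀ s τ : ℝ, 0 ≤ s → s < ρ → 0 ≤ τ → τ < ρ →
      q + s • a + τ • θ ∈ Metric.ball q ε := by
    intro s τ h1 h2 h3 h4
    rw [mem_ball_iff_norm, add_assoc, add_sub_cancel_left]
    calc ‖s • a + τ • θ‖ ≤ s * 1 + τ * ‖θ‖ := by
          refine (norm_add_le _ _).trans (le_of_eq ?_)
          rw [norm_smul, norm_smul, hA.unit, Real.norm_of_nonneg h1, Real.norm_of_nonneg h3]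
      _ ≤ ρ * 1 + ρ * ‖θ‖ := by gcongr
      _ = ε / 2 := by rw [hρ]; field_simp
      _ < ε := by linarith
  obtain ⟨L, hL, hray⟩ := hA.inner_ray
  have hs1 : 0 < min ρ L / 2 := by positivity
  have hs1' : min ρ L / 2 < ρ := by have := min_le_left ρ L; linarith
  have hm := hray (min ρ L / 2) hs1 (by have := min_le_right ρ L; linarith)
  set s₁ := min ρ L / 2
  obtain ⟨ε₁, hε₁, hb₁⟩ := P.exists_ball_height hm
  set τ₁ := min (ρ / 2) (ε₁ / (2 * (1 + ‖θ‖))) with hτ₁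
  have hτ0 : 0 < τ₁ := by positivity
  have hτρ : τ₁ < ρ := by have := min_le_left (ρ / 2) (ε₁ / (2 * (1 + ‖θ‖))); linarith
  have hx₁ : q + s₁ • a + τ₁ • θ ∈ Metric.ball (q + s₁ • a) ε₁ := by
    rw [mem_ball_iff_norm, add_sub_cancel_left, norm_smul, Real.norm_of_nonneg hτ0.le]
    calc τ₁ * ‖θ‖ ≤ ε₁ / (2 * (1 + ‖θ‖)) * (1 + ‖θ‖) := by
          gcongr
          · exact min_le_right _ _
          · linarith
      _ = ε₁ / 2 := by field_simp
      _ < ε₁ := by linarith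
  have hheight : P.height A (q + s₁ • a + τ₁ • θ) = τ₁ * P.slope A θ := by
    rw [height_add, P.height_eq_zero' hm, slope_smul, zero_add]
  obtain ⟨hi, ho⟩ := hb₁ _ hx₁
  rw [hheight] at hi ho
  refine ⟨ρ, hρ0, fun s τ hs hsρ hτ hτ' => ?_⟩
  -- The sector is convex and free of edges, so a sample point next to the inner part of `A`, where
  -- the slope decides, settles all its points.
  have hseg := P.subset_interior_or_of_isPreconnected
    (convex_segment (𝕜 := ℝ) (q + s₁ • a + τ₁ • θ) (q + s • a + τ • θ)).isPreconnected
    (fun x hx f => by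
      obtain ⟨α, β, h1, h2, h3, rfl⟩ := hx
      have hx' : α • (q + s₁ • a + τ₁ • θ) + β • (q + s • a + τ • θ) =
          q + (α * s₁ + β * s) • a + (α * τ₁ + β * τ) • θ := by
        rw [show α = 1 - β by linarith]; module
      have hb := (convex_ball q ε) (hin s₁ τ₁ hs1.le hs1' hτ0.le hτρ) (hin s τ hs hsρ hτ.le hτ')
        h1 h2 h3
      rw [hx'] at hb ⊢
      refine hsect _ _ (by positivity) ?_ f hb
      rcases h1.eq_or_lt with h | h
      · have : β = 1 := by linarith
        rw [← h, this]; linarith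
      · have := mul_pos h hτ0
        have := mul_nonneg h2 hτ.le
        linarith)
  have hl := left_mem_segment ℝ (q + s₁ • a + τ₁ • θ) (q + s • a + τ • θ)
  have hr := right_mem_segment ℝ (q + s₁ • a + τ₁ • θ) (q + s • a + τ • θ)
  constructor
  · intro h
    rcases hseg with hseg | hseg
    · exact hseg hr
    · exact absurd (interior_subset (hi (mul_pos hτ0 h))) (hseg hl)
  · intro h
    rcases hseg with hseg | hseg
    · exact absurd (interior_subset (hseg hl)) (ho (mul_neg_of_pos_of_neg hτ0 h))
    · exact hseg hr

theorem Arm.ne {A B : ι} {q a b : BilliardPlane} {κ κ' : ℝ} (hA : P.Arm A q a κ)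
    (hB : P.Arm B q b κ') (hAB : A ≠ B) : a ≠ b := by
  rintro rfl
  obtain ⟨L, hL, h⟩ := hA.inner_ray
  obtain ⟨L', hL', h'⟩ := hB.inner_ray
  have hs : 0 < min L L' / 2 := by positivity
  have h1 := h (min L L' / 2) hs (by have := min_le_left L L'; linarith)
  have h2 := h' (min L L' / 2) hs (by have := min_le_right L L'; linarith)
  exact hAB (P.eq_of_mem_edgeInterior h1 (P.edgeInterior_subset_edge _ h2))

/-- At a vertex the interior lies on the same side of both edges. -/
theorem Arm.exists_inward {A B : ι} {q a b : BilliardPlane} {κ κ' : ℝ} (hA : P.Arm A q a κ)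
    (hB : P.Arm B q b κ') (hAB : A ≠ B) :
    κ * κ' < 0 ∧ ∃ θ, ‖θ‖ = 1 ∧ 0 < P.slope A θ ∧ 0 < P.slope B θ := by
  obtain ⟨θ, h1, h2, h3, hf, hf'⟩ : ∃ θ, cross a θ ≠ 0 ∧ cross b θ ≠ 0 ∧
      cross a θ * cross b θ < 0 ∧
      (∀ s τ s' : ℝ, 0 ≤ s → 0 < τ → 0 ≤ s' → s • a + τ • θ ≠ s' • b) ∧
      ∀ s τ s' : ℝ, 0 ≤ s → 0 < τ → 0 ≤ s' → s • b + τ • θ ≠ s' • a := by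
    -- A direction that separates the arms: neither sector spanned by `θ` and one arm contains the
    -- other arm. The sum `a + b` works, or a normal to `a` if the arms are opposite.
    suffices h : ∃ θ, cross a θ * cross b θ < 0 by
      obtain ⟨θ, h⟩ := h
      have key : ∀ s τ s' : ℝ, 0 ≤ s → 0 < τ → 0 ≤ s' → s • a + τ • θ ≠ s' • b := by
        intro s τ s' hs hτ hs' h'
        have e1 : cross a (s • a + τ • θ) = cross a (s' • b) := by rw [h']
        have e2 : cross b (s • a + τ • θ) = cross b (s' • b) := by rw [h']
        simp only [cross_add_right, cross_smul_right, cross_self_eq] at e1 e2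
        rw [cross_swap b a] at e2
        have e3 : τ ^ 2 * (cross a θ * cross b θ) = s * s' * cross a b ^ 2 := by
          linear_combination (τ * cross b θ) * e1 + (s' * cross a b) * e2
        have : τ ^ 2 * (cross a θ * cross b θ) < 0 := mul_neg_of_pos_of_neg (by positivity) h
        have : 0 ≤ s * s' * cross a b ^ 2 := by positivity
        linarith
      refine ⟨θ, left_ne_zero_of_mul h.ne, right_ne_zero_of_mul h.ne, h, key, ?_⟩
      intro s τ s' hs hτ hs' h'
      have e1 : cross a (s • b + τ • θ) = cross a (s' • a) := by rw [h']
      have e2 : cross b (s • b + τ • θ) = cross b (s' • a) := by rw [h']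
      simp only [cross_add_right, cross_smul_right, cross_self_eq] at e1 e2
      rw [cross_swap b a] at e2
      have e3 : τ ^ 2 * (cross a θ * cross b θ) = s * s' * cross a b ^ 2 := by
        linear_combination (τ * cross b θ) * e1 - (s * cross a b) * e2
      have : τ ^ 2 * (cross a θ * cross b θ) < 0 := mul_neg_of_pos_of_neg (by positivity) h
      have : 0 ≤ s * s' * cross a b ^ 2 := by positivity
      linarith
    by_cases hc : cross a b = 0
    · have hba : b = -a := (eq_or_eq_neg_of_cross_eq_zero hA.unit hB.unit hc).resolve_left
        (hA.ne hB hAB).symm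
      refine ⟨!₂[-a 1, a 0], ?_⟩
      have e1 : cross a !₂[-a 1, a 0] = 1 := by
        have := norm_sq_plane a
        rw [hA.unit] at this
        simp only [cross, Matrix.cons_val_zero, Matrix.cons_val_one,
          Matrix.cons_val_fin_one]
        linarith
      have e2 : cross (-a) !₂[-a 1, a 0] = -1 := by rw [cross_neg_left, e1]
      rw [hba, e1, e2]; norm_num
    · refine ⟨a + b, ?_⟩
      rw [cross_add_right, cross_add_right, cross_self_eq, cross_self_eq, cross_swap b a]
      have := sq_pos_of_ne_zero hc
      nlinarith
  obtain ⟨ρ, hρ, h⟩ := hA.sector hB hAB h1 hf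
  obtain ⟨ρ', hρ', h'⟩ := hB.sector hA hAB.symm h2 hf'
  have hτ : 0 < min ρ ρ' / 2 := by positivity
  have k := h 0 (min ρ ρ' / 2) le_rfl hρ hτ (by have := min_le_left ρ ρ'; linarith)
  have k' := h' 0 (min ρ ρ' / 2) le_rfl hρ' hτ (by have := min_le_right ρ ρ'; linarith)
  rw [zero_smul, add_zero] at k k'
  have n1 : P.slope A θ ≠ 0 := by rw [hA.slope_eq]; exact mul_ne_zero hA.coeff_ne h1
  have n2 : P.slope B θ ≠ 0 := by rw [hB.slope_eq]; exact mul_ne_zero hB.coeff_ne h2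
  -- The point `q + τ • θ` belongs to both sectors and cannot be inside according to one edge and
  -- outside according to the other.
  have hpos : 0 < P.slope A θ * P.slope B θ := by
    rcases lt_or_gt_of_ne n1 with n1 | n1 <;> rcases lt_or_gt_of_ne n2 with n2 | n2
    · exact mul_pos_of_neg_of_neg n1 n2
    · exact absurd (interior_subset (k'.1 n2)) (k.2 n1)
    · exact absurd (interior_subset (k.1 n1)) (k'.2 n2)
    · exact mul_pos n1 n2
  have hθ0 : θ ≠ 0 := by rintro rfl; exact h1 (cross_zero_right _)
  have hn : 0 < ‖θ‖⁻¹ := inv_pos.2 (norm_pos_iff.2 hθ0)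
  constructor
  · rw [hA.slope_eq, hB.slope_eq] at hpos
    by_contra hcon
    push Not at hcon
    nlinarith
  · rcases lt_or_gt_of_ne n1 with n1 | n1
    · refine ⟨-(‖θ‖⁻¹ • θ), by rw [norm_neg]; exact norm_smul_inv_norm hθ0, ?_, ?_⟩ <;>
        rw [slope_neg, slope_smul] <;> nlinarith
    · refine ⟨‖θ‖⁻¹ • θ, norm_smul_inv_norm hθ0, ?_, ?_⟩ <;> rw [slope_smul]
      · positivity
      · have := (pos_iff_pos_of_mul_pos hpos).1 n1
        positivity

/-- A direction that points to the inner side of both edges at a vertex. -/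
theorem Arm.inward {A B : ι} {q a b : BilliardPlane} {κ κ' : ℝ} (hA : P.Arm A q a κ)
    (hB : P.Arm B q b κ') (hAB : A ≠ B) {θ : BilliardPlane} (h1 : 0 < P.slope A θ)
    (h2 : 0 < P.slope B θ) : ∃ ρ > (0 : ℝ), ∀ s τ : ℝ, 0 ≤ s → s < ρ → 0 < τ → τ < ρ →
      q + s • a + τ • θ ∈ interior P.carrier ∧ q - τ • θ ∉ P.carrier := by
  have hκ := (hA.exists_inward hB hAB).1
  have n1 := h1
  have n2 := h2
  rw [hA.slope_eq] at n1
  rw [hB.slope_eq] at n2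
  have h : cross a θ * cross b θ < 0 := by
    have := mul_pos n1 n2
    by_contra hcon
    push Not at hcon
    nlinarith
  have key : ∀ η : ℝ, η ^ 2 = 1 → ∀ s τ s' : ℝ, 0 ≤ s → 0 < τ → 0 ≤ s' →
      s • a + τ • (η • θ) ≠ s' • b := by
    intro η hη s τ s' hs hτ hs' h'
    have e1 : cross a (s • a + τ • (η • θ)) = cross a (s' • b) := by rw [h']
    have e2 : cross b (s • a + τ • (η • θ)) = cross b (s' • b) := by rw [h']
    simp only [cross_add_right, cross_smul_right, cross_self_eq] at e1 e2
    rw [cross_swap b a] at e2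
    have e3 : τ ^ 2 * (cross a θ * cross b θ) = s * s' * cross a b ^ 2 := by
      linear_combination (τ * η * cross b θ) * e1 + (s' * cross a b) * e2 -
        (τ ^ 2 * cross a θ * cross b θ) * hη
    have : τ ^ 2 * (cross a θ * cross b θ) < 0 := mul_neg_of_pos_of_neg (by positivity) h
    have : 0 ≤ s * s' * cross a b ^ 2 := by positivity
    linarith
  have hne := left_ne_zero_of_mul h.ne
  obtain ⟨ρ, hρ, h3⟩ := hA.sector hB hAB (θ := (1 : ℝ) • θ) (by rwa [one_smul])
    (key 1 (by norm_num))
  obtain ⟨ρ', hρ', h4⟩ := hA.sector hB hAB (θ := (-1 : ℝ) • θ)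
    (by rw [cross_smul_right]; simpa using hne) (key (-1) (by norm_num))
  refine ⟨min ρ ρ', lt_min hρ hρ', fun s τ hs hs' hτ hτ' => ?_⟩
  rw [lt_min_iff] at hs' hτ'
  have k1 := (h3 s τ hs hs'.1 hτ hτ'.1).1 (by rwa [one_smul])
  have k2 := (h4 0 τ le_rfl hρ' hτ hτ'.2).2 (by rw [slope_smul]; linarith)
  refine ⟨by rwa [one_smul] at k1, ?_⟩
  rwa [zero_smul, add_zero, neg_one_smul, smul_neg, ← sub_eq_add_neg] at k2

end PolygonTable

/-! ### From adjacent edges to a non-grazing aperiodic code. -/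

namespace PolygonTable
variable {ι : Type*} {P : PolygonTable ι} [Finite ι]

theorem idealFrom_of_step {y v : ℕ → BilliardPlane} {e : ℕ → ι}
    (h : ∀ n, P.Step (e n) (e (n + 1)) (y n) (v n) (y (n + 1)) (v (n + 1))) :
    P.IdealFrom 0 (fun n => y n.toNat) (fun n => v n.toNat) (fun n => e n.toNat) := fun b =>
  approx_of_step fun n hn _ => by
    have h1 := h n.toNat
    have h2 : (n + 1).toNat = n.toNat + 1 := by omega
    simpa only [StepAt, h2] using h1

/-- The directions of ideal trajectories with eventually periodic codes are countably many. -/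
theorem countable_periodic_directions : {u | ∃ y v e, P.IdealFrom 0 y v e ∧
    ¬ IsAperiodic (fun n : ℕ => e n) ∧ v 0 = u}.Countable := by
  refine Set.Countable.mono (s₂ := ⋃ N : ℕ, ⋃ k : ℕ, ⋃ c : Fin (N + k) → ι,
    {u | ∃ y v e, P.IdealFrom 0 y v e ∧ (0 < k ∧ ∀ n : ℕ, N ≤ n → e (n + k : ℕ) = e n) ∧
      (∀ i : Fin (N + k), e i = c i) ∧ v 0 = u}) ?_ ?_
  · rintro u ⟨y, v, e, h, hper, hu⟩
    rw [IsAperiodic, not_not] at hper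
    obtain ⟨N, k, hk, hE⟩ := hper
    simp only [Set.mem_iUnion]
    exact ⟨N, k, fun i => e i, y, v, e, h, ⟨hk, hE⟩, fun _ => rfl, hu⟩
  -- Preperiod, period and finitely many symbols determine the code, and the code determines the
  -- direction.
  · refine Set.countable_iUnion fun N => Set.countable_iUnion fun k => Set.countable_iUnion
      fun c => Set.Subsingleton.countable ?_
    rintro u ⟨y, v, e, h, ⟨hk, hp⟩, hc, rfl⟩ u' ⟨y', v', e', h', ⟨-, hp'⟩, hc', rfl⟩
    have hcode : ∀ n : ℕ, e n = e' n := fun n => by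
      induction n using Nat.strong_induction_on with
      | _ n ih =>
        rcases lt_or_ge n (N + k) with hn | hn
        · exact (hc ⟨n, hn⟩).trans (hc' ⟨n, hn⟩).symm
        · have h1 := hp (n - k) (by omega)
          have h2 := hp' (n - k) (by omega)
          rw [Nat.sub_add_cancel (by omega)] at h1 h2
          rw [h1, h2, ih (n - k) (by omega)]
    exact h.dir_eq h' (fun n hn => by
      obtain ⟨m, rfl⟩ := Int.eq_ofNat_of_zero_le hn
      exact hcode m) le_rfl

theorem ClosureStep.comb_mem_carrier {e e' : ι} {p v p' : BilliardPlane}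
    (h : P.ClosureStep e e' p v p') {r : ℝ} (hr : 0 < r) (hr' : r < 1) :
    p + r • (p' - p) ∈ P.carrier := by
  obtain ⟨a, u, b, w, hs, ha, -, hb⟩ := h
  refine P.isClosed_carrier.mem_of_tendsto (ha.add ((hb.sub ha).const_smul r))
    (Eventually.of_forall fun k => interior_subset ((hs k).leg.2 ?_))
  exact comb_mem_openSegment hr hr'

theorem Path.cons {A : ι} {p u : BilliardPlane} {e : ℕ → ι} {y v : ℕ → BilliardPlane} {n : ℕ}
    (h : P.Step A (e 0) p u (y 0) (v 0)) (h' : P.Path e y v n) :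
    P.Path (prepend A e) (prepend p y) (prepend u v) (n + 1) := fun k hk => by
  cases k with
  | zero => exact h
  | succ k => exact h' k (by omega)

/-- The first edge of a ray from a vertex may be replaced by an arm of the vertex. -/
theorem IsRay.isPrefix {A X : ι} {q a θ : BilliardPlane} {κ : ℝ} {y v : ℕ → BilliardPlane}
    {e : ℕ → ι} (h : P.IsRay A q θ y v e) (hθ : ‖θ‖ = 1) (hX : P.Arm X q a κ)
    (hin : ∃ ρ > (0 : ℝ), ∀ s τ : ℝ, 0 ≤ s → s < ρ → 0 < τ → τ < ρ →
      q + s • a + τ • θ ∈ interior P.carrier) : P.IsPrefix X (fun n => e (n + 1)) := by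
  rw [isPrefix_iff]
  intro n
  have hleg := (h 1).leg 0 (by omega)
  have hb := (h 1).bounce 0 (by omega)
  have hopt := (h 1).optical 0 (by omega)
  rw [(h 1).start, (h 1).direction] at hleg
  rw [(h 1).direction] at hopt
  simp only [zero_add] at hleg hb hopt
  have hs : P.slope (e 1) θ < 0 := by
    have := hleg.reverse.pointsInto.slope_pos P hb
    rw [slope_neg] at this; linarith
  have hpath : P.Path (fun k => e (k + 1)) (fun k => y (k + 1)) (fun k => v (k + 1)) n :=
    fun k hk => (h (k + 3)).step hθ (by omega)
  obtain ⟨ρ, hρ, hin⟩ := hin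
  obtain ⟨L, hL, hray⟩ := hX.inner_ray
  -- The ray is shifted parallel to itself along the arm: for small `s` it starts inside the edge
  -- `X` and follows the first `n` bounces.
  have ht : Tendsto (fun s : ℝ => (q + s • a, θ)) (𝓝[>] 0) (𝓝 (q, θ)) :=
    (tendsto_ray q a).prodMk_nhds tendsto_const_nhds
  have hnear : ∀ᶠ s : ℝ in 𝓝[>] 0, 0 < s ∧ s < ρ ∧ s < L := by
    filter_upwards [self_mem_nhdsWithin, nhdsWithin_le_nhds (gt_mem_nhds hρ),
      nhdsWithin_le_nhds (gt_mem_nhds hL)] with s h1 h2 h3 using ⟨h1, h2, h3⟩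
  have E1 := hleg.eventually hb hs (l := map (fun s : ℝ => (q + s • a, θ)) (𝓝[>] 0)) ht
    ⟨ρ, hρ, by
      rw [eventually_map]
      filter_upwards [hnear] with s hs τ hτ hτ' using hin s τ hs.1.le hs.2.1 hτ hτ'⟩
  rw [eventually_map] at E1
  have hc : cross θ (y 1 - q) = 0 := by
    obtain ⟨t, -, ht⟩ := hleg.1
    rw [ht, add_sub_cancel_left, cross_smul_right, cross_self_eq, mul_zero]
  have hhit : P.hit (e 1) q θ = y 1 := hit_eq hs.ne (P.height_eq_zero' hb) hc
  have ht' : Tendsto (fun s : ℝ => (P.hit (e 1) (q + s • a) θ, P.reflect (e 1) θ)) (𝓝[>] 0)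
      (𝓝 (y 1, v 1)) := by
    rw [hopt, ← hhit]
    exact ((continuousAt_hit hs.ne).tendsto.comp ht).prodMk_nhds tendsto_const_nhds
  obtain ⟨s, ⟨h1, h2⟩, h4⟩ := ((E1.and (ht'.eventually hpath.eventually)).and hnear).exists
  have hp := h2 (by rw [norm_reflect, hθ]) (P.height_eq_zero' h1.2)
  have hp' := Path.cons (A := X) (p := q + s • a) (u := θ)
    ⟨hθ, hray s h4.1 h4.2.2, h1.2, h1.1, rfl⟩ hp
  exact ⟨_, _, _, fun k hk => hp' k (by omega), rfl, fun k _ => rfl⟩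

/-- A point of an edge that is joined to `p` through the table, where `p` lies behind a point `q`
from which the ray leaves the table backwards. -/
theorem ClosureStep.dep_eq {e e' : ι} {q x₁ θ x₀ : BilliardPlane}
    (h : P.ClosureStep e e' x₀ θ x₁) (hne : e ≠ e') (hleg : P.IsLeg q x₁ θ) (hx₁ : x₁ ∈ P.edgeInterior e')
    (hout : ∃ ρ > (0 : ℝ), ∀ τ, 0 < τ → τ < ρ → q - τ • θ ∉ P.carrier)
    (hx : ∃ t : ℝ, 0 ≤ t ∧ x₁ = x₀ + t • θ) : x₀ = q := by
  obtain ⟨t, ht, hx⟩ := hx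
  obtain ⟨⟨s, hs, hs'⟩, hint⟩ := hleg
  obtain ⟨-, h0, -⟩ := h.facts
  have hx0 : x₀ = q + (s - t) • θ := by
    rw [eq_sub_of_add_eq hx.symm, hs']; module
  rcases lt_trichotomy t s with hts | rfl | hts
  · rcases ht.eq_or_lt with rfl | ht
    · rw [zero_smul, add_zero] at hx
      rw [← hx] at h0
      exact absurd (P.eq_of_mem_edgeInterior hx₁ h0).symm hne
    · exact absurd (hint (by
        rw [hs', mem_openSegment_iff_ray hs]
        exact ⟨s - t, by linarith, by linarith, hx0⟩)) (P.notMem_interior_of_mem_edge h0)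
  · rw [hx0, sub_self, zero_smul, add_zero]
  · obtain ⟨ρ, hρ, hout⟩ := hout
    have hτ : 0 < min ρ (t - s) / 2 := by
      have : 0 < t - s := by linarith
      positivity
    set τ := min ρ (t - s) / 2 with hτd
    have h1 : τ < ρ := by have := min_le_left ρ (t - s); linarith
    have h2 : τ < t - s := by have := min_le_right ρ (t - s); linarith
    have ht0 : 0 < t := by linarith
    have := h.comb_mem_carrier (r := (t - s - τ) / t) (div_pos (by linarith) ht0)
      ((div_lt_one ht0).2 (by linarith))
    rw [hx, add_sub_cancel_left, smul_smul, div_mul_cancel₀ _ ht0.ne', hx0] at this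
    refine absurd ?_ (hout τ hτ h1)
    convert this using 1
    module

/-- Two adjacent edges are the first edges of trajectories with a common aperiodic future that is
not grazing. -/
theorem exists_of_adjacent {A B : ι} {q : BilliardPlane} (hAB : A ≠ B)
    (hqA : q ∈ ({P.src A, P.tgt A} : Set BilliardPlane))
    (hqB : q ∈ ({P.src B, P.tgt B} : Set BilliardPlane)) :
    ∃ E : ℕ → ι, IsAperiodic E ∧ P.IsPrefix A E ∧ P.IsPrefix B E ∧ ¬ P.IsGrazing E := by
  obtain ⟨a, κ, hA⟩ := exists_arm hqA
  obtain ⟨b, κ', hB⟩ := exists_arm hqB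
  obtain ⟨-, θ₀, hθ₀, hsA, hsB⟩ := hA.exists_inward hB hAB
  have hper := P.countable_periodic_directions
  set Q := {u | ∃ y v e, P.IdealFrom 0 y v e ∧ ¬ IsAperiodic (fun n : ℕ => e n) ∧ v 0 = u}
  -- Besides singular directions, those are avoided which become the direction of an eventually
  -- periodic code after one reflection; the image under `-P.reflect e` takes care of the past, run
  -- backwards.
  have hc : ({u | ‖u‖ = 1 ∧ P.PointsInto q u ∧ ¬ ∃ y v e, P.IsRay A q u y v e} ∪
      ⋃ e, (P.reflect e '' Q ∪ (fun u => -P.reflect e u) '' Q)).Countable :=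
    (countable_singular hA.mem).union (Set.countable_iUnion fun e =>
      (hper.image _).union (hper.image _))
  have hU : {u | 0 < P.slope A u ∧ 0 < P.slope B u} ∈ 𝓝 θ₀ :=
    (((P.continuous_slope A).tendsto θ₀).eventually (lt_mem_nhds hsA)).and
      (((P.continuous_slope B).tendsto θ₀).eventually (lt_mem_nhds hsB))
  obtain ⟨θ, ⟨h1, h2⟩, hθ, hbad, -⟩ := exists_unit_near hc hθ₀ one_ne_zero hU
  obtain ⟨ρ, hρ, hin⟩ := hA.inward hB hAB h1 h2
  obtain ⟨ρ', hρ', hin'⟩ := hB.inward hA hAB.symm h2 h1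
  rw [Set.mem_union, not_or, Set.mem_iUnion, not_exists] at hbad
  have hray : ∃ y v e, P.IsRay A q θ y v e := by
    by_contra hcon
    refine hbad.1 ⟨hθ, ⟨ρ, hρ, fun t ht ht' => ?_⟩, hcon⟩
    have := (hin 0 t le_rfl hρ ht ht').1
    rwa [zero_smul, add_zero] at this
  have hQ : ∀ e u, u ∈ Q → P.reflect e u ≠ θ ∧ -P.reflect e u ≠ θ := by
    intro e u hu
    have := hbad.2 e
    rw [Set.mem_union, not_or] at this
    exact ⟨fun h => this.1 ⟨u, hu, h⟩, fun h => this.2 ⟨u, hu, h⟩⟩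
  have hout : ∃ ρ > (0 : ℝ), ∀ τ, 0 < τ → τ < ρ → q - τ • θ ∉ P.carrier :=
    ⟨ρ, hρ, fun τ hτ hτ' => (hin 0 τ le_rfl hρ hτ hτ').2⟩
  obtain ⟨y, v, e, hr⟩ := hray
  have hideal := P.idealFrom_of_step (y := fun n => y (n + 1)) (v := fun n => v (n + 1))
    (e := fun n => e (n + 1)) fun n => (hr (n + 3)).step hθ (by omega)
  have hleg := (hr 1).leg 0 (by omega)
  have hy1 := (hr 1).bounce 0 (by omega)
  have hv1 := (hr 1).optical 0 (by omega)
  rw [(hr 1).start, (hr 1).direction] at hleg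
  rw [(hr 1).direction] at hv1
  simp only [zero_add] at hleg hy1 hv1
  have hs1 : P.slope (e 1) θ < 0 := by
    have := hleg.reverse.pointsInto.slope_pos P hy1
    rw [slope_neg] at this; linarith
  have hap : IsAperiodic fun n => e (n + 1) := by
    by_contra hcon
    refine (hQ (e 1) (v 1) ⟨_, _, _, hideal, ?_, rfl⟩).1 (by rw [hv1, reflect_reflect])
    simpa using hcon
  refine ⟨fun n => e (n + 1), hap, hr.isPrefix hθ hA
    ⟨ρ, hρ, fun s τ a1 a2 a3 a4 => (hin s τ a1 a2 a3 a4).1⟩, hr.isPrefix hθ hB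
    ⟨ρ', hρ', fun s τ a1 a2 a3 a4 => (hin' s τ a1 a2 a3 a4).1⟩, ?_⟩
  rintro ⟨F, G, C, ⟨hC, hdisj, hF, -⟩, hCE⟩
  obtain ⟨x, ξ, hx⟩ := exists_ideal_of_mem_closedBounceSpectrum hC
  obtain ⟨f, w, c, hf, hcF, hcC⟩ := hF.exists_ideal
  have hC1 : C 1 = e 1 := hCE 0
  -- the present
  have hx' := (hx.shift 1).idealFrom 0
  have hcode : ∀ n : ℤ, 0 ≤ n → C (1 + n) = e (n.toNat + 1) := fun n hn => by
    obtain ⟨m, rfl⟩ := Int.eq_ofNat_of_zero_le hn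
    rw [add_comm]; exact hCE m
  have hξ1 : ξ 1 = v 1 := by simpa using hx'.dir_eq hideal hcode le_rfl
  have hx1 : x 1 = y 1 := by
    -- The grazed trajectory shares the aperiodic future of the ray and so lies on its line.
    have hx'' : P.IdealFrom 0 (fun n => x (1 + n)) (fun n => ξ (1 + n))
        (fun n => e (n.toNat + 1)) := fun b => (hx' b).congr fun n hn _ => hcode n hn
    have h := hx''.cross_eq_zero (by simpa using hap) hideal
    have hx1 := hx.limitStep 1
    rw [hC1] at hx1
    simp only [add_zero, hξ1, Int.toNat_zero, zero_add] at h
    refine (eq_of_height_eq_zero (e := e 1) (v := v 1) ?_ (P.height_eq_zero' hy1)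
      (P.height_eq_zero hx1.dep) h).symm
    rw [hv1, slope_reflect]; linarith
  have hl0 := hx.limitStep 0
  rw [zero_add, hC1, hx1, hξ1] at hl0
  have hξ0 : ξ 0 = θ := by
    have := hl0.optical
    rw [hv1] at this
    have h := congrArg (P.reflect (e 1)) this
    rw [reflect_reflect, reflect_reflect] at h
    exact h.symm
  have hcl := (hx 0 1).closureStep (n := 0) le_rfl (by omega)
  rw [zero_add, hC1, hx1, hξ0] at hcl
  have hne1 : C 0 ≠ e 1 := by
    have := (hx 0 1).ne (n := 0) le_rfl (by omega)
    rwa [zero_add, hC1] at this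
  -- Backwards along the ray there is no edge before `q`, and beyond `q` the line leaves the table.
  have hx0 : x 0 = q := hcl.dep_eq hne1 hleg hy1 hout
    ⟨_, dist_nonneg, by rw [← hξ0]; exact hl0.eq⟩
  have hC0 : 0 < P.slope (C 0) θ := by
    have hd := hl0.dep
    rw [hx0] at hd
    rcases P.eq_or_eq_of_mem_edges hAB hA.mem hB.mem hd with h | h <;> rw [h] <;> assumption
  -- the past
  have hxr := hx.reverse
  have hopt0 : ξ 0 = P.reflect (C 0) (ξ (-1)) := by simpa using (hx.limitStep (-1)).optical
  have hξm : ξ (-1) = P.reflect (C 0) θ := by rw [← hξ0, hopt0, reflect_reflect]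
  have hapr : IsAperiodic fun n : ℕ => C (-(n : ℤ)) := by
    by_contra hcon
    refine (hQ (C 0) (-ξ (-1)) ⟨_, _, _, hxr.idealFrom 0, hcon, by norm_num⟩).2 ?_
    rw [hξm, reflect_neg, reflect_reflect, neg_neg]
  have hf' := (hf.shift 1).idealFrom 0
  have hcode' : ∀ n : ℤ, 0 ≤ n → C (-n) = c (1 + n) := fun n hn => by
    obtain ⟨m, rfl⟩ := Int.eq_ofNat_of_zero_le hn
    rw [add_comm]; exact (hcC m).symm
  have hc1 : c 1 = C 0 := by simpa using (hcode' 0 le_rfl).symm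
  have hw1 : w 1 = -ξ (-1) := by simpa using ((hxr.idealFrom 0).dir_eq hf' hcode' le_rfl).symm
  have hf1 : f 1 = q := by
    -- The reversed past is aperiodic as well, so the trajectory that starts on `F` comes to `q`
    -- along the line of the ray.
    have hf'' : P.IdealFrom 0 (fun n => f (1 + n)) (fun n => w (1 + n)) (fun n => C (-n)) :=
      fun b => (hf' b).congr fun n hn _ => (hcode' n hn).symm
    have h := (hxr.idealFrom 0).cross_eq_zero hapr hf''
    have hfl := hf.limitStep 1
    rw [hc1] at hfl
    have hd := hl0.dep
    rw [hx0] at hd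
    simp only [add_zero, neg_zero, zero_sub, hx0] at h
    refine eq_of_height_eq_zero (e := C 0) (v := -ξ (-1)) ?_ (P.height_eq_zero hfl.dep)
      (P.height_eq_zero hd) h
    rw [hξm, slope_neg, slope_reflect]; linarith
  have hfl := hf.limitStep 0
  have hw0 : w 0 = -θ := by
    have h := congrArg (P.reflect (C 0)) hfl.optical
    rw [zero_add, hc1, reflect_reflect, hw1, hξm, reflect_neg, reflect_reflect] at h
    exact h.symm
  have hclf := (hf 0 1).closureStep (n := 0) le_rfl (by omega)
  rw [zero_add, hcF, hc1, hf1, hw0] at hclf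
  have hFne : F ≠ e 1 := fun h => by
    have : e 1 ∈ ({C 0, C 1} : Set ι) ∩ {F, G} := ⟨Or.inr hC1.symm, Or.inl h.symm⟩
    rw [hdisj] at this
    exact this
  obtain ⟨-, hfF, -, hsl, -⟩ := hclf.facts
  have hf0 : f 0 = q + dist (f 0) q • θ := by
    have := hfl.eq
    rw [zero_add, hf1, hw0, smul_neg] at this
    rw [← sub_eq_add_neg] at this
    exact sub_eq_iff_eq_add.1 this.symm
  set t := dist (f 0) q with ht
  have ht0 : 0 ≤ t := dist_nonneg
  obtain ⟨⟨s, hs, hs'⟩, hint⟩ := hleg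
  -- Its start lies on the ray from `q`: not on the open leg, not at `y 1` because `F ≠ e 1`, and
  -- not beyond `y 1`, where the line leaves the table.
  have hfq : f 0 = q := by
    rcases ht0.eq_or_lt with h0 | h0
    · rw [hf0, ← h0, zero_smul, add_zero]
    exfalso
    rcases lt_trichotomy t s with hts | hts | hts
    · exact P.notMem_interior_of_mem_edge hfF (hint (by
        rw [hs', mem_openSegment_iff_ray hs]; exact ⟨t, h0, hts, hf0⟩))
    · rw [hf0, hts, ← hs'] at hfF
      exact hFne (P.eq_of_mem_edgeInterior hy1 hfF).symm
    · obtain ⟨ε, hε, hb⟩ := P.exists_ball_height hy1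
      have hτ : 0 < min (ε / 2) ((t - s) / 2) := lt_min (by linarith) (by linarith)
      set τ := min (ε / 2) ((t - s) / 2)
      have k1 : τ ≤ ε / 2 := min_le_left _ _
      have k2 : τ ≤ (t - s) / 2 := min_le_right _ _
      have hcar := hclf.comb_mem_carrier (r := (t - s - τ) / t) (div_pos (by linarith) h0)
        ((div_lt_one h0).2 (by linarith))
      have hpt : f 0 + ((t - s - τ) / t) • (q - f 0) = y 1 + τ • θ := by
        rw [hs', show q - f 0 = -(t • θ) by rw [sub_eq_iff_eq_add, hf0]; module, smul_neg,
          smul_smul, div_mul_cancel₀ _ h0.ne', hf0]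
        module
      rw [hpt] at hcar
      refine (hb (y 1 + τ • θ) ?_).2 ?_ hcar
      · rw [mem_ball_iff_norm, add_sub_cancel_left, norm_smul, hθ, mul_one,
          Real.norm_of_nonneg hτ.le]
        linarith
      · rw [height_add, P.height_eq_zero' hy1, slope_smul, zero_add]
        exact mul_neg_of_pos_of_neg hτ hs1
  rw [hfq] at hfF
  rw [slope_neg] at hsl
  -- Thus `F` is one of the two edges at `q`; but a trajectory leaving `F` in direction `-θ` needs a
  -- nonpositive slope of `θ`.
  rcases P.eq_or_eq_of_mem_edges hAB hA.mem hB.mem hfF with h | h <;> rw [h] at hsl <;> linarith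

end PolygonTable

/-! ### Paths beside an ideal trajectory. -/

namespace PolygonTable
variable {ι : Type*} {P : PolygonTable ι} [Finite ι]

/-- Pigeonhole: a choice from a finite set that works for arbitrarily long pieces can be made once
for all lengths. -/
theorem exists_forall_of_antitone {T : Type*} [Finite T] {p : T → ℕ → Prop}
    (hp : ∀ t m n, m ≤ n → p t n → p t m) (h : ∀ n, ∃ t, p t n) : ∃ t, ∀ n, p t n := by
  by_contra hcon
  push Not at hcon
  choose n hn using hcon
  obtain ⟨M, hM⟩ := (Set.finite_range n).bddAbove
  obtain ⟨t, ht⟩ := h M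
  exact hn t (hp t _ _ (hM ⟨t, rfl⟩) ht)

/-- A ray that starts on the free side of an ideal trajectory and does not turn towards it follows
the ideal trajectory. -/
theorem eventually_path_of_sideFree {e : ℕ → ι} {y v : ℕ → BilliardPlane} {N : ℕ} {τ : ℝ}
    (hl : ∀ k < N, P.LimitStep (e k) (e (k + 1)) (y k) (v k) (y (k + 1)) (v (k + 1)))
    (hs : ∀ k < N, P.slope (e (k + 1)) (v k) ≠ 0)
    (hf : ∀ k < N, P.SideFree ((-1) ^ k * τ) (e k) (e (k + 1)) (y k) (v k)) :
    ∀ᶠ q : BilliardPlane × BilliardPlane in 𝓝 (y 0, v 0), ‖q.2‖ = 1 → P.height (e 0) q.1 = 0 →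
      0 < τ * cross (v 0) (q.1 - y 0) → 0 ≤ τ * cross (v 0) q.2 →
      P.Path e (fun k => (P.ghost e q k).1) (fun k => (P.ghost e q k).2) N := by
  have ht : ∀ k ≤ N, Tendsto (fun q => P.ghost e q k) (𝓝 (y 0, v 0)) (𝓝 (y k, v k)) :=
    fun k hk => tendsto_ghost (fun k hk => ⟨by
      nth_rw 1 [(hl k hk).eq]
      rw [add_sub_cancel_left, cross_smul_right, cross_self_eq, mul_zero],
      P.height_eq_zero (hl k hk).arr, hs k hk, (hl k hk).optical⟩) hk
  have hev : ∀ᶠ q in 𝓝 (y 0, v 0), ∀ k ∈ Finset.range N, ‖(P.ghost e q k).2‖ = 1 →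
      P.height (e k) (P.ghost e q k).1 = 0 →
      0 < (-1) ^ k * τ * cross (v k) ((P.ghost e q k).1 - y k) →
      0 ≤ (-1) ^ k * τ * cross (v k) (P.ghost e q k).2 →
      P.Step (e k) (e (k + 1)) (P.ghost e q k).1 (P.ghost e q k).2 (P.ghost e q (k + 1)).1
        (P.ghost e q (k + 1)).2 := by
    rw [eventually_all_finset]
    intro k hk
    rw [Finset.mem_range] at hk
    exact (ht k hk.le).eventually (hf k hk)
  filter_upwards [hev] with q hq h1 h2 h3 h4
  -- A shift to the free side with a turn that does not oppose it keeps its sign after each bounce,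
  -- so the free side is never left.
  have hq' : ∀ k ≤ N, P.height (e k) (P.ghost e q k).1 = 0 ∧
      0 < (-1) ^ k * τ * cross (v k) ((P.ghost e q k).1 - y k) ∧
      0 ≤ (-1) ^ k * τ * cross (v k) (P.ghost e q k).2 := by
    intro k
    induction k with
    | zero => intro _; simpa [ghost] using ⟨h2, h3, h4⟩
    | succ k ih =>
      intro hk
      obtain ⟨a1, a2, a3⟩ := ih (by omega)
      have hst := hq k (Finset.mem_range.2 hk) (P.norm_ghost e h1 k) a1 a2 a3
      refine ⟨P.height_eq_zero' hst.arr, ?_, ?_⟩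
      · rw [(hl k hk).cross_sub hst.limitStep, pow_succ]
        have := mul_nonneg (dist_nonneg (x := (P.ghost e q k).1) (y := (P.ghost e q (k + 1)).1)) a3
        linarith
      · rw [(hl k hk).cross_dir hst.limitStep, pow_succ]
        linarith
  exact fun k hk => hq k (Finset.mem_range.2 hk) (P.norm_ghost e h1 k) (hq' k hk.le).1
    (hq' k hk.le).2.1 (hq' k hk.le).2.2

/-- The legs of an ideal trajectory are free on a side from which it is approached by paths that
do not turn towards it. -/
theorem sideFree_of_tendsto {e : ℕ → ι} {y v : ℕ → BilliardPlane} {N : ℕ} {τ : ℝ}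
    {Y V : ℕ → ℕ → BilliardPlane} (hp : ∀ k, P.Path e (Y k) (V k) N)
    (hY : ∀ n ≤ N, Tendsto (fun k => Y k n) atTop (𝓝 (y n)))
    (hV : ∀ n ≤ N, Tendsto (fun k => V k n) atTop (𝓝 (v n)))
    (hdev : ∀ k, 0 < τ * cross (v 0) (Y k 0 - y 0)) (hη : ∀ k, 0 ≤ τ * cross (v 0) (V k 0))
    {n : ℕ} (hn : n < N) :
    P.LimitStep (e n) (e (n + 1)) (y n) (v n) (y (n + 1)) (v (n + 1)) ∧
      P.slope (e (n + 1)) (v n) ≠ 0 ∧ P.SideFree ((-1) ^ n * τ) (e n) (e (n + 1)) (y n) (v n) := by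
  have hl : ∀ n < N, P.LimitStep (e n) (e (n + 1)) (y n) (v n) (y (n + 1)) (v (n + 1)) :=
    fun n hn => limitStep_of_tendsto (Frequently.of_forall fun k => hp k n hn) (hY n hn.le)
      (hV n hn.le) (hY (n + 1) hn) (hV (n + 1) hn)
  -- A path that turns away from the limit stays strictly to one side; this also excludes ideal legs
  -- along an edge.
  have hside : ∀ n ≤ N, ∀ k, 0 < (-1) ^ n * τ * cross (v n) (Y k n - y n) := by
    intro n hn k
    have h := (separation hl (fun j hj => (hp k j hj).limitStep) hn).2.2.1
    rw [h]
    have e1 : ((-1 : ℝ) ^ n) * (-1) ^ n = 1 := by rw [← mul_pow]; norm_num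
    have h0 : 0 ≤ ∑ i ∈ Finset.range n, dist (Y k i) (Y k (i + 1)) :=
      Finset.sum_nonneg fun _ _ => dist_nonneg
    have := mul_nonneg (hη k) h0
    have := hdev k
    calc (0 : ℝ) < τ * cross (v 0) (Y k 0 - y 0) + τ * cross (v 0) (V k 0) *
          ∑ i ∈ Finset.range n, dist (Y k i) (Y k (i + 1)) := by linarith
      _ = _ := by linear_combination (-(τ * cross (v 0) (Y k 0 - y 0)) -
          τ * cross (v 0) (V k 0) * ∑ i ∈ Finset.range n, dist (Y k i) (Y k (i + 1))) * e1
  have hslope : ∀ n ≤ N, 0 < n → P.slope (e n) (v n) ≠ 0 := by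
    intro n hn hn0
    obtain ⟨m, rfl⟩ := Nat.exists_eq_succ_of_ne_zero hn0.ne'
    exact slope_ne_zero_of_cross_ne_zero (P.height_eq_zero' (hp 0 m hn).arr)
      (P.height_eq_zero (hl m hn).arr) fun h => by
        have := hside _ hn 0
        rw [h, mul_zero] at this
        exact lt_irrefl _ this
  have hslope' : ∀ n < N, P.slope (e n) (v n) ≠ 0 := by
    intro n hn
    exact slope_ne_zero_of_cross_ne_zero (P.height_eq_zero' (hp 0 n hn).dep)
      (P.height_eq_zero (hl n hn).dep) fun h => by
        have := hside _ hn.le 0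
        rw [h, mul_zero] at this
        exact lt_irrefl _ this
  have hs1 : P.slope (e (n + 1)) (v n) ≠ 0 := by
    have := hslope (n + 1) hn (by omega)
    rwa [(hl n hn).optical, slope_reflect, neg_ne_zero] at this
  refine ⟨hl n hn, hs1, SideStep.sideFree ⟨fun k => Y k n, fun k => V k n, fun k => Y k (n + 1),
    fun k => V k (n + 1), fun k => hp k n hn, hY n hn.le, hV n hn.le, hY (n + 1) hn, fun k =>
    ⟨hside n hn.le k, ?_⟩⟩ (hslope' n hn) hs1⟩
  have h1 := hside (n + 1) hn k
  have hd : cross (v n) (y (n + 1) - y n) = 0 := by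
    nth_rw 1 [(hl n hn).eq]
    rw [add_sub_cancel_left, cross_smul_right, cross_self_eq, mul_zero]
  rw [(hl n hn).optical, P.cross_reflect_sub (P.height_eq_zero' (hp k n hn).arr)
    (P.height_eq_zero (hl n hn).arr), pow_succ] at h1
  have h2 : cross (v n) (Y k (n + 1) - y n) = cross (v n) (Y k (n + 1) - y (n + 1)) := by
    rw [← sub_add_sub_cancel (Y k (n + 1)) (y (n + 1)) (y n), cross_add_right, hd, add_zero]
  rw [h2]
  linarith

variable (P) in
/-- The sequence `(C, E 0, E 1, …)` is followed by paths that start near `x`, on the side `τ` of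
the line through `x` in the direction `v`, and that do not move away from this line. -/
def Inward (E : ℕ → ι) (C : ι) (x v : BilliardPlane) (τ : ℝ) : Prop :=
  ∀ (N : ℕ) (ε : ℝ), 0 < ε → ∃ Y V, P.Path (prepend C E) Y V N ∧ dist (Y 0) x < ε ∧
    dist (V 0) v < ε ∧ 0 < τ * cross v (Y 0 - x) ∧ τ * cross v (V 0) ≤ 0

/-- On a free side one may start exactly parallel to `v 0`: zero turn is allowed both by `SideFree`
and by `Inward`. -/
theorem inward_of_sideFree {C : ι} {E : ℕ → ι} {y v : ℕ → BilliardPlane} {τ : ℝ}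
    (hv : ‖v 0‖ = 1)
    (hl : ∀ n, P.LimitStep (prepend C E n) (prepend C E (n + 1)) (y n) (v n) (y (n + 1))
      (v (n + 1)))
    (hs : ∀ n, P.slope (prepend C E (n + 1)) (v n) ≠ 0)
    (hf : ∀ n, P.SideFree ((-1) ^ n * τ) (prepend C E n) (prepend C E (n + 1)) (y n) (v n))
    {r : ℕ → BilliardPlane} (hr : Tendsto r atTop (𝓝 (y 0)))
    (hr0 : ∀ k, P.height C (r k) = 0 ∧ 0 < τ * cross (v 0) (r k - y 0)) :
    P.Inward E C (y 0) (v 0) τ := by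
  intro N ε hε
  have h := P.eventually_path_of_sideFree (N := N) (fun k _ => hl k) (fun k _ => hs k)
    (fun k _ => hf k)
  have ht : Tendsto (fun k => (r k, v 0)) atTop (𝓝 (y 0, v 0)) :=
    hr.prodMk_nhds tendsto_const_nhds
  obtain ⟨k, h1, h2⟩ := ((ht.eventually h).and (hr.eventually (Metric.ball_mem_nhds _ hε))).exists
  refine ⟨_, _, h1 hv (hr0 k).1 (hr0 k).2 (by rw [cross_self_eq, mul_zero]), h2, ?_, (hr0 k).2, ?_⟩
  · simpa [ghost] using hε
  · simp [ghost, cross_self_eq]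

end PolygonTable

/-! ### Inward trajectories and legs towards a prescribed edge. -/

namespace PolygonTable
variable {ι : Type*} {P : PolygonTable ι} [Finite ι]

/-- Addition formula for the sine in the frame given by the unit vector `v`; it adds the signs of
two small turns. -/
theorem cross_eq_add (x w : BilliardPlane) {v : BilliardPlane} (hv : ‖v‖ = 1) :
    cross x w = cross x v * ⟪v, w⟫ + ⟪x, v⟫ * cross v w := by
  have h := norm_sq_plane v
  rw [hv] at h
  rw [inner_plane, inner_plane]
  unfold cross
  linear_combination (x 0 * w 1 - x 1 * w 0) * h

theorem inner_pos_of_dist_lt {v w : BilliardPlane} (hv : ‖v‖ = 1) (hw : ‖w‖ = 1)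
    (h : dist v w < 1) : 0 < ⟪v, w⟫ := by
  have h1 := norm_sub_sq_real v w
  rw [hv, hw, ← dist_eq_norm] at h1
  have h0 : 0 ≤ dist v w := dist_nonneg
  nlinarith

/-- The paths in the definition of `Inward` may be taken from bi-infinite trajectories. -/
theorem Inward.exists_full {E : ℕ → ι} {C : ι} {x v : BilliardPlane} {τ : ℝ}
    (h : P.Inward E C x v τ) (hv : ‖v‖ = 1) (N : ℕ) {ε : ℝ} (hε : 0 < ε) :
    ∃ Y V c, P.IsFullTrajectory Y V c ∧ (∀ k : ℕ, k ≤ N → c k = prepend C E k) ∧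
      dist (Y 0) x < ε ∧ dist (V 0) v < ε ∧ 0 < τ * cross v (Y 0 - x) ∧
      τ * cross v (V 0) ≤ 0 := by
  have hε' : 0 < min (ε / 2) (1 / 2) := by positivity
  obtain ⟨y, w, hp, h1, h2, h3, h4⟩ := h (N + 1) _ hε'
  have hτ : -τ ≠ 0 := by
    rintro h
    rw [neg_eq_zero.1 h, zero_mul] at h3
    exact lt_irrefl _ h3
  -- The direction is perturbed towards the line, which preserves the inward condition.
  obtain ⟨Y, V, c, hf, hY0, hV0, hside, hc⟩ := hp.exists_full hτ hε'
  have k1 := min_le_left (ε / 2) (1 / 2)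
  have k2 := min_le_right (ε / 2) (1 / 2)
  refine ⟨Y, V, c, hf, fun k hk => (hc k (by omega)).1, by rw [hY0]; linarith, ?_, by rwa [hY0], ?_⟩
  · have := dist_triangle (V 0) (w 0) v
    linarith
  · have hw := (hp 0 (by omega)).unit
    rw [cross_eq_add v (V 0) hw]
    have i1 : 0 < ⟪w 0, V 0⟫ := inner_pos_of_dist_lt hw (hf.unit 0) (by rw [dist_comm]; linarith)
    have i2 : 0 < ⟪v, w 0⟫ := inner_pos_of_dist_lt hv hw (by rw [dist_comm]; linarith)
    have j1 := mul_nonneg (neg_nonneg.2 h4) i1.le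
    have j2 := mul_pos hside i2
    linarith

/-- From a point near `x` one can hit an edge, other than the edges `C` and `e`, in a direction
towards a prescribed point of an edge `G`. -/
theorem exists_hit_towards {C G e : ι} {c m : BilliardPlane} (hc : c ∈ P.edgeInterior C)
    (hm : m ∈ P.edgeInterior G) (hG : P.height G c ≠ 0) (hce : 0 < P.height e c)
    (hme : 0 < P.height e m) (hs : 0 < P.slope C (m - c)) {U : Set BilliardPlane}
    (hU : U ∈ 𝓝 m) : ∃ m' ∈ U, ∃ (f : ι) (x : BilliardPlane), f ≠ C ∧ f ≠ e ∧
      x ∈ P.edgeInterior f ∧ P.IsLeg c x (‖m' - c‖⁻¹ • (m' - c)) := by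
  have hvert : P.vertices.Finite := (Set.finite_range P.src).union (Set.finite_range P.tgt)
  set d := P.edgeVec G
  have ht : Tendsto (fun s : ℝ => m + s • d) (𝓝[≠] 0) (𝓝 m) := by
    have : Continuous fun s : ℝ => m + s • d := by fun_prop
    have h0 := (this.tendsto 0).mono_left (nhdsWithin_le_nhds (s := {0}ᶜ))
    rwa [zero_smul, add_zero] at h0
  have hd : ∀ s : ℝ, P.height G (m + s • d) = 0 := fun s => by
    rw [height_add, P.height_eq_zero' hm, slope_smul, P.slope_eq_zero_iff.2 (cross_self_eq _),
      mul_zero, add_zero]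
  -- Moving `m` along `G` turns its line through `c`, as `c` is off the line of `G`. Each vertex is
  -- met for at most one value of `s`, so small nonzero values avoid all of them.
  have E1 : ∀ᶠ s : ℝ in 𝓝[≠] 0, ∀ w ∈ P.vertices, cross (m + s • d - c) (w - c) ≠ 0 := by
    rw [eventually_all_finite hvert]
    intro w hw
    have hwc : w - c ≠ 0 := by
      intro h
      rw [sub_eq_zero.1 h] at hw
      exact P.edgeInterior_notMem_vertices hc hw
    have hex : ∀ s : ℝ, cross (m + s • d - c) (w - c) =
        cross (m - c) (w - c) + s * cross d (w - c) := fun s => by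
      rw [show m + s • d - c = (m - c) + s • d by module, cross_swap, cross_add_right,
        cross_smul_right, cross_swap (w - c) (m - c), cross_swap (w - c) d]
      ring
    simp only [hex]
    by_cases h1 : cross (m - c) (w - c) = 0
    · by_cases h2 : cross d (w - c) = 0
      · exfalso
        obtain ⟨r, hr⟩ : ∃ r : ℝ, d = r • (w - c) := ⟨_, exists_smul_of_cross_eq_zero hwc (by
          rw [cross_swap, h2, neg_zero])⟩
        have h3 : P.slope G (m - c) = 0 := by
          rw [slope_eq_zero_iff]
          change cross d (m - c) = 0
          rw [hr, cross_smul_left, cross_swap, h1, neg_zero, mul_zero]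
        rw [← height_sub_height, P.height_eq_zero' hm, zero_sub, neg_eq_zero] at h3
        exact hG h3
      · filter_upwards [self_mem_nhdsWithin] with s hs
        rw [h1, zero_add]
        exact mul_ne_zero hs h2
    · have hcont : Tendsto (fun s : ℝ => cross (m - c) (w - c) + s * cross d (w - c)) (𝓝[≠] 0)
          (𝓝 (cross (m - c) (w - c))) := by
        have : Continuous fun s : ℝ => cross (m - c) (w - c) + s * cross d (w - c) := by fun_prop
        have h0 := (this.tendsto 0).mono_left (nhdsWithin_le_nhds (s := {0}ᶜ))
        rwa [zero_mul, add_zero] at h0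
      exact hcont.eventually_ne h1
  have E2 : ∀ᶠ x in 𝓝 m, 0 < P.height e x ∧ 0 < P.slope C (x - c) ∧
      (P.height G x = 0 → x ∈ P.edgeInterior G) ∧ x ∈ U := by
    have c1 := ((P.continuous_height e).tendsto m).eventually (lt_mem_nhds hme)
    have c2 := (((P.continuous_slope C).comp (continuous_id.sub continuous_const)).tendsto
      m).eventually (lt_mem_nhds hs)
    filter_upwards [c1, c2, P.eventually_mem_edgeInterior hm, hU] with x a1 a2 a3 a4
      using ⟨a1, a2, a3, a4⟩
  obtain ⟨s, h1, h2, h3, h4, h5⟩ := (E1.and (ht.eventually E2)).exists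
  have hmG := h4 (hd s)
  set m' := m + s • d
  have hmc : m' - c ≠ 0 := by
    intro h
    rw [h, P.slope_eq_zero_iff.2 (cross_zero_right _)] at h3
    exact lt_irrefl _ h3
  have hn : 0 < ‖m' - c‖ := norm_pos_iff.2 hmc
  set u := ‖m' - c‖⁻¹ • (m' - c) with hu
  have hu1 : ‖u‖ = 1 := norm_smul_inv_norm hmc
  have hmu : m' = c + ‖m' - c‖ • u := by
    rw [hu, smul_smul, mul_inv_cancel₀ hn.ne', one_smul]; abel
  have hsu : 0 < P.slope C u := by rw [hu, slope_smul]; positivity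
  obtain ⟨x, f, hleg, hf⟩ := (P.pointsInto_of_slope_pos hc hsu).exists_leg hu1
  obtain ⟨⟨T, hT, hx⟩, hint⟩ := hleg
  -- The boundary is met at `m'` at the latest. The height over `e` is affine and positive at both
  -- `c` and `m'`, hence positive at the point that is hit.
  have hTle : T ≤ ‖m' - c‖ := by
    by_contra hcon
    push Not at hcon
    refine P.notMem_interior_of_mem_edge (P.edgeInterior_subset_edge _ hmG) (hint ?_)
    rw [hx, mem_openSegment_iff_ray hT]
    exact ⟨‖m' - c‖, hn, hcon, hmu⟩
  have hxe : 0 < P.height e x := by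
    have hh : P.height e m' = P.height e c + ‖m' - c‖ * P.slope e u := by
      nth_rw 1 [hmu]; rw [height_add, slope_smul]
    rw [hx, height_add, slope_smul]
    rcases le_or_gt 0 (P.slope e u) with h0 | h0
    · positivity
    · have := mul_nonneg (sub_nonneg.2 hTle) (neg_nonneg.2 h0.le)
      linarith
  refine ⟨m', h5, f, x, ?_, ?_, P.mem_edgeInterior_of_notMem_vertices hf fun hv => ?_,
    ⟨T, hT, hx⟩, hint⟩
  · rintro rfl
    have := P.height_eq_zero hf
    rw [hx, height_add, P.height_eq_zero' hc, slope_smul, zero_add] at this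
    exact (mul_pos hT hsu).ne' this
  · rintro rfl
    exact hxe.ne' (P.height_eq_zero hf)
  · refine h1 x hv ?_
    rw [hx, add_sub_cancel_left, cross_smul_right, hu, cross_smul_right, cross_self_eq, mul_zero,
      mul_zero]

end PolygonTable

/-! ### An edge ahead on the same line produces grazing. -/

namespace PolygonTable
variable {ι : Type*} {P : PolygonTable ι} [Finite ι]

/-- Compactness supplies a past for the sequence: the limit has code `C`, `E 0`, … from index `0`
on, and is approached from the side `τ` by full trajectories that move inwards. -/
theorem Inward.exists_limit {E : ℕ → ι} {C : ι} {x₀ v₀ : BilliardPlane} {τ : ℝ}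
    (h : P.Inward E C x₀ v₀ τ) (hv : ‖v₀‖ = 1) : ∃ (Y V : ℕ → ℤ → BilliardPlane)
      (c : ℕ → ℤ → ι) (x ξ : ℤ → BilliardPlane) (e : ℤ → ι),
      (∀ k, P.IsFullTrajectory (Y k) (V k) (c k)) ∧
      (∀ k, c k 0 = C ∧ c k 1 = E 0 ∧ 0 < τ * cross v₀ (Y k 0 - x₀) ∧
        τ * cross v₀ (V k 0) ≤ 0) ∧
      P.Ideal x ξ e ∧ (∀ n, Tendsto (fun k => Y k n) atTop (𝓝 (x n)) ∧
        Tendsto (fun k => V k n) atTop (𝓝 (ξ n)) ∧ ∀ᶠ k in atTop, c k n = e n) ∧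
      x 0 = x₀ ∧ ξ 0 = v₀ ∧ e 0 = C ∧ ∀ n : ℕ, e (n + 1) = E n := by
  choose Y V c hf hc hY hV hdev hη using fun k : ℕ =>
    h.exists_full hv (k + 1) (ε := 1 / ((k : ℝ) + 1)) (by positivity)
  obtain ⟨φ, hφ, x, ξ, z, e, hx, -, hlim⟩ := exists_limit_pair (Y := Y) (V := V) (Z := Y) (U := V)
    (C := c) fun L => Eventually.of_forall fun k => ⟨(hf k).approx _ _, (hf k).approx _ _⟩
  have h0 : ∀ {f : ℕ → BilliardPlane} {a : BilliardPlane},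
      (∀ k : ℕ, dist (f k) a < 1 / ((k : ℝ) + 1)) → Tendsto (fun k => f (φ k)) atTop (𝓝 a) :=
    fun {f a} hf => by
      have : Tendsto f atTop (𝓝 a) := by
        rw [tendsto_iff_dist_tendsto_zero]
        exact squeeze_zero (fun _ => dist_nonneg) (fun k => (hf k).le)
          tendsto_one_div_add_atTop_nhds_zero_nat
      exact this.comp hφ.tendsto_atTop
  have hcode : ∀ n : ℕ, e n = prepend C E n := fun n => by
    obtain ⟨k, hk, hk'⟩ := ((hlim n).2.2.2.2.and (eventually_ge_atTop n)).exists
    exact hk.symm.trans (hc _ n (by have := hφ.le_apply (x := k); omega))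
  refine ⟨fun k => Y (φ k), fun k => V (φ k), fun k => c (φ k), x, ξ, e, fun k => hf _,
    fun k => ⟨hc _ 0 (by omega), hc _ 1 (by omega), hdev _, hη _⟩, hx,
    fun n => ⟨(hlim n).1, (hlim n).2.1, (hlim n).2.2.2.2⟩,
    tendsto_nhds_unique (hlim 0).1 (h0 hY), tendsto_nhds_unique (hlim 0).2.1 (h0 hV),
    hcode 0, fun n => ?_⟩
  have := hcode (n + 1)
  exact_mod_cast this

theorem tendsto_direction {x v : BilliardPlane} (hv : ‖v‖ = 1) {t : ℝ} (ht : 0 < t) :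
    Tendsto (fun q : BilliardPlane × BilliardPlane => ‖q.2 - q.1‖⁻¹ • (q.2 - q.1))
      (𝓝 (x, x + t • v)) (𝓝 v) := by
  have h1 : Tendsto (fun q : BilliardPlane × BilliardPlane => q.2 - q.1) (𝓝 (x, x + t • v))
      (𝓝 (t • v)) := by
    have hc : Continuous fun q : BilliardPlane × BilliardPlane => q.2 - q.1 := by fun_prop
    have := hc.tendsto (x, x + t • v)
    simpa using this
  have hn : ‖t • v‖ = t := by rw [norm_smul, hv, mul_one, Real.norm_of_nonneg ht.le]
  have h2 := (h1.norm.inv₀ (by rw [hn]; exact ht.ne')).smul h1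
  rwa [hn, smul_smul, inv_mul_cancel₀ ht.ne', one_smul] at h2

/-- If a further edge `G` starts the sequence `E` from a place ahead of `C` on the same line, then
`E` is grazing. -/
theorem Inward.isGrazing {E : ℕ → ι} {C G : ι} {x₀ v₀ : BilliardPlane} {τ t : ℝ}
    (h : P.Inward E C x₀ v₀ τ) (hv : ‖v₀‖ = 1) (hsC : 0 < P.slope C v₀) (hG : P.IsPrefix G E)
    (ht : 0 < t) (hm : ∀ U ∈ 𝓝 (x₀ + t • v₀), ∃ m ∈ U, m ∈ P.edgeInterior G ∧
      0 < P.height (E 0) m) : P.IsGrazing E := by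
  obtain ⟨Y, V, c, x, ξ, e, hfull, hC, hx, hlim, hx0, hξ0, he0, heE⟩ := h.exists_limit hv
  have he1 : e 1 = E 0 := heE 0
  have hx0C : P.height C x₀ = 0 := by
    have := (hx.limitStep 0).dep
    rw [hx0, he0] at this
    exact P.height_eq_zero this
  have hY0 : Tendsto (fun k => Y k 0) atTop (𝓝 x₀) := hx0 ▸ (hlim 0).1
  -- the past of the limit trajectory
  have hopt : ξ 0 = P.reflect C (ξ (-1)) := by
    have := (hx.limitStep (-1)).optical
    rwa [neg_add_cancel, he0] at this
  have hξm : ξ (-1) = P.reflect C v₀ := by rw [← hξ0, hopt, reflect_reflect]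
  have hdirtend : ∀ n : ℤ, Tendsto (fun k => -V k n) atTop (𝓝 (-ξ n)) := fun n => (hlim n).2.1.neg
  have hstep0 : ∀ k, P.Step C (E 0) (Y k 0) (V k 0) (Y k 1) (V k 1) := fun k => by
    have := isFullTrajectory_iff.1 (hfull k) 0
    rwa [StepAt, zero_add, (hC k).1, (hC k).2.1] at this
  -- Inward motion becomes outward motion when time is reversed. So the reversed past is free on the
  -- side `τ`, and every state that moves outwards there follows it.
  have hpast : ∀ N : ℕ, ∀ᶠ q : BilliardPlane × BilliardPlane in 𝓝 (x₀, -P.reflect C v₀),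
      ‖q.2‖ = 1 → P.height C q.1 = 0 → 0 < τ * cross (-P.reflect C v₀) (q.1 - x₀) →
      0 ≤ τ * cross (-P.reflect C v₀) q.2 → ∃ y v, y 0 = q.1 ∧ v 0 = q.2 ∧
        P.Path (fun n : ℕ => e (-(n : ℤ))) y v N := by
    intro N
    have hcode : ∀ᶠ k in atTop, ∀ n ∈ Finset.range (N + 1), c k (-(n : ℤ)) = e (-(n : ℤ)) := by
      rw [eventually_all_finset]
      exact fun n _ => (hlim _).2.2
    obtain ⟨k₀, hk₀⟩ := eventually_atTop.1 hcode
    have hp : ∀ k, P.Path (fun n : ℕ => e (-(n : ℤ))) (fun n : ℕ => Y (k + k₀) (-(n : ℤ)))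
        (fun n : ℕ => -V (k + k₀) (-(n : ℤ) - 1)) N := by
      intro k n hn
      have hs := isFullTrajectory_iff.1 (hfull (k + k₀)) (-(n : ℤ) - 1)
      have hs' := isFullTrajectory_iff.1 (hfull (k + k₀)) (-(n : ℤ) - 1 - 1)
      simp only [StepAt, sub_add_cancel] at hs hs'
      have h1 := hs.reverse (w := -V (k + k₀) (-(n : ℤ) - 1 - 1)) (by
        rw [reflect_neg, hs'.optical, reflect_reflect])
      have c1 := hk₀ (k + k₀) (by omega) n (Finset.mem_range.2 (by omega))
      have c2 := hk₀ (k + k₀) (by omega) (n + 1) (Finset.mem_range.2 (by omega))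
      have hidx : (-((n + 1 : ℕ) : ℤ)) = -(n : ℤ) - 1 := by push_cast; ring
      rw [hidx] at c2
      simp only [hidx]
      rwa [← c1, ← c2]
    have hdev : ∀ k, 0 < τ * cross (-ξ (-((0 : ℕ) : ℤ) - 1)) (Y (k + k₀) (-((0 : ℕ) : ℤ)) -
        x (-((0 : ℕ) : ℤ))) := by
      intro k
      have h1 := (hC (k + k₀)).2.2.1
      simp only [Nat.cast_zero, neg_zero, zero_sub]
      rw [hξm, cross_neg_left, hx0, P.cross_reflect_sub (P.height_eq_zero' (hstep0 _).dep) hx0C,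
        neg_neg]
      exact h1
    have hη : ∀ k, 0 ≤ τ * cross (-ξ (-((0 : ℕ) : ℤ) - 1)) (-V (k + k₀) (-((0 : ℕ) : ℤ) - 1)) := by
      intro k
      have h1 := (hC (k + k₀)).2.2.2
      have h2 := (isFullTrajectory_iff.1 (hfull (k + k₀)) (-1)).optical
      rw [neg_add_cancel, (hC (k + k₀)).1] at h2
      rw [← hξ0, hopt, h2, cross_reflect] at h1
      simp only [Nat.cast_zero, neg_zero, zero_sub]
      rw [cross_neg_left, cross_neg_right]
      linarith
    have hall := fun n (hn : n < N) => sideFree_of_tendsto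
      (y := fun n : ℕ => x (-(n : ℤ))) (v := fun n : ℕ => -ξ (-(n : ℤ) - 1)) (τ := τ) hp
      (fun n _ => (hlim _).1.comp (tendsto_add_atTop_nat k₀))
      (fun n _ => (hdirtend _).comp (tendsto_add_atTop_nat k₀)) hdev hη hn
    have hev := eventually_path_of_sideFree (fun n hn => (hall n hn).1)
      (fun n hn => (hall n hn).2.1) (fun n hn => (hall n hn).2.2)
    simp only [Nat.cast_zero, neg_zero, zero_sub, hx0, hξm, he0] at hev
    filter_upwards [hev] with q hq h1 h2 h3 h4
    exact ⟨_, _, rfl, rfl, hq h1 h2 h3 h4⟩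
  -- the edge that grazes from the other side
  have hmG : P.height G (x₀ + t • v₀) = 0 := by
    have hcl : x₀ + t • v₀ ∈ closure (P.edge G) := mem_closure_iff_nhds.2 fun U hU => by
      obtain ⟨m, h1, h2, -⟩ := hm U hU
      exact ⟨m, h1, P.edgeInterior_subset_edge _ h2⟩
    rw [(P.isClosed_edge G).closure_eq] at hcl
    exact P.height_eq_zero hcl
  have hGc : ∀ᶠ k in atTop, P.height G (Y k 0) ≠ 0 := by
    -- If `G` is parallel to `v₀`, its line is the limit line, which `Y k 0` avoids; otherwise `x₀`
    -- is already off the line of `G`.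
    by_cases hs : P.slope G v₀ = 0
    · refine Eventually.of_forall fun k h0 => ?_
      rw [height_add, slope_smul, hs, mul_zero, add_zero] at hmG
      have := (hC k).2.2.1
      rw [cross_eq_zero_of_slope_eq_zero hs h0 hmG, mul_zero] at this
      exact lt_irrefl _ this
    · refine ((P.continuous_height G).tendsto x₀ |>.comp hY0).eventually_ne ?_
      intro h0
      rw [height_add, h0, slope_smul, zero_add] at hmG
      exact (mul_ne_zero ht.ne' hs) hmG
  -- From a point `p` of `C` beside the line, aim at a point of `G` near the line. The edge `F` met
  -- on the way, traversed backwards, prefixes the past; one `F` serves all lengths by pigeonhole.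
  have hF : ∃ F, ∀ N : ℕ, F ≠ C ∧ F ≠ E 0 ∧ ∃ y v,
      P.Path (prepend F fun n : ℕ => e (-(n : ℤ))) y v N := by
    refine exists_forall_of_antitone ?_ fun N => ?_
    · rintro F m n hmn ⟨h1, h2, y, v, hp⟩
      exact ⟨h1, h2, y, v, fun k hk => hp k (by omega)⟩
    have hdir := tendsto_direction (x := x₀) hv ht
    have hq : Tendsto (fun q : BilliardPlane × BilliardPlane =>
        (q.1, -P.reflect C (‖q.2 - q.1‖⁻¹ • (q.2 - q.1)))) (𝓝 (x₀, x₀ + t • v₀))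
        (𝓝 (x₀, -P.reflect C v₀)) :=
      (continuous_fst.tendsto _).prodMk_nhds
        ((((P.continuous_reflect C).tendsto v₀).comp hdir).neg)
    have E1 := (hq.eventually (hpast N)).and
      (hdir.eventually (((P.continuous_slope C).tendsto v₀).eventually (lt_mem_nhds hsC)))
    obtain ⟨k, E2, hck⟩ := ((hY0.eventually E1.curry_nhds).and hGc).exists
    have hst := hstep0 k
    have hdev := (hC k).2.2.1
    set p := Y k 0
    -- The target is closer to the limit line than `p`, so aiming at it turns inwards and the
    -- reversed motion turns outwards.
    have E3 : ∀ᶠ m in 𝓝 (x₀ + t • v₀), τ * cross v₀ (m - x₀) < τ * cross v₀ (p - x₀) := by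
      have hcont : Continuous fun m : BilliardPlane => τ * cross v₀ (m - x₀) := by
        unfold cross; fun_prop
      refine (hcont.tendsto (x₀ + t • v₀)).eventually (gt_mem_nhds ?_)
      rwa [add_sub_cancel_left, cross_smul_right, cross_self_eq, mul_zero, mul_zero]
    obtain ⟨m, hmU, hmG', hmE⟩ := hm _ (E2.and E3).eventually_nhds
    have hsm : 0 < P.slope C (m - p) := by
      have h1 := hmU.self_of_nhds.1.2
      rw [slope_smul] at h1
      exact lt_of_not_ge fun hle =>
        absurd h1 (not_lt.2 (mul_nonpos_of_nonneg_of_nonpos (by positivity) hle))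
    obtain ⟨m', hm', F, z, hFC, hFE, hz, hleg⟩ :=
      exists_hit_towards hst.dep hmG' hck hst.height_dep hmE hsm hmU
    obtain ⟨⟨k1, k2⟩, k3⟩ := hm'
    simp only at k1 k2
    have hne : m' - p ≠ 0 := by
      intro h0
      rw [h0, smul_zero, P.slope_eq_zero_iff.2 (cross_zero_right _)] at k2
      exact lt_irrefl _ k2
    have hu1 : ‖(‖m' - p‖⁻¹ • (m' - p))‖ = 1 := norm_smul_inv_norm hne
    obtain ⟨y, v, hy0, hv0, hpath⟩ := k1 (by rw [norm_neg, norm_reflect, hu1])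
      (P.height_eq_zero' hst.dep)
      (by rwa [cross_neg_left, P.cross_reflect_sub (P.height_eq_zero' hst.dep) hx0C, neg_neg])
      (by
        rw [cross_neg_left, cross_neg_right, neg_neg, cross_reflect, cross_smul_right]
        have h1 : 0 < ‖m' - p‖⁻¹ := inv_pos.2 (norm_pos_iff.2 hne)
        have h2 : cross v₀ (m' - p) = cross v₀ (m' - x₀) - cross v₀ (p - x₀) := by
          rw [← cross_sub_right, sub_sub_sub_cancel_right]
        rw [h2]
        have h3 := mul_nonneg h1.le (sub_nonneg.2 k3.le)
        linarith)
    refine ⟨F, hFC, hFE, prepend z y, prepend (-(‖m' - p‖⁻¹ • (m' - p))) v, fun k hk =>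
      Path.cons ?_ hpath k (by omega)⟩
    simp only [Nat.cast_zero, neg_zero, he0, hy0, hv0]
    exact ⟨by rw [norm_neg, hu1], hz, hst.dep, hleg.reverse, by rw [reflect_neg]⟩
  obtain ⟨F, hF⟩ := hF
  have hGC : G ≠ C := by
    rintro rfl
    rw [height_add, hx0C, slope_smul, zero_add] at hmG
    exact (mul_pos ht hsC).ne' hmG
  have hGE : G ≠ E 0 := by
    obtain ⟨y, v, g, hg, hg0, hgE⟩ := hG.exists_ideal
    have h1 := (hg 0 1).ne (n := 0) le_rfl (by omega)
    have h2 := hgE 0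
    rw [Nat.cast_zero] at h2
    rwa [h2, hg0] at h1
  refine ⟨F, G, e, ⟨hx.mem_closedBounceSpectrum, ?_, ?_, ?_⟩, heE⟩
  · rw [he0, he1, Set.eq_empty_iff_forall_notMem]
    rintro f ⟨rfl | rfl, h2 | h2⟩
    exacts [(hF 0).1 h2.symm, hGC h2.symm, (hF 0).2.1 h2.symm, hGE h2.symm]
  · rw [isPrefix_iff]
    intro N
    obtain ⟨-, -, y, v, hp⟩ := hF N
    exact ⟨y, v, _, hp, rfl, fun _ _ => rfl⟩
  · simpa only [heE] using hG

end PolygonTable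

/-! ### Inward paths for a transversal start. -/

namespace PolygonTable
variable {ι : Type*} {P : PolygonTable ι} [Finite ι]

/-- An ideal trajectory that starts transversally is approached by paths beside its first line. -/
theorem Ideal.exists_path_beside {y v : ℤ → BilliardPlane} {b : ℤ → ι} {B : ι} {E : ℕ → ι}
    (h : P.Ideal y v b) (hb : ∀ n : ℕ, b n = prepend B E n) (hs : P.slope B (v 0) ≠ 0) (N : ℕ)
    {ε : ℝ} (hε : 0 < ε) : ∃ Y V, P.Path (prepend B E) Y V N ∧
      (∀ n : ℕ, n ≤ N → dist (Y n) (y n) < ε ∧ dist (V n) (v n) < ε) ∧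
      cross (v 0) (Y 0 - y 0) ≠ 0 := by
  obtain ⟨Y, V, hst, hd⟩ := h 0 (N + 1) (ε / 2) (by linarith)
  have hp : P.Path (prepend B E) (fun n : ℕ => Y n) (fun n : ℕ => V n) (N + 1) := by
    have := path_of_stepAt (a := 0) (n := N + 1) fun k h1 h2 => hst k h1 (by push_cast at h2; omega)
    simp only [zero_add] at this
    rwa [funext hb] at this
  -- If the start lies on the ideal line, slide it slightly along `B`, which is transversal to that
  -- line.
  by_cases h0 : cross (v 0) (Y 0 - y 0) = 0
  · have hs0 := hp 0 (by omega)
    have ht : Tendsto (fun s : ℝ => (Y 0 + s • P.edgeVec B, V 0)) (𝓝[>] 0) (𝓝 (Y 0, V 0)) :=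
      (tendsto_ray _ _).prodMk_nhds tendsto_const_nhds
    have hnear : ∀ᶠ q in 𝓝 ((Y 0, V 0) : BilliardPlane × BilliardPlane),
        ∀ n ∈ Finset.range (N + 1), P.ghost (prepend B E) q n ∈ Metric.ball (Y n, V n) (ε / 2) := by
      rw [eventually_all_finset]
      intro n hn
      rw [Finset.mem_range] at hn
      exact (hp.tendsto_ghost (by omega)).eventually (Metric.ball_mem_nhds _ (by linarith))
    have hall := (((ht.eventually hp.eventually).and (ht.eventually hnear)).and
      (self_mem_nhdsWithin : Set.Ioi (0 : ℝ) ∈ 𝓝[>] 0)).exists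
    obtain ⟨s, ⟨h1, h2⟩, hs'⟩ := hall
    have hheight : P.height (prepend B E 0) (Y 0 + s • P.edgeVec B) = 0 := by
      have h3 := P.height_eq_zero' hs0.dep
      change P.height B _ = 0 at h3
      change P.height B _ = 0
      rw [height_add, slope_smul, P.slope_eq_zero_iff.2 (cross_self_eq _), mul_zero, add_zero]
      exact h3
    have h1 := h1 hs0.unit hheight
    refine ⟨_, _, fun k hk => h1 k (by omega), fun n hn => ?_, ?_⟩
    · have h3 := h2 n (Finset.mem_range.2 (by omega))
      rw [Metric.mem_ball, Prod.dist_eq, max_lt_iff] at h3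
      have h4 := hd n (by omega) (by omega)
      have t1 := dist_triangle (P.ghost (prepend B E) (Y 0 + s • P.edgeVec B, V 0) n).1 (Y n) (y n)
      have t2 := dist_triangle (P.ghost (prepend B E) (Y 0 + s • P.edgeVec B, V 0) n).2 (V n) (v n)
      exact ⟨by linarith [h3.1, h4.1], by linarith [h3.2, h4.2]⟩
    · simp only [ghost]
      rw [add_sub_right_comm, cross_add_right, h0, zero_add, cross_smul_right]
      refine mul_ne_zero (ne_of_gt hs') fun h3 => hs ?_
      rw [slope_eq_zero_iff, cross_swap, h3, neg_zero]
  · refine ⟨_, _, fun k hk => hp k (by omega), fun n hn => ?_, h0⟩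
    have h4 := hd n (by omega) (by omega)
    exact ⟨by linarith [h4.1], by linarith [h4.2]⟩

/-- By pigeonhole the approximating paths lie on one side and all turn the same way. If inwards,
they are as required; if outwards, that side of every leg is free, and parallel paths serve instead.
-/
theorem Ideal.inward_of_slope_ne_zero {y v : ℤ → BilliardPlane} {b : ℤ → ι} {B : ι} {E : ℕ → ι}
    (h : P.Ideal y v b) (hb : ∀ n : ℕ, b n = prepend B E n) (hs : P.slope B (v 0) ≠ 0) :
    ∃ τ, P.Inward E B (y 0) (v 0) τ := by
  set sg : Bool → ℝ := fun t => if t then 1 else -1 with hsg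
  have hsgn : ∀ x : ℝ, ∃ t, sg t * x ≤ 0 := fun x => by
    rcases le_total x 0 with h | h
    · exact ⟨true, by simpa [hsg] using h⟩
    · exact ⟨false, by simpa [hsg] using h⟩
  have hpig : ∃ s : Bool × Bool, ∀ N : ℕ, ∃ Y V, P.Path (prepend B E) Y V N ∧
      (∀ n : ℕ, n ≤ N → dist (Y n) (y n) < 1 / ((N : ℝ) + 1) ∧
        dist (V n) (v n) < 1 / ((N : ℝ) + 1)) ∧
      0 < sg s.1 * cross (v 0) (Y 0 - y 0) ∧ sg s.2 * (sg s.1 * cross (v 0) (V 0)) ≤ 0 := by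
    refine exists_forall_of_antitone ?_ fun N => ?_
    · rintro s m n hmn ⟨Y, V, h1, h2, h3⟩
      have : 1 / ((n : ℝ) + 1) ≤ 1 / ((m : ℝ) + 1) := by gcongr
      exact ⟨Y, V, fun k hk => h1 k (by omega), fun k hk =>
        ⟨(h2 k (by omega)).1.trans_le this, (h2 k (by omega)).2.trans_le this⟩, h3⟩
    · obtain ⟨Y, V, h1, h2, h3⟩ := h.exists_path_beside hb hs N
        (ε := 1 / ((N : ℝ) + 1)) (by positivity)
      obtain ⟨t, ht⟩ : ∃ t, 0 < sg t * cross (v 0) (Y 0 - y 0) := by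
        rcases lt_or_gt_of_ne h3 with h3 | h3
        · exact ⟨false, by simpa [hsg] using h3⟩
        · exact ⟨true, by simpa [hsg] using h3⟩
      obtain ⟨t', ht'⟩ := hsgn (sg t * cross (v 0) (V 0))
      exact ⟨(t, t'), Y, V, h1, h2, ht, ht'⟩
  obtain ⟨⟨t, t'⟩, hpig⟩ := hpig
  refine ⟨sg t, ?_⟩
  cases t' with
  | true =>
    intro N ε hε
    obtain ⟨n, hn⟩ := exists_nat_one_div_lt hε
    obtain ⟨Y, V, h1, h2, h3, h4⟩ := hpig (max N n)
    have hle : 1 / (((max N n : ℕ) : ℝ) + 1) ≤ 1 / ((n : ℝ) + 1) := by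
      gcongr; exact le_max_right _ _
    have h5 := h2 0 (by omega)
    exact ⟨Y, V, fun k hk => h1 k (lt_max_of_lt_left hk), (h5.1.trans_le hle).trans hn,
      (h5.2.trans_le hle).trans hn, h3, by simpa [hsg] using h4⟩
  | false =>
    choose Y V h1 h2 h3 h4 using hpig
    have htend : ∀ (f : ℕ → ℕ → BilliardPlane) (x : BilliardPlane) (n : ℕ),
        (∀ N, n ≤ N → dist (f N n) x < 1 / ((N : ℝ) + 1)) →
        Tendsto (fun N => f N n) atTop (𝓝 x) := fun f x n hf => by
      rw [tendsto_iff_dist_tendsto_zero]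
      refine squeeze_zero' (Eventually.of_forall fun _ => dist_nonneg) ?_
        tendsto_one_div_add_atTop_nhds_zero_nat
      filter_upwards [eventually_ge_atTop n] with N hN using (hf N hN).le
    have hall := fun n : ℕ => sideFree_of_tendsto (P := P) (e := prepend B E)
      (y := fun n : ℕ => y n) (v := fun n : ℕ => v n) (N := n + 1) (τ := sg t)
      (Y := fun k => Y (k + (n + 1))) (V := fun k => V (k + (n + 1)))
      (fun k j hj => h1 _ j (by omega))
      (fun j _ => (htend Y _ j fun N hN => (h2 N j hN).1).comp (tendsto_add_atTop_nat (n + 1)))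
      (fun j _ => (htend V _ j fun N hN => (h2 N j hN).2).comp (tendsto_add_atTop_nat (n + 1)))
      (fun k => h3 _) (fun k => by
        have h5 := h4 (k + (n + 1))
        rw [show sg false = -1 by simp [hsg]] at h5
        simp only [Nat.cast_zero]
        linarith) (Nat.lt_succ_self n)
    exact inward_of_sideFree (y := fun n : ℕ => y n) (v := fun n : ℕ => v n)
      (h.limitStep 0).unit (fun n => (hall n).1) (fun n => (hall n).2.1) (fun n => (hall n).2.2)
      (r := fun k => Y (k + 1) 0)
      ((htend Y _ 0 fun N hN => (h2 N 0 hN).1).comp (tendsto_add_atTop_nat 1))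
      fun k => ⟨P.height_eq_zero' (h1 (k + 1) 0 (by omega)).dep, h3 _⟩

end PolygonTable

/-! ### Inward paths for a start along the edge itself. -/

namespace PolygonTable
variable {ι : Type*} {P : PolygonTable ι} [Finite ι]

theorem exists_slope_eq {e : ι} {v : BilliardPlane} (hv : ‖v‖ = 1) (hs : P.slope e v = 0) :
    ∃ κ : ℝ, κ ≠ 0 ∧ ∀ x, P.slope e x = κ * cross v x := by
  have hc : cross v (P.edgeVec e) = 0 := by
    rw [cross_swap, P.slope_eq_zero_iff.1 hs, neg_zero]
  have hd := eq_smul_of_cross_eq_zero hv hc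
  refine ⟨P.orient e * ⟪v, P.edgeVec e⟫, mul_ne_zero (P.orient_ne_zero e) fun h => ?_, fun x => ?_⟩
  · rw [h, zero_smul] at hd
    exact P.edgeVec_ne_zero e hd
  · rw [slope, hd, cross_smul_left, inner_smul_right, real_inner_self_eq_norm_sq, hv]
    ring

/-- Two consecutive legs that touch the edge `B` under a small angle enclose no obstacle above
`B`. -/
theorem Step.false_of_touching {C B D f : ι} {p u g w r w' a z : BilliardPlane} {κ : ℝ}
    {v : BilliardPlane} (hv : ‖v‖ = 1) (hκ : ∀ x, P.slope B x = κ * cross v x) (hκ0 : κ ≠ 0)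
    (S₁ : P.Step C B p u g w) (S₂ : P.Step B D g w r w')
    (hu : dist u v < 1) (hw : dist w v < 1) (ha : P.height B a = 0) (haf : a ∈ P.edge f)
    (hz : z ∈ P.edge f) (haC : 0 ≤ P.height C a) (haD : 0 ≤ P.height D a)
    (hzC : 0 < P.height C z) (hzD : 0 < P.height D z) (hzB : 0 < P.height B z)
    (h1 : 0 < κ * cross u (z - g)) (h2 : 0 < κ * cross w (z - g)) : False := by
  have hsu := S₁.slope_arr
  have hsw := S₂.slope_dep
  have hg := P.height_eq_zero' S₂.dep
  obtain ⟨ρ, hρ⟩ : ∃ ρ : ℝ, a - g = ρ • v := by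
    refine ⟨_, eq_smul_of_cross_eq_zero hv ?_⟩
    have : P.slope B (a - g) = 0 := by rw [← height_sub_height, ha, hg, sub_zero]
    rw [hκ] at this
    exact (mul_eq_zero.1 this).resolve_left hκ0
  have e1 : κ * cross u (a - g) = -ρ * P.slope B u := by
    rw [hρ, cross_smul_right, cross_swap, hκ]; ring
  have e2 : κ * cross w (a - g) = -ρ * P.slope B w := by
    rw [hρ, cross_smul_right, cross_swap, hκ]; ring
  have huw : 0 < κ * cross u w := by
    have i1 := inner_pos_of_dist_lt hv S₁.unit (by rwa [dist_comm])
    have i2 := inner_pos_of_dist_lt hv S₂.unit (by rwa [dist_comm])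
    have c1 : ⟪u, v⟫ = ⟪v, u⟫ := real_inner_comm _ _
    rw [cross_eq_add u w hv, cross_swap u v, c1]
    rw [hκ] at hsu hsw
    have j1 := mul_pos (neg_pos.2 hsu) i2
    have j2 := mul_pos hsw i1
    linarith
  have hcont : ∀ x : BilliardPlane, Continuous fun s : ℝ => κ * cross x (a + s • (z - a) - g) :=
    fun x => by unfold cross; fun_prop
  -- The legs form a wedge with apex `g`. The obstacle joins `a`, not inside the wedge, to `z`
  -- inside it; the minimum of the two side functions vanishes where it meets the boundary of the
  -- wedge, and that point lies on an open leg.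
  have hF := intermediate_value_Icc (zero_le_one (α := ℝ))
    (((hcont u).min (hcont w)).continuousOn)
  have h0 : (0 : ℝ) ∈ (fun s : ℝ => min (κ * cross u (a + s • (z - a) - g))
      (κ * cross w (a + s • (z - a) - g))) '' Set.Icc 0 1 := by
    refine hF ⟨?_, ?_⟩
    · simp only [zero_smul, add_zero]
      rw [e1, e2]
      rcases le_total 0 ρ with h | h
      · exact (min_le_right _ _).trans (by nlinarith)
      · exact (min_le_left _ _).trans (by nlinarith)
    · simp only [one_smul, add_sub_cancel]
      exact (lt_min h1 h2).le
  obtain ⟨s, ⟨hs0, hs1⟩, hs⟩ := h0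
  simp only at hs
  set q := a + s • (z - a) with hq
  have hqf : q ∈ P.edge f := comb_mem_edge hs0 hs1 haf hz
  have hqB : P.height B q = s * P.height B z := by rw [hq, height_comb, ha]; ring
  have hqC : 0 < s → 0 < P.height C q := fun h => by
    rw [hq, height_comb]
    have := mul_pos h hzC
    have := mul_nonneg (sub_nonneg.2 hs1) haC
    linarith
  have hqD : 0 < s → 0 < P.height D q := fun h => by
    rw [hq, height_comb]
    have := mul_pos h hzD
    have := mul_nonneg (sub_nonneg.2 hs1) haD
    linarith
  have hqg : q ≠ g := by
    intro h
    rw [h] at hqf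
    rw [P.eq_of_mem_edgeInterior S₂.dep hqf, P.height_eq_zero hz] at hzB
    exact lt_irrefl _ hzB
  have key : ∀ x, ‖x‖ = 1 → κ * cross x (q - g) = 0 → ∃ lam : ℝ, lam ≠ 0 ∧ q - g = lam • x := by
    intro x hx h
    refine ⟨_, fun h3 => ?_, eq_smul_of_cross_eq_zero hx ((mul_eq_zero.1 h).resolve_left hκ0)⟩
    have := eq_smul_of_cross_eq_zero hx ((mul_eq_zero.1 h).resolve_left hκ0)
    rw [h3, zero_smul, sub_eq_zero] at this
    exact hqg this
  have hheight : ∀ (lam : ℝ) x, q - g = lam • x → P.height B q = lam * P.slope B x := by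
    intro lam x h
    rw [← slope_smul, ← h, ← height_sub_height, hg, sub_zero]
  rcases min_choice (κ * cross u (q - g)) (κ * cross w (q - g)) with h | h
  · rw [hs] at h
    have h3 : 0 ≤ κ * cross w (q - g) := by rw [← hs]; exact min_le_right _ _
    obtain ⟨lam, hl, hlam⟩ := key u S₁.unit h.symm
    rw [hlam, cross_smul_right, cross_swap] at h3
    have hneg : lam < 0 := lt_of_le_of_ne (by
      by_contra hcon
      push Not at hcon
      nlinarith [mul_pos hcon huw]) hl
    have hB := hheight _ _ hlam
    have hBpos : 0 < P.height B q := by rw [hB]; exact mul_pos_of_neg_of_neg hneg hsu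
    have hspos : 0 < s := by
      rw [hqB] at hBpos
      exact pos_of_mul_pos_left hBpos hzB.le
    refine P.notMem_interior_of_mem_edge hqf (S₁.mem_interior_of_between ?_ (hqC hspos) hBpos)
    obtain ⟨t, -, ht⟩ := S₁.exists_pos
    rw [show q - p = (q - g) + (g - p) by abel, hlam, ht, add_sub_cancel_left, cross_add_right,
      cross_smul_right, cross_smul_right, cross_self_eq, mul_zero, mul_zero, add_zero]
  · rw [hs] at h
    have h3 : 0 ≤ κ * cross u (q - g) := by rw [← hs]; exact min_le_left _ _
    obtain ⟨lam, hl, hlam⟩ := key w S₂.unit h.symm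
    rw [hlam, cross_smul_right] at h3
    have hpos : 0 < lam := lt_of_le_of_ne (by
      by_contra hcon
      push Not at hcon
      nlinarith [mul_pos (neg_pos.2 hcon) huw]) hl.symm
    have hB := hheight _ _ hlam
    have hBpos : 0 < P.height B q := by rw [hB]; exact mul_pos hpos hsw
    have hspos : 0 < s := by
      rw [hqB] at hBpos
      exact pos_of_mul_pos_left hBpos hzB.le
    refine P.notMem_interior_of_mem_edge hqf (S₂.mem_interior_of_between ?_ hBpos (hqD hspos))
    rw [hlam, cross_smul_right, cross_self_eq, mul_zero]

/-- If an ideal trajectory starts along the edge `B`, then its future is also that of paths that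
start on the edge before `B`. -/
theorem Ideal.inward_of_slope_eq_zero {y v : ℤ → BilliardPlane} {b : ℤ → ι} {B : ι} {E : ℕ → ι}
    (h : P.Ideal y v b) (hb0 : b 0 = B) (hb : ∀ n : ℕ, b (n + 1) = E n)
    (hs : P.slope B (v 0) = 0) : ∃ τ, P.Inward E (b (-1)) (y (-1)) (v 0) τ ∧
      0 < P.slope (b (-1)) (v 0) ∧ ∃ m ∈ P.edgeInterior B, 0 < P.height (E 0) m ∧
        ∃ t : ℝ, 0 < t ∧ m = y (-1) + t • v 0 := by
  have hb1 : b 1 = E 0 := hb 0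
  set C := b (-1)
  set x := y (-1)
  have l0 := h.limitStep (-1)
  have l1 := h.limitStep 0
  rw [neg_add_cancel, hb0] at l0
  rw [zero_add, hb0, hb1] at l1
  have hv := l1.unit
  have hvm : v (-1) = v 0 := by
    have h1 := congrArg (P.reflect B) l0.optical
    rw [reflect_reflect, P.reflect_of_cross_eq_zero (P.slope_eq_zero_iff.1 hs)] at h1
    exact h1.symm
  -- As `v 0` runs along `B`, the height over `B` is `κ` times the signed distance from the
  -- trajectory. Thus `κ` marks the inner side of `B` as the side of the line to be used.
  obtain ⟨κ, hκ0, hκ⟩ := P.exists_slope_eq hv hs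
  have hB0 := P.height_eq_zero l1.dep
  have hxB : P.height B x = 0 := by
    have h1 := l0.eq
    rw [h1, height_add, slope_smul, hvm, hs, mul_zero, add_zero] at hB0
    exact hB0
  have hside : ∀ z, κ * cross (v 0) (z - x) = P.height B z := fun z => by
    rw [← hκ, ← height_sub_height, hxB, sub_zero]
  have hline : ∀ z z', P.height B z = 0 → P.height B z' = 0 → ∃ t : ℝ, z' = z + t • v 0 := by
    intro z z' hz hz'
    have h1 : P.slope B (z' - z) = 0 := by rw [← height_sub_height, hz, hz', sub_zero]
    rw [hκ] at h1
    exact ⟨_, eq_add_of_sub_eq' (eq_smul_of_cross_eq_zero hv ((mul_eq_zero.1 h1).resolve_left hκ0))⟩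
  have hy1B : P.height B (y 1) = 0 := by
    rw [l1.eq, height_add, slope_smul, hs, mul_zero, add_zero, hB0]
  obtain ⟨Y, V, hst, hlim⟩ := (h.idealFrom (-1)).exists_seq
  have S₁ : ∀ k, P.Step C B (Y (k + 2) (-1)) (V (k + 2) (-1)) (Y (k + 2) 0) (V (k + 2) 0) :=
    fun k => by
      have := hst (k + 2) (-1) le_rfl (by push_cast; omega)
      rwa [StepAt, neg_add_cancel, hb0] at this
  have S₂ : ∀ k, P.Step B (E 0) (Y (k + 2) 0) (V (k + 2) 0) (Y (k + 2) 1) (V (k + 2) 1) :=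
    fun k => by
      have := hst (k + 2) 0 (by omega) (by push_cast; omega)
      rwa [StepAt, zero_add, hb0, hb1] at this
  have hYl : ∀ n, -1 ≤ n → Tendsto (fun k => Y (k + 2) n) atTop (𝓝 (y n)) :=
    fun n hn => (hlim n hn).1.comp (tendsto_add_atTop_nat 2)
  have hVl : ∀ n, -1 ≤ n → Tendsto (fun k => V (k + 2) n) atTop (𝓝 (v n)) :=
    fun n hn => (hlim n hn).2.comp (tendsto_add_atTop_nat 2)
  have hVm := hVl (-1) le_rfl
  rw [hvm] at hVm
  -- slopes
  have f0 := (h (-1) 1).closureStep (n := -1) le_rfl (by omega)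
  have f1 := (h 0 1).closureStep (n := 0) le_rfl (by omega)
  rw [neg_add_cancel, hvm] at f0
  rw [zero_add, hb1] at f1
  have hsC0 : 0 ≤ P.slope C (v 0) := f0.facts.2.2.2.1
  have hsE0 : P.slope (E 0) (v 0) ≤ 0 := f1.facts.2.2.2.2.1
  -- If `E 0` were parallel to `v 0`, its line would be that of `B`, but true steps from `B` arrive
  -- at positive height.
  have hsE : P.slope (E 0) (v 0) < 0 := by
    refine lt_of_le_of_ne hsE0 (slope_ne_zero_of_cross_ne_zero (P.height_eq_zero' (S₂ 0).arr)
      (P.height_eq_zero l1.arr) fun h0 => ?_)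
    have h1 := (S₂ 0).height_arr
    have h2 : P.height B (Y (0 + 2) 1) = κ * cross (v 0) (Y (0 + 2) 1 - y 1) := by
      rw [← hκ, ← height_sub_height, hy1B, sub_zero]
    rw [h2, h0, mul_zero] at h1
    exact lt_irrefl _ h1
  -- An actual bounce point inside `B`. It lies on the limit line, strictly between `x` and `y 1`,
  -- by its positive heights over `C` and `E 0`.
  set m := Y (0 + 2) 0
  have hmB : P.height B m = 0 := P.height_eq_zero' (S₂ 0).dep
  obtain ⟨t, ht⟩ := hline x m hxB hmB
  obtain ⟨t', ht'⟩ := hline m (y 1) hmB hy1B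
  have hxC : P.height C x = 0 := P.height_eq_zero l0.dep
  have hmC : 0 < P.height C m := (S₁ 0).height_arr
  have hmE : 0 < P.height (E 0) m := (S₂ 0).height_dep
  have htC : 0 < t * P.slope C (v 0) := by
    rw [ht, height_add, hxC, slope_smul, zero_add] at hmC
    exact hmC
  have ht0 : 0 < t := pos_of_mul_pos_left htC hsC0
  have hsC : 0 < P.slope C (v 0) := pos_of_mul_pos_right htC ht0.le
  have ht0' : 0 < t' := by
    have h1 := P.height_eq_zero l1.arr
    rw [ht', height_add, slope_smul] at h1
    by_contra hcon
    push Not at hcon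
    nlinarith
  have hxE : 0 < P.height (E 0) x := by
    rw [ht, height_add, slope_smul] at hmE
    have := mul_pos ht0 (neg_pos.2 hsE)
    linarith
  have hyC : 0 < P.height C (y 1) := by
    rw [ht', height_add, slope_smul]
    positivity
  -- the leg from `C` to `E 0`
  have hbar : P.SideBarrier κ C (E 0) x (v 0) (y 1) := by
    refine ⟨l0.dep, l1.arr, ?_, hsC, hsE, hxE.le, hyC.le, ?_, ?_, ?_⟩
    · have := hside (y 1)
      rw [hy1B] at this
      exact (mul_eq_zero.1 this).resolve_left hκ0
    · have h1 := ((P.continuous_height (E 0)).tendsto x).eventually (lt_mem_nhds hxE)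
      obtain ⟨k, hk⟩ := ((hYl (-1) le_rfl).eventually h1).exists
      exact ⟨_, (S₁ k).dep, hk, by rw [hside]; exact (S₁ k).height_dep⟩
    · have h1 := ((P.continuous_height C).tendsto (y 1)).eventually (lt_mem_nhds hyC)
      obtain ⟨k, hk⟩ := ((hYl 1 (by omega)).eventually h1).exists
      exact ⟨_, (S₂ k).arr, hk, by rw [hside]; exact (S₂ k).height_arr⟩
    -- The approximations pass from `C` to `E 0` by touching `B` under a small angle, and an edge
    -- rising from the line of `B` between them would cut one of the two legs.
    · intro f a ha haf z hz hzC hzE hzB haC haE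
      rw [hside] at hzB
      have haB : P.height B a = 0 := by
        obtain ⟨s, -, rfl⟩ := (segment_eq_image' ℝ x (y 1)) ▸ ha
        rw [height_comb, hxB, hy1B]; ring
      have hz0 : 0 < κ * cross (v 0) (z - y 0) := by
        rwa [← hκ, ← height_sub_height, hB0, sub_zero]
      have ev : ∀ {F : ℕ → BilliardPlane}, Tendsto F atTop (𝓝 (v 0)) →
          ∀ᶠ k in atTop, dist (F k) (v 0) < 1 ∧ 0 < κ * cross (F k) (z - Y (k + 2) 0) := by
        intro F hF
        have h1 := (hF.cross ((tendsto_const_nhds (x := z)).sub (hYl 0 (by omega)))).const_mul κ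
        exact (hF.eventually (Metric.ball_mem_nhds _ one_pos)).and
          (h1.eventually (lt_mem_nhds hz0))
      obtain ⟨k, ⟨h1, h2⟩, h3, h4⟩ := ((ev hVm).and (ev (hVl 0 (by omega)))).exists
      exact (S₁ k).false_of_touching hv hκ hκ0 (S₂ k) h1 h3 haB haf hz haC haE hzC hzE hzB h2 h4
  -- the later legs
  have hlater : ∀ n : ℕ, P.LimitStep (E n) (E (n + 1)) (y (n + 1)) (v (n + 1)) (y (n + 1 + 1))
      (v (n + 1 + 1)) ∧ P.slope (E (n + 1)) (v (n + 1)) ≠ 0 ∧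
      P.SideFree ((-1) ^ n * -κ) (E n) (E (n + 1)) (y (n + 1)) (v (n + 1)) := by
    intro n
    -- True steps from `B` arrive at `E 0` above the line of `B` while moving away from it; the
    -- reflection at `E 0` turns the side `κ` into `-κ`.
    have hall := sideFree_of_tendsto (P := P) (e := E) (y := fun n : ℕ => y (n + 1))
      (v := fun n : ℕ => v (n + 1)) (N := n + 1) (τ := -κ)
      (Y := fun k j => Y (k + n + 1 + 2) (j + 1)) (V := fun k j => V (k + n + 1 + 2) (j + 1))
      (fun k j hj => by
        have h1 := hst (k + n + 1 + 2) (j + 1) (by omega) (by push_cast; omega)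
        rw [StepAt, hb, show (j : ℤ) + 1 + 1 = (j + 1 : ℕ) + 1 by push_cast; ring, hb] at h1
        exact h1)
      (fun j _ => (hYl (j + 1) (by omega)).comp (tendsto_add_atTop_nat (n + 1)))
      (fun j _ => (hVl (j + 1) (by omega)).comp (tendsto_add_atTop_nat (n + 1)))
      (fun k => by
        have s := S₂ (k + n + 1)
        simp only [Nat.cast_zero, zero_add]
        rw [l1.optical, P.cross_reflect_sub (P.height_eq_zero' s.arr) (P.height_eq_zero l1.arr),
          neg_mul_neg, ← hκ, ← height_sub_height, hy1B, sub_zero]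
        exact s.height_arr)
      (fun k => by
        have s := S₂ (k + n + 1)
        simp only [Nat.cast_zero, zero_add]
        rw [l1.optical, s.optical, cross_reflect, neg_mul_neg, ← hκ]
        exact s.slope_dep.le) (Nat.lt_succ_self n)
    exact_mod_cast hall
  refine ⟨κ, ?_, hsC, m, (S₂ 0).dep, hmE, t, ht0, ht⟩
  have hdist : y 1 = x + dist x (y 1) • v 0 := by
    have h1 : y 1 = x + (t + t') • v 0 := by rw [ht', ht]; module
    nth_rw 2 [h1]
    rw [dist_self_add_right, norm_smul, hv, mul_one, Real.norm_of_nonneg (by linarith), h1]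
  -- The bounce on `B` is omitted: `C` is joined directly to `E 0`, beside the straight segment from
  -- `x` to `y 1`.
  refine inward_of_sideFree (y := prepend x fun n : ℕ => y (n + 1))
    (v := prepend (v 0) fun n : ℕ => v (n + 1)) hv ?_ ?_ ?_ (r := fun k => Y (k + 2) (-1))
    (hYl (-1) le_rfl) fun k => ⟨P.height_eq_zero' (S₁ k).dep, ?_⟩
  · rintro (_ | n)
    · exact ⟨hv, l0.dep, l1.arr, hdist, l1.optical⟩
    · exact (hlater n).1
  · rintro (_ | n)
    · exact hsE.ne
    · exact (hlater n).2.1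
  · rintro (_ | n)
    · have := hbar.sideFree
      rwa [← one_mul κ, ← pow_zero (-1)] at this
    · have := (hlater n).2.2
      rwa [mul_neg, ← neg_mul, ← mul_neg_one, ← pow_succ] at this
  · change 0 < κ * cross (v 0) (_ - x)
    rw [hside]
    exact (S₁ k).height_dep

end PolygonTable

/-! ### Non-grazing common prefixes are adjacent. -/

namespace PolygonTable
variable {ι : Type*} {P : PolygonTable ι} [Finite ι]

/-- If the trajectory leaves `B` transversally, `A` is the edge ahead of `B`. If it starts along
`B`, then `B` itself is ahead of the edge hit before it, and this edge and `B` are used. -/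
theorem isGrazing_of_ahead {A B : ι} {E : ℕ → ι} {x v y u : ℤ → BilliardPlane} {a b : ℤ → ι}
    (hx : P.Ideal x v a) (ha : a 0 = A) (ha' : ∀ n : ℕ, a (n + 1) = E n) (hA : P.IsPrefix A E)
    (hy : P.Ideal y u b) (hb : b 0 = B) (hb' : ∀ n : ℕ, b (n + 1) = E n) (hB : P.IsPrefix B E)
    {t : ℝ} (ht : 0 < t) (h : x 0 = y 0 + t • u 0) : P.IsGrazing E := by
  have hu := (hy.limitStep 0).unit
  by_cases hs : P.slope B (u 0) = 0
  · obtain ⟨τ, hin, hsC, m, hm, hmE, t', ht', hmt⟩ := hy.inward_of_slope_eq_zero hb hb' hs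
    exact hin.isGrazing hu hsC hB ht' fun U hU => ⟨m, by rw [hmt]; exact mem_of_mem_nhds hU, hm, hmE⟩
  · obtain ⟨τ, hin⟩ := hy.inward_of_slope_ne_zero (B := B) (E := E) (fun n => by
      cases n with
      | zero => exact hb
      | succ n => exact_mod_cast hb' n) hs
    have hsB : 0 < P.slope B (u 0) := by
      have := ((hy 0 1).closureStep (n := 0) le_rfl (by omega)).facts.2.2.2.1
      rw [hb] at this
      exact lt_of_le_of_ne this (Ne.symm hs)
    refine hin.isGrazing hu hsB hA ht fun U hU => ?_
    rw [← h] at hU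
    obtain ⟨Y, V, hst, hlim⟩ := (hx 0 1).exists_seq
    obtain ⟨k, hk⟩ := ((hlim 0 le_rfl (by omega)).1.eventually hU).exists
    have hS := hst k 0 le_rfl (by omega)
    have ha1 := ha' 0
    rw [Nat.cast_zero, zero_add] at ha1
    rw [StepAt, zero_add, ha, ha1] at hS
    exact ⟨_, hk, hS.dep, hS.height_dep⟩

/-- If the common aperiodic future of two edges is not grazing, then the edges are adjacent. -/
theorem adjacent_of_isPrefix {A B : ι} (hAB : A ≠ B) {E : ℕ → ι} (hE : IsAperiodic E)
    (hA : P.IsPrefix A E) (hB : P.IsPrefix B E) (hgr : ¬ P.IsGrazing E) : P.Adjacent A B := by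
  obtain ⟨x, v, a, hx, ha, ha'⟩ := hA.exists_ideal
  obtain ⟨y, u, b, hy, hb, hb'⟩ := hB.exists_ideal
  have ha1 : a 1 = E 0 := ha' 0
  have hb1 : b 1 = E 0 := hb' 0
  have l := hx.limitStep 0
  have l' := hy.limitStep 0
  rw [zero_add, ha1] at l
  rw [zero_add, hb1] at l'
  have hcode : ∀ n : ℤ, 0 ≤ n → b (1 + n) = a (1 + n) := fun n hn => by
    obtain ⟨m, rfl⟩ := Int.eq_ofNat_of_zero_le hn
    rw [add_comm]; exact (hb' m).trans (ha' m).symm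
  have hx' := (hx.shift 1).idealFrom 0
  have hy' : P.IdealFrom 0 (fun n => y (1 + n)) (fun n => u (1 + n)) (fun n => a (1 + n)) :=
    fun c => ((hy.shift 1) 0 c).congr fun n hn _ => hcode n hn
  have hv1 : v 1 = u 1 := by simpa using hx'.dir_eq hy' (fun _ _ => rfl) le_rfl
  have hv0 : v 0 = u 0 := by
    have h := congrArg (P.reflect (E 0)) (l.optical.symm.trans (hv1.trans l'.optical))
    rwa [reflect_reflect, reflect_reflect] at h
  -- The common future from `E 0` on is aperiodic, so both trajectories share their line there, and
  -- hence also before the bounce on `E 0`.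
  have hc := hx'.cross_eq_zero (by
    have : (fun n : ℕ => a (1 + (n : ℤ))) = E := funext fun n => by rw [add_comm]; exact ha' n
    rw [this]; exact hE) hy'
  simp only [add_zero] at hc
  rw [l.optical, P.cross_reflect_sub (P.height_eq_zero l'.arr) (P.height_eq_zero l.arr),
    neg_eq_zero, hv0] at hc
  have hl := l.eq
  have hl' := l'.eq
  have hc0 : cross (u 0) (x 0 - y 0) = 0 := by
    rw [hl, hl', hv0, show y 0 + dist (y 0) (y 1) • u 0 - (x 0 + dist (x 0) (x 1) • u 0) =
      (dist (y 0) (y 1) - dist (x 0) (x 1)) • u 0 - (x 0 - y 0) by module, cross_sub_right,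
      cross_smul_right, cross_self_eq] at hc
    linarith
  have hxy := eq_smul_of_cross_eq_zero l'.unit hc0
  -- The order of the two starting points on the common line: a start strictly ahead gives grazing,
  -- and equal starts are a point of both edges, hence a common endpoint.
  rcases lt_trichotomy ⟪u 0, x 0 - y 0⟫ 0 with ht | ht | ht
  · refine absurd (isGrazing_of_ahead hy hb hb' hB hx ha ha' hA (neg_pos.2 ht) ?_) hgr
    rw [hv0, neg_smul, ← hxy]; abel
  · rw [ht, zero_smul, sub_eq_zero] at hxy
    have hd := l.dep
    have hd' := l'.dep
    rw [ha, hxy] at hd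
    rw [hb] at hd'
    have := P.mem_endpoints_of_mem_edges hAB hd hd'
    exact ⟨hAB, y 0, this.1, this.2⟩
  · exact absurd (isGrazing_of_ahead hx ha ha' hA hy hb hb' hB ht (eq_add_of_sub_eq' hxy)) hgr

end PolygonTable

theorem mainTheorem4 {ι : Type*} [Finite ι] (P : PolygonTable ι) (A B : ι) (hAB : A ≠ B) :
    P.Adjacent A B ↔
      ∃ E : ℕ → ι, PolygonTable.IsAperiodic E ∧ P.IsCommonPrefixes {A, B} E ∧
        ¬ P.IsGrazing E := by
  constructor
  · rintro ⟨-, q, hA, hB⟩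
    obtain ⟨E, hE, hA', hB', hgr⟩ := PolygonTable.exists_of_adjacent hAB hA hB
    refine ⟨E, hE, ?_, hgr⟩
    rintro X (rfl | rfl)
    exacts [hA', hB']
  · rintro ⟨E, hE, hpre, hgr⟩
    exact PolygonTable.adjacent_of_isPrefix hAB hE (hpre A (Or.inl rfl)) (hpre B (Or.inr rfl)) hgr
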